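/- **Setting.** Let $(M,d,\mu)$ be a complete, separable, volume doubling metric measure space (for instance a complete volume doubling Riemannian manifold), with a reference point $o$. On the real space $L^2(M,\mu)$ let $V_1,\dots,V_{\ell_0}$ and $L$ be (unbounded) linear operators and write $V_I=V_{i_k}\cdots V_{i_1}$, $|I|=k$, for a tuple $I=(i_1,\dots,i_k)$. Assume: $-L$ generates a strongly continuous holomorphic semigroup $(e^{-tL})_{t\ge 0}$ on $L^2$ (i.e. $e^{-tL}L^2\subset D(L)$ and $\|tLe^{-tL}\|\le C$ for $0<t\le1$); $D(L)\subset D(V_i^2)$ and $L=-\sum_iV_i^2$ on $D(L)$; $V_i(uv)=uV_iv+vV_iu$ for $u,v\in D(L)$ with $uv\in D(V_i)$; the semigroup is conservative; and for every tuple $I$ the operators $t^{|I|/2}V_Ie^{-tL}$ and $e^{-tL}t^{|I|/2}V_I$, $0<t\le1$, have kernels $K_t$ with $$|K_t(x,y)|\le C\,G_t(x,y),\qquad |K_t(x,y)-K_t(z,y)|\le C\,\tfrac{d(x,z)}{\sqrt t}\,G_t(x,y)\ \text{ if } d(x,z)\le\sqrt t,$$ where $G_t(x,y)=\mu(B(x,\sqrt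 t))^{-1}e^{-c\,d(x,y)^2/t}$ and $C,c>0$ may depend on $I$. **Distributions.** Set $\mathcal M=M\times\mathbb R$, $\nu=\mu\otimes d\tau$. Test functions are the $\chi$ on $\mathcal M$, compactly supported in time, such that all $e^{a\,d(o,\cdot)}\partial_\tau^{n}(L^*)^{k}\chi$ ($a,n,k\in\mathbb N$) exist and are bounded in $\tau$ with values in $L^2(M)$; distributions are the linear functionals on them that are, for test functions supported in any fixed bounded time interval, continuous for these seminorms. For a bounded operator $R$ on $L^2(M)$ and a function $m$ on $\mathbb R$, let $m_t=t^{-1}m(\cdot/t)$ and let $R\otimes m_t^\star$ be $R$ in space and convolution with $m_t$ over $\mathbb R$ in time; it acts on distributions by duality. (For objects supported in $\tau\ge0$ the convolution is $\int_0^\infty m_t(\tau-\sigma)f(\sigma)d\sigma$.) **Weights and Hölder spaces.** A space-time weight is $\omega:\mathcal M\to[1,\infty)$, non-decreasing in time, with $\omega(x,\tau)e^{-c_1d(x,y)}\le c_2\,\omega(y,\tau)$ for some constants $c_1,c_2$. Let $b\ge6$ be even. For $c\ge1$ let $P^{(c)}_t=\sum_{i<c}\frac{(tL)^i}{i!}e^{-tL}$.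 For an integer $0\le a\le 2b$, $\mathsf{StGC}^a$ is the set of all families $$\mathcal Q_t=(t^{|J|/2}V_J)(tL)^nP^{(c)}_t\otimes m_t^\star,\qquad |J|+2n+2k=a,\quad n,k\in\mathbb N,\quad 1\le c\le b,$$ with $m$ smooth, supported in $[\frac12,2]$, $\int\tau^im(\tau)d\tau=0$ for $0\le i\le k-1$, and $|m^{(i)}|\le1$ for $0\le i\le b$. For $\alpha\in\mathbb R$, $\mathcal C^\alpha_\omega$ is the set of distributions $f$ with $$\|f\|_{\mathcal C^\alpha_\omega}=\sup_{\mathcal Q\in\mathsf{StGC}^k,\,0\le k\le2b}\|\omega^{-1}\mathcal Q_1f\|_{L^\infty(\nu)}+\sup_{\mathcal Q\in\mathsf{StGC}^k,\,|\alpha|<k\le2b}\ \sup_{0<t\le1}t^{-\alpha/2}\|\omega^{-1}\mathcal Q_tf\|_{L^\infty(\nu)}<\infty .$$ **Paraproduct and resonant term.** Fix a smooth $\varphi$ supported in $[\frac12,2]$ with $\int\varphi=1$ and $\int\tau^k\varphi(\tau)d\tau=0$ for $1\le k\le b$. Put $h=b/2$, $\mathcal P_t=P_t^{(b)}\otimes\varphi_t^\star$,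 $\mathcal S^1_t=\frac{1}{(b-1)!}(tL)^{h}e^{-tL}\otimes\varphi_t^\star$, and $\mathcal S^2_t=P^{(b)}_t\otimes\Psi_t^\star$, where $\Psi$ is the compactly supported function with $\Psi^{(h)}(\sigma)=\varphi(\sigma)+\sigma\varphi'(\sigma)$; thus $\mathcal Q_t:=-t\partial_t\mathcal P_t=(tL)^h\mathcal S^1_t+t^h\partial_\tau^h\mathcal S_t^2$. For tuples $I,J$ and integers $k,l\ge0$ let $$\mathcal A_{I,J}(f,g)=\mathcal P_tt^{\frac{|I|}2}V_I\big(\mathcal S^1_tf\cdot t^{\frac{|J|}2}V_J\mathcal P_tg\big),\qquad \mathcal B_{I,J}(f,g)=\mathcal S^1_t\big(t^{\frac{|I|}2}V_I\mathcal P_tf\cdot t^{\frac{|J|}2}V_J\mathcal P_tg\big),$$ $$\mathcal A_{k,l}(f,g)=\mathcal P_tt^k\partial_\tau^k\big(\mathcal S^2_tf\cdot t^l\partial_\tau^l\mathcal P_tg\big),\qquad \mathcal B_{k,l}(f,g)=\mathcal S^2_t\big(t^k\partial_\tau^k\mathcal P_tf\cdot t^l\partial_\tau^l\mathcal P_tg\big).$$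 For $i\in\{1,\dots,\ell_0\}^h$ and $A\subset\{1,\dots,b\}$ let $i_A$ be the subword of $(i_1,i_1,i_2,i_2,\dots,i_h,i_h)$ of the letters at the positions in $A$, $A^c$ the complement of $A$, and $\overline{i}_{A}$ the word $i_A$ reversed. Expanding $\mathcal P_t(\mathcal Q_tf\cdot\mathcal P_tg)$ and $\mathcal Q_t(\mathcal P_tf\cdot\mathcal P_tg)$ by the Leibniz rule and keeping the indicated terms, define $$\Pi_g(f)=\int_0^1\Big\{(-1)^h\sum_{i}\sum_{|A|>h}\big[(-1)^{|A^c|}\mathcal A_{i_A,\overline{i}_{A^c}}(f,g)+\mathcal B_{i_A,i_{A^c}}(f,g)\big]+\sum_{h/2<k\le h}\tbinom hk\big[(-1)^{h-k}\mathcal A_{k,h-k}(f,g)+\mathcal B_{k,h-k}(f,g)\big]\Big\}\frac{dt}t,$$ $$\Pi(f,g)=\int_0^1\Big\{(-1)^h\sum_i\Big(\sum_{|A|\le h}(-1)^{|A^c|}\big[\mathcal A_{i_A,\overline i_{A^c}}(f,g)+\mathcal A_{i_A,\overline i_{A^c}}(g,f)\big]+\sum_{|A|=h}\mathcal B_{i_A,i_{A^c}}(f,g)\Big)$$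 $$\qquad+\sum_{0\le k\le h/2}\tbinom hk(-1)^{h-k}\big[\mathcal A_{k,h-k}(f,g)+\mathcal A_{k,h-k}(g,f)\big]+\sum_{2k=h}\tbinom hk\mathcal B_{k,h-k}(f,g)\Big\}\frac{dt}t,$$ $$\Delta_{-1}(f,g)=\mathcal P_1(\mathcal P_1f\cdot\mathcal P_1g).$$ **Proposition.** Let $\omega_1,\omega_2$ be space-time weights and $\omega=\omega_1\omega_2$. The constants implicit in $\lesssim$ do not depend on $f,g$. (a) For all $\alpha,\beta\in\mathbb R$ and $\gamma>0$: if $f\in\mathcal C^\alpha_{\omega_1}$ and $g\in\mathcal C^\beta_{\omega_2}$, then $\Delta_{-1}(f,g)\in\mathcal C^\gamma_\omega$ and $\|\Delta_{-1}(f,g)\|_{\mathcal C^\gamma_\omega}\lesssim\|f\|_{\mathcal C^\alpha_{\omega_1}}\|g\|_{\mathcal C^\beta_{\omega_2}}$. (b) For all $\alpha\in(-3,3)$ and $f\in\mathcal C^\alpha_{\omega_1}$: if $\omega_2^{-1}g\in L^\infty(\nu)$, then $\Pi_g(f)\in\mathcal C^\alpha_\omega$ and $\|\Pi_g(f)\|_{\mathcal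 C^\alpha_\omega}\lesssim\|\omega_2^{-1}g\|_{L^\infty}\|f\|_{\mathcal C^\alpha_{\omega_1}}$; if $g\in\mathcal C^\beta_{\omega_2}$ with $\beta<0$ and $\alpha+\beta\in(-3,3)$, then $\Pi_g(f)\in\mathcal C^{\alpha+\beta}_\omega$ and $\|\Pi_g(f)\|_{\mathcal C^{\alpha+\beta}_\omega}\lesssim\|g\|_{\mathcal C^\beta_{\omega_2}}\|f\|_{\mathcal C^\alpha_{\omega_1}}$. (c) For all $\alpha,\beta\in(-\infty,3)$ with $\alpha+\beta>0$: if $f\in\mathcal C^\alpha_{\omega_1}$ and $g\in\mathcal C^\beta_{\omega_2}$, then $\Pi(f,g)\in\mathcal C^{\alpha+\beta}_\omega$ and $\|\Pi(f,g)\|_{\mathcal C^{\alpha+\beta}_\omega}\lesssim\|f\|_{\mathcal C^\alpha_{\omega_1}}\|g\|_{\mathcal C^\beta_{\omega_2}}$. In (b) and (c) the integrals over $t$ converge absolutely when tested against any test function, and define distributions. -/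

import Mathlib

open MeasureTheory Set Filter Topology
open scoped ENNReal NNReal

noncomputable section

namespace Parabolic

/-! ### Unbounded operators -/

section Unbounded

variable {E : Type*} [NormedAddCommGroup E] [NormedSpace ℝ E] {ι : Type*}

open Classical in
/-- The value `A x` of an unbounded operator; the value off the domain is irrelevant. -/
def app (A : E →ₗ.[ℝ] E) (x : E) : E :=
  if hx : x ∈ A.domain then A ⟨x, hx⟩ else 0

/-- `x` belongs to the domain of `A ^ n`; there, `A ^ n x = (app A)^[n] x`. -/
def PowDom (A : E →ₗ.[ℝ] E) (n : ℕ) (x : E) : Prop :=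
  ∀ j < n, (app A)^[j] x ∈ A.domain

/-- `V_I x = V_{i_k} (⋯ (V_{i_1} x))` for `I = (i_1, …, i_k)`. -/
def wordApp (V : ι → E →ₗ.[ℝ] E) : List ι → E → E
  | [], x => x
  | i :: I, x => wordApp V I (app (V i) x)

/-- `x` belongs to the domain of `V_I`. -/
def WordDom (V : ι → E →ₗ.[ℝ] E) : List ι → E → Prop
  | [], _ => True
  | i :: I, x => x ∈ (V i).domain ∧ WordDom V I (app (V i) x)

open Classical in
/-- The bounded operator that extends the map `A`, given on the (dense) set `D`. -/
def boundedExtension (D : Set E) (A : E → E) : E →L[ℝ] E :=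
  if h : ∃ R : E →L[ℝ] E, ∀ u ∈ D, R u = A u then h.choose else 0

end Unbounded

/-! ### The geometric and functional setting -/

variable {M : Type*} [MetricSpace M] [MeasurableSpace M]

/-- Volume doubling: balls have positive finite volume, and doubling the radius multiplies the
volume by at most a fixed factor. -/
def VolumeDoubling (μ : Measure M) : Prop :=
  (∀ (x : M) (r : ℝ), 0 < r → 0 < μ (Metric.ball x r) ∧ μ (Metric.ball x r) < ∞) ∧
  ∃ D : ℝ≥0, ∀ (x : M) (r : ℝ), 0 < r →
    μ (Metric.ball x (2 * r)) ≤ D * μ (Metric.ball x r)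

/-- The Gaussian function `μ(B(x, √t))⁻¹ exp (-c d(x,y)² / t)`. -/
def gaussian (μ : Measure M) (c t : ℝ) (x y : M) : ℝ :=
  (μ.real (Metric.ball x (√t)))⁻¹ * Real.exp (-c * dist x y ^ 2 / t)

/-- Gaussian bound and Gaussian Lipschitz bound at time `t` for a kernel. -/
structure IsGaussianKernel (μ : Measure M) (C c t : ℝ) (K : M → M → ℝ) : Prop where
  measurable : Measurable (Function.uncurry K)
  bound : ∀ x y, |K x y| ≤ C * gaussian μ c t x y
  lipschitz : ∀ x y z, dist x z ≤ √t →
    |K x y - K z y| ≤ C * (dist x z / √t) * gaussian μ c t x y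

/-- A system of operators `L = -∑ V_i²` on `L²(M, μ)`, together with the heat semigroup
`T t = e^{-tL}`, which satisfies the standing assumption of the theory. -/
structure HeatSystem (μ : Measure M) (ℓ₀ : ℕ) where
  /-- The first order operators `V_i`. -/
  V : Fin ℓ₀ → Lp ℝ 2 μ →ₗ.[ℝ] Lp ℝ 2 μ
  /-- The second order operator `L`. -/
  L : Lp ℝ 2 μ →ₗ.[ℝ] Lp ℝ 2 μ
  /-- The semigroup `T t = e^{-tL}`, for `t ≥ 0`. -/
  T : ℝ → Lp ℝ 2 μ →L[ℝ] Lp ℝ 2 μ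
  T_zero : T 0 = ContinuousLinearMap.id ℝ _
  T_add : ∀ s t, 0 ≤ s → 0 ≤ t → T (s + t) = (T s).comp (T t)
  T_continuous : ∀ u, Tendsto (fun t => T t u) (𝓝[>] 0) (𝓝 u)
  /-- `-L` is the generator of the semigroup. -/
  generator : ∀ u v, (u, v) ∈ L.graph ↔
    Tendsto (fun t : ℝ => t⁻¹ • (u - T t u)) (𝓝[>] 0) (𝓝 v)
  /-- The semigroup is holomorphic. -/
  holomorphic : ∃ C : ℝ, ∀ t, 0 < t → t ≤ 1 → ∀ u,
    T t u ∈ L.domain ∧ ‖t • app L (T t u)‖ ≤ C * ‖u‖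
  /-- `D(L)` is contained in the domain of `V_i²`. -/
  domain_le : ∀ u ∈ L.domain, ∀ i, WordDom V [i, i] u
  /-- `L = -∑ V_i²` on `D(L)`. -/
  L_eq : ∀ u ∈ L.domain, app L u = -∑ i, wordApp V [i, i] u
  /-- The Leibniz rule `V_i(uv) = u V_i v + v V_i u` for `u, v` in `D(L)`. -/
  leibniz : ∀ i, ∀ u ∈ L.domain, ∀ v ∈ L.domain, ∀ w ∈ (V i).domain,
    (∀ᵐ x ∂μ, w x = u x * v x) →
    ∀ᵐ x ∂μ, (app (V i) w) x = u x * (app (V i) v) x + v x * (app (V i) u) x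
  /-- The semigroup is conservative: its kernel has total mass one. -/
  conservative : ∀ t, 0 < t → t ≤ 1 → ∃ (C c : ℝ) (K : M → M → ℝ),
    0 < c ∧ IsGaussianKernel μ C c t K ∧
    (∀ u : Lp ℝ 2 μ, ∀ᵐ x ∂μ, (T t u) x = ∫ y, K x y * u y ∂μ) ∧
    ∀ᵐ x ∂μ, ∫ y, K x y ∂μ = 1
  /-- Gaussian estimates for `t^{|I|/2} V_I e^{-tL}`. -/
  gaussian_left : ∀ I : List (Fin ℓ₀), ∃ C c : ℝ, 0 < c ∧ ∀ t, 0 < t → t ≤ 1 →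
    ∃ K : M → M → ℝ, IsGaussianKernel μ C c t K ∧
      ∀ u : Lp ℝ 2 μ, WordDom V I (T t u) ∧
        ∀ᵐ x ∂μ, t ^ ((I.length : ℝ) / 2) * (wordApp V I (T t u)) x = ∫ y, K x y * u y ∂μ
  /-- Gaussian estimates for `e^{-tL} t^{|I|/2} V_I`. -/
  gaussian_right : ∀ I : List (Fin ℓ₀), ∃ C c : ℝ, 0 < c ∧ ∀ t, 0 < t → t ≤ 1 →
    ∃ K : M → M → ℝ, IsGaussianKernel μ C c t K ∧
      ∀ u : Lp ℝ 2 μ, WordDom V I u →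
        ∀ᵐ x ∂μ, t ^ ((I.length : ℝ) / 2) * (T t (wordApp V I u)) x = ∫ y, K x y * u y ∂μ

/-- Space-time weights on `M × ℝ`. -/
structure IsSpaceTimeWeight (ω : M × ℝ → ℝ) : Prop where
  one_le : ∀ e, 1 ≤ ω e
  mono : ∀ x, Monotone fun τ => ω (x, τ)
  growth : ∃ c₁ c₂ : ℝ, ∀ x y τ, ω (x, τ) * Real.exp (-c₁ * dist x y) ≤ c₂ * ω (y, τ)

/-- The norm `‖ω⁻¹ u‖` in `L^∞(M × ℝ, μ ⊗ dτ)`. -/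
def wNorm (μ : Measure M) (ω u : M × ℝ → ℝ) : ℝ≥0∞ :=
  eLpNormEssSup (fun e => (ω e)⁻¹ * u e) (μ.prod volume)

variable {μ : Measure M} {ℓ₀ : ℕ}

/-- The integral of `u χ` over `M × ℝ`, where `χ` is seen as a curve in `L²(M)`. -/
def pair (u : M × ℝ → ℝ) (χ : ℝ → Lp ℝ 2 μ) : ℝ :=
  ∫ τ, ∫ x, u (x, τ) * (χ τ) x ∂μ

/-! ### Test functions and distributions -/

namespace HeatSystem

variable (S : HeatSystem μ ℓ₀) (o : M)

/-- `(L^*)^k χ`. -/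
def adjPow (k : ℕ) (χ : ℝ → Lp ℝ 2 μ) : ℝ → Lp ℝ 2 μ :=
  fun τ => (app S.L.adjoint)^[k] (χ τ)

/-- The seminorms `sup_τ ‖exp(a d(o,·)) ∂_τ^n (L^*)^k χ(τ)‖_{L²(M)}`. -/
def testSeminorm (a n k : ℕ) (χ : ℝ → Lp ℝ 2 μ) : ℝ≥0∞ :=
  ⨆ τ : ℝ, eLpNorm
    (fun x => Real.exp (a * dist o x) * (iteratedDeriv n (S.adjPow k χ) τ) x) 2 μ

/-- Test functions on `M × ℝ`, as curves in `L²(M)`: compactly supported in time, and all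
`∂_τ^n (L^*)^k χ` exist and decay faster than every exponential in space. -/
structure IsTest (χ : ℝ → Lp ℝ 2 μ) : Prop where
  compact : HasCompactSupport χ
  domain : ∀ k τ, PowDom S.L.adjoint k (χ τ)
  smooth : ∀ k, ContDiff ℝ ((⊤ : ℕ∞) : WithTop ℕ∞) (S.adjPow k χ)
  decay : ∀ a n k, S.testSeminorm o a n k χ < ∞

/-- Distributions: continuous linear functionals on the space of test functions (values off that
space are irrelevant). -/
structure IsDistribution (F : (ℝ → Lp ℝ 2 μ) → ℝ) : Prop where
  add : ∀ χ₁ χ₂, S.IsTest o χ₁ → S.IsTest o χ₂ → F (χ₁ + χ₂) = F χ₁ + F χ₂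
  smul : ∀ (r : ℝ) χ, S.IsTest o χ → F (r • χ) = r * F χ
  continuous : ∀ τ₀ : ℝ, ∃ (N : ℕ) (C : ℝ≥0), ∀ χ, S.IsTest o χ →
    (∀ τ, τ₀ < |τ| → χ τ = 0) → ∀ B : ℝ≥0,
    (∀ a ≤ N, ∀ n ≤ N, ∀ k ≤ N, S.testSeminorm o a n k χ ≤ B) → |F χ| ≤ C * B

/-- The distribution `F` is (given by) the function `u`. -/
def IsRepr (F : (ℝ → Lp ℝ 2 μ) → ℝ) (u : M × ℝ → ℝ) : Prop :=
  AEStronglyMeasurable u (μ.prod volume) ∧ ∀ χ, S.IsTest o χ → F χ = pair u χ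

/-- The norm `‖ω⁻¹ F‖` in `L^∞` of a distribution, infinite unless `F` is given by a function. -/
def distWNorm (ω : M × ℝ → ℝ) (F : (ℝ → Lp ℝ 2 μ) → ℝ) : ℝ≥0∞ :=
  ⨅ (u : M × ℝ → ℝ) (_ : S.IsRepr o F u), wNorm μ ω u

open Classical in
/-- The function that a distribution of `⋃_ω L^∞(ω⁻¹)` is given by (unique almost everywhere). -/
def toFunction (F : (ℝ → Lp ℝ 2 μ) → ℝ) : M × ℝ → ℝ :=
  if h : ∃ u, S.IsRepr o F u ∧ ∃ ω, IsSpaceTimeWeight ω ∧ wNorm μ ω u < ∞ then h.choose else 0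

end HeatSystem

/-- The formal adjoint of `R ⊗ m_t^⋆`, where `m_t = t⁻¹ m(·/t)` acts by convolution in time and
`R` is a bounded operator on `L²(M)`. -/
def opAdj (R : Lp ℝ 2 μ →L[ℝ] Lp ℝ 2 μ) (m : ℝ → ℝ) (t : ℝ) (χ : ℝ → Lp ℝ 2 μ) :
    ℝ → Lp ℝ 2 μ :=
  fun σ => R.adjoint (∫ τ, (t⁻¹ * m ((τ - σ) / t)) • χ τ)

/-- The action of `R ⊗ m_t^⋆` on distributions, by duality. -/
def opDist (R : Lp ℝ 2 μ →L[ℝ] Lp ℝ 2 μ) (m : ℝ → ℝ) (t : ℝ) (F : (ℝ → Lp ℝ 2 μ) → ℝ) :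
    (ℝ → Lp ℝ 2 μ) → ℝ :=
  fun χ => F (opAdj R m t χ)

/-! ### Standard families of operators and parabolic Hölder spaces -/

/-- Parameters of `(t^{|J|/2} V_J) (tL)^n P_t^{(c)} ⊗ m_t^⋆`; `k` is the number of vanishing
moments of `m` that is taken into account. -/
structure StdFamily (ℓ₀ : ℕ) where
  J : List (Fin ℓ₀)
  n : ℕ
  k : ℕ
  c : ℕ
  m : ℝ → ℝ

/-- Membership in the standard collection `StGC^a`. -/
structure StdFamily.IsStGC (b a : ℕ) (Q : StdFamily ℓ₀) : Prop where
  order : Q.J.length + 2 * Q.n + 2 * Q.k = a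
  c_pos : 1 ≤ Q.c
  c_le : Q.c ≤ b
  smooth : ContDiff ℝ ((⊤ : ℕ∞) : WithTop ℕ∞) Q.m
  support : ∀ τ, τ ∉ Icc (1 / 2 : ℝ) 2 → Q.m τ = 0
  moments : ∀ i < Q.k, ∫ τ, τ ^ i * Q.m τ = 0
  bounded : ∀ i ≤ b, ∀ τ, |iteratedDeriv i Q.m τ| ≤ 1

namespace HeatSystem

variable (S : HeatSystem μ ℓ₀) (o : M)

/-- `P_t^{(c)} = ∑_{i < c} (tL)^i / i! e^{-tL}`. -/
def P (c : ℕ) (t : ℝ) : Lp ℝ 2 μ →L[ℝ] Lp ℝ 2 μ :=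
  boundedExtension univ fun u =>
    ∑ i ∈ Finset.range c, (t ^ i / (i.factorial : ℝ)) • (app S.L)^[i] (S.T t u)

/-- `(t^{|J|/2} V_J) (tL)^n P_t^{(c)}`. -/
def pre (J : List (Fin ℓ₀)) (n c : ℕ) (t : ℝ) : Lp ℝ 2 μ →L[ℝ] Lp ℝ 2 μ :=
  boundedExtension univ fun u =>
    (t ^ ((J.length : ℝ) / 2) * t ^ n) • wordApp S.V J ((app S.L)^[n] (S.P c t u))

/-- `P_t^{(c)} (t^{|I|/2} V_I)`. -/
def post (c : ℕ) (I : List (Fin ℓ₀)) (t : ℝ) : Lp ℝ 2 μ →L[ℝ] Lp ℝ 2 μ :=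
  boundedExtension {u | WordDom S.V I u} fun u =>
    t ^ ((I.length : ℝ) / 2) • S.P c t (wordApp S.V I u)

/-- The action `Q_t F` of a standard family on a distribution. -/
def stdDist (Q : StdFamily ℓ₀) (t : ℝ) (F : (ℝ → Lp ℝ 2 μ) → ℝ) : (ℝ → Lp ℝ 2 μ) → ℝ :=
  opDist (S.pre Q.J Q.n Q.c t) Q.m t F

/-- The norm of the weighted parabolic Hölder space `𝒞^α_ω`. -/
def holderNorm (b : ℕ) (α : ℝ) (ω : M × ℝ → ℝ) (F : (ℝ → Lp ℝ 2 μ) → ℝ) : ℝ≥0∞ :=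
  (⨆ (Q : StdFamily ℓ₀) (k : ℕ) (_ : k ≤ 2 * b) (_ : Q.IsStGC b k),
    S.distWNorm o ω (S.stdDist Q 1 F)) +
  ⨆ (Q : StdFamily ℓ₀) (k : ℕ) (_ : |α| < k) (_ : k ≤ 2 * b) (_ : Q.IsStGC b k)
    (t : ℝ) (_ : 0 < t) (_ : t ≤ 1),
    ENNReal.ofReal (t ^ (-α / 2)) * S.distWNorm o ω (S.stdDist Q t F)

/-- The weighted parabolic Hölder space `𝒞^α_ω`. -/
def MemHolder (b : ℕ) (α : ℝ) (ω : M × ℝ → ℝ) (F : (ℝ → Lp ℝ 2 μ) → ℝ) : Prop :=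
  S.IsDistribution o F ∧ S.holderNorm o b α ω F < ∞

/-- The function `(R ⊗ m_t^⋆) F`. -/
def opFun (R : Lp ℝ 2 μ →L[ℝ] Lp ℝ 2 μ) (m : ℝ → ℝ) (t : ℝ) (F : (ℝ → Lp ℝ 2 μ) → ℝ) :
    M × ℝ → ℝ :=
  S.toFunction o (opDist R m t F)

end HeatSystem

/-! ### Paraproduct, resonant term and low-frequency part, with `b = 2 h` -/

/-- The profile `φ`: smooth, supported in `[1/2, 2]`, of unit integral, with vanishing moments of
order `1, …, b`. -/
structure IsProfile (b : ℕ) (φ : ℝ → ℝ) : Prop where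
  smooth : ContDiff ℝ ((⊤ : ℕ∞) : WithTop ℕ∞) φ
  support : ∀ τ, τ ∉ Icc (1 / 2 : ℝ) 2 → φ τ = 0
  integral : ∫ τ, φ τ = 1
  moments : ∀ k, 1 ≤ k → k ≤ b → ∫ τ, τ ^ k * φ τ = 0

/-- The `h`-th primitive (null on the left) of `ψ(σ) = φ(σ) + σ φ'(σ)`. -/
def primitive (h : ℕ) (φ : ℝ → ℝ) (σ : ℝ) : ℝ :=
  ∫ r in Iic σ, (σ - r) ^ (h - 1) / ((h - 1).factorial : ℝ) * (φ r + r * deriv φ r)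

/-- The letters of the tuple `(i_1, i_1, i_2, i_2, …, i_h, i_h)` at the positions in `A`. -/
def subword {h : ℕ} (i : Fin h → Fin ℓ₀) (A : Finset (Fin (2 * h))) : List (Fin ℓ₀) :=
  (A.sort (· ≤ ·)).map fun p => i ⟨p.1 / 2, by have := p.2; omega⟩

namespace HeatSystem

variable (S : HeatSystem μ ℓ₀) (o : M) (h : ℕ) (φ : ℝ → ℝ)

/-- The operator `((b-1)!)⁻¹ (tL)^{b/2} e^{-tL}`, which together with `(tL)^{b/2}` makes up
`Q_t^{(b)}`. -/
def halfQ (t : ℝ) : Lp ℝ 2 μ →L[ℝ] Lp ℝ 2 μ :=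
  (((2 * h - 1).factorial : ℝ))⁻¹ • S.pre [] h 1 t

/-- `𝒜^{I,J}_{0,0}(f,g)` at scale `t`, paired with `χ`. -/
def spaceA (I J : List (Fin ℓ₀)) (f g : (ℝ → Lp ℝ 2 μ) → ℝ) (t : ℝ) (χ : ℝ → Lp ℝ 2 μ) : ℝ :=
  pair (S.opFun o (S.halfQ h t) φ t f * S.opFun o (S.pre J 0 (2 * h) t) φ t g)
    (opAdj (S.post (2 * h) I t) φ t χ)

/-- `ℬ^{I,J}_{0,0}(f,g)` at scale `t`, paired with `χ`. -/
def spaceB (I J : List (Fin ℓ₀)) (f g : (ℝ → Lp ℝ 2 μ) → ℝ) (t : ℝ) (χ : ℝ → Lp ℝ 2 μ) : ℝ :=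
  pair (S.opFun o (S.pre I 0 (2 * h) t) φ t f * S.opFun o (S.pre J 0 (2 * h) t) φ t g)
    (opAdj (S.halfQ h t) φ t χ)

/-- `𝒜^{∅,∅}_{k,l}(f,g)` at scale `t`, paired with `χ`; here `t^l ∂_τ^l φ_t^⋆` is the convolution
operator of the profile `φ^{(l)}`. -/
def timeA (k l : ℕ) (f g : (ℝ → Lp ℝ 2 μ) → ℝ) (t : ℝ) (χ : ℝ → Lp ℝ 2 μ) : ℝ :=
  pair (S.opFun o (S.P (2 * h) t) (primitive h φ) t f *
      S.opFun o (S.P (2 * h) t) (iteratedDeriv l φ) t g)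
    (opAdj (S.P (2 * h) t) (iteratedDeriv k φ) t χ)

/-- `ℬ^{∅,∅}_{k,l}(f,g)` at scale `t`, paired with `χ`. -/
def timeB (k l : ℕ) (f g : (ℝ → Lp ℝ 2 μ) → ℝ) (t : ℝ) (χ : ℝ → Lp ℝ 2 μ) : ℝ :=
  pair (S.opFun o (S.P (2 * h) t) (iteratedDeriv k φ) t f *
      S.opFun o (S.P (2 * h) t) (iteratedDeriv l φ) t g)
    (opAdj (S.P (2 * h) t) (primitive h φ) t χ)

/-- The integrand of `Π_g(f)`: the terms with `|I|/2 + k > b/4` of the Leibniz expansions of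
`𝒫_t(𝒬_t f · 𝒫_t g)` and `𝒬_t(𝒫_t f · 𝒫_t g)`. -/
def paraIntegrand (f g : (ℝ → Lp ℝ 2 μ) → ℝ) (t : ℝ) (χ : ℝ → Lp ℝ 2 μ) : ℝ :=
  (∑ i : Fin h → Fin ℓ₀, ∑ A : Finset (Fin (2 * h)) with h < A.card,
    (-1 : ℝ) ^ h *
      ((-1) ^ (Aᶜ).card * S.spaceA o h φ (subword i A) (subword i Aᶜ).reverse f g t χ +
        S.spaceB o h φ (subword i A) (subword i Aᶜ) f g t χ)) +
  ∑ k ∈ Finset.range (h + 1) with h < 2 * k,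
    (h.choose k : ℝ) *
      ((-1) ^ (h - k) * S.timeA o h φ k (h - k) f g t χ + S.timeB o h φ k (h - k) f g t χ)

/-- The integrand of `Π(f,g)`: the terms with `|I|/2 + k ≤ b/4` of the expansions of
`𝒫_t(𝒬_t f · 𝒫_t g)` and `𝒫_t(𝒬_t g · 𝒫_t f)`, and the terms with
`|I|/2 + k = |J|/2 + l = b/4` of the expansion of `𝒬_t(𝒫_t f · 𝒫_t g)`. -/
def resonantIntegrand (f g : (ℝ → Lp ℝ 2 μ) → ℝ) (t : ℝ) (χ : ℝ → Lp ℝ 2 μ) : ℝ :=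
  (∑ i : Fin h → Fin ℓ₀,
    ((∑ A : Finset (Fin (2 * h)) with A.card ≤ h,
        (-1 : ℝ) ^ h * (-1) ^ (Aᶜ).card *
          (S.spaceA o h φ (subword i A) (subword i Aᶜ).reverse f g t χ +
            S.spaceA o h φ (subword i A) (subword i Aᶜ).reverse g f t χ)) +
      ∑ A : Finset (Fin (2 * h)) with A.card = h,
        (-1 : ℝ) ^ h * S.spaceB o h φ (subword i A) (subword i Aᶜ) f g t χ)) +
  ((∑ k ∈ Finset.range (h + 1) with 2 * k ≤ h,
      (h.choose k : ℝ) * (-1) ^ (h - k) *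
        (S.timeA o h φ k (h - k) f g t χ + S.timeA o h φ k (h - k) g f t χ)) +
    ∑ k ∈ Finset.range (h + 1) with 2 * k = h,
      (h.choose k : ℝ) * S.timeB o h φ k (h - k) f g t χ)

/-- The paraproduct `Π_g(f)`. -/
def paraproduct (g f : (ℝ → Lp ℝ 2 μ) → ℝ) (χ : ℝ → Lp ℝ 2 μ) : ℝ :=
  ∫ t in Ioc (0 : ℝ) 1, S.paraIntegrand o h φ f g t χ / t

/-- The integral that defines `Π_g(f)` converges absolutely when tested. -/
def ParaConverges (g f : (ℝ → Lp ℝ 2 μ) → ℝ) : Prop :=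
  ∀ χ, S.IsTest o χ → IntegrableOn (fun t => S.paraIntegrand o h φ f g t χ / t) (Ioc (0 : ℝ) 1)

/-- The resonant term `Π(f,g)`. -/
def resonant (f g : (ℝ → Lp ℝ 2 μ) → ℝ) (χ : ℝ → Lp ℝ 2 μ) : ℝ :=
  ∫ t in Ioc (0 : ℝ) 1, S.resonantIntegrand o h φ f g t χ / t

/-- The integral that defines `Π(f,g)` converges absolutely when tested. -/
def ResonantConverges (f g : (ℝ → Lp ℝ 2 μ) → ℝ) : Prop :=
  ∀ χ, S.IsTest o χ →
    IntegrableOn (fun t => S.resonantIntegrand o h φ f g t χ / t) (Ioc (0 : ℝ) 1)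

/-- The low-frequency part `Δ_{-1}(f,g) = 𝒫_1(𝒫_1 f · 𝒫_1 g)`. -/
def lowFrequency (f g : (ℝ → Lp ℝ 2 μ) → ℝ) (χ : ℝ → Lp ℝ 2 μ) : ℝ :=
  pair (S.opFun o (S.P (2 * h) 1) φ 1 f * S.opFun o (S.P (2 * h) 1) φ 1 g)
    (opAdj (S.P (2 * h) 1) φ 1 χ)

end HeatSystem

end Parabolic

end

set_option linter.unusedSectionVars false
set_option linter.unusedSimpArgs false
set_option linter.style.haveILetI false

namespace Parabolic

section Weights

variable {M : Type*} [MetricSpace M] [MeasurableSpace M] {μ : Measure M}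

/-- Positive weights on `M` with exponential growth at rate at most `a`. -/
structure IsWt (a : ℝ) (w : M → ℝ) : Prop where
  nonneg : 0 ≤ a
  pos : ∀ x, 0 < w x
  le : ∀ x y, w x ≤ Real.exp (a * dist x y) * w y

lemma IsWt.continuous {a : ℝ} {w : M → ℝ} (hw : IsWt a w) : Continuous w := by
  have h : LipschitzWith (Real.toNNReal a) (fun x => Real.log (w x)) := by
    refine LipschitzWith.of_le_add_mul _ fun x y => ?_
    rw [Real.coe_toNNReal _ hw.nonneg]
    have := Real.log_le_log (hw.pos x) (hw.le x y)
    rw [Real.log_mul (Real.exp_pos _).ne' (hw.pos y).ne', Real.log_exp] at this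
    linarith
  have h2 : w = fun x => Real.exp (Real.log (w x)) := by
    funext x; rw [Real.exp_log (hw.pos x)]
  rw [h2]; exact Real.continuous_exp.comp h.continuous

lemma IsWt.mono {a a' : ℝ} {w : M → ℝ} (hw : IsWt a w) (h : a ≤ a') : IsWt a' w :=
  ⟨hw.nonneg.trans h, hw.pos, fun x y => (hw.le x y).trans (by
    have := (hw.pos y).le
    gcongr)⟩

lemma IsWt.mul {a a' : ℝ} {w w' : M → ℝ} (hw : IsWt a w) (hw' : IsWt a' w') :
    IsWt (a + a') (fun x => w x * w' x) :=
  ⟨add_nonneg hw.nonneg hw'.nonneg, fun x => mul_pos (hw.pos x) (hw'.pos x), fun x y => by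
    have h1 := mul_le_mul (hw.le x y) (hw'.le x y) (hw'.pos x).le
      (mul_nonneg (Real.exp_pos _).le (hw.pos y).le)
    have h2 : Real.exp ((a + a') * dist x y) =
      Real.exp (a * dist x y) * Real.exp (a' * dist x y) := by rw [← Real.exp_add]; ring_nf
    rw [h2]; linarith⟩

lemma isWt_exp (o : M) {a : ℝ} (ha : 0 ≤ a) : IsWt a (fun x => Real.exp (a * dist o x)) :=
  ⟨ha, fun _ => Real.exp_pos _, fun x y => by
    rw [← Real.exp_add, Real.exp_le_exp]
    have := dist_triangle o y x
    rw [dist_comm y x] at this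
    nlinarith⟩

lemma isWt_one : IsWt 0 (fun _ : M => (1 : ℝ)) :=
  ⟨le_rfl, fun _ => one_pos, fun x y => by simp⟩

variable [BorelSpace M] [SecondCountableTopology M]

/-- Weighted `L^p` norm. -/
noncomputable def wn (p : ℝ≥0∞) (w : M → ℝ) (v : Lp ℝ 2 μ) : ℝ≥0∞ :=
  eLpNorm (fun x => w x * v x) p μ

/-- The pairs of exponents in use. -/
def DualPair (p q : ℝ≥0∞) : Prop := (p = 1 ∧ q = ∞) ∨ (p = 2 ∧ q = 2)

/-- The exponents in use. -/
def GoodExp (p : ℝ≥0∞) : Prop := p = 1 ∨ p = 2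

lemma GoodExp.exists_dual {p : ℝ≥0∞} (hp : GoodExp p) : ∃ q, DualPair p q := by
  rcases hp with h | h
  · exact ⟨∞, Or.inl ⟨h, rfl⟩⟩
  · exact ⟨2, Or.inr ⟨h, rfl⟩⟩

lemma DualPair.goodExp {p q : ℝ≥0∞} (h : DualPair p q) : GoodExp p := by
  rcases h with h | h
  · exact Or.inl h.1
  · exact Or.inr h.1

lemma GoodExp.one_le {p : ℝ≥0∞} (hp : GoodExp p) : 1 ≤ p := by
  rcases hp with h | h <;> simp [h]

lemma wn_add_le {p : ℝ≥0∞} (hp : GoodExp p) {a : ℝ} {w : M → ℝ} (hw : IsWt a w)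
    (u v : Lp ℝ 2 μ) : wn p w (u + v) ≤ wn p w u + wn p w v := by
  have h : (fun x => w x * (u + v : Lp ℝ 2 μ) x) =ᵐ[μ]
      (fun x => w x * u x) + fun x => w x * v x := by
    filter_upwards [Lp.coeFn_add u v] with x hx
    rw [hx]; simp only [Pi.add_apply]; ring
  unfold wn
  rw [eLpNorm_congr_ae h]
  exact eLpNorm_add_le
    (hw.continuous.aestronglyMeasurable.mul (Lp.aestronglyMeasurable _))
    (hw.continuous.aestronglyMeasurable.mul (Lp.aestronglyMeasurable _)) hp.one_le

lemma wn_smul (p : ℝ≥0∞) (w : M → ℝ) (r : ℝ) (v : Lp ℝ 2 μ) :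
    wn p w (r • v) = ‖r‖ₑ * wn p w v := by
  have h : (fun x => w x * (r • v : Lp ℝ 2 μ) x) =ᵐ[μ] r • fun x => w x * v x := by
    filter_upwards [Lp.coeFn_smul r v] with x hx
    simp [hx]; ring
  unfold wn
  rw [eLpNorm_congr_ae h, eLpNorm_const_smul]

lemma wn_zero (p : ℝ≥0∞) (w : M → ℝ) : wn p w (0 : Lp ℝ 2 μ) = 0 := by
  have := wn_smul p w 0 (0 : Lp ℝ 2 μ)
  simpa using this

lemma wn_mono {p : ℝ≥0∞} {w w' : M → ℝ} (h0 : ∀ x, 0 ≤ w x) (h : ∀ x, w x ≤ w' x)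
    (v : Lp ℝ 2 μ) : wn p w v ≤ wn p w' v := by
  refine eLpNorm_mono fun x => ?_
  rw [norm_mul, norm_mul, Real.norm_of_nonneg (h0 x), Real.norm_of_nonneg ((h0 x).trans (h x))]
  gcongr; exact h x

lemma enorm_inner_le {p q : ℝ≥0∞} (hpq : DualPair p q) {a : ℝ} {w : M → ℝ} (hw : IsWt a w)
    (ψ v : Lp ℝ 2 μ) :
    ‖inner ℝ ψ v‖ₑ ≤ wn q (fun x => (w x)⁻¹) ψ * wn p w v := by
  have hq : q.HolderTriple p 1 := by
    rcases hpq with ⟨rfl, rfl⟩ | ⟨rfl, rfl⟩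
    · exact ⟨by simp⟩
    · exact ⟨by rw [ENNReal.inv_two_add_inv_two]; simp⟩
  have hm : AEStronglyMeasurable (fun x => (w x)⁻¹ * ψ x) μ :=
    (hw.continuous.inv₀ fun x => (hw.pos x).ne').aestronglyMeasurable.mul
      (Lp.aestronglyMeasurable _)
  have hm' : AEStronglyMeasurable (fun x => w x * v x) μ :=
    hw.continuous.aestronglyMeasurable.mul (Lp.aestronglyMeasurable _)
  have key := eLpNorm_smul_le_mul_eLpNorm (p := q) (q := p) (r := 1) hm' hm
  refine le_trans ?_ key
  rw [L2.inner_def, eLpNorm_one_eq_lintegral_enorm]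
  refine (enorm_integral_le_lintegral_enorm _).trans (lintegral_mono fun x => le_of_eq ?_)
  congr 1
  have := (hw.pos x).ne'
  simp only [Pi.smul_apply', smul_eq_mul, real_inner_eq_re_inner, RCLike.inner_apply]
  simp
  field_simp

variable [SigmaFinite μ]

/-- Sets exhausting `M` on which a weight is bounded. -/
def exhaust (μ : Measure M) [SigmaFinite μ] (w : M → ℝ) (n : ℕ) : Set M :=
  {x | w x ≤ n} ∩ spanningSets μ n

lemma measurableSet_exhaust {w : M → ℝ} (hw : Measurable w) (n : ℕ) :
    MeasurableSet (exhaust μ w n) :=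
  (measurableSet_le hw measurable_const).inter (measurableSet_spanningSets μ n)

lemma monotone_exhaust (w : M → ℝ) : Monotone (exhaust μ w) := fun m n h x hx =>
  ⟨(show w x ≤ m from hx.1).trans (by exact_mod_cast h), monotone_spanningSets μ h hx.2⟩

lemma iUnion_exhaust (w : M → ℝ) : ⋃ n, exhaust μ w n = univ := by
  refine eq_univ_of_forall fun x => ?_
  obtain ⟨n, hn⟩ := exists_nat_ge (w x)
  have : x ∈ ⋃ n, spanningSets μ n := by rw [iUnion_spanningSets]; trivial
  obtain ⟨m, hm⟩ := mem_iUnion.1 this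
  refine mem_iUnion.2 ⟨max n m, ?_, monotone_spanningSets μ (le_max_right _ _) hm⟩
  exact hn.trans (by exact_mod_cast le_max_left _ _)

lemma measure_exhaust_lt_top (w : M → ℝ) (n : ℕ) : μ (exhaust μ w n) < ∞ :=
  (measure_mono inter_subset_right).trans_lt (measure_spanningSets_lt_top μ n)

lemma lintegral_le_of_exhaust {w : M → ℝ} {f : M → ℝ≥0∞} {B : ℝ≥0∞}
    (h : ∀ n, ∫⁻ x in exhaust μ w n, f x ∂μ ≤ B) : ∫⁻ x, f x ∂μ ≤ B := by
  rw [← setLIntegral_univ, ← iUnion_exhaust (μ := μ) w,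
    setLIntegral_iUnion_of_directed _ (directed_of_isDirected_le (monotone_exhaust w))]
  exact iSup_le h

lemma inner_toLp_indicator {A : Set M} (hA : MeasurableSet A) {g : M → ℝ} (v : Lp ℝ 2 μ)
    (hg : MemLp (A.indicator g) 2 μ) (hnn : ∀ x, 0 ≤ g x * v x) :
    ‖inner ℝ (hg.toLp _) v‖ₑ = ∫⁻ x in A, ENNReal.ofReal (g x * v x) ∂μ := by
  have h1 : (fun x => inner ℝ ((hg.toLp _ : Lp ℝ 2 μ) x) (v x)) =ᵐ[μ]
      A.indicator (fun x => g x * v x) := by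
    filter_upwards [hg.coeFn_toLp] with x hx
    rw [hx]
    by_cases hxA : x ∈ A <;> simp [hxA, mul_comm]
  have h0 : ∀ x, 0 ≤ A.indicator (fun x => g x * v x) x :=
    fun x => indicator_nonneg (fun x _ => hnn x) x
  have h2 : Integrable (A.indicator (fun x => g x * v x)) μ :=
    (L2.integrable_inner (𝕜 := ℝ) (hg.toLp _) v).congr h1
  rw [L2.inner_def, integral_congr_ae h1, Real.enorm_of_nonneg (integral_nonneg h0),
    ofReal_integral_eq_lintegral_ofReal h2 (Eventually.of_forall h0), ← lintegral_indicator hA]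
  refine lintegral_congr fun x => ?_
  by_cases hxA : x ∈ A <;> simp [hxA]

/-- The weighted norms by duality. -/
lemma wn_le_of_dual {p q : ℝ≥0∞} (hpq : DualPair p q) {a : ℝ} {w : M → ℝ} (hw : IsWt a w)
    (v : Lp ℝ 2 μ) (B : ℝ≥0∞)
    (h : ∀ ψ : Lp ℝ 2 μ, wn q (fun x => (w x)⁻¹) ψ ≠ ∞ →
      ‖inner ℝ ψ v‖ₑ ≤ wn q (fun x => (w x)⁻¹) ψ * B) :
    wn p w v ≤ B := by
  have hwm : Measurable w := hw.continuous.measurable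
  have hvm : Measurable v := (Lp.stronglyMeasurable v).measurable
  rcases hpq with ⟨rfl, rfl⟩ | ⟨rfl, rfl⟩
  · unfold wn
    rw [eLpNorm_one_eq_lintegral_enorm]
    refine lintegral_le_of_exhaust (w := w) fun n => ?_
    set A := exhaust μ w n with hAdef
    have hA : MeasurableSet A := measurableSet_exhaust hwm n
    set g : M → ℝ := fun x => w x * SignType.sign (v x) with hg
    have hsgn : ∀ r : ℝ, |(SignType.sign r : ℝ)| ≤ 1 := fun r => by
      rcases lt_trichotomy r 0 with h | h | h <;> simp [h]
    have hgm : Measurable g := by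
      refine hwm.mul ?_
      have : (fun x => ((SignType.sign (v x) : SignType) : ℝ)) =
          fun x => if 0 < v x then 1 else if v x < 0 then -1 else 0 := by
        funext x
        rw [sign_apply]; split_ifs <;> simp
      rw [this]
      exact Measurable.ite (measurableSet_lt measurable_const hvm) measurable_const
        (Measurable.ite (measurableSet_lt hvm measurable_const) measurable_const measurable_const)
    have hmem : MemLp (A.indicator g) 2 μ := by
      rw [memLp_indicator_iff_restrict hA]
      haveI : IsFiniteMeasure (μ.restrict A) :=
        ⟨by simpa using measure_exhaust_lt_top (μ := μ) w n⟩
      refine MemLp.of_bound hgm.aestronglyMeasurable (n : ℝ) ?_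
      filter_upwards [ae_restrict_mem hA] with x hx
      rw [hg, norm_mul, Real.norm_of_nonneg (hw.pos x).le, Real.norm_eq_abs]
      have h1 : w x ≤ n := hx.1
      nlinarith [hsgn (v x), hw.pos x, abs_nonneg ((SignType.sign (v x) : SignType) : ℝ)]
    have hnn : ∀ x, g x * v x = w x * |v x| := fun x => by
      simp only [hg]; rw [mul_assoc, sign_mul_self]
    have h2 : wn ∞ (fun x => (w x)⁻¹) (hmem.toLp _) ≤ 1 := by
      unfold wn
      rw [eLpNorm_exponent_top]
      refine eLpNormEssSup_le_of_ae_enorm_bound ?_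
      filter_upwards [hmem.coeFn_toLp] with x hx
      rw [hx]
      by_cases hxA : x ∈ A
      · simp only [indicator_of_mem hxA, hg]
        rw [inv_mul_cancel_left₀ (hw.pos x).ne', ← ofReal_norm, ENNReal.ofReal_le_one]
        exact hsgn (v x)
      · simp [hxA]
    have h1 := h (hmem.toLp _) (ne_top_of_le_ne_top ENNReal.one_ne_top h2)
    rw [inner_toLp_indicator hA v hmem
      (fun x => by rw [hnn]; exact mul_nonneg (hw.pos x).le (abs_nonneg _))] at h1
    calc ∫⁻ x in A, ‖w x * v x‖ₑ ∂μ = ∫⁻ x in A, ENNReal.ofReal (g x * v x) ∂μ := by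
          refine lintegral_congr fun x => ?_
          rw [hnn, ← ofReal_norm, norm_mul, Real.norm_of_nonneg (hw.pos x).le,
            Real.norm_eq_abs]
      _ ≤ _ := h1.trans (by gcongr)
      _ = B := one_mul B
  · unfold wn
    rw [eLpNorm_eq_lintegral_rpow_enorm_toReal (by simp) (by simp)]
    have hle : ∫⁻ x, ‖w x * v x‖ₑ ^ (2 : ℝ) ∂μ ≤ B ^ (2 : ℝ) := by
      refine lintegral_le_of_exhaust (w := w) fun n => ?_
      set A := exhaust μ w n with hAdef
      have hA : MeasurableSet A := measurableSet_exhaust hwm n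
      set g : M → ℝ := fun x => w x ^ 2 * v x with hg
      have hgv : ∀ x, g x * v x = (w x * v x) ^ 2 := fun x => by simp only [hg]; ring
      have hmem : MemLp (A.indicator g) 2 μ := by
        rw [memLp_indicator_iff_restrict hA]
        have hb : MemLp (fun x => (n : ℝ) ^ 2 * v x) 2 (μ.restrict A) :=
          ((Lp.memLp v).restrict A).const_mul _
        refine hb.mono ((hwm.pow_const 2).mul hvm).aestronglyMeasurable ?_
        filter_upwards [ae_restrict_mem hA] with x hx
        have h1 : w x ≤ n := hx.1
        have h2 := (hw.pos x).le
        rw [hg, norm_mul, norm_mul, Real.norm_of_nonneg (pow_nonneg h2 2),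
          Real.norm_of_nonneg (pow_nonneg n.cast_nonneg 2)]
        gcongr
      have hnn : ∀ x, 0 ≤ g x * v x := fun x => by rw [hgv]; positivity
      have e1 : ∫⁻ x in A, ENNReal.ofReal (g x * v x) ∂μ =
          ∫⁻ x in A, ‖w x * v x‖ₑ ^ (2 : ℝ) ∂μ := by
        refine lintegral_congr fun x => ?_
        rw [hgv, ← sq_abs, ← Real.norm_eq_abs, ← ofReal_norm,
          ENNReal.ofReal_rpow_of_nonneg (norm_nonneg _) (by norm_num)]
        norm_num
      set I := ∫⁻ x in A, ‖w x * v x‖ₑ ^ (2 : ℝ) ∂μ with hI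
      have h2 : wn 2 (fun x => (w x)⁻¹) (hmem.toLp _) = I ^ (1 / 2 : ℝ) := by
        unfold wn
        rw [eLpNorm_eq_lintegral_rpow_enorm_toReal (by simp) (by simp), hI,
          ← lintegral_indicator hA]
        congr 1
        refine lintegral_congr_ae ?_
        filter_upwards [hmem.coeFn_toLp] with x hx
        rw [hx]
        by_cases hxA : x ∈ A
        · simp only [indicator_of_mem hxA, hg]
          congr 2
          have := (hw.pos x).ne'
          field_simp
        · simp [hxA]
      have hIfin : I ≠ ∞ := by
        have hb : MemLp (fun x => (n : ℝ) * v x) 2 (μ.restrict A) :=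
          ((Lp.memLp v).restrict A).const_mul _
        have hc : MemLp (fun x => w x * v x) 2 (μ.restrict A) := by
          refine hb.mono (hwm.mul hvm).aestronglyMeasurable ?_
          filter_upwards [ae_restrict_mem hA] with x hx
          have h1 : w x ≤ n := hx.1
          have h2 := (hw.pos x).le
          rw [norm_mul, norm_mul, Real.norm_of_nonneg h2, Real.norm_of_nonneg n.cast_nonneg]
          gcongr
        have := lintegral_rpow_enorm_lt_top_of_eLpNorm_lt_top (by simp) (by simp) hc.2
        rw [ENNReal.toReal_ofNat] at this
        exact this.ne
      have h1 := h (hmem.toLp _) (by simp [h2, ENNReal.rpow_eq_top_iff, hIfin])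
      rw [inner_toLp_indicator hA v hmem hnn] at h1
      rw [e1, h2] at h1
      by_cases hI0 : I = 0
      · rw [hI0]; exact zero_le
      have hs0 : I ^ (1 / 2 : ℝ) ≠ 0 := by
        simp [ENNReal.rpow_eq_zero_iff, hI0]
      have hsf : I ^ (1 / 2 : ℝ) ≠ ∞ := by
        simp [ENNReal.rpow_eq_top_iff, hIfin]
      have hII : I = I ^ (1 / 2 : ℝ) * I ^ (1 / 2 : ℝ) := by
        rw [← ENNReal.rpow_add_of_nonneg _ _ (by norm_num) (by norm_num)]; norm_num
      have h3 : I ^ (1 / 2 : ℝ) ≤ B := by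
        have h4 : I ^ (1 / 2 : ℝ) * I ^ (1 / 2 : ℝ) ≤ I ^ (1 / 2 : ℝ) * B := by
          rw [← hII]; exact h1
        exact (ENNReal.mul_le_mul_iff_right hs0 hsf).1 h4
      calc I = (I ^ (1 / 2 : ℝ)) ^ (2 : ℝ) := by rw [← ENNReal.rpow_mul]; norm_num
        _ ≤ B ^ (2 : ℝ) := by gcongr
    calc _ ≤ (B ^ (2 : ℝ)) ^ (1 / (2 : ℝ≥0∞).toReal) := by
          simp only [ENNReal.toReal_ofNat]; gcongr
      _ = B := by rw [← ENNReal.rpow_mul]; norm_num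

/-- Weighted norms of integrals. -/
lemma wn_integral_le {p : ℝ≥0∞} (hp : GoodExp p) {a : ℝ} {w : M → ℝ} (hw : IsWt a w)
    {α : Type*} [MeasurableSpace α] {m : Measure α} (f : α → Lp ℝ 2 μ) :
    wn p w (∫ s, f s ∂m) ≤ ∫⁻ s, wn p w (f s) ∂m := by
  obtain ⟨q, hq⟩ := hp.exists_dual
  by_cases hf : Integrable f m
  · refine wn_le_of_dual hq hw _ _ fun ψ h0 => ?_
    rw [← integral_inner hf]
    refine (enorm_integral_le_lintegral_enorm _).trans ?_
    rw [← lintegral_const_mul' _ _ h0]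
    exact lintegral_mono fun s => enorm_inner_le hq hw _ _
  · rw [integral_undef hf, wn_zero]; exact zero_le

end Weights

end Parabolic

namespace Parabolic

section Kernels

variable {M : Type*} [MetricSpace M] [MeasurableSpace M] {μ : Measure M}

lemma VolumeDoubling.exists_const (hμ : VolumeDoubling μ) :
    ∃ κ : ℝ, 0 < κ ∧ ∀ (x : M) (r : ℝ), 0 < r → ∀ n : ℕ,
      μ.real (Metric.ball x (n * r)) ≤ (Real.exp κ / 2) ^ n * μ.real (Metric.ball x r) := by
  obtain ⟨hfin, D, hD⟩ := hμ
  refine ⟨Real.log (2 * (D + 1)), Real.log_pos (by have := D.2; linarith [D.coe_nonneg]), ?_⟩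
  have h2 : Real.exp (Real.log (2 * ((D : ℝ) + 1))) / 2 = D + 1 := by
    rw [Real.exp_log (by positivity)]; ring
  rw [h2]
  have key : ∀ (x : M) (r : ℝ), 0 < r → ∀ n : ℕ,
      μ (Metric.ball x (2 ^ n * r)) ≤ (D : ℝ≥0∞) ^ n * μ (Metric.ball x r) := by
    intro x r hr n
    induction n with
    | zero => simp
    | succ n ih =>
      have := hD x (2 ^ n * r) (by positivity)
      calc μ (Metric.ball x (2 ^ (n + 1) * r)) = μ (Metric.ball x (2 * (2 ^ n * r))) := by
            congr 2; ring
        _ ≤ D * (D ^ n * μ (Metric.ball x r)) := this.trans (by gcongr)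
        _ = _ := by ring
  intro x r hr n
  have h3 : μ (Metric.ball x (n * r)) ≤ (D : ℝ≥0∞) ^ n * μ (Metric.ball x r) := by
    refine le_trans (measure_mono (Metric.ball_subset_ball ?_)) (key x r hr n)
    gcongr
    exact_mod_cast Nat.lt_two_pow_self.le
  have h4 := ENNReal.toReal_mono (ENNReal.mul_ne_top (by simp) (hfin x r hr).2.ne) h3
  rw [ENNReal.toReal_mul, ENNReal.toReal_pow, ENNReal.coe_toReal] at h4
  refine h4.trans ?_
  have : (0 : ℝ) ≤ D := D.2
  unfold Measure.real
  gcongr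
  linarith

lemma VolumeDoubling.real_pos (hμ : VolumeDoubling μ) (x : M) {r : ℝ} (hr : 0 < r) :
    0 < μ.real (Metric.ball x r) :=
  ENNReal.toReal_pos (hμ.1 x r hr).1.ne' (hμ.1 x r hr).2.ne

variable [BorelSpace M]

lemma VolumeDoubling.exists_lintegral_exp (hμ : VolumeDoubling μ) :
    ∃ κ C : ℝ, 0 < κ ∧ 0 ≤ C ∧ ∀ (x : M) (r : ℝ), 0 < r →
      ∫⁻ y, ENNReal.ofReal (Real.exp (-κ * (dist x y / r))) ∂μ ≤
        ENNReal.ofReal (C * μ.real (Metric.ball x r)) ∧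
      ∀ y, (μ.real (Metric.ball x r))⁻¹ ≤
        C * Real.exp (κ * (dist x y / r)) * (μ.real (Metric.ball y r))⁻¹ := by
  obtain ⟨κ, hκ, h⟩ := hμ.exists_const
  have hq : (0 : ℝ) < Real.exp κ / 2 := by positivity
  refine ⟨κ, Real.exp κ + Real.exp (2 * κ), hκ, by positivity, fun x r hr => ⟨?_, fun y => ?_⟩⟩
  · have h1 : ∀ y, ENNReal.ofReal (Real.exp (-κ * (dist x y / r))) ≤
        ∑' n : ℕ, (Metric.ball x ((n + 1 : ℕ) * r)).indicator
          (fun _ => ENNReal.ofReal (Real.exp (-κ * n))) y := by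
      intro y
      refine le_trans ?_ (ENNReal.le_tsum ⌊dist x y / r⌋₊)
      have hd : (0 : ℝ) ≤ dist x y / r := by positivity
      have hmem : y ∈ Metric.ball x ((⌊dist x y / r⌋₊ + 1 : ℕ) * r) := by
        rw [Metric.mem_ball, dist_comm, ← div_lt_iff₀ hr]
        push_cast
        exact Nat.lt_floor_add_one _
      rw [indicator_of_mem hmem]
      refine ENNReal.ofReal_le_ofReal (Real.exp_le_exp.2 ?_)
      have := Nat.floor_le hd
      nlinarith
    have hV := (hμ.real_pos x hr).le
    calc ∫⁻ y, ENNReal.ofReal (Real.exp (-κ * (dist x y / r))) ∂μ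
        ≤ ∫⁻ y, ∑' n : ℕ, (Metric.ball x ((n + 1 : ℕ) * r)).indicator
          (fun _ => ENNReal.ofReal (Real.exp (-κ * n))) y ∂μ := lintegral_mono h1
      _ = ∑' n : ℕ, ENNReal.ofReal (Real.exp (-κ * n)) *
            μ (Metric.ball x ((n + 1 : ℕ) * r)) := by
          rw [lintegral_tsum fun n =>
            (measurable_const.indicator Metric.isOpen_ball.measurableSet).aemeasurable]
          congr 1; funext n
          rw [lintegral_indicator_const Metric.isOpen_ball.measurableSet]
      _ ≤ ∑' n : ℕ, ENNReal.ofReal (Real.exp κ / 2 * μ.real (Metric.ball x r) * (1 / 2) ^ n) := by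
          refine ENNReal.tsum_le_tsum fun n => ?_
          have hb := (hμ.1 x ((n + 1 : ℕ) * r) (by positivity)).2
          rw [← ofReal_measureReal hb.ne, ← ENNReal.ofReal_mul (Real.exp_pos _).le]
          refine ENNReal.ofReal_le_ofReal ?_
          calc Real.exp (-κ * n) * μ.real (Metric.ball x ((n + 1 : ℕ) * r))
              ≤ Real.exp (-κ * n) * ((Real.exp κ / 2) ^ (n + 1) * μ.real (Metric.ball x r)) := by
                gcongr; exact h x r hr (n + 1)
            _ = Real.exp κ / 2 * μ.real (Metric.ball x r) * (1 / 2) ^ n := by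
                have : Real.exp (-κ * n) = (Real.exp κ)⁻¹ ^ n := by
                  rw [← Real.exp_neg, ← Real.exp_nat_mul]; ring_nf
                rw [this, pow_succ, div_pow, inv_pow, one_div_pow]
                have : Real.exp κ ^ n ≠ 0 := by positivity
                field_simp
      _ = ENNReal.ofReal (Real.exp κ * μ.real (Metric.ball x r)) := by
          rw [← ENNReal.ofReal_tsum_of_nonneg (fun n => by positivity)
            ((summable_geometric_of_lt_one (by norm_num) (by norm_num)).mul_left _), tsum_mul_left,
            tsum_geometric_of_lt_one (by norm_num) (by norm_num)]
          congr 1; norm_num; ring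
      _ ≤ _ := by
          refine ENNReal.ofReal_le_ofReal ?_
          have : 0 ≤ Real.exp (2 * κ) * μ.real (Metric.ball x r) := by positivity
          nlinarith
  · set s := dist x y / r with hs
    have hs0 : 0 ≤ s := by positivity
    have hVx := hμ.real_pos x hr
    have hVy := hμ.real_pos y hr
    set n := ⌈1 + s⌉₊ with hn
    have hn1 : 1 + s ≤ n := Nat.le_ceil _
    have hn2 : (n : ℝ) < 1 + s + 1 := Nat.ceil_lt_add_one (by positivity)
    have hsub : Metric.ball y r ⊆ Metric.ball x (n * r) := by
      refine Metric.ball_subset_ball' ?_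
      have : dist x y = s * r := by rw [hs]; field_simp
      rw [dist_comm, this]; nlinarith
    have h2 : μ.real (Metric.ball y r) ≤ Real.exp (2 * κ) * Real.exp (κ * s) *
        μ.real (Metric.ball x r) := by
      have hnr : 0 < (n : ℝ) * r := by
        have : (0 : ℝ) < n := by linarith
        positivity
      calc μ.real (Metric.ball y r) ≤ μ.real (Metric.ball x (n * r)) :=
            measureReal_mono hsub (hμ.1 x _ hnr).2.ne
        _ ≤ (Real.exp κ / 2) ^ n * μ.real (Metric.ball x r) := h x r hr n
        _ ≤ _ := by
          gcongr
          calc (Real.exp κ / 2) ^ n ≤ (Real.exp κ) ^ n := by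
                gcongr; linarith [Real.exp_pos κ]
            _ = Real.exp (n * κ) := by rw [← Real.exp_nat_mul]
            _ ≤ _ := by rw [← Real.exp_add]; exact Real.exp_le_exp.2 (by nlinarith)
    calc (μ.real (Metric.ball x r))⁻¹ ≤
          Real.exp (2 * κ) * Real.exp (κ * s) * (μ.real (Metric.ball y r))⁻¹ := by
          rw [← div_eq_mul_inv, le_div_iff₀ hVy, inv_mul_le_iff₀ hVx]
          linarith
      _ ≤ _ := by
          gcongr
          linarith [Real.exp_pos κ]

lemma VolumeDoubling.lintegral_exp_lt_top (hμ : VolumeDoubling μ) (o : M) {a : ℝ} (ha : 0 < a) :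
    ∫⁻ y, ENNReal.ofReal (Real.exp (-a * dist o y)) ∂μ < ∞ := by
  obtain ⟨κ, C, hκ, -, h⟩ := hμ.exists_lintegral_exp
  have := (h o (κ / a) (by positivity)).1
  refine lt_of_eq_of_lt ?_ (this.trans_lt ENNReal.ofReal_lt_top)
  refine lintegral_congr fun y => ?_
  congr 2; field_simp

lemma measurable_exp_dist [SecondCountableTopology M] (a : ℝ) :
    Measurable (Function.uncurry fun x y : M => Real.exp (a * dist x y)) :=
  Real.measurable_exp.comp ((measurable_fst.dist measurable_snd).const_mul a)

/-- Exponential moments of the Gaussian function, in both variables. -/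
lemma VolumeDoubling.exists_lintegral_gaussian (hμ : VolumeDoubling μ) {c a : ℝ} (hc : 0 < c)
    (ha : 0 ≤ a) :
    ∃ C : ℝ, 0 ≤ C ∧ ∀ t, 0 < t → t ≤ 1 →
      (∀ x, ∫⁻ y, ENNReal.ofReal (Real.exp (a * dist x y) * gaussian μ c t x y) ∂μ ≤
        ENNReal.ofReal C) ∧
      ∀ y, ∫⁻ x, ENNReal.ofReal (Real.exp (a * dist x y) * gaussian μ c t x y) ∂μ ≤
        ENNReal.ofReal C := by
  obtain ⟨κ, C, hκ, hC, h⟩ := hμ.exists_lintegral_exp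
  set B := Real.exp ((2 * κ + a) ^ 2 / (4 * c)) with hB
  refine ⟨B * C + B * C * C, by positivity, fun t ht ht1 => ?_⟩
  have hst : 0 < √t := Real.sqrt_pos.2 ht
  have hst1 : √t ≤ 1 := Real.sqrt_le_one.2 ht1
  have hexp : ∀ x y, Real.exp (a * dist x y) * gaussian μ c t x y ≤
      B * (μ.real (Metric.ball x √t))⁻¹ * Real.exp (-(2 * κ) * (dist x y / √t)) := by
    intro x y
    have hV := hμ.real_pos x hst
    unfold gaussian
    have h1 : Real.exp (a * dist x y) * Real.exp (-c * dist x y ^ 2 / t) ≤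
        B * Real.exp (-(2 * κ) * (dist x y / √t)) := by
      rw [← Real.exp_add, hB, ← Real.exp_add, Real.exp_le_exp]
      set s := dist x y / √t with hs
      have hd : dist x y = s * √t := by rw [hs]; field_simp
      have hs0 : 0 ≤ s := by positivity
      have e1 : -c * dist x y ^ 2 / t = -c * s ^ 2 := by
        rw [hd, mul_pow, Real.sq_sqrt ht.le]; field_simp
      rw [e1, hd]
      have e2 : a * (s * √t) ≤ a * s := by
        have : s * √t ≤ s * 1 := by gcongr
        nlinarith
      have e3 : (2 * κ + a) * s - c * s ^ 2 ≤ (2 * κ + a) ^ 2 / (4 * c) := by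
        rw [le_div_iff₀ (by positivity)]
        nlinarith [sq_nonneg (2 * κ + a - 2 * c * s)]
      linarith
    have hVi : 0 ≤ (μ.real (Metric.ball x √t))⁻¹ := by positivity
    nlinarith
  refine ⟨fun x => ?_, fun y => ?_⟩
  · have hV := hμ.real_pos x hst
    calc _ ≤ ∫⁻ y, ENNReal.ofReal (B * (μ.real (Metric.ball x √t))⁻¹) *
          ENNReal.ofReal (Real.exp (-κ * (dist x y / √t))) ∂μ := by
          refine lintegral_mono fun y => ?_
          rw [← ENNReal.ofReal_mul (by positivity)]
          refine ENNReal.ofReal_le_ofReal ((hexp x y).trans ?_)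
          gcongr; linarith
      _ = ENNReal.ofReal (B * (μ.real (Metric.ball x √t))⁻¹) *
          ∫⁻ y, ENNReal.ofReal (Real.exp (-κ * (dist x y / √t))) ∂μ :=
          lintegral_const_mul' _ _ ENNReal.ofReal_ne_top
      _ ≤ ENNReal.ofReal (B * (μ.real (Metric.ball x √t))⁻¹) *
          ENNReal.ofReal (C * μ.real (Metric.ball x √t)) := by gcongr; exact (h x _ hst).1
      _ = ENNReal.ofReal (B * C) := by
          rw [← ENNReal.ofReal_mul (by positivity)]; congr 1; field_simp
      _ ≤ _ := ENNReal.ofReal_le_ofReal (by have : 0 ≤ B * C * C := by positivity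
                                            linarith)
  · have hV := hμ.real_pos y hst
    calc _ ≤ ∫⁻ x, ENNReal.ofReal (B * C * (μ.real (Metric.ball y √t))⁻¹) *
          ENNReal.ofReal (Real.exp (-κ * (dist y x / √t))) ∂μ := by
          refine lintegral_mono fun x => ?_
          rw [← ENNReal.ofReal_mul (by positivity)]
          refine ENNReal.ofReal_le_ofReal ((hexp x y).trans ?_)
          have h1 := (h x _ hst).2 y
          have h2 : Real.exp (-(2 * κ) * (dist x y / √t)) =
              Real.exp (-κ * (dist y x / √t)) * Real.exp (-κ * (dist x y / √t)) := by
            rw [← Real.exp_add, dist_comm y x]; ring_nf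
          have h3 : Real.exp (κ * (dist x y / √t)) * Real.exp (-κ * (dist x y / √t)) = 1 := by
            rw [← Real.exp_add]; ring_nf; exact Real.exp_zero
          rw [h2]
          calc B * (μ.real (Metric.ball x √t))⁻¹ * (Real.exp (-κ * (dist y x / √t)) *
                Real.exp (-κ * (dist x y / √t)))
              ≤ B * (C * Real.exp (κ * (dist x y / √t)) * (μ.real (Metric.ball y √t))⁻¹) *
                (Real.exp (-κ * (dist y x / √t)) * Real.exp (-κ * (dist x y / √t))) := by gcongr
            _ = B * C * (μ.real (Metric.ball y √t))⁻¹ * Real.exp (-κ * (dist y x / √t)) *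
                (Real.exp (κ * (dist x y / √t)) * Real.exp (-κ * (dist x y / √t))) := by ring
            _ = _ := by rw [h3, mul_one]
      _ = ENNReal.ofReal (B * C * (μ.real (Metric.ball y √t))⁻¹) *
          ∫⁻ x, ENNReal.ofReal (Real.exp (-κ * (dist y x / √t))) ∂μ :=
          lintegral_const_mul' _ _ ENNReal.ofReal_ne_top
      _ ≤ ENNReal.ofReal (B * C * (μ.real (Metric.ball y √t))⁻¹) *
          ENNReal.ofReal (C * μ.real (Metric.ball y √t)) := by gcongr; exact (h y _ hst).1
      _ = ENNReal.ofReal (B * C * C) := by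
          rw [← ENNReal.ofReal_mul (by positivity)]; congr 1; field_simp
      _ ≤ _ := ENNReal.ofReal_le_ofReal (by have : 0 ≤ B * C := by positivity
                                            linarith)

variable [SecondCountableTopology M]

/-- The adjoint of `R` has norm at most `C` in all weighted spaces `L^1` and `L^2`. -/
structure WB (a C : ℝ) (R : Lp ℝ 2 μ →L[ℝ] Lp ℝ 2 μ) : Prop where
  nonneg : 0 ≤ C
  le : ∀ w, IsWt a w → ∀ p, GoodExp p → ∀ v : Lp ℝ 2 μ,
    wn p w (R.adjoint v) ≤ ENNReal.ofReal C * wn p w v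

namespace WB

variable {a C C' : ℝ} {R R' : Lp ℝ 2 μ →L[ℝ] Lp ℝ 2 μ}

lemma mono (h : WB a C R) (hC : C ≤ C') : WB a C' R :=
  ⟨h.nonneg.trans hC, fun w hw p hp v => (h.le w hw p hp v).trans (by gcongr)⟩

lemma anti {a' : ℝ} (h : WB a C R) (ha : a' ≤ a) : WB a' C R :=
  ⟨h.nonneg, fun w hw p hp v => h.le w (hw.mono ha) p hp v⟩

lemma comp (h : WB a C R) (h' : WB a C' R') : WB a (C * C') (R.comp R') :=
  ⟨mul_nonneg h.nonneg h'.nonneg, fun w hw p hp v => by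
    rw [ContinuousLinearMap.adjoint_comp, ContinuousLinearMap.comp_apply,
      ENNReal.ofReal_mul h.nonneg, mul_comm (ENNReal.ofReal C), mul_assoc]
    exact (h'.le w hw p hp _).trans (by gcongr; exact h.le w hw p hp v)⟩

lemma add (h : WB a C R) (h' : WB a C' R') : WB a (C + C') (R + R') :=
  ⟨add_nonneg h.nonneg h'.nonneg, fun w hw p hp v => by
    rw [map_add, _root_.add_apply, ENNReal.ofReal_add h.nonneg h'.nonneg, add_mul]
    exact (wn_add_le hp hw _ _).trans (add_le_add (h.le w hw p hp v) (h'.le w hw p hp v))⟩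

lemma smul (h : WB a C R) (r : ℝ) : WB a (|r| * C) (r • R) :=
  ⟨mul_nonneg (abs_nonneg _) h.nonneg, fun w hw p hp v => by
    rw [map_smulₛₗ, _root_.smul_apply, wn_smul]
    simp only [conj_trivial]
    rw [ENNReal.ofReal_mul (abs_nonneg r), mul_assoc, ← Real.norm_eq_abs, ofReal_norm]
    gcongr; exact h.le w hw p hp v⟩

lemma zero (a : ℝ) : WB a 0 (0 : Lp ℝ 2 μ →L[ℝ] Lp ℝ 2 μ) :=
  ⟨le_rfl, fun w hw p hp v => by rw [map_zero, _root_.zero_apply, wn_zero]; simp⟩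

lemma one (a : ℝ) : WB a 1 (ContinuousLinearMap.id ℝ (Lp ℝ 2 μ)) :=
  ⟨zero_le_one, fun w hw p hp v => by
    rw [show (ContinuousLinearMap.id ℝ (Lp ℝ 2 μ)).adjoint v = v from
      ext_inner_left ℝ fun u => by simp [ContinuousLinearMap.adjoint_inner_right]]
    simp⟩

lemma sum {ι : Type*} (s : Finset ι) {C : ι → ℝ} {R : ι → Lp ℝ 2 μ →L[ℝ] Lp ℝ 2 μ}
    (h : ∀ i ∈ s, WB a (C i) (R i)) : WB a (∑ i ∈ s, C i) (∑ i ∈ s, R i) := by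
  classical
  induction s using Finset.induction_on with
  | empty => simpa using zero a
  | insert i s hi ih =>
    rw [Finset.sum_insert hi, Finset.sum_insert hi]
    exact (h i (Finset.mem_insert_self _ _)).add
      (ih fun j hj => h j (Finset.mem_insert_of_mem hj))

lemma enorm_inner_le (h : WB a C R) {p q : ℝ≥0∞} (hpq : DualPair p q) {w : M → ℝ}
    (hw : IsWt a w) (ψ v : Lp ℝ 2 μ) :
    ‖inner ℝ (R ψ) v‖ₑ ≤ wn q (fun x => (w x)⁻¹) ψ * (ENNReal.ofReal C * wn p w v) := by
  rw [← ContinuousLinearMap.adjoint_inner_right]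
  exact (Parabolic.enorm_inner_le hpq hw _ _).trans (by gcongr; exact h.le w hw p hpq.goodExp v)

lemma of_dual [SigmaFinite μ] (hC : 0 ≤ C)
    (h : ∀ p q, DualPair p q → ∀ w, IsWt a w → ∀ ψ v : Lp ℝ 2 μ,
      wn q (fun x => (w x)⁻¹) ψ ≠ ∞ →
      ‖inner ℝ (R ψ) v‖ₑ ≤ wn q (fun x => (w x)⁻¹) ψ * (ENNReal.ofReal C * wn p w v)) :
    WB a C R :=
  ⟨hC, fun w hw p hp v => by
    obtain ⟨q, hq⟩ := hp.exists_dual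
    refine wn_le_of_dual hq hw _ _ fun ψ hψ => ?_
    rw [ContinuousLinearMap.adjoint_inner_right]
    exact h p q hq w hw ψ v hψ⟩

end WB

variable [SigmaFinite μ]

/-- Schur's test in weighted spaces. -/
lemma WB.of_kernel {K : M → M → ℝ} (hK : Measurable (Function.uncurry K)) {a C : ℝ} (hC : 0 ≤ C)
    (h1 : ∀ x, ∫⁻ y, ENNReal.ofReal (Real.exp (a * dist x y)) * ‖K x y‖ₑ ∂μ ≤ ENNReal.ofReal C)
    (h2 : ∀ y, ∫⁻ x, ENNReal.ofReal (Real.exp (a * dist x y)) * ‖K x y‖ₑ ∂μ ≤ ENNReal.ofReal C)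
    {R : Lp ℝ 2 μ →L[ℝ] Lp ℝ 2 μ} (hR : ∀ u : Lp ℝ 2 μ, ∀ᵐ x ∂μ, R u x = ∫ y, K x y * u y ∂μ) :
    WB a C R := by
  refine WB.of_dual hC fun p q hpq w hw ψ v hψ => ?_
  set ψ' : M → ℝ≥0∞ := fun y => ‖(w y)⁻¹ * ψ y‖ₑ with hψ'
  set v' : M → ℝ≥0∞ := fun x => ‖w x * v x‖ₑ with hv'
  set H : M → M → ℝ≥0∞ := fun x y => ENNReal.ofReal (Real.exp (a * dist x y)) * ‖K x y‖ₑ with hH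
  have hwm := hw.continuous.measurable
  have hψm : Measurable ψ' := (hwm.inv.mul (Lp.stronglyMeasurable ψ).measurable).enorm
  have hvm : Measurable v' := (hwm.mul (Lp.stronglyMeasurable v).measurable).enorm
  have hHm : Measurable (Function.uncurry H) :=
    (measurable_exp_dist a).ennreal_ofReal.mul hK.enorm
  have key : ‖inner ℝ (R ψ) v‖ₑ ≤ ∫⁻ x, ∫⁻ y, H x y * ψ' y * v' x ∂μ ∂μ := by
    rw [L2.inner_def]
    refine (enorm_integral_le_lintegral_enorm _).trans (lintegral_mono_ae ?_)
    filter_upwards [hR ψ] with x hx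
    rw [hx]
    have : inner ℝ (∫ y, K x y * ψ y ∂μ) (v x) = (∫ y, K x y * ψ y ∂μ) * v x := by
      simp [mul_comm]
    rw [this, enorm_mul]
    have hvx : ‖v x‖ₑ ≠ ∞ := enorm_ne_top
    refine (mul_le_mul_left (enorm_integral_le_lintegral_enorm _) _).trans ?_
    rw [← lintegral_mul_const' _ _ hvx]
    refine lintegral_mono fun y => ?_
    simp only [hH, hψ', hv', enorm_mul]
    have hwx := hw.pos x
    have hwy := hw.pos y
    rw [Real.enorm_of_nonneg (inv_nonneg.2 hwy.le), Real.enorm_of_nonneg hwx.le]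
    have h1 : 1 ≤ ENNReal.ofReal (Real.exp (a * dist x y)) * ENNReal.ofReal (w y)⁻¹ *
        ENNReal.ofReal (w x) := by
      rw [← ENNReal.ofReal_mul (Real.exp_pos _).le, ← ENNReal.ofReal_mul (by positivity),
        ENNReal.one_le_ofReal]
      have := hw.le y x
      rw [dist_comm] at this
      rw [mul_assoc, mul_comm (w y)⁻¹, ← mul_assoc, ← div_eq_mul_inv, le_div_iff₀ hwy]
      linarith
    calc ‖K x y‖ₑ * ‖ψ y‖ₑ * ‖v x‖ₑ = 1 * (‖K x y‖ₑ * ‖ψ y‖ₑ * ‖v x‖ₑ) := (one_mul _).symm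
      _ ≤ (ENNReal.ofReal (Real.exp (a * dist x y)) * ENNReal.ofReal (w y)⁻¹ *
        ENNReal.ofReal (w x)) * (‖K x y‖ₑ * ‖ψ y‖ₑ * ‖v x‖ₑ) := by gcongr
      _ = _ := by ring
  refine key.trans ?_
  rcases hpq with ⟨rfl, rfl⟩ | ⟨rfl, rfl⟩
  · have e1 : ∀ᵐ y ∂μ, ψ' y ≤ wn ∞ (fun x => (w x)⁻¹) ψ := by
      unfold wn; rw [eLpNorm_exponent_top]
      exact ae_le_eLpNormEssSup
    calc ∫⁻ x, ∫⁻ y, H x y * ψ' y * v' x ∂μ ∂μ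
        ≤ ∫⁻ x, wn ∞ (fun x => (w x)⁻¹) ψ * ENNReal.ofReal C * v' x ∂μ := by
          refine lintegral_mono fun x => ?_
          rw [lintegral_mul_const' _ _ enorm_ne_top]
          gcongr
          calc ∫⁻ y, H x y * ψ' y ∂μ ≤ ∫⁻ y, H x y * wn ∞ (fun x => (w x)⁻¹) ψ ∂μ := by
                refine lintegral_mono_ae ?_
                filter_upwards [e1] with y hy
                gcongr
            _ = (∫⁻ y, H x y ∂μ) * wn ∞ (fun x => (w x)⁻¹) ψ := lintegral_mul_const' _ _ hψ
            _ ≤ _ := by rw [mul_comm]; gcongr; exact h1 x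
      _ = wn ∞ (fun x => (w x)⁻¹) ψ * ENNReal.ofReal C * ∫⁻ x, v' x ∂μ :=
          lintegral_const_mul' _ _ (ENNReal.mul_ne_top hψ ENNReal.ofReal_ne_top)
      _ = _ := by unfold wn; rw [eLpNorm_one_eq_lintegral_enorm, mul_assoc]
  · have e2 : ∀ f : M → ℝ, eLpNorm f 2 μ = (∫⁻ x, ‖f x‖ₑ ^ (2 : ℝ) ∂μ) ^ (1 / 2 : ℝ) := fun f => by
      rw [eLpNorm_eq_lintegral_rpow_enorm_toReal (by simp) (by simp), ENNReal.toReal_ofNat]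
    have hm1 : Measurable fun z : M × M => H z.1 z.2 * ψ' z.2 ^ (2 : ℝ) :=
      hHm.mul ((hψm.comp measurable_snd).pow_const _)
    have hm2 : Measurable fun z : M × M => H z.1 z.2 * v' z.1 ^ (2 : ℝ) :=
      hHm.mul ((hvm.comp measurable_fst).pow_const _)
    have hsq : ∀ b c : ℝ≥0∞, (b * c ^ (2 : ℝ)) ^ (1 / 2 : ℝ) = b ^ (1 / 2 : ℝ) * c := fun b c => by
      rw [ENNReal.mul_rpow_of_nonneg _ _ (by norm_num), ← ENNReal.rpow_mul]; norm_num
    have hhalf : ∀ b : ℝ≥0∞, b ^ (1 / 2 : ℝ) * b ^ (1 / 2 : ℝ) = b := fun b => by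
      rw [← ENNReal.rpow_add_of_nonneg _ _ (by norm_num) (by norm_num)]; norm_num
    calc ∫⁻ x, ∫⁻ y, H x y * ψ' y * v' x ∂μ ∂μ
        = ∫⁻ z, H z.1 z.2 * ψ' z.2 * v' z.1 ∂(μ.prod μ) := by
          have hm : Measurable fun z : M × M => H z.1 z.2 * ψ' z.2 * v' z.1 :=
            (hHm.mul (hψm.comp measurable_snd)).mul (hvm.comp measurable_fst)
          rw [lintegral_prod _ hm.aemeasurable]
      _ = ∫⁻ z, (H z.1 z.2 * ψ' z.2 ^ (2 : ℝ)) ^ (1 / 2 : ℝ) *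
            (H z.1 z.2 * v' z.1 ^ (2 : ℝ)) ^ (1 / 2 : ℝ) ∂(μ.prod μ) := by
          refine lintegral_congr fun z => ?_
          rw [hsq, hsq]
          nth_rewrite 1 [← hhalf (H z.1 z.2)]
          ring
      _ ≤ (∫⁻ z, H z.1 z.2 * ψ' z.2 ^ (2 : ℝ) ∂(μ.prod μ)) ^ (1 / 2 : ℝ) *
          (∫⁻ z, H z.1 z.2 * v' z.1 ^ (2 : ℝ) ∂(μ.prod μ)) ^ (1 / 2 : ℝ) :=
          ENNReal.lintegral_mul_norm_pow_le hm1.aemeasurable hm2.aemeasurable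
            (by norm_num) (by norm_num) (by norm_num)
      _ ≤ (ENNReal.ofReal C * ∫⁻ y, ψ' y ^ (2 : ℝ) ∂μ) ^ (1 / 2 : ℝ) *
          (ENNReal.ofReal C * ∫⁻ x, v' x ^ (2 : ℝ) ∂μ) ^ (1 / 2 : ℝ) := by
          gcongr
          · rw [lintegral_prod_symm' _ hm1, ← lintegral_const_mul _ (hψm.pow_const _)]
            refine lintegral_mono fun y => ?_
            have hm : Measurable fun x => H x y :=
              hHm.comp (measurable_id.prodMk measurable_const)
            dsimp only
            rw [lintegral_mul_const _ hm]
            gcongr; exact h2 y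
          · rw [lintegral_prod _ hm2.aemeasurable, ← lintegral_const_mul _ (hvm.pow_const _)]
            refine lintegral_mono fun x => ?_
            have hm : Measurable fun y => H x y :=
              hHm.comp (measurable_const.prodMk measurable_id)
            dsimp only
            rw [lintegral_mul_const _ hm]
            gcongr; exact h1 x
      _ = _ := by
          unfold wn
          rw [e2, e2, ENNReal.mul_rpow_of_nonneg _ _ (by norm_num),
            ENNReal.mul_rpow_of_nonneg _ _ (by norm_num)]
          nth_rewrite 3 [← hhalf (ENNReal.ofReal C)]
          ring

/-- Integral operators with kernels that satisfy Schur's condition. -/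
lemma exists_kernel_operator {K : M → M → ℝ} (hK : Measurable (Function.uncurry K)) {C : ℝ}
    (h1 : ∀ x, ∫⁻ y, ‖K x y‖ₑ ∂μ ≤ ENNReal.ofReal C)
    (h2 : ∀ y, ∫⁻ x, ‖K x y‖ₑ ∂μ ≤ ENNReal.ofReal C) :
    ∃ R : Lp ℝ 2 μ →L[ℝ] Lp ℝ 2 μ,
      ∀ u : Lp ℝ 2 μ, ∀ᵐ x ∂μ, R u x = ∫ y, K x y * u y ∂μ := by
  have hhalf : ∀ b : ℝ≥0∞, (b ^ (1 / 2 : ℝ)) ^ (2 : ℝ) = b := fun b => by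
    rw [← ENNReal.rpow_mul]; norm_num
  have e2 : ∀ f : M → ℝ, eLpNorm f 2 μ = (∫⁻ x, ‖f x‖ₑ ^ (2 : ℝ) ∂μ) ^ (1 / 2 : ℝ) := fun f => by
    rw [eLpNorm_eq_lintegral_rpow_enorm_toReal (by simp) (by simp), ENNReal.toReal_ofNat]
  have hrow : ∀ u : Lp ℝ 2 μ,
      ∫⁻ x, (∫⁻ y, ‖K x y * u y‖ₑ ∂μ) ^ (2 : ℝ) ∂μ ≤
        ENNReal.ofReal C ^ (2 : ℝ) * ∫⁻ y, ‖u y‖ₑ ^ (2 : ℝ) ∂μ := by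
    intro u
    have hum := (Lp.stronglyMeasurable u).measurable
    have hm : Measurable fun z : M × M => ‖K z.1 z.2‖ₑ * ‖u z.2‖ₑ ^ (2 : ℝ) :=
      hK.enorm.mul ((hum.comp measurable_snd).enorm.pow_const _)
    have hx : ∀ x, (∫⁻ y, ‖K x y * u y‖ₑ ∂μ) ^ (2 : ℝ) ≤
        ENNReal.ofReal C * ∫⁻ y, ‖K x y‖ₑ * ‖u y‖ₑ ^ (2 : ℝ) ∂μ := by
      intro x
      have hKx : Measurable (K x) := hK.comp (measurable_const.prodMk measurable_id)
      calc (∫⁻ y, ‖K x y * u y‖ₑ ∂μ) ^ (2 : ℝ)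
          = (∫⁻ y, ‖K x y‖ₑ ^ (1 / 2 : ℝ) *
              (‖K x y‖ₑ * ‖u y‖ₑ ^ (2 : ℝ)) ^ (1 / 2 : ℝ) ∂μ) ^ (2 : ℝ) := by
            congr 1
            refine lintegral_congr fun y => ?_
            rw [ENNReal.mul_rpow_of_nonneg _ _ (by norm_num), ← mul_assoc,
              ← ENNReal.rpow_add_of_nonneg _ _ (by norm_num) (by norm_num), ← ENNReal.rpow_mul,
              enorm_mul]
            norm_num
        _ ≤ ((∫⁻ y, ‖K x y‖ₑ ∂μ) ^ (1 / 2 : ℝ) *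
              (∫⁻ y, ‖K x y‖ₑ * ‖u y‖ₑ ^ (2 : ℝ) ∂μ) ^ (1 / 2 : ℝ)) ^ (2 : ℝ) := by
            gcongr
            exact ENNReal.lintegral_mul_norm_pow_le hKx.enorm.aemeasurable
              (hKx.enorm.mul (hum.enorm.pow_const _)).aemeasurable
              (by norm_num) (by norm_num) (by norm_num)
        _ = (∫⁻ y, ‖K x y‖ₑ ∂μ) * ∫⁻ y, ‖K x y‖ₑ * ‖u y‖ₑ ^ (2 : ℝ) ∂μ := by
            rw [ENNReal.mul_rpow_of_nonneg _ _ (by norm_num), hhalf, hhalf]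
        _ ≤ _ := by gcongr; exact h1 x
    calc _ ≤ ∫⁻ x, ENNReal.ofReal C * ∫⁻ y, ‖K x y‖ₑ * ‖u y‖ₑ ^ (2 : ℝ) ∂μ ∂μ := lintegral_mono hx
      _ = ENNReal.ofReal C * ∫⁻ x, ∫⁻ y, ‖K x y‖ₑ * ‖u y‖ₑ ^ (2 : ℝ) ∂μ ∂μ :=
          lintegral_const_mul' _ _ ENNReal.ofReal_ne_top
      _ ≤ ENNReal.ofReal C * (ENNReal.ofReal C * ∫⁻ y, ‖u y‖ₑ ^ (2 : ℝ) ∂μ) := by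
          gcongr
          rw [lintegral_lintegral_swap hm.aemeasurable,
            ← lintegral_const_mul _ (hum.enorm.pow_const _)]
          refine lintegral_mono fun y => ?_
          have hm : Measurable fun x => ‖K x y‖ₑ :=
            (hK.comp (measurable_id.prodMk measurable_const)).enorm
          dsimp only
          rw [lintegral_mul_const _ hm]
          gcongr; exact h2 y
      _ = _ := by rw [← mul_assoc, ENNReal.rpow_two, sq]
  have hfin : ∀ u : Lp ℝ 2 μ, ∫⁻ y, ‖u y‖ₑ ^ (2 : ℝ) ∂μ < ∞ := fun u => by
    have := lintegral_rpow_enorm_lt_top_of_eLpNorm_lt_top (by simp) (by simp) (Lp.memLp u).2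
    rwa [ENNReal.toReal_ofNat] at this
  have hint : ∀ u : Lp ℝ 2 μ, ∀ᵐ x ∂μ, Integrable (fun y => K x y * u y) μ := by
    intro u
    have hum := (Lp.stronglyMeasurable u).measurable
    have hm : Measurable fun z : M × M => ‖K z.1 z.2 * u z.2‖ₑ :=
      (hK.mul (hum.comp measurable_snd)).enorm
    have := ae_lt_top (hm.lintegral_prod_right'.pow_const 2)
      ((hrow u).trans_lt (ENNReal.mul_lt_top (by simp) (hfin u))).ne
    filter_upwards [this] with x hx
    refine ⟨((hK.comp (measurable_const.prodMk measurable_id)).mul hum).aestronglyMeasurable, ?_⟩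
    rw [hasFiniteIntegral_iff_enorm]
    by_contra hcon
    rw [not_lt, top_le_iff] at hcon
    rw [hcon] at hx
    simp at hx
  have hsm : ∀ u : Lp ℝ 2 μ, StronglyMeasurable fun x => ∫ y, K x y * u y ∂μ := fun u => by
    have : StronglyMeasurable (Function.uncurry fun x y => K x y * u y) :=
      (hK.mul ((Lp.stronglyMeasurable u).measurable.comp measurable_snd)).stronglyMeasurable
    exact this.integral_prod_right
  have hnorm : ∀ u : Lp ℝ 2 μ, eLpNorm (fun x => ∫ y, K x y * u y ∂μ) 2 μ ≤
      ENNReal.ofReal C * eLpNorm u 2 μ := by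
    intro u
    rw [e2, e2]
    calc _ ≤ (∫⁻ x, (∫⁻ y, ‖K x y * u y‖ₑ ∂μ) ^ (2 : ℝ) ∂μ) ^ (1 / 2 : ℝ) := by
          gcongr with x
          exact enorm_integral_le_lintegral_enorm _
      _ ≤ (ENNReal.ofReal C ^ (2 : ℝ) * ∫⁻ y, ‖u y‖ₑ ^ (2 : ℝ) ∂μ) ^ (1 / 2 : ℝ) := by
          gcongr; exact hrow u
      _ = _ := by
          rw [ENNReal.mul_rpow_of_nonneg _ _ (by norm_num), ← ENNReal.rpow_mul]
          norm_num
  have hmem : ∀ u : Lp ℝ 2 μ, MemLp (fun x => ∫ y, K x y * u y ∂μ) 2 μ := fun u =>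
    ⟨(hsm u).aestronglyMeasurable,
      (hnorm u).trans_lt (ENNReal.mul_lt_top (by simp) (Lp.memLp u).2)⟩
  refine ⟨LinearMap.mkContinuous
    { toFun := fun u => (hmem u).toLp _
      map_add' := fun u v => ?_
      map_smul' := fun r u => ?_ } (max C 0) fun u => ?_, fun u => ?_⟩
  · rw [← MemLp.toLp_add]
    refine MemLp.toLp_congr _ _ ?_
    filter_upwards [hint u, hint v] with x hx hy
    rw [Pi.add_apply, ← integral_add hx hy]
    refine integral_congr_ae ?_
    filter_upwards [Lp.coeFn_add u v] with y hy
    rw [hy, Pi.add_apply, mul_add]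
  · rw [RingHom.id_apply, ← MemLp.toLp_const_smul]
    refine MemLp.toLp_congr _ _ (Eventually.of_forall fun x => ?_)
    simp only [Pi.smul_apply, smul_eq_mul]
    rw [← integral_const_mul]
    refine integral_congr_ae ?_
    filter_upwards [Lp.coeFn_smul r u] with y hy
    rw [hy, Pi.smul_apply, smul_eq_mul]; ring
  · simp only [LinearMap.coe_mk, AddHom.coe_mk]
    rw [Lp.norm_toLp, Lp.norm_def]
    have := ENNReal.toReal_mono (ENNReal.mul_ne_top ENNReal.ofReal_ne_top (Lp.memLp u).2.ne)
      (hnorm u)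
    rwa [ENNReal.toReal_mul, ENNReal.toReal_ofReal'] at this
  · exact (hmem u).coeFn_toLp

/-- Operators with Gaussian kernels. -/
lemma VolumeDoubling.exists_gaussian_operator (hμ : VolumeDoubling μ) (C : ℝ) {c : ℝ} (hc : 0 < c) :
    ∃ C' : ℝ → ℝ, ∀ t, 0 < t → t ≤ 1 → ∀ K, IsGaussianKernel μ C c t K →
      ∃ R : Lp ℝ 2 μ →L[ℝ] Lp ℝ 2 μ,
        (∀ u : Lp ℝ 2 μ, ∀ᵐ x ∂μ, R u x = ∫ y, K x y * u y ∂μ) ∧ ∀ a, 0 ≤ a → WB a (C' a) R := by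
  choose! G hG0 hG using fun (a : ℝ) (ha : 0 ≤ a) =>
    hμ.exists_lintegral_gaussian (c := c) (a := a) hc ha
  refine ⟨fun a => |C| * G a, fun t ht ht1 K hK => ?_⟩
  have hle : ∀ a x y, ENNReal.ofReal (Real.exp (a * dist x y)) * ‖K x y‖ₑ ≤
      ENNReal.ofReal |C| * ENNReal.ofReal (Real.exp (a * dist x y) * gaussian μ c t x y) := by
    intro a x y
    have hg : 0 ≤ gaussian μ c t x y := by unfold gaussian; positivity
    rw [← ofReal_norm, ← ENNReal.ofReal_mul (Real.exp_pos _).le,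
      ← ENNReal.ofReal_mul (abs_nonneg _)]
    refine ENNReal.ofReal_le_ofReal ?_
    have h1 := (hK.bound x y).trans (mul_le_mul_of_nonneg_right (le_abs_self C) hg)
    rw [Real.norm_eq_abs]
    nlinarith [Real.exp_pos (a * dist x y)]
  have hr : ∀ a, 0 ≤ a → ∀ x, ∫⁻ y, ENNReal.ofReal (Real.exp (a * dist x y)) * ‖K x y‖ₑ ∂μ ≤
      ENNReal.ofReal (|C| * G a) := fun a ha x => by
    refine (lintegral_mono fun y => hle a x y).trans ?_
    rw [lintegral_const_mul' _ _ ENNReal.ofReal_ne_top, ENNReal.ofReal_mul (abs_nonneg _)]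
    gcongr; exact (hG a ha t ht ht1).1 x
  have hcol : ∀ a, 0 ≤ a → ∀ y, ∫⁻ x, ENNReal.ofReal (Real.exp (a * dist x y)) * ‖K x y‖ₑ ∂μ ≤
      ENNReal.ofReal (|C| * G a) := fun a ha y => by
    refine (lintegral_mono fun x => hle a x y).trans ?_
    rw [lintegral_const_mul' _ _ ENNReal.ofReal_ne_top, ENNReal.ofReal_mul (abs_nonneg _)]
    gcongr; exact (hG a ha t ht ht1).2 y
  obtain ⟨R, hR⟩ := exists_kernel_operator (μ := μ) hK.measurable
    (C := |C| * G 0)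
    (fun x => le_trans (by simp) (hr 0 le_rfl x)) (fun y => le_trans (by simp) (hcol 0 le_rfl y))
  exact ⟨R, hR, fun a ha => WB.of_kernel hK.measurable (mul_nonneg (abs_nonneg _) (hG0 a ha))
    (hr a ha) (hcol a ha) hR⟩

end Kernels

end Parabolic

namespace Parabolic

section Abstract

variable {E : Type*} [NormedAddCommGroup E] [NormedSpace ℝ E] {ι : Type*}

lemma app_of_mem {A : E →ₗ.[ℝ] E} {x : E} (hx : x ∈ A.domain) : app A x = A ⟨x, hx⟩ := dif_pos hx

lemma boundedExtension_apply {D : Set E} {A : E → E} {R : E →L[ℝ] E} (h : ∀ u ∈ D, R u = A u)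
    {u : E} (hu : u ∈ D) : boundedExtension D A u = A u := by
  have h' : ∃ R : E →L[ℝ] E, ∀ u ∈ D, R u = A u := ⟨R, h⟩
  rw [boundedExtension, dif_pos h']
  exact h'.choose_spec u hu

lemma boundedExtension_eq_of_dense {D : Set E} (hD : Dense D) {A : E → E} {R : E →L[ℝ] E}
    (h : ∀ u ∈ D, R u = A u) : boundedExtension D A = R := by
  ext u
  refine hD.induction (P := fun u => boundedExtension D A u = R u)
    (fun u hu => (boundedExtension_apply h hu).trans (h u hu).symm) ?_ u
  exact isClosed_eq (boundedExtension D A).continuous R.continuous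

lemma boundedExtension_univ_eq {A : E → E} {R : E →L[ℝ] E} (h : ∀ u, R u = A u) :
    boundedExtension univ A = R :=
  boundedExtension_eq_of_dense dense_univ fun u _ => h u

lemma mem_of_graph {A : E →ₗ.[ℝ] E} {u v : E} (h : (u, v) ∈ A.graph) :
    u ∈ A.domain ∧ app A u = v := by
  obtain ⟨y, hy1, hy2⟩ := (LinearPMap.mem_graph_iff A).1 h
  simp only at hy1 hy2
  subst hy1
  exact ⟨y.2, by rw [app_of_mem y.2]; exact hy2⟩

lemma graph_of_mem {A : E →ₗ.[ℝ] E} {u : E} (h : u ∈ A.domain) : (u, app A u) ∈ A.graph := by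
  rw [app_of_mem h]; exact A.mem_graph ⟨u, h⟩

end Abstract

variable {M : Type*} [MetricSpace M] [MeasurableSpace M] {μ : Measure M} {ℓ₀ : ℕ}

lemma WB.norm_le [BorelSpace M] [SecondCountableTopology M] {a C : ℝ} (ha : 0 ≤ a)
    {R : Lp ℝ 2 μ →L[ℝ] Lp ℝ 2 μ} (h : WB a C R) (u : Lp ℝ 2 μ) : ‖R u‖ ≤ C * ‖u‖ := by
  have h1 : ∀ v : Lp ℝ 2 μ, ‖R.adjoint v‖ ≤ C * ‖v‖ := fun v => by
    have := h.le _ ((isWt_one (M := M)).mono ha) 2 (Or.inr rfl) v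
    simp only [wn, one_mul] at this
    have h2 := ENNReal.toReal_mono (ENNReal.mul_ne_top ENNReal.ofReal_ne_top (Lp.memLp v).2.ne)
      this
    rwa [ENNReal.toReal_mul, ENNReal.toReal_ofReal h.nonneg] at h2
  have h2 : ‖R.adjoint‖ ≤ C := ContinuousLinearMap.opNorm_le_bound _ h.nonneg h1
  rw [LinearIsometryEquiv.norm_map] at h2
  exact (R.le_opNorm u).trans (by gcongr)

namespace HeatSystem

variable (S : HeatSystem μ ℓ₀)

lemma tendsto_generator {u : Lp ℝ 2 μ} (hu : u ∈ S.L.domain) :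
    Tendsto (fun t : ℝ => t⁻¹ • (u - S.T t u)) (𝓝[>] 0) (𝓝 (app S.L u)) :=
  (S.generator _ _).1 (graph_of_mem hu)

lemma app_L_of_tendsto {u v : Lp ℝ 2 μ}
    (h : Tendsto (fun t : ℝ => t⁻¹ • (u - S.T t u)) (𝓝[>] 0) (𝓝 v)) :
    u ∈ S.L.domain ∧ app S.L u = v :=
  mem_of_graph ((S.generator _ _).2 h)

lemma T_add_apply {s t : ℝ} (hs : 0 ≤ s) (ht : 0 ≤ t) (u : Lp ℝ 2 μ) :
    S.T (s + t) u = S.T s (S.T t u) := by rw [S.T_add s t hs ht]; rfl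

lemma T_comm {s t : ℝ} (hs : 0 ≤ s) (ht : 0 ≤ t) (u : Lp ℝ 2 μ) :
    S.T s (S.T t u) = S.T t (S.T s u) := by
  rw [← S.T_add_apply hs ht, add_comm, S.T_add_apply ht hs]

lemma T_mem_domain {s : ℝ} (hs : 0 ≤ s) {u : Lp ℝ 2 μ} (hu : u ∈ S.L.domain) :
    S.T s u ∈ S.L.domain ∧ app S.L (S.T s u) = S.T s (app S.L u) := by
  refine S.app_L_of_tendsto ?_
  have h := ((S.T s).continuous.tendsto _).comp (S.tendsto_generator hu)
  refine h.congr' ?_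
  filter_upwards [self_mem_nhdsWithin] with t ht
  have ht' : (0 : ℝ) ≤ t := le_of_lt ht
  simp only [Function.comp_apply, map_smul, map_sub]
  rw [S.T_comm hs ht']

lemma T_mem_domain_of_pos {t : ℝ} (ht : 0 < t) (u : Lp ℝ 2 μ) : S.T t u ∈ S.L.domain := by
  obtain ⟨C, hC⟩ := S.holomorphic
  rcases le_or_gt t 1 with h | h
  · exact (hC t ht h u).1
  · have : S.T t u = S.T (t - 1) (S.T 1 u) := by
      rw [← S.T_add_apply (by linarith) zero_le_one]; ring_nf
    rw [this]
    exact (S.T_mem_domain (by linarith) (hC 1 one_pos le_rfl u).1).1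

lemma iterate_T {s : ℝ} (hs : 0 ≤ s) (k : ℕ) {u : Lp ℝ 2 μ} (hu : PowDom S.L k u) :
    (app S.L)^[k] (S.T s u) = S.T s ((app S.L)^[k] u) := by
  induction k with
  | zero => rfl
  | succ k ih =>
    rw [Function.iterate_succ_apply', Function.iterate_succ_apply',
      ih fun j hj => hu j (by omega), (S.T_mem_domain hs (hu k (by omega))).2]

lemma powDom_T (k : ℕ) {t : ℝ} (ht : 0 < t) (u : Lp ℝ 2 μ) : PowDom S.L k (S.T t u) := by
  induction k generalizing t u with
  | zero => intro j hj; omega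
  | succ k ih =>
    intro j hj
    have h1 : S.T t u = S.T (t / 2) (S.T (t / 2) u) := by
      rw [← S.T_add_apply (by positivity) (by positivity)]; ring_nf
    rw [h1, S.iterate_T (by positivity) j fun i hi => ih (by positivity) _ i (by omega)]
    exact S.T_mem_domain_of_pos (by positivity) _

lemma iterate_T_add (k : ℕ) {s t : ℝ} (hs : 0 ≤ s) (ht : 0 < t) (u : Lp ℝ 2 μ) :
    (app S.L)^[k] (S.T (s + t) u) = S.T s ((app S.L)^[k] (S.T t u)) := by
  rw [S.T_add_apply hs ht.le, S.iterate_T hs k (S.powDom_T k ht u)]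

lemma iterate_iterate (k l : ℕ) {s t : ℝ} (hs : 0 ≤ s) (ht : 0 < t) (u : Lp ℝ 2 μ) :
    (app S.L)^[k] (S.T s ((app S.L)^[l] (S.T t u))) = (app S.L)^[k + l] (S.T (s + t) u) := by
  rw [← S.iterate_T_add l hs ht, ← Function.iterate_add_apply]

lemma iterate_T_L (k : ℕ) {t : ℝ} (ht : 0 ≤ t) {u : Lp ℝ 2 μ} (hu : u ∈ S.L.domain) :
    (app S.L)^[k] (S.T t (app S.L u)) = (app S.L)^[k + 1] (S.T t u) := by
  rw [Function.iterate_succ_apply, (S.T_mem_domain ht hu).2]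

/-- The operator `V_I e^{-tL}`. -/
noncomputable def opA (I : List (Fin ℓ₀)) (t : ℝ) : Lp ℝ 2 μ →L[ℝ] Lp ℝ 2 μ :=
  boundedExtension univ fun u => wordApp S.V I (S.T t u)

/-- The operator `L^k e^{-tL}`. -/
noncomputable def opD (k : ℕ) (t : ℝ) : Lp ℝ 2 μ →L[ℝ] Lp ℝ 2 μ :=
  boundedExtension univ fun u => (app S.L)^[k] (S.T t u)

/-- The bounded extension of `e^{-tL} V_I`. -/
noncomputable def opB (I : List (Fin ℓ₀)) (t : ℝ) : Lp ℝ 2 μ →L[ℝ] Lp ℝ 2 μ :=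
  boundedExtension {u | WordDom S.V I u} fun u => S.T t (wordApp S.V I u)

variable [BorelSpace M] [SecondCountableTopology M] [SigmaFinite μ]

lemma exists_opA_one (hμ : VolumeDoubling μ) (I : List (Fin ℓ₀)) : ∃ C : ℝ → ℝ,
    ∀ t, 0 < t → t ≤ 1 → ∃ R : Lp ℝ 2 μ →L[ℝ] Lp ℝ 2 μ, (∀ u, R u = wordApp S.V I (S.T t u)) ∧
      ∀ a, 0 ≤ a → WB a (C a * t ^ (-((I.length : ℝ) / 2))) R := by
  obtain ⟨C, c, hc, h⟩ := S.gaussian_left I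
  obtain ⟨C', h'⟩ := hμ.exists_gaussian_operator C hc
  refine ⟨C', fun t ht ht1 => ?_⟩
  obtain ⟨K, hK, hKu⟩ := h t ht ht1
  obtain ⟨R, hR, hRw⟩ := h' t ht ht1 K hK
  refine ⟨t ^ (-((I.length : ℝ) / 2)) • R, fun u => ?_, fun a ha => ?_⟩
  · have h1 : R u = t ^ ((I.length : ℝ) / 2) • wordApp S.V I (S.T t u) := by
      refine Lp.ext ?_
      filter_upwards [hR u, (hKu u).2, Lp.coeFn_smul (t ^ ((I.length : ℝ) / 2))
        (wordApp S.V I (S.T t u))] with x h1 h2 h3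
      rw [h1, h3, ← h2]; rfl
    rw [_root_.smul_apply, h1, smul_smul, ← Real.rpow_add ht, neg_add_cancel, Real.rpow_zero,
      one_smul]
  · have := (hRw a ha).smul (t ^ (-((I.length : ℝ) / 2)))
    rwa [abs_of_pos (by positivity), mul_comm] at this

lemma exists_opA (hμ : VolumeDoubling μ) (I : List (Fin ℓ₀)) : ∃ C : ℝ → ℝ,
    ∀ t, 0 < t → t ≤ 2 → ∃ R : Lp ℝ 2 μ →L[ℝ] Lp ℝ 2 μ, (∀ u, R u = wordApp S.V I (S.T t u)) ∧
      ∀ a, 0 ≤ a → WB a (C a * t ^ (-((I.length : ℝ) / 2))) R := by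
  obtain ⟨C, h⟩ := S.exists_opA_one hμ I
  obtain ⟨C', h'⟩ := S.exists_opA_one hμ []
  refine ⟨fun a => C a * C' a * (1 / 2 : ℝ) ^ (-((I.length : ℝ) / 2)), fun t ht ht2 => ?_⟩
  obtain ⟨R, hR, hRw⟩ := h (t / 2) (by linarith) (by linarith)
  obtain ⟨R', hR', hRw'⟩ := h' (t / 2) (by linarith) (by linarith)
  refine ⟨R.comp R', fun u => ?_, fun a ha => ?_⟩
  · rw [ContinuousLinearMap.comp_apply, hR, hR']
    simp only [wordApp]
    rw [← S.T_add_apply (by linarith) (by linarith), add_halves]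
  · have := (hRw a ha).comp (hRw' a ha)
    convert this using 1
    simp only [List.length_nil, Nat.cast_zero, zero_div, neg_zero, Real.rpow_zero, mul_one]
    rw [div_eq_mul_one_div t 2, Real.mul_rpow ht.le (by norm_num)]; ring

lemma exists_wB_opA (hμ : VolumeDoubling μ) (I : List (Fin ℓ₀)) {a : ℝ} (ha : 0 ≤ a) : ∃ C : ℝ,
    0 ≤ C ∧ ∀ t, 0 < t → t ≤ 2 → WB a (C * t ^ (-((I.length : ℝ) / 2))) (S.opA I t) := by
  obtain ⟨C, h⟩ := S.exists_opA hμ I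
  refine ⟨C a, ?_, fun t ht ht2 => ?_⟩
  · obtain ⟨R, -, hR⟩ := h 1 one_pos one_le_two
    simpa using (hR a ha).nonneg
  · obtain ⟨R, hR, hRw⟩ := h t ht ht2
    rw [opA, boundedExtension_univ_eq hR]
    exact hRw a ha

lemma opA_apply (hμ : VolumeDoubling μ) (I : List (Fin ℓ₀)) {t : ℝ} (ht : 0 < t) (ht2 : t ≤ 2)
    (u : Lp ℝ 2 μ) : S.opA I t u = wordApp S.V I (S.T t u) := by
  obtain ⟨C, h⟩ := S.exists_opA hμ I
  obtain ⟨R, hR, -⟩ := h t ht ht2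
  exact boundedExtension_apply (fun u _ => hR u) (mem_univ u)

lemma opA_nil (hμ : VolumeDoubling μ) {t : ℝ} (ht : 0 < t) (ht2 : t ≤ 2) : S.opA [] t = S.T t := by
  ext1 u; rw [S.opA_apply hμ [] ht ht2]; rfl

lemma exists_wB_T (hμ : VolumeDoubling μ) {a : ℝ} (ha : 0 ≤ a) : ∃ C : ℝ,
    0 ≤ C ∧ ∀ t, 0 < t → t ≤ 2 → WB a C (S.T t) := by
  obtain ⟨C, hC, h⟩ := S.exists_wB_opA hμ [] ha
  refine ⟨C, hC, fun t ht ht2 => ?_⟩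
  have := h t ht ht2
  rw [S.opA_nil hμ ht ht2] at this
  simpa using this

lemma exists_norm_T_le (hμ : VolumeDoubling μ) : ∃ C : ℝ,
    0 ≤ C ∧ ∀ t, 0 ≤ t → t ≤ 2 → ∀ u, ‖S.T t u‖ ≤ C * ‖u‖ := by
  obtain ⟨C, hC, h⟩ := S.exists_wB_T hμ le_rfl
  refine ⟨max C 1, hC.trans (le_max_left _ _), fun t ht ht2 u => ?_⟩
  rcases ht.eq_or_lt with rfl | ht
  · rw [S.T_zero]
    have := norm_nonneg u
    have h1 := le_max_right C 1
    simp only [ContinuousLinearMap.id_apply]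
    nlinarith
  · exact ((h t ht ht2).norm_le le_rfl u).trans (by gcongr; exact le_max_left _ _)

lemma wordDom_T (I : List (Fin ℓ₀)) {t : ℝ} (ht : 0 < t) (ht1 : t ≤ 1) (u : Lp ℝ 2 μ) :
    WordDom S.V I (S.T t u) := by
  obtain ⟨C, c, hc, h⟩ := S.gaussian_left I
  obtain ⟨K, -, hK⟩ := h t ht ht1
  exact (hK u).1

lemma dense_wordDom (I : List (Fin ℓ₀)) : Dense {u : Lp ℝ 2 μ | WordDom S.V I u} := by
  intro u
  refine mem_closure_of_tendsto (S.T_continuous u) ?_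
  filter_upwards [Ioc_mem_nhdsGT (zero_lt_one' ℝ)] with t ht
  exact S.wordDom_T I ht.1 ht.2 u

lemma dense_domain : Dense (S.L.domain : Set (Lp ℝ 2 μ)) := by
  intro u
  refine mem_closure_of_tendsto (S.T_continuous u) ?_
  filter_upwards [self_mem_nhdsWithin] with t ht
  exact S.T_mem_domain_of_pos ht u

lemma exists_opD (hμ : VolumeDoubling μ) (k : ℕ) : ∃ C : ℝ → ℝ,
    ∀ t, 0 < t → t ≤ 2 → ∃ R : Lp ℝ 2 μ →L[ℝ] Lp ℝ 2 μ,
      (∀ u, R u = (app S.L)^[k] (S.T t u)) ∧ ∀ a, 0 ≤ a → WB a (C a * t ^ (-(k : ℝ))) R := by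
  choose! G hG0 hG using fun (i : Fin ℓ₀) (a : ℝ) (ha : 0 ≤ a) => S.exists_wB_opA hμ [i, i] ha
  choose! H hH0 hH using fun (a : ℝ) (ha : 0 ≤ a) => S.exists_wB_T hμ ha
  set N : ℝ := (k : ℝ) + 1 with hN
  refine ⟨fun a => (∑ i, G i a) ^ k * H a * (1 / N) ^ (-(k : ℝ)), fun t ht ht2 => ?_⟩
  have hNpos : 0 < N := by positivity
  set s := t / N with hs
  have hs0 : 0 < s := by positivity
  have hs2 : s ≤ 2 := (div_le_self ht.le (by rw [hN]; linarith [k.cast_nonneg (α := ℝ)])).trans ht2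
  set R1 : Lp ℝ 2 μ →L[ℝ] Lp ℝ 2 μ := (-1 : ℝ) • ∑ i, S.opA [i, i] s with hR1
  have hR1u : ∀ u, R1 u = app S.L (S.T s u) := fun u => by
    rw [S.L_eq _ (S.T_mem_domain_of_pos hs0 u), hR1, _root_.smul_apply, neg_one_smul,
      _root_.sum_apply]
    congr 1
    exact Finset.sum_congr rfl fun i _ => S.opA_apply hμ _ hs0 hs2 u
  have hpow : ∀ (j : ℕ) u, (app S.L)^[j] (S.T (j * s) u) = (R1 ^ j) u := by
    intro j
    induction j with
    | zero => intro u; simp [S.T_zero]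
    | succ j ih =>
      intro u
      have e : ((j + 1 : ℕ) : ℝ) * s = j * s + s := by push_cast; ring
      rw [e, S.T_add_apply (by positivity) hs0.le, Function.iterate_succ_apply,
        (S.T_mem_domain (by positivity) (S.T_mem_domain_of_pos hs0 u)).2, ih, ← hR1u, pow_succ]
      rfl
  refine ⟨(R1 ^ k).comp (S.T s), fun u => ?_, fun a ha => ?_⟩
  · rw [ContinuousLinearMap.comp_apply, ← hpow, ← S.T_add_apply (by positivity) hs0.le]
    congr 2
    have : t = (k : ℝ) * s + s := by rw [hs, hN]; field_simp
    rw [this]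
  · have h1 : WB a ((∑ i, G i a) * s⁻¹) R1 := by
      have := (WB.sum Finset.univ fun i _ => hG i a ha s hs0 hs2).smul (-1)
      refine this.mono (le_of_eq ?_)
      rw [Finset.sum_mul]
      simp [Real.rpow_neg_one]
    have h2 : ∀ j : ℕ, WB a (((∑ i, G i a) * s⁻¹) ^ j) (R1 ^ j) := fun j => by
      induction j with
      | zero => rw [pow_zero, pow_zero]; exact WB.one a
      | succ j ih => exact ih.comp h1
    refine ((h2 k).comp (hH a ha s hs0 hs2)).mono (le_of_eq ?_)
    rw [hs, mul_pow, Real.rpow_neg (by positivity), Real.rpow_neg ht.le, Real.rpow_natCast,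
      Real.rpow_natCast]
    have e3 : ((t / N)⁻¹) ^ k = t⁻¹ ^ k * N ^ k := by rw [← mul_pow]; congr 1; field_simp
    simp only [e3, one_div, inv_pow, inv_inv]
    ring

lemma exists_wB_opD (hμ : VolumeDoubling μ) (k : ℕ) {a : ℝ} (ha : 0 ≤ a) : ∃ C : ℝ,
    0 ≤ C ∧ ∀ t, 0 < t → t ≤ 2 → WB a (C * t ^ (-(k : ℝ))) (S.opD k t) := by
  obtain ⟨C, h⟩ := S.exists_opD hμ k
  refine ⟨C a, ?_, fun t ht ht2 => ?_⟩
  · obtain ⟨R, -, hR⟩ := h 1 one_pos one_le_two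
    simpa using (hR a ha).nonneg
  · obtain ⟨R, hR, hRw⟩ := h t ht ht2
    rw [opD, boundedExtension_univ_eq hR]
    exact hRw a ha

lemma opD_apply (hμ : VolumeDoubling μ) (k : ℕ) {t : ℝ} (ht : 0 < t) (ht2 : t ≤ 2)
    (u : Lp ℝ 2 μ) : S.opD k t u = (app S.L)^[k] (S.T t u) := by
  obtain ⟨C, h⟩ := S.exists_opD hμ k
  obtain ⟨R, hR, -⟩ := h t ht ht2
  exact boundedExtension_apply (fun u _ => hR u) (mem_univ u)

lemma exists_opB_one (hμ : VolumeDoubling μ) (I : List (Fin ℓ₀)) : ∃ C : ℝ → ℝ,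
    ∀ t, 0 < t → t ≤ 1 → ∃ R : Lp ℝ 2 μ →L[ℝ] Lp ℝ 2 μ,
      (∀ u, WordDom S.V I u → R u = S.T t (wordApp S.V I u)) ∧
      ∀ a, 0 ≤ a → WB a (C a * t ^ (-((I.length : ℝ) / 2))) R := by
  obtain ⟨C, c, hc, h⟩ := S.gaussian_right I
  obtain ⟨C', h'⟩ := hμ.exists_gaussian_operator C hc
  refine ⟨C', fun t ht ht1 => ?_⟩
  obtain ⟨K, hK, hKu⟩ := h t ht ht1
  obtain ⟨R, hR, hRw⟩ := h' t ht ht1 K hK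
  refine ⟨t ^ (-((I.length : ℝ) / 2)) • R, fun u hu => ?_, fun a ha => ?_⟩
  · have h1 : R u = t ^ ((I.length : ℝ) / 2) • S.T t (wordApp S.V I u) := by
      refine Lp.ext ?_
      filter_upwards [hR u, hKu u hu, Lp.coeFn_smul (t ^ ((I.length : ℝ) / 2))
        (S.T t (wordApp S.V I u))] with x h1 h2 h3
      rw [h1, h3, ← h2]; rfl
    rw [_root_.smul_apply, h1, smul_smul, ← Real.rpow_add ht, neg_add_cancel, Real.rpow_zero,
      one_smul]
  · have := (hRw a ha).smul (t ^ (-((I.length : ℝ) / 2)))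
    rwa [abs_of_pos (by positivity), mul_comm] at this

lemma exists_opB (hμ : VolumeDoubling μ) (I : List (Fin ℓ₀)) : ∃ C : ℝ → ℝ,
    ∀ t, 0 < t → t ≤ 2 → ∃ R : Lp ℝ 2 μ →L[ℝ] Lp ℝ 2 μ,
      (∀ u, WordDom S.V I u → R u = S.T t (wordApp S.V I u)) ∧
      ∀ a, 0 ≤ a → WB a (C a * t ^ (-((I.length : ℝ) / 2))) R := by
  obtain ⟨C, h⟩ := S.exists_opB_one hμ I
  choose! C' hC' h' using fun (a : ℝ) (ha : 0 ≤ a) => S.exists_wB_T hμ ha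
  refine ⟨fun a => C' a * C a * (1 / 2 : ℝ) ^ (-((I.length : ℝ) / 2)), fun t ht ht2 => ?_⟩
  obtain ⟨R, hR, hRw⟩ := h (t / 2) (by linarith) (by linarith)
  refine ⟨(S.T (t / 2)).comp R, fun u hu => ?_, fun a ha => ?_⟩
  · rw [ContinuousLinearMap.comp_apply, hR u hu, ← S.T_add_apply (by linarith) (by linarith),
      add_halves]
  · have := (h' a ha (t / 2) (by linarith) (by linarith)).comp (hRw a ha)
    convert this using 1
    rw [div_eq_mul_one_div t 2, Real.mul_rpow ht.le (by norm_num)]; ring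

lemma exists_wB_opB (hμ : VolumeDoubling μ) (I : List (Fin ℓ₀)) {a : ℝ} (ha : 0 ≤ a) : ∃ C : ℝ,
    0 ≤ C ∧ ∀ t, 0 < t → t ≤ 2 → WB a (C * t ^ (-((I.length : ℝ) / 2))) (S.opB I t) := by
  obtain ⟨C, h⟩ := S.exists_opB hμ I
  refine ⟨C a, ?_, fun t ht ht2 => ?_⟩
  · obtain ⟨R, -, hR⟩ := h 1 one_pos one_le_two
    simpa using (hR a ha).nonneg
  · obtain ⟨R, hR, hRw⟩ := h t ht ht2
    rw [opB, boundedExtension_eq_of_dense (S.dense_wordDom I) (R := R) hR]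
    exact hRw a ha

lemma opB_apply (hμ : VolumeDoubling μ) (I : List (Fin ℓ₀)) {t : ℝ} (ht : 0 < t) (ht2 : t ≤ 2)
    {u : Lp ℝ 2 μ} (hu : WordDom S.V I u) : S.opB I t u = S.T t (wordApp S.V I u) := by
  obtain ⟨C, h⟩ := S.exists_opB hμ I
  obtain ⟨R, hR, -⟩ := h t ht ht2
  exact boundedExtension_apply (D := {u | WordDom S.V I u}) hR hu

lemma ext_wordDom (I : List (Fin ℓ₀)) {R R' : Lp ℝ 2 μ →L[ℝ] Lp ℝ 2 μ}
    (h : ∀ u, WordDom S.V I u → R u = R' u) : R = R' :=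
  ContinuousLinearMap.ext_on (S.dense_wordDom I |>.mono Submodule.subset_span) h

/-- The operator `V_J L^p e^{-tL}`. -/
noncomputable def vlt (J : List (Fin ℓ₀)) (p : ℕ) (t : ℝ) : Lp ℝ 2 μ →L[ℝ] Lp ℝ 2 μ :=
  (S.opA J (t / 2)).comp (S.opD p (t / 2))

/-- The bounded extension of `L^q e^{-tL} V_I`. -/
noncomputable def rlt (I : List (Fin ℓ₀)) (q : ℕ) (t : ℝ) : Lp ℝ 2 μ →L[ℝ] Lp ℝ 2 μ :=
  (S.opD q (t / 2)).comp (S.opB I (t / 2))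

/-- The bounded extension of `V_J L^p e^{-tL} V_I`. -/
noncomputable def vrl (J : List (Fin ℓ₀)) (p : ℕ) (I : List (Fin ℓ₀)) (t : ℝ) :
    Lp ℝ 2 μ →L[ℝ] Lp ℝ 2 μ :=
  (S.vlt J p (t / 2)).comp (S.opB I (t / 2))

lemma vlt_apply (hμ : VolumeDoubling μ) (J : List (Fin ℓ₀)) (p : ℕ) {t : ℝ} (ht : 0 < t)
    (ht2 : t ≤ 2) (u : Lp ℝ 2 μ) : S.vlt J p t u = wordApp S.V J ((app S.L)^[p] (S.T t u)) := by
  rw [vlt, ContinuousLinearMap.comp_apply, S.opA_apply hμ J (by linarith) (by linarith),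
    S.opD_apply hμ p (by linarith) (by linarith), ← S.iterate_T_add p (by linarith) (by linarith),
    add_halves]

lemma rlt_apply (hμ : VolumeDoubling μ) (I : List (Fin ℓ₀)) (q : ℕ) {t : ℝ} (ht : 0 < t)
    (ht2 : t ≤ 2) {u : Lp ℝ 2 μ} (hu : WordDom S.V I u) :
    S.rlt I q t u = (app S.L)^[q] (S.T t (wordApp S.V I u)) := by
  rw [rlt, ContinuousLinearMap.comp_apply, S.opB_apply hμ I (by linarith) (by linarith) hu,
    S.opD_apply hμ q (by linarith) (by linarith), ← S.T_add_apply (by linarith) (by linarith),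
    add_halves]

lemma vrl_apply (hμ : VolumeDoubling μ) (J : List (Fin ℓ₀)) (p : ℕ) (I : List (Fin ℓ₀)) {t : ℝ}
    (ht : 0 < t) (ht2 : t ≤ 2) {u : Lp ℝ 2 μ} (hu : WordDom S.V I u) :
    S.vrl J p I t u = wordApp S.V J ((app S.L)^[p] (S.T t (wordApp S.V I u))) := by
  rw [vrl, ContinuousLinearMap.comp_apply, S.opB_apply hμ I (by linarith) (by linarith) hu,
    S.vlt_apply hμ J p (by linarith) (by linarith), ← S.T_add_apply (by linarith) (by linarith),
    add_halves]

lemma vlt_comp_opD (hμ : VolumeDoubling μ) (J : List (Fin ℓ₀)) (p q : ℕ) {s t : ℝ} (hs : 0 < s)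
    (ht : 0 < t) (hst : s + t ≤ 2) :
    (S.vlt J p s).comp (S.opD q t) = S.vlt J (p + q) (s + t) := by
  ext1 u
  rw [ContinuousLinearMap.comp_apply, S.vlt_apply hμ J _ hs (by linarith),
    S.opD_apply hμ q ht (by linarith), S.vlt_apply hμ J _ (by linarith) hst,
    S.iterate_iterate p q hs.le ht]

lemma opD_comp_rlt (hμ : VolumeDoubling μ) (I : List (Fin ℓ₀)) (p q : ℕ) {s t : ℝ} (hs : 0 < s)
    (ht : 0 < t) (hst : s + t ≤ 2) :
    (S.opD p s).comp (S.rlt I q t) = S.rlt I (p + q) (s + t) := by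
  refine S.ext_wordDom I fun u hu => ?_
  rw [ContinuousLinearMap.comp_apply, S.rlt_apply hμ I _ ht (by linarith) hu,
    S.opD_apply hμ p hs (by linarith), S.rlt_apply hμ I _ (by linarith) hst hu,
    S.iterate_iterate p q hs.le ht]

lemma vlt_comp_rlt (hμ : VolumeDoubling μ) (J I : List (Fin ℓ₀)) (p q : ℕ) {s t : ℝ} (hs : 0 < s)
    (ht : 0 < t) (hst : s + t ≤ 2) :
    (S.vlt J p s).comp (S.rlt I q t) = S.vrl J (p + q) I (s + t) := by
  refine S.ext_wordDom I fun u hu => ?_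
  rw [ContinuousLinearMap.comp_apply, S.rlt_apply hμ I _ ht (by linarith) hu,
    S.vlt_apply hμ J _ hs (by linarith), S.vrl_apply hμ J _ I (by linarith) hst hu,
    S.iterate_iterate p q hs.le ht]

lemma opD_zero (hμ : VolumeDoubling μ) {t : ℝ} (ht : 0 < t) (ht2 : t ≤ 2) : S.opD 0 t = S.T t := by
  ext1 u; rw [S.opD_apply hμ 0 ht ht2]; rfl

lemma vlt_nil (hμ : VolumeDoubling μ) (p : ℕ) {t : ℝ} (ht : 0 < t) (ht2 : t ≤ 2) :
    S.vlt [] p t = S.opD p t := by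
  ext1 u; rw [S.vlt_apply hμ [] p ht ht2, S.opD_apply hμ p ht ht2]; rfl

lemma rlt_nil (hμ : VolumeDoubling μ) (p : ℕ) {t : ℝ} (ht : 0 < t) (ht2 : t ≤ 2) :
    S.rlt [] p t = S.opD p t := by
  ext1 u; rw [S.rlt_apply hμ [] p ht ht2 (by trivial), S.opD_apply hμ p ht ht2]; rfl

lemma vlt_L (hμ : VolumeDoubling μ) (J : List (Fin ℓ₀)) (p : ℕ) {t : ℝ} (ht : 0 < t) (ht2 : t ≤ 2)
    {u : Lp ℝ 2 μ} (hu : u ∈ S.L.domain) : S.vlt J p t (app S.L u) = S.vlt J (p + 1) t u := by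
  rw [S.vlt_apply hμ J p ht ht2, S.vlt_apply hμ J _ ht ht2, S.iterate_T_L p ht.le hu]

lemma half_rpow {t : ℝ} (ht : 0 < t) (r : ℝ) : (t / 2) ^ r = (1 / 2 : ℝ) ^ r * t ^ r := by
  rw [div_eq_mul_one_div t 2, Real.mul_rpow ht.le (by norm_num), mul_comm]

lemma exists_wB_vlt (hμ : VolumeDoubling μ) (J : List (Fin ℓ₀)) (p : ℕ) {a : ℝ} (ha : 0 ≤ a) :
    ∃ C : ℝ, 0 ≤ C ∧ ∀ t, 0 < t → t ≤ 2 →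
      WB a (C * t ^ (-((J.length : ℝ) / 2 + p))) (S.vlt J p t) := by
  obtain ⟨C, hC, h⟩ := S.exists_wB_opA hμ J ha
  obtain ⟨C', hC', h'⟩ := S.exists_wB_opD hμ p ha
  refine ⟨C * C' * (1 / 2 : ℝ) ^ (-((J.length : ℝ) / 2)) * (1 / 2 : ℝ) ^ (-(p : ℝ)), by positivity,
    fun t ht ht2 => ?_⟩
  refine ((h (t / 2) (by linarith) (by linarith)).comp
    (h' (t / 2) (by linarith) (by linarith))).mono (le_of_eq ?_)
  rw [half_rpow ht, half_rpow ht, neg_add, Real.rpow_add ht]; ring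

lemma exists_wB_rlt (hμ : VolumeDoubling μ) (I : List (Fin ℓ₀)) (p : ℕ) {a : ℝ} (ha : 0 ≤ a) :
    ∃ C : ℝ, 0 ≤ C ∧ ∀ t, 0 < t → t ≤ 2 →
      WB a (C * t ^ (-((I.length : ℝ) / 2 + p))) (S.rlt I p t) := by
  obtain ⟨C, hC, h⟩ := S.exists_wB_opB hμ I ha
  obtain ⟨C', hC', h'⟩ := S.exists_wB_opD hμ p ha
  refine ⟨C * C' * (1 / 2 : ℝ) ^ (-((I.length : ℝ) / 2)) * (1 / 2 : ℝ) ^ (-(p : ℝ)), by positivity,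
    fun t ht ht2 => ?_⟩
  refine ((h' (t / 2) (by linarith) (by linarith)).comp
    (h (t / 2) (by linarith) (by linarith))).mono (le_of_eq ?_)
  rw [half_rpow ht, half_rpow ht, neg_add, Real.rpow_add ht]; ring

lemma exists_wB_vrl (hμ : VolumeDoubling μ) (J : List (Fin ℓ₀)) (p : ℕ) (I : List (Fin ℓ₀)) {a : ℝ}
    (ha : 0 ≤ a) : ∃ C : ℝ, 0 ≤ C ∧ ∀ t, 0 < t → t ≤ 2 →
      WB a (C * t ^ (-((J.length : ℝ) / 2 + p + (I.length : ℝ) / 2))) (S.vrl J p I t) := by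
  obtain ⟨C, hC, h⟩ := S.exists_wB_opB hμ I ha
  obtain ⟨C', hC', h'⟩ := S.exists_wB_vlt hμ J p ha
  refine ⟨C * C' * (1 / 2 : ℝ) ^ (-((I.length : ℝ) / 2)) *
    (1 / 2 : ℝ) ^ (-((J.length : ℝ) / 2 + p)), by positivity, fun t ht ht2 => ?_⟩
  refine ((h' (t / 2) (by linarith) (by linarith)).comp
    (h (t / 2) (by linarith) (by linarith))).mono (le_of_eq ?_)
  rw [half_rpow ht, half_rpow ht, neg_add (_ + _), Real.rpow_add ht]; ring

lemma hasDerivAt_T (hμ : VolumeDoubling μ) {s : ℝ} (hs : 0 < s) (hs2 : s ≤ 2) (u : Lp ℝ 2 μ) :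
    HasDerivAt (fun x => S.T x u) (-S.opD 1 s u) s := by
  obtain ⟨C, hC, hTC⟩ := S.exists_norm_T_le hμ
  rw [S.opD_apply hμ 1 hs hs2, Function.iterate_one]
  have hr : HasDerivWithinAt (fun x => S.T x u) (-app S.L (S.T s u)) (Ici s) s := by
    rw [← hasDerivWithinAt_Ioi_iff_Ici, hasDerivWithinAt_iff_tendsto_slope' self_notMem_Ioi]
    have h1 := (S.tendsto_generator (S.T_mem_domain_of_pos hs u)).neg
    have h2 : Tendsto (fun x : ℝ => x - s) (𝓝[>] s) (𝓝[>] 0) := by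
      refine tendsto_nhdsWithin_iff.2 ⟨?_, ?_⟩
      · have : Tendsto (fun x : ℝ => x - s) (𝓝 s) (𝓝 (s - s)) :=
          (continuous_id.sub continuous_const).tendsto s
        rw [sub_self] at this
        exact this.mono_left nhdsWithin_le_nhds
      · filter_upwards [self_mem_nhdsWithin] with x hx
        exact sub_pos.2 (mem_Ioi.1 hx)
    refine (h1.comp h2).congr' ?_
    filter_upwards [self_mem_nhdsWithin] with x hx
    have hx' : 0 ≤ x - s := (sub_pos.2 (mem_Ioi.1 hx)).le
    simp only [Function.comp_apply, slope, vsub_eq_sub]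
    rw [← S.T_add_apply hx' hs.le, sub_add_cancel, ← smul_neg, neg_sub]
  have hl : HasDerivWithinAt (fun x => S.T x u) (-app S.L (S.T s u)) (Iic s) s := by
    rw [← hasDerivWithinAt_Iio_iff_Iic, hasDerivWithinAt_iff_tendsto_slope' self_notMem_Iio]
    set v := S.T (s / 2) u with hv
    have hvd : v ∈ S.L.domain := S.T_mem_domain_of_pos (by linarith) u
    set z := app S.L v with hz
    have e0 : app S.L (S.T s u) = S.T (s / 2) z := by
      rw [← (S.T_mem_domain (by linarith) hvd).2, hv, ← S.T_add_apply (by linarith) (by linarith),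
        add_halves]
    have h2 : Tendsto (fun x : ℝ => s - x) (𝓝[<] s) (𝓝[>] 0) := by
      refine tendsto_nhdsWithin_iff.2 ⟨?_, ?_⟩
      · have : Tendsto (fun x : ℝ => s - x) (𝓝 s) (𝓝 (s - s)) :=
          (continuous_const.sub continuous_id).tendsto s
        rw [sub_self] at this
        exact this.mono_left nhdsWithin_le_nhds
      · filter_upwards [self_mem_nhdsWithin] with x hx
        exact sub_pos.2 (mem_Iio.1 hx)
    have h3 := (S.tendsto_generator hvd).comp h2
    have h4 := (S.T_continuous z).comp h2
    have h5 : Tendsto (fun x => C * ‖(s - x)⁻¹ • (v - S.T (s - x) v) - z‖ +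
        C * ‖z - S.T (s - x) z‖) (𝓝[<] s) (𝓝 0) := by
      have a1 := ((h3.sub_const z).norm).const_mul C
      have a2 := ((tendsto_const_nhds (x := z)).sub h4).norm.const_mul C
      simpa [← hz] using a1.add a2
    rw [e0, tendsto_iff_norm_sub_tendsto_zero]
    refine squeeze_zero' (Eventually.of_forall fun _ => norm_nonneg _) ?_ h5
    filter_upwards [Ioo_mem_nhdsLT (show s / 2 < s by linarith)] with x hx
    have hx1 : 0 < s - x := by linarith [hx.2]
    have hx2 : 0 ≤ x - s / 2 := by linarith [hx.1]
    have e1 : S.T x u = S.T (x - s / 2) v := by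
      rw [hv, ← S.T_add_apply hx2 (by linarith)]; ring_nf
    have e2 : S.T s u = S.T (x - s / 2) (S.T (s - x) v) := by
      rw [hv, ← S.T_add_apply hx1.le (by linarith), ← S.T_add_apply hx2 (by linarith)]; ring_nf
    have e3 : S.T (s / 2) z = S.T (x - s / 2) (S.T (s - x) z) := by
      rw [← S.T_add_apply hx2 hx1.le]; ring_nf
    have e4 : slope (fun x => S.T x u) s x - -S.T (s / 2) z =
        S.T (x - s / 2) (-((s - x)⁻¹ • (v - S.T (s - x) v) - z)) +
          S.T (x - s / 2) (-(z - S.T (s - x) z)) := by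
      simp only [slope, vsub_eq_sub]
      rw [e1, e2, e3, ← map_sub, ← map_smul, ← map_neg, ← map_sub, ← map_add]
      congr 1
      have : (x - s)⁻¹ = -(s - x)⁻¹ := by rw [← neg_sub s x, inv_neg]
      rw [this, neg_smul]
      abel
    rw [e4]
    refine (norm_add_le _ _).trans (add_le_add ?_ ?_)
    · refine (hTC _ hx2 (by linarith [hx.2]) _).trans ?_
      rw [norm_neg]
    · refine (hTC _ hx2 (by linarith [hx.2]) _).trans ?_
      rw [norm_neg]
  have := hl.union hr
  rwa [Iic_union_Ici, hasDerivWithinAt_univ] at this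

lemma hasDerivAt_vlt (hμ : VolumeDoubling μ) (J : List (Fin ℓ₀)) (p : ℕ) {s : ℝ} (hs : 0 < s)
    (hs2 : s < 2) (u : Lp ℝ 2 μ) :
    HasDerivAt (fun x => S.vlt J p x u) (-S.vlt J (p + 1) s u) s := by
  have h1 := S.hasDerivAt_T hμ (show 0 < s - s / 2 by linarith) (by linarith) u
  have h2 : HasDerivAt (fun x => S.T (x - s / 2) u) (-S.opD 1 (s - s / 2) u) s := 
    h1.comp_sub_const s (s / 2)
  have h3 := (S.vlt J p (s / 2)).hasFDerivAt.comp_hasDerivAt s h2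
  have e1 : S.vlt J p (s / 2) (-S.opD 1 (s - s / 2) u) = -S.vlt J (p + 1) s u := by
    rw [map_neg, ← ContinuousLinearMap.comp_apply,
      S.vlt_comp_opD hμ J p 1 (by linarith) (by linarith) (by linarith)]
    congr 3; ring
  rw [e1] at h3
  refine h3.congr_of_eventuallyEq ?_
  filter_upwards [Ioo_mem_nhds (show s / 2 < s by linarith) hs2] with x hx
  have : S.vlt J p x = (S.vlt J p (s / 2)).comp (S.T (x - s / 2)) := by
    rw [← S.opD_zero hμ (by linarith [hx.1]) (by linarith [hx.2]),
      S.vlt_comp_opD hμ J p 0 (by linarith) (by linarith [hx.1]) (by linarith [hx.2])]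
    congr 1; ring
  rw [this]; rfl

lemma hasDerivAt_rlt (hμ : VolumeDoubling μ) (I : List (Fin ℓ₀)) (q : ℕ) {s : ℝ} (hs : 0 < s)
    (hs2 : s < 2) (u : Lp ℝ 2 μ) :
    HasDerivAt (fun x => S.rlt I q x u) (-S.rlt I (q + 1) s u) s := by
  have h1 := S.hasDerivAt_T hμ (show 0 < s - s / 2 by linarith) (by linarith)
    (S.rlt I q (s / 2) u)
  have h2 : HasDerivAt (fun x => S.T (x - s / 2) (S.rlt I q (s / 2) u))
      (-S.opD 1 (s - s / 2) (S.rlt I q (s / 2) u)) s := 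
    h1.comp_sub_const s (s / 2)
  have e1 : -S.opD 1 (s - s / 2) (S.rlt I q (s / 2) u) = -S.rlt I (q + 1) s u := by
    rw [← ContinuousLinearMap.comp_apply,
      S.opD_comp_rlt hμ I 1 q (by linarith) (by linarith) (by linarith)]
    rw [sub_add_cancel, add_comm 1 q]
  rw [e1] at h2
  refine h2.congr_of_eventuallyEq ?_
  filter_upwards [Ioo_mem_nhds (show s / 2 < s by linarith) hs2] with x hx
  have : S.rlt I q x = (S.T (x - s / 2)).comp (S.rlt I q (s / 2)) := by
    rw [← S.opD_zero hμ (by linarith [hx.1]) (by linarith [hx.2]),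
      S.opD_comp_rlt hμ I 0 q (by linarith [hx.1]) (by linarith) (by linarith [hx.2])]
    rw [sub_add_cancel, zero_add]
  rw [this]; rfl

end HeatSystem

end Parabolic

namespace Parabolic

variable {M : Type*} [MetricSpace M] [MeasurableSpace M] {μ : Measure M} {ℓ₀ : ℕ}
  [BorelSpace M] [SecondCountableTopology M] [SigmaFinite μ]

/-- The mean value inequality for curves of operators. -/
lemma WB.sub_of_hasDerivAt {a C s s' : ℝ} {R R' : ℝ → Lp ℝ 2 μ →L[ℝ] Lp ℝ 2 μ}
    (hd : ∀ x ∈ uIcc s s', ∀ u, HasDerivAt (fun x => R x u) (R' x u) x)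
    (hR' : ∀ x ∈ uIcc s s', WB a C (R' x)) : WB a (C * |s' - s|) (R s' - R s) := by
  have hC := (hR' s left_mem_uIcc).nonneg
  refine WB.of_dual (by positivity) fun p q hpq w hw ψ v hψ => ?_
  set K := wn q (fun x => (w x)⁻¹) ψ * (ENNReal.ofReal C * wn p w v) with hK
  have e : wn q (fun x => (w x)⁻¹) ψ * (ENNReal.ofReal (C * |s' - s|) * wn p w v) =
      K * ENNReal.ofReal |s' - s| := by
    rw [hK, ENNReal.ofReal_mul hC]; ring
  rw [e]
  rcases eq_or_ne s' s with rfl | hne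
  · simp
  have hpos : ENNReal.ofReal |s' - s| ≠ 0 := by
    simpa [ENNReal.ofReal_eq_zero, sub_eq_zero] using hne
  by_cases hKt : K = ∞
  · rw [hKt, ENNReal.top_mul hpos]; exact le_top
  have hder : ∀ x ∈ uIcc s s', HasDerivWithinAt (fun x => inner ℝ (R x ψ) v)
      (inner ℝ (R' x ψ) v) (uIcc s s') x := fun x hx => by
    have h1 := ((hd x hx ψ).inner ℝ (hasDerivAt_const x v)).hasDerivWithinAt (s := uIcc s s')
    simpa using h1
  have hb : ∀ x ∈ uIcc s s', ‖inner ℝ (R' x ψ) v‖ ≤ K.toReal := fun x hx => by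
    have := ENNReal.toReal_mono hKt ((hR' x hx).enorm_inner_le hpq hw ψ v)
    rwa [toReal_enorm] at this
  have := (convex_uIcc s s').norm_image_sub_le_of_norm_hasDerivWithin_le hder hb
    left_mem_uIcc right_mem_uIcc
  rw [_root_.sub_apply, inner_sub_left, ← ofReal_norm, ← ENNReal.ofReal_toReal hKt,
    ← ENNReal.ofReal_mul ENNReal.toReal_nonneg]
  exact ENNReal.ofReal_le_ofReal this

lemma WB.sub_of_hasDerivAt_two {a C s s' : ℝ} {R R' R'' : ℝ → Lp ℝ 2 μ →L[ℝ] Lp ℝ 2 μ}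
    (hd : ∀ x ∈ uIcc s s', ∀ u, HasDerivAt (fun x => R x u) (R' x u) x)
    (hd' : ∀ x ∈ uIcc s s', ∀ u, HasDerivAt (fun x => R' x u) (R'' x u) x)
    (hR'' : ∀ x ∈ uIcc s s', WB a C (R'' x)) :
    WB a (C * |s' - s| ^ 2) (R s' - R s - (s' - s) • R' s) := by
  have h1 : ∀ x ∈ uIcc s s', WB a (C * |s' - s|) (R' x - R' s) := fun x hx => by
    have hsub := uIcc_subset_uIcc left_mem_uIcc hx
    refine (WB.sub_of_hasDerivAt (fun y hy => hd' y (hsub hy))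
      (fun y hy => hR'' y (hsub hy))).mono ?_
    have := (hR'' s left_mem_uIcc).nonneg
    gcongr 1
    exact abs_sub_left_of_mem_uIcc hx
  have h2 : ∀ x ∈ uIcc s s', ∀ u, HasDerivAt (fun x => (R x - x • R' s) u)
      ((R' x - R' s) u) x := fun x hx u => by
    have := (hd x hx u).sub ((hasDerivAt_id x).smul_const (R' s u))
    exact this.congr_deriv (by simp)
  have h3 := WB.sub_of_hasDerivAt h2 h1
  have e : R s' - s' • R' s - (R s - s • R' s) = R s' - R s - (s' - s) • R' s := by
    rw [sub_smul]; abel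
  rw [e] at h3
  refine h3.mono (le_of_eq ?_)
  ring

namespace HeatSystem

variable (S : HeatSystem μ ℓ₀)

lemma rpow_neg_le_of_le {δ x r : ℝ} (hδ : 0 < δ) (hx : δ ≤ x) (hr : 0 ≤ r) :
    x ^ (-r) ≤ δ ^ (-r) :=
  Real.rpow_le_rpow_of_nonpos hδ hx (by linarith)

lemma exists_wB_rlt_sub (hμ : VolumeDoubling μ) (J : List (Fin ℓ₀)) (p : ℕ) {a : ℝ} (ha : 0 ≤ a)
    {δ : ℝ} (hδ : 0 < δ) : ∃ C : ℝ, 0 ≤ C ∧ ∀ s ∈ Ico δ 2, ∀ s' ∈ Ico δ 2,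
      WB a (C * |s' - s|) (S.rlt J p s' - S.rlt J p s) := by
  obtain ⟨C, hC, h⟩ := S.exists_wB_rlt hμ J (p + 1) ha
  refine ⟨C * δ ^ (-((J.length : ℝ) / 2 + (p + 1 : ℕ))), by positivity, fun s hs s' hs' => ?_⟩
  have hmem : ∀ x ∈ uIcc s s', δ ≤ x ∧ x < 2 := fun x hx =>
    ⟨(le_min hs.1 hs'.1).trans hx.1, hx.2.trans_lt (max_lt hs.2 hs'.2)⟩
  refine WB.sub_of_hasDerivAt (R' := fun x => -S.rlt J (p + 1) x) (fun x hx u => ?_)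
    fun x hx => ?_
  · exact S.hasDerivAt_rlt hμ J p (hδ.trans_le (hmem x hx).1) (hmem x hx).2 u
  · have h1 := (h x (hδ.trans_le (hmem x hx).1) (hmem x hx).2.le).smul (-1)
    rw [neg_one_smul] at h1
    refine h1.mono ?_
    rw [abs_neg, abs_one, one_mul]
    gcongr C * ?_
    exact rpow_neg_le_of_le hδ (hmem x hx).1 (by positivity)

lemma exists_wB_vlt_sub_two (hμ : VolumeDoubling μ) (J : List (Fin ℓ₀)) (p : ℕ) {a : ℝ}
    (ha : 0 ≤ a) {δ : ℝ} (hδ : 0 < δ) : ∃ C : ℝ, 0 ≤ C ∧ ∀ s ∈ Ico δ 2, ∀ s' ∈ Ico δ 2,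
      WB a (C * |s' - s| ^ 2)
        (S.vlt J p s' - S.vlt J p s - (s' - s) • -S.vlt J (p + 1) s) := by
  obtain ⟨C, hC, h⟩ := S.exists_wB_vlt hμ J (p + 1 + 1) ha
  refine ⟨C * δ ^ (-((J.length : ℝ) / 2 + (p + 1 + 1 : ℕ))), by positivity,
    fun s hs s' hs' => ?_⟩
  have hmem : ∀ x ∈ uIcc s s', δ ≤ x ∧ x < 2 := fun x hx =>
    ⟨(le_min hs.1 hs'.1).trans hx.1, hx.2.trans_lt (max_lt hs.2 hs'.2)⟩
  refine WB.sub_of_hasDerivAt_two (R' := fun x => -S.vlt J (p + 1) x)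
    (R'' := S.vlt J (p + 1 + 1)) (fun x hx u => ?_) (fun x hx u => ?_) fun x hx => ?_
  · exact S.hasDerivAt_vlt hμ J p (hδ.trans_le (hmem x hx).1) (hmem x hx).2 u
  · have := (S.hasDerivAt_vlt hμ J (p + 1) (hδ.trans_le (hmem x hx).1) (hmem x hx).2 u).neg
    rw [neg_neg] at this
    exact this
  · refine (h x (hδ.trans_le (hmem x hx).1) (hmem x hx).2.le).mono ?_
    gcongr C * ?_
    exact rpow_neg_le_of_le hδ (hmem x hx).1 (by positivity)

/-- The operator `(t^{|J|/2} V_J) (tL)^p e^{-tL}`. -/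
noncomputable def elt (J : List (Fin ℓ₀)) (p : ℕ) (t : ℝ) : Lp ℝ 2 μ →L[ℝ] Lp ℝ 2 μ :=
  (t ^ ((J.length : ℝ) / 2) * t ^ p) • S.vlt J p t

/-- The operator `(tL)^q e^{-tL} (t^{|I|/2} V_I)`. -/
noncomputable def ert (I : List (Fin ℓ₀)) (q : ℕ) (t : ℝ) : Lp ℝ 2 μ →L[ℝ] Lp ℝ 2 μ :=
  (t ^ ((I.length : ℝ) / 2) * t ^ q) • S.rlt I q t

lemma P_eq (hμ : VolumeDoubling μ) (c : ℕ) {t : ℝ} (ht : 0 < t) (ht2 : t ≤ 2) :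
    S.P c t = ∑ i ∈ Finset.range c, (t ^ i / (i.factorial : ℝ)) • S.opD i t := by
  refine boundedExtension_univ_eq fun u => ?_
  rw [_root_.sum_apply]
  refine Finset.sum_congr rfl fun i _ => ?_
  rw [_root_.smul_apply, S.opD_apply hμ i ht ht2]

lemma pre_eq (hμ : VolumeDoubling μ) (J : List (Fin ℓ₀)) (n c : ℕ) {t : ℝ} (ht : 0 < t)
    (ht2 : t ≤ 2) :
    S.pre J n c t = ∑ i ∈ Finset.range c, ((i.factorial : ℝ)⁻¹) • S.elt J (n + i) t := by
  refine boundedExtension_univ_eq fun u => ?_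
  set z := (∑ i ∈ Finset.range c, (t ^ i / (i.factorial : ℝ)) • S.opD i (t / 2)) u with hz
  have h1 : S.P c t u = S.T (t / 2) z := by
    rw [S.P_eq hμ c ht ht2, hz, _root_.sum_apply, _root_.sum_apply, map_sum]
    refine Finset.sum_congr rfl fun i _ => ?_
    rw [_root_.smul_apply, _root_.smul_apply, map_smul, S.opD_apply hμ i ht ht2,
      S.opD_apply hμ i (by linarith) (by linarith), ← S.iterate_T_add i (by linarith)
      (by linarith), add_halves]
  rw [h1, ← S.vlt_apply hμ J n (by linarith) (by linarith), hz, _root_.sum_apply,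
    _root_.sum_apply, map_sum, Finset.smul_sum]
  refine Finset.sum_congr rfl fun i _ => ?_
  rw [_root_.smul_apply, _root_.smul_apply, map_smul, ← ContinuousLinearMap.comp_apply,
    S.vlt_comp_opD hμ J n i (by linarith) (by linarith) (by linarith), add_halves, elt,
    _root_.smul_apply, smul_smul, smul_smul]
  congr 1
  rw [pow_add]; ring

lemma post_eq (hμ : VolumeDoubling μ) (I : List (Fin ℓ₀)) (c : ℕ) {t : ℝ} (ht : 0 < t)
    (ht2 : t ≤ 2) :
    S.post c I t = ∑ i ∈ Finset.range c, ((i.factorial : ℝ)⁻¹) • S.ert I i t := by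
  refine boundedExtension_eq_of_dense (S.dense_wordDom I) fun u hu => ?_
  rw [S.P_eq hμ c ht ht2, _root_.sum_apply, _root_.sum_apply, Finset.smul_sum]
  refine Finset.sum_congr rfl fun i _ => ?_
  rw [_root_.smul_apply, _root_.smul_apply, S.opD_apply hμ i ht ht2, ert, _root_.smul_apply,
    S.rlt_apply hμ I i ht ht2 hu, smul_smul, smul_smul]
  congr 1
  ring

lemma elt_nil (hμ : VolumeDoubling μ) (p : ℕ) {t : ℝ} (ht : 0 < t) (ht2 : t ≤ 2) :
    S.elt [] p t = S.ert [] p t := by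
  rw [elt, ert, S.vlt_nil hμ p ht ht2, S.rlt_nil hμ p ht ht2]

lemma P_eq_ert (hμ : VolumeDoubling μ) (c : ℕ) {t : ℝ} (ht : 0 < t) (ht2 : t ≤ 2) :
    S.P c t = ∑ i ∈ Finset.range c, ((i.factorial : ℝ)⁻¹) • S.ert [] i t := by
  rw [S.P_eq hμ c ht ht2]
  refine Finset.sum_congr rfl fun i _ => ?_
  rw [ert, S.rlt_nil hμ i ht ht2, smul_smul]
  congr 1
  simp; ring

lemma P_eq_pre (hμ : VolumeDoubling μ) (c : ℕ) {t : ℝ} (ht : 0 < t) (ht2 : t ≤ 2) :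
    S.P c t = S.pre [] 0 c t := by
  rw [S.P_eq_ert hμ c ht ht2, S.pre_eq hμ [] 0 c ht ht2]
  refine Finset.sum_congr rfl fun i _ => ?_
  rw [zero_add, S.elt_nil hμ i ht ht2]

lemma halfQ_eq_elt (hμ : VolumeDoubling μ) (h : ℕ) {t : ℝ} (ht : 0 < t) (ht2 : t ≤ 2) :
    S.halfQ h t = (((2 * h - 1).factorial : ℝ))⁻¹ • S.elt [] h t := by
  rw [halfQ, S.pre_eq hμ [] h 1 ht ht2]
  simp

lemma halfQ_eq_ert (hμ : VolumeDoubling μ) (h : ℕ) {t : ℝ} (ht : 0 < t) (ht2 : t ≤ 2) :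
    S.halfQ h t = (((2 * h - 1).factorial : ℝ))⁻¹ • S.ert [] h t := by
  rw [S.halfQ_eq_elt hμ h ht ht2, S.elt_nil hμ h ht ht2]

lemma exists_wB_elt (hμ : VolumeDoubling μ) (J : List (Fin ℓ₀)) (p : ℕ) {a : ℝ} (ha : 0 ≤ a) :
    ∃ C : ℝ, 0 ≤ C ∧ ∀ t, 0 < t → t ≤ 2 → WB a C (S.elt J p t) := by
  obtain ⟨C, hC, h⟩ := S.exists_wB_vlt hμ J p ha
  refine ⟨C, hC, fun t ht ht2 => ((h t ht ht2).smul _).mono (le_of_eq ?_)⟩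
  rw [abs_of_pos (by positivity), neg_add, Real.rpow_add ht, Real.rpow_neg ht.le,
    Real.rpow_neg ht.le, Real.rpow_natCast]
  have : t ^ ((J.length : ℝ) / 2) ≠ 0 := by positivity
  field_simp

lemma exists_wB_ert (hμ : VolumeDoubling μ) (J : List (Fin ℓ₀)) (p : ℕ) {a : ℝ} (ha : 0 ≤ a) :
    ∃ C : ℝ, 0 ≤ C ∧ ∀ t, 0 < t → t ≤ 2 → WB a C (S.ert J p t) := by
  obtain ⟨C, hC, h⟩ := S.exists_wB_rlt hμ J p ha
  refine ⟨C, hC, fun t ht ht2 => ((h t ht ht2).smul _).mono (le_of_eq ?_)⟩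
  rw [abs_of_pos (by positivity), neg_add, Real.rpow_add ht, Real.rpow_neg ht.le,
    Real.rpow_neg ht.le, Real.rpow_natCast]
  have : t ^ ((J.length : ℝ) / 2) ≠ 0 := by positivity
  field_simp

/-- Gain in the composition of operators at two scales. -/
lemma exists_wB_elt_comp_ert (hμ : VolumeDoubling μ) (J I : List (Fin ℓ₀)) (p q : ℕ) {a : ℝ}
    (ha : 0 ≤ a) : ∃ C : ℝ, 0 ≤ C ∧ ∀ r t, 0 < r → r ≤ 1 → 0 < t → t ≤ 1 →
      WB a (C * (r / (r + t)) ^ ((J.length : ℝ) / 2 + p) *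
        (t / (r + t)) ^ ((I.length : ℝ) / 2 + q)) ((S.elt J p r).comp (S.ert I q t)) := by
  obtain ⟨C, hC, h⟩ := S.exists_wB_vrl hμ J (p + q) I ha
  refine ⟨C, hC, fun r t hr hr1 ht ht1 => ?_⟩
  have e : (S.elt J p r).comp (S.ert I q t) =
      ((r ^ ((J.length : ℝ) / 2) * r ^ p) * (t ^ ((I.length : ℝ) / 2) * t ^ q)) •
        S.vrl J (p + q) I (r + t) := by
    rw [elt, ert, ContinuousLinearMap.smul_comp, ContinuousLinearMap.comp_smul, smul_smul,
      S.vlt_comp_rlt hμ J I p q hr ht (by linarith)]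
  rw [e]
  refine ((h (r + t) (by linarith) (by linarith)).smul _).mono (le_of_eq ?_)
  have hrt : 0 < r + t := by linarith
  rw [abs_of_pos (by positivity), Real.div_rpow hr.le hrt.le, Real.div_rpow ht.le hrt.le,
    ← Real.rpow_natCast r p, ← Real.rpow_natCast t q, ← Real.rpow_add hr, ← Real.rpow_add ht]
  have : (r + t) ^ (-((J.length : ℝ) / 2 + (p + q : ℕ) + (I.length : ℝ) / 2)) =
      (r + t) ^ (-((J.length : ℝ) / 2 + p)) * (r + t) ^ (-((I.length : ℝ) / 2 + q)) := by
    rw [← Real.rpow_add hrt]; congr 1; push_cast; ring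
  rw [this, Real.rpow_neg hrt.le, Real.rpow_neg hrt.le]; ring

end HeatSystem

end Parabolic

namespace Parabolic

/-- Regular space-time weights: log-Lipschitz in space and non-decreasing in time. -/
structure IsReg {M : Type*} [MetricSpace M] (a : ℝ) (W : M × ℝ → ℝ) : Prop where
  wt : ∀ τ, IsWt a fun x => W (x, τ)
  mono : ∀ x, Monotone fun τ => W (x, τ)

variable {M : Type*} [MetricSpace M] [MeasurableSpace M] {μ : Measure M}
  [BorelSpace M] [SecondCountableTopology M]

lemma IsReg.measurable {a : ℝ} {W : M × ℝ → ℝ} (hW : IsReg a W) : Measurable W :=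
  measurable_uncurry_of_continuous_of_measurable (u := fun x τ => W (x, τ))
    (fun τ => (hW.wt τ).continuous) fun x => (hW.mono x).measurable

lemma IsReg.pos {a : ℝ} {W : M × ℝ → ℝ} (hW : IsReg a W) (e : M × ℝ) : 0 < W e :=
  (hW.wt e.2).pos e.1

lemma IsReg.mul {a a' : ℝ} {W W' : M × ℝ → ℝ} (hW : IsReg a W) (hW' : IsReg a' W') :
    IsReg (a + a') (W * W') :=
  ⟨fun τ => (hW.wt τ).mul (hW'.wt τ), fun x => fun s t hst => by
    have h1 := hW.mono x hst
    have h2 := hW'.mono x hst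
    exact mul_le_mul h1 h2 (hW'.pos _).le (hW.pos _).le⟩

lemma IsReg.add {a a' : ℝ} {W W' : M × ℝ → ℝ} (hW : IsReg a W) (hW' : IsReg a' W') :
    IsReg (max a a') (W + W') :=
  ⟨fun τ => ⟨(hW.wt τ).nonneg.trans (le_max_left _ _), fun x => add_pos (hW.pos _) (hW'.pos _),
    fun x y => by
      have h1 := ((hW.wt τ).mono (le_max_left a a')).le x y
      have h2 := ((hW'.wt τ).mono (le_max_right a a')).le x y
      simp only [Pi.add_apply]
      linarith⟩,
    fun x => fun s t hst => add_le_add (hW.mono x hst) (hW'.mono x hst)⟩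

/-- Every space-time weight is equivalent to a regular one. -/
lemma IsSpaceTimeWeight.exists_isReg {ω : M × ℝ → ℝ} (hω : IsSpaceTimeWeight ω) :
    ∃ (a c : ℝ) (W : M × ℝ → ℝ), 0 < c ∧ IsReg a W ∧ (∀ e, ω e ≤ W e) ∧ ∀ e, W e ≤ c * ω e := by
  obtain ⟨c₁, c₂, hc⟩ := hω.growth
  set a := max c₁ 0 with ha
  set F : M × ℝ → M → ℝ := fun e y => ω (y, e.2) * Real.exp (-a * dist e.1 y) with hF
  have hωpos : ∀ e, 0 < ω e := fun e => one_pos.trans_le (hω.one_le e)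
  have hbd : ∀ e y, F e y ≤ c₂ * ω e := fun e y => by
    refine le_trans ?_ (hc y e.1 e.2)
    simp only [hF]
    have := (hωpos (y, e.2)).le
    rw [dist_comm]
    gcongr
    exact le_max_left _ _
  have hself : ∀ e, F e e.1 = ω e := fun e => by simp [hF]
  have hB : ∀ e, BddAbove (range (F e)) := fun e => ⟨_, by rintro _ ⟨y, rfl⟩; exact hbd e y⟩
  set W : M × ℝ → ℝ := fun e => ⨆ y, F e y with hW
  have hle : ∀ e, ω e ≤ W e := fun e => by rw [← hself e]; exact le_ciSup (hB e) e.1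
  have hne : ∀ e : M × ℝ, Nonempty M := fun e => ⟨e.1⟩
  have hWle : ∀ e, W e ≤ c₂ * ω e := fun e => by
    have := hne e
    exact ciSup_le (hbd e)
  refine ⟨a, max c₂ 1, W, by positivity, ⟨fun τ => ⟨le_max_right _ _, fun x => (hωpos _).trans_le
    (hle _), fun x y => ?_⟩, fun x s t hst => ?_⟩, hle, fun e => (hWle e).trans ?_⟩
  · have := hne (x, τ)
    refine ciSup_le fun z => ?_
    calc F (x, τ) z ≤ Real.exp (a * dist x y) * F (y, τ) z := by
          simp only [hF]
          rw [mul_left_comm, ← Real.exp_add]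
          have h1 := dist_triangle y x z
          rw [dist_comm y x] at h1
          have h2 : 0 ≤ a := le_max_right _ _
          have := (hωpos (z, τ)).le
          gcongr
          nlinarith
      _ ≤ _ := by gcongr; exact le_ciSup (hB (y, τ)) z
  · have := hne (x, s)
    refine ciSup_le fun z => le_trans ?_ (le_ciSup (hB (x, t)) z)
    simp only [hF]
    gcongr
    exact hω.mono z hst
  · gcongr
    · exact (hωpos e).le
    · exact le_max_left _ _

/-- Continuous curves in `L²` with compact support. -/
structure IsCurve (χ : ℝ → Lp ℝ 2 μ) : Prop where
  cont : Continuous χ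
  cpt : HasCompactSupport χ

lemma IsCurve.add {χ χ' : ℝ → Lp ℝ 2 μ} (h : IsCurve χ) (h' : IsCurve χ') : IsCurve (χ + χ') :=
  ⟨h.cont.add h'.cont, h.cpt.add h'.cpt⟩

lemma IsCurve.smul {χ : ℝ → Lp ℝ 2 μ} (h : IsCurve χ) (r : ℝ) : IsCurve (r • χ) :=
  ⟨h.cont.const_smul r, h.cpt.smul_left (f := fun _ => r)⟩

lemma IsCurve.sub {χ χ' : ℝ → Lp ℝ 2 μ} (h : IsCurve χ) (h' : IsCurve χ') : IsCurve (χ - χ') := by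
  have := h.add (h'.smul (-1))
  rwa [neg_one_smul, ← sub_eq_add_neg] at this

/-- Jointly measurable representatives of curves. -/
lemma IsCurve.exists_joint {χ : ℝ → Lp ℝ 2 μ} (hχ : IsCurve χ) :
    ∃ X : M × ℝ → ℝ, Measurable X ∧ ∀ τ, (fun x => X (x, τ)) =ᵐ[μ] χ τ := by
  have huc := hχ.cpt.uniformContinuous_of_continuous hχ.cont
  rw [Metric.uniformContinuous_iff] at huc
  choose δ hδ hδχ using fun n : ℕ => huc ((1 / 2 : ℝ) ^ n) (by positivity)
  set g : ℕ → ℝ → ℝ := fun n τ => ⌊τ / δ n⌋ * δ n / 1 with hg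
  have hgd : ∀ n τ, dist (χ (g n τ)) (χ τ) < (1 / 2 : ℝ) ^ n := by
    intro n τ
    refine hδχ n ?_
    have h0 := hδ n
    have h1 := Int.floor_le (τ / δ n)
    have h2 := Int.lt_floor_add_one (τ / δ n)
    rw [le_div_iff₀ h0] at h1
    rw [div_lt_iff₀ h0] at h2
    rw [hg, Real.dist_eq, abs_lt]
    simp only [div_one]
    constructor <;> nlinarith
  set f : ℕ → M × ℝ → ℝ := fun n e => χ (g n e.2) e.1 with hf
  have hfm : ∀ n, Measurable (f n) := by
    intro n
    have h1 : Measurable fun z : M × ℤ => χ (z.2 * δ n / 1) z.1 :=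
      measurable_from_prod_countable_left fun k =>
        (Lp.stronglyMeasurable (χ (k * δ n / 1))).measurable
    exact h1.comp (measurable_fst.prodMk
      (Int.measurable_floor.comp (measurable_snd.div_const (δ n))))
  have hlim : ∀ τ, ∀ᵐ x ∂μ, Tendsto (fun n => f n (x, τ)) atTop (𝓝 (χ τ x)) := by
    intro τ
    have hdist : ∀ n, eLpNorm (⇑(χ (g n τ)) - ⇑(χ τ)) 2 μ ≤ ENNReal.ofReal ((1 / 2) ^ n) := by
      intro n
      have := (hgd n τ).le
      rw [dist_edist, Lp.edist_def] at this
      rw [← ENNReal.ofReal_toReal (a := eLpNorm _ 2 μ)]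
      · exact ENNReal.ofReal_le_ofReal this
      · exact ((Lp.memLp _).sub (Lp.memLp _)).2.ne
    have h1 : ∀ᵐ x ∂μ, ∃ l : ℝ, Tendsto (fun n => f n (x, τ)) atTop (𝓝 l) := by
      refine Lp.ae_tendsto_of_cauchy_eLpNorm (f := fun n => ⇑(χ (g n τ))) (p := 2)
        (B := fun n => ENNReal.ofReal (3 * (1 / 2) ^ n)) (fun n => Lp.aestronglyMeasurable _)
        (by norm_num) ?_ ?_
      · rw [← ENNReal.ofReal_tsum_of_nonneg (fun n => by positivity)
          ((summable_geometric_of_lt_one (by norm_num) (by norm_num)).mul_left _)]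
        exact ENNReal.ofReal_ne_top
      · intro N n m hn hm
        have e : ⇑(χ (g n τ)) - ⇑(χ (g m τ)) =
            (⇑(χ (g n τ)) - ⇑(χ τ)) - (⇑(χ (g m τ)) - ⇑(χ τ)) := by abel
        have hpow : ∀ k, N ≤ k → ENNReal.ofReal ((1 / 2 : ℝ) ^ k) ≤
            ENNReal.ofReal ((1 / 2) ^ N) := fun k hk =>
          ENNReal.ofReal_le_ofReal (pow_le_pow_of_le_one (by norm_num) (by norm_num) hk)
        rw [e]
        calc _ ≤ eLpNorm (⇑(χ (g n τ)) - ⇑(χ τ)) 2 μ + eLpNorm (⇑(χ (g m τ)) - ⇑(χ τ)) 2 μ :=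
              eLpNorm_sub_le ((Lp.aestronglyMeasurable _).sub (Lp.aestronglyMeasurable _))
                ((Lp.aestronglyMeasurable _).sub (Lp.aestronglyMeasurable _)) (by norm_num)
          _ ≤ ENNReal.ofReal ((1 / 2) ^ N) + ENNReal.ofReal ((1 / 2) ^ N) :=
              add_le_add ((hdist n).trans (hpow n hn)) ((hdist m).trans (hpow m hm))
          _ = ENNReal.ofReal (2 * (1 / 2) ^ N) := by
              rw [← ENNReal.ofReal_add (by positivity) (by positivity)]; congr 1; ring
          _ < _ := by
              rw [ENNReal.ofReal_lt_ofReal_iff (by positivity)]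
              have : (0 : ℝ) < (1 / 2) ^ N := by positivity
              linarith
    have h2 : TendstoInMeasure μ (fun n => ⇑(χ (g n τ))) atTop (χ τ) := by
      refine tendstoInMeasure_of_tendsto_eLpNorm (p := 2) (by norm_num)
        (fun n => Lp.aestronglyMeasurable _) (Lp.aestronglyMeasurable _) ?_
      have h0 : Tendsto (fun n : ℕ => ENNReal.ofReal ((1 / 2 : ℝ) ^ n)) atTop (𝓝 0) := by
        have := ENNReal.tendsto_ofReal
          (tendsto_pow_atTop_nhds_zero_of_lt_one (r := (1 / 2 : ℝ)) (by norm_num) (by norm_num))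
        rwa [ENNReal.ofReal_zero] at this
      exact tendsto_of_tendsto_of_tendsto_of_le_of_le tendsto_const_nhds h0
        (fun n => zero_le) hdist
    obtain ⟨ns, hns, h3⟩ := h2.exists_seq_tendsto_ae
    filter_upwards [h1, h3] with x ⟨l, hl⟩ hx
    rwa [tendsto_nhds_unique hx (hl.comp hns.tendsto_atTop)]
  refine ⟨fun e => limUnder atTop fun n => f n e,
    (StronglyMeasurable.limUnder fun n => (hfm n).stronglyMeasurable).measurable, fun τ => ?_⟩
  filter_upwards [hlim τ] with x hx
  exact hx.limUnder_eq

/-- The norm of curves in `L^1(W)`. -/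
noncomputable def crvNorm (W : M × ℝ → ℝ) (χ : ℝ → Lp ℝ 2 μ) : ℝ≥0∞ :=
  ∫⁻ τ, wn 1 (fun x => W (x, τ)) (χ τ)

/-- The norm of curves in `L^1(W)`, as a real number. -/
noncomputable def tn (W : M × ℝ → ℝ) (χ : ℝ → Lp ℝ 2 μ) : ℝ := (crvNorm W χ).toReal

lemma tn_nonneg (W : M × ℝ → ℝ) (χ : ℝ → Lp ℝ 2 μ) : 0 ≤ tn W χ := ENNReal.toReal_nonneg

lemma wn_one_eq {X : M × ℝ → ℝ} {χ : ℝ → Lp ℝ 2 μ} {τ : ℝ}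
    (hX : (fun x => X (x, τ)) =ᵐ[μ] χ τ) (w : M → ℝ) :
    wn 1 w (χ τ) = ∫⁻ x, ‖w x * X (x, τ)‖ₑ ∂μ := by
  unfold wn
  rw [eLpNorm_one_eq_lintegral_enorm]
  refine lintegral_congr_ae ?_
  filter_upwards [hX] with x hx
  rw [← hx]

variable [SigmaFinite μ]

lemma IsCurve.measurable_wn {χ : ℝ → Lp ℝ 2 μ} (hχ : IsCurve χ) {a : ℝ} {W : M × ℝ → ℝ}
    (hW : IsReg a W) : Measurable fun τ => wn 1 (fun x => W (x, τ)) (χ τ) := by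
  obtain ⟨X, hXm, hX⟩ := hχ.exists_joint
  have : (fun τ => wn 1 (fun x => W (x, τ)) (χ τ)) =
      fun τ => ∫⁻ x, ‖W (x, τ) * X (x, τ)‖ₑ ∂μ := by
    funext τ; rw [wn_one_eq (hX τ)]
  rw [this]
  exact ((hW.measurable.mul hXm).enorm).lintegral_prod_left'

lemma crvNorm_eq {X : M × ℝ → ℝ} (hXm : Measurable X) {χ : ℝ → Lp ℝ 2 μ}
    (hX : ∀ τ, (fun x => X (x, τ)) =ᵐ[μ] χ τ) {a : ℝ} {W : M × ℝ → ℝ} (hW : IsReg a W) :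
    crvNorm W χ = ∫⁻ e, ‖W e * X e‖ₑ ∂(μ.prod volume) := by
  have hm : Measurable fun e => ‖W e * X e‖ₑ := (hW.measurable.mul hXm).enorm
  rw [lintegral_prod_symm' _ hm]
  unfold crvNorm
  exact lintegral_congr fun τ => wn_one_eq (hX τ) _

lemma crvNorm_add_le {χ χ' : ℝ → Lp ℝ 2 μ} (hχ : IsCurve χ) {a : ℝ} {W : M × ℝ → ℝ}
    (hW : IsReg a W) : crvNorm W (χ + χ') ≤ crvNorm W χ + crvNorm W χ' := by
  unfold crvNorm
  rw [← lintegral_add_left (hχ.measurable_wn hW)]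
  exact lintegral_mono fun τ => wn_add_le (Or.inl rfl) (hW.wt τ) _ _

lemma crvNorm_smul (W : M × ℝ → ℝ) (r : ℝ) (χ : ℝ → Lp ℝ 2 μ) :
    crvNorm W (r • χ) = ‖r‖ₑ * crvNorm W χ := by
  unfold crvNorm
  rw [← lintegral_const_mul' _ _ enorm_ne_top]
  exact lintegral_congr fun τ => wn_smul _ _ _ _

/-- Functions bounded by a multiple of a weight. -/
structure BddBy (μ : Measure M) (W : M × ℝ → ℝ) (N : ℝ) (u : M × ℝ → ℝ) : Prop where
  meas : AEStronglyMeasurable u (μ.prod volume)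
  le : ∀ᵐ e ∂(μ.prod volume), |u e| ≤ N * W e

section Pair

variable {a N : ℝ} {W : M × ℝ → ℝ} {u u' : M × ℝ → ℝ} {χ χ' : ℝ → Lp ℝ 2 μ}

lemma BddBy.pair_eq (hW : IsReg a W) (hu : BddBy μ W N u) (hfin : crvNorm W χ ≠ ∞)
    {X : M × ℝ → ℝ} (hXm : Measurable X) (hX : ∀ τ, (fun x => X (x, τ)) =ᵐ[μ] χ τ) :
    Integrable (fun e => u e * X e) (μ.prod volume) ∧
      pair u χ = ∫ e, u e * X e ∂(μ.prod volume) ∧ |pair u χ| ≤ N * tn W χ := by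
  have hle : ∀ᵐ e ∂(μ.prod volume), ‖u e * X e‖ₑ ≤ ENNReal.ofReal N * ‖W e * X e‖ₑ := by
    filter_upwards [hu.le] with e he
    have hN : 0 ≤ N := by
      have := (abs_nonneg _).trans he
      have hp := hW.pos e
      by_contra hneg
      nlinarith
    rw [← ofReal_norm, ← ofReal_norm, ← ENNReal.ofReal_mul hN]
    refine ENNReal.ofReal_le_ofReal ?_
    rw [norm_mul, norm_mul, Real.norm_of_nonneg (hW.pos e).le, Real.norm_eq_abs (u e), ← mul_assoc]
    gcongr
  have hint : ∫⁻ e, ‖u e * X e‖ₑ ∂(μ.prod volume) ≤ ENNReal.ofReal N * crvNorm W χ := by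
    rw [crvNorm_eq hXm hX hW, ← lintegral_const_mul' _ _ ENNReal.ofReal_ne_top]
    exact lintegral_mono_ae hle
  have hI : Integrable (fun e => u e * X e) (μ.prod volume) :=
    ⟨hu.meas.mul hXm.aestronglyMeasurable, hint.trans_lt
      (ENNReal.mul_lt_top ENNReal.ofReal_lt_top hfin.lt_top)⟩
  have heq : pair u χ = ∫ e, u e * X e ∂(μ.prod volume) := by
    rw [integral_prod_symm _ hI]
    unfold pair
    refine integral_congr_ae (Eventually.of_forall fun τ => integral_congr_ae ?_)
    filter_upwards [hX τ] with x hx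
    rw [← hx]
  refine ⟨hI, heq, ?_⟩
  rw [heq]
  have h1 := ENNReal.toReal_mono (ENNReal.mul_ne_top ENNReal.ofReal_ne_top hfin)
    ((enorm_integral_le_lintegral_enorm _).trans hint)
  rw [toReal_enorm, ENNReal.toReal_mul, Real.norm_eq_abs] at h1
  rcases le_or_gt 0 N with hN | hN
  · rwa [ENNReal.toReal_ofReal hN] at h1
  · have : ∀ᵐ e ∂(μ.prod volume), u e * X e = 0 := by
      filter_upwards [hu.le] with e he
      have := (abs_nonneg _).trans he
      have hp := hW.pos e
      nlinarith
    have h0 : ∀ᵐ _ ∂(μ.prod (volume : Measure ℝ)), False := by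
      filter_upwards [hu.le] with e he
      have := (abs_nonneg _).trans he
      have hp := hW.pos e
      nlinarith
    have hz : μ.prod (volume : Measure ℝ) = 0 := by
      rw [← Measure.measure_univ_eq_zero]
      have : {e : M × ℝ | ¬False} = univ := by simp
      rw [← this]; exact h0
    have h2 : tn W χ = 0 := by
      unfold tn; rw [crvNorm_eq hXm hX hW, hz]; simp
    rw [h2, hz]; simp

lemma BddBy.abs_pair_le (hW : IsReg a W) (hu : BddBy μ W N u) (hχ : IsCurve χ)
    (hfin : crvNorm W χ ≠ ∞) : |pair u χ| ≤ N * tn W χ := by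
  obtain ⟨X, hXm, hX⟩ := hχ.exists_joint
  exact (hu.pair_eq hW hfin hXm hX).2.2

lemma BddBy.pair_add (hW : IsReg a W) (hu : BddBy μ W N u) (hχ : IsCurve χ) (hχ' : IsCurve χ')
    (hfin : crvNorm W χ ≠ ∞) (hfin' : crvNorm W χ' ≠ ∞) :
    pair u (χ + χ') = pair u χ + pair u χ' := by
  obtain ⟨X, hXm, hX⟩ := hχ.exists_joint
  obtain ⟨X', hXm', hX'⟩ := hχ'.exists_joint
  have h1 := hu.pair_eq hW hfin hXm hX
  have h2 := hu.pair_eq hW hfin' hXm' hX'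
  have hs : ∀ τ, (fun x => (X + X') (x, τ)) =ᵐ[μ] (χ + χ') τ := fun τ => by
    filter_upwards [hX τ, hX' τ, Lp.coeFn_add (χ τ) (χ' τ)] with x a1 a2 a3
    rw [Pi.add_apply χ, a3, Pi.add_apply, Pi.add_apply, ← a1, ← a2]
  have h3 := hu.pair_eq hW (ne_top_of_le_ne_top (ENNReal.add_ne_top.2 ⟨hfin, hfin'⟩)
    (crvNorm_add_le hχ hW)) (hXm.add hXm') hs
  rw [h1.2.1, h2.2.1, h3.2.1, ← integral_add h1.1 h2.1]
  refine integral_congr_ae (Eventually.of_forall fun e => ?_)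
  simp only [Pi.add_apply]; ring

lemma BddBy.pair_smul (hW : IsReg a W) (hu : BddBy μ W N u) (hχ : IsCurve χ) (r : ℝ)
    (hfin : crvNorm W χ ≠ ∞) : pair u (r • χ) = r * pair u χ := by
  obtain ⟨X, hXm, hX⟩ := hχ.exists_joint
  have h1 := hu.pair_eq hW hfin hXm hX
  have hs : ∀ τ, (fun x => (r • X) (x, τ)) =ᵐ[μ] (r • χ) τ := fun τ => by
    filter_upwards [hX τ, Lp.coeFn_smul r (χ τ)] with x a1 a3
    rw [Pi.smul_apply r χ, a3, Pi.smul_apply, Pi.smul_apply, ← a1]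
  have h3 := hu.pair_eq hW (χ := r • χ) (by
    rw [crvNorm_smul]; exact ENNReal.mul_ne_top enorm_ne_top hfin) (hXm.const_smul r) hs
  rw [h1.2.1, h3.2.1, ← integral_const_mul]
  refine integral_congr_ae (Eventually.of_forall fun e => ?_)
  simp only [Pi.smul_apply, smul_eq_mul]; ring

lemma BddBy.pair_sub_left {N' : ℝ} (hW : IsReg a W) (hu : BddBy μ W N u) (hu' : BddBy μ W N' u')
    (hχ : IsCurve χ) (hfin : crvNorm W χ ≠ ∞) :
    pair (u - u') χ = pair u χ - pair u' χ := by
  obtain ⟨X, hXm, hX⟩ := hχ.exists_joint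
  have h1 := hu.pair_eq hW hfin hXm hX
  have h2 := hu'.pair_eq hW hfin hXm hX
  have hd : BddBy μ W (N + N') (u - u') := ⟨hu.meas.sub hu'.meas, by
    filter_upwards [hu.le, hu'.le] with e a1 a2
    rw [Pi.sub_apply, add_mul]
    exact (abs_sub _ _).trans (add_le_add a1 a2)⟩
  have h3 := hd.pair_eq hW hfin hXm hX
  rw [h1.2.1, h2.2.1, h3.2.1, ← integral_sub h1.1 h2.1]
  refine integral_congr_ae (Eventually.of_forall fun e => ?_)
  simp only [Pi.sub_apply]; ring

end Pair

/-! ### Space-time convolution operators -/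

/-- Continuous causal convolution kernels with compact support. -/
structure IsKer (k : ℝ → ℝ) : Prop where
  cont : Continuous k
  cpt : HasCompactSupport k
  causal : ∀ s < 0, k s = 0

/-- The formal adjoint of `R ⊗ k⋆`. -/
noncomputable def opK (R : Lp ℝ 2 μ →L[ℝ] Lp ℝ 2 μ) (k : ℝ → ℝ) (χ : ℝ → Lp ℝ 2 μ) :
    ℝ → Lp ℝ 2 μ :=
  fun σ => R.adjoint (∫ τ, k (τ - σ) • χ τ)

/-- The kernel `m_t = t⁻¹ m(·/t)`. -/
noncomputable def scaled (m : ℝ → ℝ) (t : ℝ) : ℝ → ℝ := fun s => t⁻¹ * m (s / t)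

lemma opAdj_eq (R : Lp ℝ 2 μ →L[ℝ] Lp ℝ 2 μ) (m : ℝ → ℝ) (t : ℝ) (χ : ℝ → Lp ℝ 2 μ) :
    opAdj R m t χ = opK R (scaled m t) χ := rfl

section OpK

variable {R R' : Lp ℝ 2 μ →L[ℝ] Lp ℝ 2 μ} {k k' : ℝ → ℝ} {χ χ' : ℝ → Lp ℝ 2 μ}

lemma opK_eq_convolution (R : Lp ℝ 2 μ →L[ℝ] Lp ℝ 2 μ) (k : ℝ → ℝ) (χ : ℝ → Lp ℝ 2 μ) (σ : ℝ) :
    opK R k χ σ = R.adjoint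
      (convolution (fun s => k (-s)) χ (ContinuousLinearMap.lsmul ℝ ℝ) volume σ) := by
  rw [convolution_eq_swap]
  simp [opK]

lemma integrable_smul_curve (hk : Continuous k) (hχ : IsCurve χ) (σ : ℝ) :
    Integrable fun τ => k (τ - σ) • χ τ :=
  ((hk.comp (continuous_id.sub continuous_const)).smul hχ.cont).integrable_of_hasCompactSupport
    (hχ.cpt.smul_left (f := fun τ => k (τ - σ)))

lemma IsKer.comp_neg_cpt (hk : IsKer k) : HasCompactSupport fun s => k (-s) :=
  hk.cpt.comp_homeomorph (Homeomorph.neg ℝ)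

lemma IsCurve.opK (hk : IsKer k) (hχ : IsCurve χ) (R : Lp ℝ 2 μ →L[ℝ] Lp ℝ 2 μ) :
    IsCurve (opK R k χ) := by
  have e : Parabolic.opK R k χ = fun σ => R.adjoint
      (convolution (fun s => k (-s)) χ (ContinuousLinearMap.lsmul ℝ ℝ) volume σ) :=
    funext fun σ => opK_eq_convolution R k χ σ
  rw [e]
  refine ⟨R.adjoint.continuous.comp ?_, ?_⟩
  · exact hχ.cpt.continuous_convolution_right _ (hk.cont.comp continuous_neg).locallyIntegrable
      hχ.cont
  · exact (hk.comp_neg_cpt.convolution (ContinuousLinearMap.lsmul ℝ ℝ) hχ.cpt).comp_left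
      (map_zero _)

lemma opK_add_right (hk : Continuous k) (hχ : IsCurve χ) (hχ' : IsCurve χ') :
    opK R k (χ + χ') = opK R k χ + opK R k χ' := by
  funext σ
  simp only [opK, Pi.add_apply, smul_add]
  rw [integral_add (integrable_smul_curve hk hχ σ) (integrable_smul_curve hk hχ' σ), map_add]

lemma opK_smul_right (r : ℝ) : opK R k (r • χ) = r • opK R k χ := by
  funext σ
  simp only [opK, Pi.smul_apply]
  rw [← map_smul, ← integral_smul]
  simp only [smul_comm r]

lemma opK_smul_left (r : ℝ) : opK (r • R) k χ = r • opK R k χ := by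
  funext σ; simp [opK]

lemma opK_sub_left : opK (R - R') k χ = opK R k χ - opK R' k χ := by
  funext σ; simp [opK]

lemma opK_sum_left {ι : Type*} (s : Finset ι) (c : ι → ℝ) (R : ι → Lp ℝ 2 μ →L[ℝ] Lp ℝ 2 μ) :
    opK (∑ i ∈ s, c i • R i) k χ = ∑ i ∈ s, c i • opK (R i) k χ := by
  funext σ; simp [opK]

lemma opK_smul_ker (r : ℝ) : opK R (fun s => r * k s) χ = r • opK R k χ := by
  funext σ
  simp only [opK, Pi.smul_apply]
  rw [← map_smul, ← integral_smul]
  simp only [smul_smul]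

lemma opK_add_ker (hk : Continuous k) (hk' : Continuous k') (hχ : IsCurve χ) :
    opK R (fun s => k s + k' s) χ = opK R k χ + opK R k' χ := by
  funext σ
  simp only [opK, Pi.add_apply, add_smul]
  rw [integral_add (integrable_smul_curve hk hχ σ) (integrable_smul_curve hk' hχ σ), map_add]

lemma opK_sub_ker (hk : Continuous k) (hk' : Continuous k') (hχ : IsCurve χ) :
    opK R (fun s => k s - k' s) χ = opK R k χ - opK R k' χ := by
  funext σ
  simp only [opK, Pi.sub_apply, sub_smul]
  rw [integral_sub (integrable_smul_curve hk hχ σ) (integrable_smul_curve hk' hχ σ), map_sub]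

lemma crvNorm_opK_le {a C : ℝ} (hR : WB a C R) {W : M × ℝ → ℝ} (hW : IsReg a W)
    (hk : Continuous k) (hk0 : ∀ s < 0, k s = 0) (hχ : IsCurve χ) :
    crvNorm W (opK R k χ) ≤ ENNReal.ofReal C * (∫⁻ s, ‖k s‖ₑ) * crvNorm W χ := by
  set F : ℝ → ℝ≥0∞ := fun τ => wn 1 (fun x => W (x, τ)) (χ τ) with hF
  have hFm : Measurable F := hχ.measurable_wn hW
  have h1 : ∀ σ, wn 1 (fun x => W (x, σ)) (opK R k χ σ) ≤
      ENNReal.ofReal C * ∫⁻ τ, ‖k (τ - σ)‖ₑ * F τ := by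
    intro σ
    refine (hR.le _ (hW.wt σ) 1 (Or.inl rfl) _).trans ?_
    gcongr
    refine (wn_integral_le (Or.inl rfl) (hW.wt σ) _).trans (lintegral_mono fun τ => ?_)
    rw [wn_smul]
    rcases lt_or_ge τ σ with h | h
    · rw [hk0 _ (sub_neg.2 h)]; simp
    · gcongr
      exact wn_mono (fun x => (hW.pos _).le) (fun x => hW.mono x h) _
  calc crvNorm W (opK R k χ) ≤ ∫⁻ σ, ENNReal.ofReal C * ∫⁻ τ, ‖k (τ - σ)‖ₑ * F τ :=
        lintegral_mono h1
    _ = ENNReal.ofReal C * ∫⁻ σ, ∫⁻ τ, ‖k (τ - σ)‖ₑ * F τ :=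
        lintegral_const_mul' _ _ ENNReal.ofReal_ne_top
    _ = ENNReal.ofReal C * ∫⁻ τ, ∫⁻ σ, ‖k (τ - σ)‖ₑ * F τ := by
        rw [lintegral_lintegral_swap]
        have : Measurable fun z : ℝ × ℝ => ‖k (z.2 - z.1)‖ₑ * F z.2 :=
          (hk.measurable.comp (measurable_snd.sub measurable_fst)).enorm.mul
            (hFm.comp measurable_snd)
        exact this.aemeasurable
    _ = ENNReal.ofReal C * ∫⁻ τ, (∫⁻ s, ‖k s‖ₑ) * F τ := by
        congr 1
        refine lintegral_congr fun τ => ?_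
        have hm : Measurable fun σ => ‖k (τ - σ)‖ₑ :=
          (hk.measurable.comp (measurable_const.sub measurable_id)).enorm
        rw [lintegral_mul_const _ hm, lintegral_sub_left_eq_self (fun s => ‖k s‖ₑ) τ]
    _ = _ := by
        rw [lintegral_const_mul _ hFm, ← mul_assoc]; rfl

lemma IsKer.lintegral_lt_top (hk : IsKer k) : ∫⁻ s, ‖k s‖ₑ < ∞ :=
  (hk.cont.integrable_of_hasCompactSupport hk.cpt).2

lemma IsKer.lintegral_eq (hk : IsKer k) : ∫⁻ s, ‖k s‖ₑ = ENNReal.ofReal (∫ s, |k s|) := by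
  have := ofReal_integral_eq_lintegral_ofReal (μ := (volume : Measure ℝ))
    (hk.cont.integrable_of_hasCompactSupport hk.cpt).norm
    (Eventually.of_forall fun _ => norm_nonneg _)
  simp only [Real.norm_eq_abs] at this
  rw [this]
  refine lintegral_congr fun s => ?_
  rw [← ofReal_norm, Real.norm_eq_abs]

lemma crvNorm_opK_ne_top {a C : ℝ} (hR : WB a C R) {W : M × ℝ → ℝ} (hW : IsReg a W)
    (hk : IsKer k) (hχ : IsCurve χ) (hfin : crvNorm W χ ≠ ∞) : crvNorm W (opK R k χ) ≠ ∞ :=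
  ne_top_of_le_ne_top (ENNReal.mul_ne_top (ENNReal.mul_ne_top ENNReal.ofReal_ne_top
    hk.lintegral_lt_top.ne) hfin) (crvNorm_opK_le hR hW hk.cont hk.causal hχ)

lemma tn_opK_le {a C : ℝ} (hR : WB a C R) {W : M × ℝ → ℝ} (hW : IsReg a W)
    (hk : IsKer k) (hχ : IsCurve χ) (hfin : crvNorm W χ ≠ ∞) :
    tn W (opK R k χ) ≤ C * (∫ s, |k s|) * tn W χ := by
  have h := ENNReal.toReal_mono (ENNReal.mul_ne_top (ENNReal.mul_ne_top ENNReal.ofReal_ne_top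
    hk.lintegral_lt_top.ne) hfin) (crvNorm_opK_le hR hW hk.cont hk.causal hχ)
  rwa [hk.lintegral_eq, ENNReal.toReal_mul, ENNReal.toReal_mul, ENNReal.toReal_ofReal hR.nonneg,
    ENNReal.toReal_ofReal (integral_nonneg fun _ => abs_nonneg _)] at h

/-- The convolution of two causal kernels. -/
noncomputable def kc (k k' : ℝ → ℝ) : ℝ → ℝ := fun s => ∫ y, k' y * k (s - y)

lemma IsKer.kc (hk : IsKer k) (hk' : IsKer k') : IsKer (kc k k') := by
  have e : Parabolic.kc k k' = convolution k' k (ContinuousLinearMap.mul ℝ ℝ) volume := by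
    funext s; simp [Parabolic.kc, convolution_def]
  refine ⟨?_, ?_, fun s hs => ?_⟩
  · rw [e]; exact hk.cpt.continuous_convolution_right _ hk'.cont.locallyIntegrable hk.cont
  · rw [e]; exact hk'.cpt.convolution _ hk.cpt
  · refine integral_eq_zero_of_ae (Eventually.of_forall fun y => ?_)
    rcases lt_or_ge y 0 with h | h
    · simp [hk'.causal y h]
    · simp [hk.causal (s - y) (by linarith)]

lemma opK_opK (hk : IsKer k) (hk' : IsKer k') (hχ : IsCurve χ) :
    opK R' k' (opK R k χ) = opK (R.comp R') (kc k k') χ := by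
  funext σ
  simp only [opK]
  rw [ContinuousLinearMap.adjoint_comp, ContinuousLinearMap.comp_apply]
  congr 1
  have h1 : ∀ τ, k' (τ - σ) • R.adjoint (∫ τ', k (τ' - τ) • χ τ') =
      R.adjoint (k' (τ - σ) • ∫ τ', k (τ' - τ) • χ τ') := fun τ => by rw [map_smul]
  simp_rw [h1]
  have hcv : IsCurve (opK (ContinuousLinearMap.id ℝ (Lp ℝ 2 μ)) k χ) := hχ.opK hk _
  have hint := integrable_smul_curve hk'.cont hcv σ
  have hid : ∀ v : Lp ℝ 2 μ, (ContinuousLinearMap.id ℝ (Lp ℝ 2 μ)).adjoint v = v := fun v =>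
    ext_inner_left ℝ fun u => by simp [ContinuousLinearMap.adjoint_inner_right]
  simp only [opK, hid] at hint
  rw [ContinuousLinearMap.integral_comp_comm _ hint]
  congr 1
  simp_rw [← integral_smul]
  rw [integral_integral_swap]
  · refine integral_congr_ae (Eventually.of_forall fun τ' => ?_)
    simp only [kc, smul_smul]
    rw [integral_smul_const]
    congr 1
    rw [← integral_sub_right_eq_self (fun y => k' y * k (τ' - σ - y)) σ]
    refine integral_congr_ae (Eventually.of_forall fun y => ?_)
    simp only
    congr 2; ring
  · have hc : Continuous (Function.uncurry fun τ τ' => k' (τ - σ) • k (τ' - τ) • χ τ') := by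
      refine Continuous.smul (hk'.cont.comp (continuous_fst.sub continuous_const)) ?_
      exact (hk.cont.comp (continuous_snd.sub continuous_fst)).smul (hχ.cont.comp continuous_snd)
    refine hc.integrable_of_hasCompactSupport ?_
    have hk'σ : HasCompactSupport fun τ => k' (τ - σ) :=
      hk'.cpt.comp_homeomorph (Homeomorph.subRight σ)
    refine HasCompactSupport.intro (hk'σ.isCompact.prod hχ.cpt.isCompact) fun z hz => ?_
    rw [mem_prod, not_and_or] at hz
    rcases hz with h | h
    · have : k' (z.1 - σ) = 0 :=
        image_eq_zero_of_notMem_tsupport (f := fun τ => k' (τ - σ)) h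
      simp [Function.uncurry, this]
    · have : χ z.2 = 0 := image_eq_zero_of_notMem_tsupport h
      simp [Function.uncurry, this]

end OpK

end Parabolic

namespace Parabolic

/-! ### Moments and convolution kernels -/

/-- Taylor approximation on the half-line, for a function given with its derivatives. -/
lemma exists_taylor_approx (k : ℕ) {G : ℝ} : ∀ g : ℕ → ℝ → ℝ,
    (∀ j < k, ∀ x, HasDerivAt (g j) (g (j + 1) x) x) → (∀ x, 0 ≤ x → |g k x| ≤ G) →
    ∃ c : ℕ → ℝ, ∀ x, 0 ≤ x → |g 0 x - ∑ i ∈ Finset.range k, c i * x ^ i| ≤ G * x ^ k := by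
  induction k with
  | zero => intro g _ hG; exact ⟨0, fun x hx => by simpa using hG x hx⟩
  | succ k ih =>
    intro g hg hG
    obtain ⟨c, hc⟩ := ih (fun j => g (j + 1)) (fun j hj => hg (j + 1) (by omega)) hG
    have hG0 : 0 ≤ G := (abs_nonneg _).trans (hG 0 le_rfl)
    refine ⟨fun i => if i = 0 then g 0 0 else c (i - 1) / i, fun x hx => ?_⟩
    set e : ℝ → ℝ := fun y => g 0 y - ∑ i ∈ Finset.range k, c i / (i + 1 : ℕ) * y ^ (i + 1) with he
    have hd : ∀ y, HasDerivAt e (g 1 y - ∑ i ∈ Finset.range k, c i * y ^ i) y := by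
      intro y
      refine (hg 0 (by omega) y).sub (HasDerivAt.fun_sum fun i _ => ?_)
      refine ((hasDerivAt_pow (i + 1) y).const_mul (c i / (i + 1 : ℕ))).congr_deriv ?_
      have : ((i + 1 : ℕ) : ℝ) ≠ 0 := by positivity
      rw [Nat.add_sub_cancel]
      field_simp
    have h1 := Convex.norm_image_sub_le_of_norm_hasDerivWithin_le (f := e)
      (s := Icc 0 x) (C := G * x ^ k) (fun y _ => (hd y).hasDerivWithinAt)
      (fun y hy => by
        rw [Real.norm_eq_abs]
        refine (hc y hy.1).trans ?_
        have := hy.1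
        have := hy.2
        gcongr) (convex_Icc 0 x) (left_mem_Icc.2 hx) (right_mem_Icc.2 hx)
    have h0 : e 0 = g 0 0 := by simp [he]
    rw [h0, Real.norm_eq_abs, sub_zero, Real.norm_of_nonneg hx] at h1
    rw [Finset.sum_range_succ']
    simp only [if_true, pow_zero, mul_one, Nat.add_sub_cancel, Nat.succ_ne_zero, if_false]
    calc _ = |e x - g 0 0| := by congr 1; simp only [he]; ring
      _ ≤ _ := h1.trans_eq (by ring)

lemma integrable_of_support_Icc {m : ℝ → ℝ} (hm : Continuous m) {a b : ℝ}
    (hs : ∀ x, x ∉ Icc a b → m x = 0) : Integrable m :=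
  hm.integrable_of_hasCompactSupport (HasCompactSupport.intro isCompact_Icc hs)

lemma abs_integral_le_of_support {f : ℝ → ℝ} {a b C : ℝ} (hab : a ≤ b)
    (hs : ∀ x, x ∉ Icc a b → f x = 0) (hC : ∀ x ∈ Icc a b, |f x| ≤ C) :
    |∫ x, f x| ≤ C * (b - a) := by
  rw [← setIntegral_eq_integral_of_forall_compl_eq_zero hs]
  have := norm_setIntegral_le_of_norm_le_const (μ := volume) (s := Icc a b) (f := f) (C := C)
    measure_Icc_lt_top hC
  rwa [Real.volume_real_Icc_of_le hab] at this

/-- Cancellation: integrals against a function with vanishing moments. -/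
lemma abs_integral_moments_le {m : ℝ → ℝ} (hm : Continuous m)
    (hs : ∀ x, x ∉ Icc (1 / 2 : ℝ) 2 → m x = 0) {A : ℝ} (hA : ∀ x, |m x| ≤ A) {k : ℕ}
    (hmom : ∀ i < k, ∫ x, x ^ i * m x = 0) {G : ℝ} (g : ℕ → ℝ → ℝ)
    (hg : ∀ j < k, ∀ x, HasDerivAt (g j) (g (j + 1) x) x) (hg0 : Continuous (g 0))
    (hG : ∀ x, 0 ≤ x → |g k x| ≤ G) {ρ : ℝ} (hρ : 0 ≤ ρ) :
    |∫ x, m x * g 0 (ρ * x)| ≤ 2 * 2 ^ k * A * G * ρ ^ k := by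
  obtain ⟨c, hc⟩ := exists_taylor_approx k g hg hG
  have hA0 : 0 ≤ A := (abs_nonneg _).trans (hA 0)
  have hG0 : 0 ≤ G := (abs_nonneg _).trans (hG 0 le_rfl)
  have hp : ∫ x, m x * ∑ i ∈ Finset.range k, c i * (ρ * x) ^ i = 0 := by
    have e : ∀ x, m x * ∑ i ∈ Finset.range k, c i * (ρ * x) ^ i =
        ∑ i ∈ Finset.range k, c i * ρ ^ i * (x ^ i * m x) := fun x => by
      rw [Finset.mul_sum]; exact Finset.sum_congr rfl fun i _ => by ring
    simp_rw [e]
    rw [integral_finsetSum]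
    · refine Finset.sum_eq_zero fun i hi => ?_
      rw [integral_const_mul, hmom i (Finset.mem_range.1 hi), mul_zero]
    · intro i _
      refine (integrable_of_support_Icc ((continuous_pow i).mul hm) (a := 1 / 2) (b := 2)
        fun x hx => ?_).const_mul _
      simp [hs x hx]
  have hI1 : Integrable fun x => m x * g 0 (ρ * x) :=
    integrable_of_support_Icc (hm.mul (hg0.comp (continuous_const.mul continuous_id)))
      (a := 1 / 2) (b := 2) fun x hx => by simp [hs x hx]
  have hI2 : Integrable fun x => m x * ∑ i ∈ Finset.range k, c i * (ρ * x) ^ i :=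
    integrable_of_support_Icc (by fun_prop) (a := 1 / 2) (b := 2) fun x hx => by simp [hs x hx]
  rw [← sub_zero (∫ x, m x * g 0 (ρ * x)), ← hp, ← integral_sub hI1 hI2]
  refine (abs_integral_le_of_support (a := 1 / 2) (b := 2) (C := A * (G * (2 * ρ) ^ k))
    (by norm_num) (fun x hx => by simp [hs x hx]) fun x hx => ?_).trans ?_
  · rw [← mul_sub, abs_mul]
    have hx0 : 0 ≤ x := le_trans (by norm_num) hx.1
    have h1 := hc (ρ * x) (by positivity)
    have h2 : (ρ * x) ^ k ≤ (2 * ρ) ^ k := by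
      have := hx.2
      exact pow_le_pow_left₀ (by positivity) (by nlinarith) k
    exact mul_le_mul (hA x) (h1.trans (by gcongr)) (abs_nonneg _) hA0
  · rw [mul_pow]
    have : 0 ≤ A * (G * (2 ^ k * ρ ^ k)) := by positivity
    nlinarith

/-- Smooth functions supported in `[1/2, 2]`. -/
structure IsBump (m : ℝ → ℝ) : Prop where
  smooth : ContDiff ℝ ((⊤ : ℕ∞) : WithTop ℕ∞) m
  support : ∀ τ, τ ∉ Icc (1 / 2 : ℝ) 2 → m τ = 0

/-- The generator of dilations. -/
noncomputable def dil (m : ℝ → ℝ) : ℝ → ℝ := fun σ => m σ + σ * deriv m σ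

namespace IsBump

variable {m n : ℝ → ℝ}

lemma cpt (hm : IsBump m) : HasCompactSupport m := HasCompactSupport.intro isCompact_Icc hm.support

lemma hasDerivAt (hm : IsBump m) (x : ℝ) : HasDerivAt m (deriv m x) x :=
  (hm.smooth.differentiable (by simp) x).hasDerivAt

lemma deriv (hm : IsBump m) : IsBump (deriv m) := by
  refine ⟨(contDiff_infty_iff_deriv.1 hm.smooth).2, fun τ hτ => ?_⟩
  have : m =ᶠ[𝓝 τ] 0 := by
    filter_upwards [isClosed_Icc.isOpen_compl.mem_nhds hτ] with x hx
    exact hm.support x hx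
  rw [this.deriv_eq]; simp

lemma iteratedDeriv (hm : IsBump m) (j : ℕ) : IsBump (iteratedDeriv j m) := by
  induction j with
  | zero => simpa using hm
  | succ j ih => rw [iteratedDeriv_succ]; exact ih.deriv

lemma add (hm : IsBump m) (hn : IsBump n) : IsBump fun x => m x + n x :=
  ⟨hm.smooth.add hn.smooth, fun τ hτ => by simp [hm.support τ hτ, hn.support τ hτ]⟩

lemma const_mul (hm : IsBump m) (r : ℝ) : IsBump fun x => r * m x :=
  ⟨contDiff_const.mul hm.smooth, fun τ hτ => by simp [hm.support τ hτ]⟩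

lemma id_mul (hm : IsBump m) : IsBump fun x => x * m x :=
  ⟨contDiff_id.mul hm.smooth, fun τ hτ => by simp [hm.support τ hτ]⟩

lemma dil (hm : IsBump m) : IsBump (dil m) := hm.add hm.deriv.id_mul

lemma exists_bound (hm : IsBump m) : ∃ K, 0 < K ∧ ∀ x, |m x| ≤ K := by
  obtain ⟨K, hK⟩ := hm.cpt.exists_bound_of_continuous hm.smooth.continuous
  exact ⟨max K 1, by positivity, fun x => (hK x).trans (le_max_left _ _)⟩

lemma exists_bound_iteratedDeriv (hm : IsBump m) (b : ℕ) :
    ∃ K, 0 < K ∧ ∀ i ≤ b, ∀ x, |_root_.iteratedDeriv i m x| ≤ K := by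
  choose K hK0 hK using fun i => (hm.iteratedDeriv i).exists_bound
  refine ⟨∑ i ∈ Finset.range (b + 1), K i, Finset.sum_pos (fun i _ => hK0 i) (by simp),
    fun i hi x => (hK i x).trans ?_⟩
  exact Finset.single_le_sum (f := K) (fun i _ => (hK0 i).le) (Finset.mem_range.2 (by omega))

lemma isKer (hm : IsBump m) {t : ℝ} (ht : 0 < t) : IsKer (scaled m t) := by
  refine ⟨continuous_const.mul (hm.smooth.continuous.comp (continuous_id.div_const t)), ?_,
    fun s hs => ?_⟩
  · refine HasCompactSupport.intro (isCompact_Icc (a := t * (1 / 2)) (b := t * 2)) fun x hx => ?_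
    have : m (x / t) = 0 := hm.support _ fun h => hx
      ⟨by have := h.1; rwa [le_div_iff₀' ht] at this, by have := h.2; rwa [div_le_iff₀' ht] at this⟩
    simp [scaled, this]
  · have : m (s / t) = 0 := hm.support _ fun h => by
      have h1 := h.1
      have : s / t < 0 := div_neg_of_neg_of_pos hs ht
      linarith
    simp [scaled, this]

lemma scaled_eq_zero (hm : IsBump m) {t x : ℝ} (ht : 0 < t) (hx : x ∉ Icc 0 (2 * t)) :
    scaled m t x = 0 := by
  have : m (x / t) = 0 := hm.support _ fun h => hx ⟨by
    have h1 : 0 ≤ x / t := le_trans (by norm_num) h.1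
    have := mul_nonneg h1 ht.le
    rwa [div_mul_cancel₀ _ ht.ne'] at this, by have := h.2; rwa [div_le_iff₀ ht] at this⟩
  simp [scaled, this]

end IsBump

lemma integral_scaled_mul (m g : ℝ → ℝ) {t : ℝ} (ht : 0 < t) :
    ∫ x, scaled m t x * g x = ∫ x, m x * g (t * x) := by
  have h := Measure.integral_comp_div (fun x => m x * g (t * x)) t
  rw [abs_of_pos ht, smul_eq_mul] at h
  have e : ∀ x, scaled m t x * g x = t⁻¹ * (m (x / t) * g (t * (x / t))) := fun x => by
    rw [mul_div_cancel₀ _ ht.ne', scaled]; ring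
  simp_rw [e]
  rw [integral_const_mul, h, ← mul_assoc, inv_mul_cancel₀ ht.ne', one_mul]

lemma integral_abs_scaled (m : ℝ → ℝ) {t : ℝ} (ht : 0 < t) :
    ∫ x, |scaled m t x| = ∫ x, |m x| := by
  have h := integral_scaled_mul (fun x => |m x|) (fun _ => 1) ht
  simp only [mul_one] at h
  rw [← h]
  simp [scaled, abs_mul, abs_of_pos ht]

lemma kc_comm (k k' : ℝ → ℝ) : kc k k' = kc k' k := by
  funext s
  unfold kc
  rw [← integral_sub_left_eq_self _ _ s]
  refine integral_congr_ae (Eventually.of_forall fun y => ?_)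
  simp only [sub_sub_cancel, mul_comm]

/-- Cancellation in the convolution of two kernels at different scales. -/
lemma integral_abs_kc_le {m n : ℝ → ℝ} (hm : IsBump m) (hn : IsBump n) {A G : ℝ} {k : ℕ}
    (hA : ∀ x, |m x| ≤ A) (hmom : ∀ i < k, ∫ x, x ^ i * m x = 0)
    (hG : ∀ x, |iteratedDeriv k n x| ≤ G) {r t : ℝ} (hr : 0 < r) (hrt : r ≤ t) :
    ∫ s, |kc (scaled m r) (scaled n t) s| ≤ 8 * 2 ^ k * A * G * (r / t) ^ k := by
  have ht := hr.trans_le hrt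
  have hA0 : 0 ≤ A := (abs_nonneg _).trans (hA 0)
  have hG0 : 0 ≤ G := (abs_nonneg _).trans (hG 0)
  have key : ∀ s, |kc (scaled m r) (scaled n t) s| ≤
      2 * 2 ^ k * A * (t⁻¹ ^ (k + 1) * G) * r ^ k := by
    intro s
    have e : kc (scaled m r) (scaled n t) s = ∫ x, m x * (fun y => scaled n t (s - y)) (r * x) := by
      rw [← integral_scaled_mul m (fun y => scaled n t (s - y)) hr, kc_comm]; rfl
    rw [e]
    have h := abs_integral_moments_le hm.smooth.continuous hm.support hA hmom
      (G := t⁻¹ ^ (k + 1) * G)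
      (fun j y => (-1) ^ j * t⁻¹ ^ (j + 1) * iteratedDeriv j n ((s - y) / t)) ?_ ?_ ?_ hr.le
    · simpa [scaled] using h
    · intro j _ x
      have h1 : HasDerivAt (fun y => (s - y) / t) (-1 / t) x :=
        ((hasDerivAt_id x).const_sub s).div_const t
      have h2 := ((hn.iteratedDeriv j).hasDerivAt ((s - x) / t)).comp x h1
      refine (h2.const_mul ((-1) ^ j * t⁻¹ ^ (j + 1))).congr_deriv ?_
      rw [iteratedDeriv_succ, div_eq_mul_inv]
      ring
    · simp only [pow_zero, one_mul, iteratedDeriv_zero]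
      exact continuous_const.mul (hn.smooth.continuous.comp (by fun_prop))
    · intro x _
      rw [abs_mul, abs_mul, abs_pow, abs_neg, abs_one, one_pow, one_mul, abs_of_pos (by positivity)]
      gcongr
      exact hG _
  have hsupp : ∀ s, s ∉ Icc (0 : ℝ) (4 * t) → kc (scaled m r) (scaled n t) s = 0 := by
    intro s hs
    refine integral_eq_zero_of_ae (Eventually.of_forall fun y => ?_)
    by_cases h1 : y ∈ Icc 0 (2 * t)
    · have h2 : s - y ∉ Icc 0 (2 * r) := fun h => hs ⟨by linarith [h.1, h1.1], by
        linarith [h.2, h1.2]⟩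
      simp [hm.scaled_eq_zero hr h2]
    · simp [hn.scaled_eq_zero ht h1]
  refine (le_abs_self _).trans ((abs_integral_le_of_support (a := 0) (b := 4 * t)
    (C := 2 * 2 ^ k * A * (t⁻¹ ^ (k + 1) * G) * r ^ k) (by linarith)
    (fun s hs => by rw [hsupp s hs, abs_zero]) fun s _ => by rw [abs_abs]; exact key s).trans_eq ?_)
  rw [div_pow, pow_succ, inv_pow]
  field_simp
  ring

section Dilation

variable {m : ℝ → ℝ}

lemma hasDerivAt_scaled (hm : IsBump m) (x : ℝ) {s : ℝ} (hs : s ≠ 0) :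
    HasDerivAt (fun s => scaled m s x) (-s⁻¹ * scaled (dil m) s x) s := by
  have h1 : HasDerivAt (fun s : ℝ => s⁻¹) (-(s ^ 2)⁻¹) s := hasDerivAt_inv hs
  have h2 : HasDerivAt (fun s : ℝ => x / s) (x * -(s ^ 2)⁻¹) s := by
    simpa [div_eq_mul_inv] using h1.const_mul x
  have h3 := h1.mul ((hm.hasDerivAt (x / s)).comp s h2)
  refine h3.congr_deriv ?_
  simp only [scaled, dil, Function.comp]
  field_simp
  ring

lemma abs_scaled_le {K : ℝ} (hK : ∀ x, |m x| ≤ K) {δ s : ℝ} (hδ : 0 < δ) (hs : δ ≤ s) (x : ℝ) :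
    |scaled m s x| ≤ δ⁻¹ * K := by
  have h0 := hδ.trans_le hs
  rw [scaled, abs_mul, abs_inv, abs_of_pos h0]
  exact mul_le_mul (inv_anti₀ hδ hs) (hK _) (abs_nonneg _) (by positivity)

lemma exists_abs_scaled_sub_le (hm : IsBump m) {δ : ℝ} (hδ : 0 < δ) : ∃ D, 0 ≤ D ∧
    ∀ s t, δ ≤ s → δ ≤ t → ∀ x, |scaled m s x - scaled m t x| ≤ D * |s - t| := by
  obtain ⟨K, hK0, hK⟩ := hm.dil.exists_bound
  refine ⟨δ⁻¹ * (δ⁻¹ * K), by positivity, fun s t hs ht x => ?_⟩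
  refine Convex.norm_image_sub_le_of_norm_hasDerivWithin_le (f := fun s => scaled m s x)
    (s := Ici δ) (fun u hu => (hasDerivAt_scaled hm x (hδ.trans_le hu).ne').hasDerivWithinAt)
    (fun u hu => ?_) (convex_Ici δ) ht hs
  have h0 := hδ.trans_le (mem_Ici.1 hu)
  rw [Real.norm_eq_abs, abs_mul, abs_neg, abs_inv, abs_of_pos h0]
  exact mul_le_mul (inv_anti₀ hδ hu) (abs_scaled_le hK hδ hu x) (abs_nonneg _) (by positivity)

lemma exists_abs_scaled_sub_le_two (hm : IsBump m) {δ : ℝ} (hδ : 0 < δ) : ∃ D, 0 ≤ D ∧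
    ∀ s t, δ ≤ s → δ ≤ t → ∀ x,
      |scaled m s x - scaled m t x - (s - t) * (-t⁻¹ * scaled (dil m) t x)| ≤ D * |s - t| ^ 2 := by
  obtain ⟨D, hD0, hD⟩ := exists_abs_scaled_sub_le hm.dil hδ
  obtain ⟨K, hK0, hK⟩ := hm.dil.exists_bound
  refine ⟨δ⁻¹ * D + δ⁻¹ * δ⁻¹ * (δ⁻¹ * K), by positivity, fun s t hs ht x => ?_⟩
  set E := δ⁻¹ * D + δ⁻¹ * δ⁻¹ * (δ⁻¹ * K) with hE
  have hE0 : 0 ≤ E := by positivity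
  have ht0 := hδ.trans_le ht
  have hmem : ∀ u ∈ uIcc t s, δ ≤ u ∧ |u - t| ≤ |s - t| := fun u hu =>
    ⟨(le_min ht hs).trans hu.1, abs_sub_left_of_mem_uIcc hu⟩
  have h := Convex.norm_image_sub_le_of_norm_hasDerivWithin_le
    (f := fun u => scaled m u x - (u - t) * (-t⁻¹ * scaled (dil m) t x))
    (f' := fun u => -u⁻¹ * scaled (dil m) u x - 1 * (-t⁻¹ * scaled (dil m) t x))
    (s := uIcc t s) (C := E * |s - t|) (fun u hu => by
      refine HasDerivAt.hasDerivWithinAt ?_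
      exact (hasDerivAt_scaled hm x (hδ.trans_le (hmem u hu).1).ne').sub
        (((hasDerivAt_id u).sub_const t).mul_const _))
    (fun u hu => ?_) (convex_uIcc t s) left_mem_uIcc right_mem_uIcc
  · rw [Real.norm_eq_abs, Real.norm_eq_abs] at h
    refine le_trans (le_of_eq ?_) (h.trans_eq (by ring))
    congr 1; ring
  · obtain ⟨hu1, hu2⟩ := hmem u hu
    have hu0 := hδ.trans_le hu1
    have e : -u⁻¹ * scaled (dil m) u x - 1 * (-t⁻¹ * scaled (dil m) t x) =
        -(u⁻¹ * (scaled (dil m) u x - scaled (dil m) t x)) +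
          (u - t) * (u⁻¹ * t⁻¹) * scaled (dil m) t x := by
      field_simp; ring
    rw [e, Real.norm_eq_abs]
    have i1 : u⁻¹ ≤ δ⁻¹ := inv_anti₀ hδ hu1
    have i2 : t⁻¹ ≤ δ⁻¹ := inv_anti₀ hδ ht
    have j1 : |u⁻¹ * (scaled (dil m) u x - scaled (dil m) t x)| ≤ δ⁻¹ * (D * |s - t|) := by
      rw [abs_mul, abs_of_pos (inv_pos.2 hu0)]
      exact mul_le_mul i1 ((hD u t hu1 ht x).trans (by gcongr)) (abs_nonneg _) (by positivity)
    have j2 : |(u - t) * (u⁻¹ * t⁻¹) * scaled (dil m) t x| ≤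
        |s - t| * (δ⁻¹ * δ⁻¹) * (δ⁻¹ * K) := by
      rw [abs_mul, abs_mul, abs_of_pos (mul_pos (inv_pos.2 hu0) (inv_pos.2 ht0))]
      have := abs_scaled_le hK hδ ht x
      have hp : 0 < u⁻¹ := inv_pos.2 hu0
      have hp' : 0 < t⁻¹ := inv_pos.2 ht0
      gcongr
    refine (abs_add_le _ _).trans ?_
    rw [abs_neg]
    calc _ ≤ _ := add_le_add j1 j2
      _ = _ := by rw [hE]; ring

lemma scaled_eq_zero_of_le (hm : IsBump m) {t x : ℝ} (ht : 0 < t) (ht2 : t ≤ 2)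
    (hx : x ∉ Icc (0 : ℝ) 4) : scaled m t x = 0 :=
  hm.scaled_eq_zero ht fun h => hx ⟨h.1, h.2.trans (by linarith)⟩

lemma exists_integral_scaled_sub_le (hm : IsBump m) {δ : ℝ} (hδ : 0 < δ) : ∃ D, 0 ≤ D ∧
    ∀ s t, δ ≤ s → δ ≤ t → s ≤ 2 → t ≤ 2 →
      ∫ x, |scaled m s x - scaled m t x| ≤ D * |s - t| := by
  obtain ⟨D, hD0, hD⟩ := exists_abs_scaled_sub_le hm hδ
  refine ⟨D * 4, by positivity, fun s t hs ht hs2 ht2 => ?_⟩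
  refine (le_abs_self _).trans ((abs_integral_le_of_support (a := 0) (b := 4)
    (C := D * |s - t|) (by norm_num) (fun x hx => ?_) fun x _ => ?_).trans_eq (by ring))
  · rw [scaled_eq_zero_of_le hm (hδ.trans_le hs) hs2 hx,
      scaled_eq_zero_of_le hm (hδ.trans_le ht) ht2 hx, sub_zero, abs_zero]
  · rw [abs_abs]; exact hD s t hs ht x

lemma exists_integral_scaled_sub_le_two (hm : IsBump m) {δ : ℝ} (hδ : 0 < δ) : ∃ D, 0 ≤ D ∧
    ∀ s t, δ ≤ s → δ ≤ t → s ≤ 2 → t ≤ 2 →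
      ∫ x, |scaled m s x - scaled m t x - (s - t) * (-t⁻¹ * scaled (dil m) t x)| ≤
        D * |s - t| ^ 2 := by
  obtain ⟨D, hD0, hD⟩ := exists_abs_scaled_sub_le_two hm hδ
  refine ⟨D * 4, by positivity, fun s t hs ht hs2 ht2 => ?_⟩
  refine (le_abs_self _).trans ((abs_integral_le_of_support (a := 0) (b := 4)
    (C := D * |s - t| ^ 2) (by norm_num) (fun x hx => ?_) fun x _ => ?_).trans_eq (by ring))
  · rw [scaled_eq_zero_of_le hm (hδ.trans_le hs) hs2 hx,
      scaled_eq_zero_of_le hm (hδ.trans_le ht) ht2 hx,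
      scaled_eq_zero_of_le hm.dil (hδ.trans_le ht) ht2 hx]; simp
  · rw [abs_abs]; exact hD s t hs ht x

end Dilation

/-! ### Moments of profiles -/

lemma integral_pow_succ_mul_deriv {m : ℝ → ℝ} (hm : IsBump m) (i : ℕ) :
    ∫ x, x ^ i * deriv m x = -(i * ∫ x, x ^ (i - 1) * m x) := by
  have hi : ∀ {n : ℝ → ℝ} (j : ℕ), IsBump n → Integrable fun x => x ^ j * n x := fun j hn =>
    integrable_of_support_Icc ((continuous_pow j).mul hn.smooth.continuous) (a := 1 / 2) (b := 2)
      fun x hx => by simp [hn.support x hx]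
  have h := integral_mul_deriv_eq_deriv_mul_of_integrable (u := fun x : ℝ => x ^ i)
    (u' := fun x => i * x ^ (i - 1)) (v := m) (v' := deriv m)
    (fun x _ => by simpa using hasDerivAt_pow i x) (fun x _ => hm.hasDerivAt x) (hi i hm.deriv)
    (by
      have := (hi (i - 1) hm).const_mul (i : ℝ)
      refine this.congr (Eventually.of_forall fun x => ?_)
      simp only [Pi.mul_apply]; ring) (hi i hm)
  rw [h, ← integral_const_mul]
  congr 2
  funext x; ring

lemma integrable_pow_mul {n : ℝ → ℝ} (hn : IsBump n) (j : ℕ) : Integrable fun x => x ^ j * n x :=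
  integrable_of_support_Icc ((continuous_pow j).mul hn.smooth.continuous) (a := 1 / 2) (b := 2)
    fun x hx => by simp [hn.support x hx]

lemma integral_pow_mul_dil {m : ℝ → ℝ} (hm : IsBump m) (i : ℕ) :
    ∫ x, x ^ i * dil m x = -(i * ∫ x, x ^ i * m x) := by
  have e : ∀ x, x ^ i * dil m x = x ^ i * m x + x ^ (i + 1) * deriv m x := fun x => by
    simp only [dil]; ring
  simp_rw [e]
  rw [integral_add (integrable_pow_mul hm i) (integrable_pow_mul hm.deriv (i + 1)),
    integral_pow_succ_mul_deriv hm (i + 1), Nat.add_sub_cancel]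
  push_cast; ring

namespace IsProfile

variable {b : ℕ} {φ : ℝ → ℝ}

lemma isBump (hφ : IsProfile b φ) : IsBump φ := ⟨hφ.smooth, hφ.support⟩

lemma moments_iteratedDeriv (hφ : IsProfile b φ) (l : ℕ) : ∀ i ≤ b, i ≠ l →
    ∫ x, x ^ i * iteratedDeriv l φ x = 0 := by
  induction l with
  | zero => intro i hi h0; simpa using hφ.moments i (by omega) hi
  | succ l ih =>
    intro i hi h
    rw [iteratedDeriv_succ, integral_pow_succ_mul_deriv (hφ.isBump.iteratedDeriv l)]
    rcases Nat.eq_zero_or_pos i with rfl | h0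
    · simp
    · rw [ih (i - 1) (by omega) (by omega)]; simp

lemma moments_dil_iteratedDeriv (hφ : IsProfile b φ) (l : ℕ) : ∀ i ≤ b,
    ∫ x, x ^ i * (l * iteratedDeriv l φ x + dil (iteratedDeriv l φ) x) = 0 := by
  intro i hi
  have hB := hφ.isBump.iteratedDeriv l
  have e : ∀ x, x ^ i * (l * iteratedDeriv l φ x + dil (iteratedDeriv l φ) x) =
      l * (x ^ i * iteratedDeriv l φ x) + x ^ i * dil (iteratedDeriv l φ) x := fun x => by ring
  simp_rw [e]
  rw [integral_add ((integrable_pow_mul hB i).const_mul _) (integrable_pow_mul hB.dil i),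
    integral_const_mul, integral_pow_mul_dil hB]
  rcases eq_or_ne i l with rfl | h
  · ring
  · rw [hφ.moments_iteratedDeriv l i hi h]; ring

end IsProfile

/-- Iterated primitives. -/
noncomputable def iprim (ψ : ℝ → ℝ) : ℕ → ℝ → ℝ
  | 0 => ψ
  | j + 1 => fun σ => ∫ r in (0 : ℝ)..σ, iprim ψ j r

lemma iprim_isBump {ψ : ℝ → ℝ} (hψ : IsBump ψ) {N : ℕ} (hmom : ∀ i < N, ∫ x, x ^ i * ψ x = 0)
    (j : ℕ) (hj : j ≤ N) :
    IsBump (iprim ψ j) ∧ ∀ i, i + j < N → ∫ x, x ^ i * iprim ψ j x = 0 := by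
  induction j with
  | zero => exact ⟨hψ, fun i hi => hmom i hi⟩
  | succ j ih =>
    obtain ⟨hB, hM⟩ := ih (by omega)
    have hd : ∀ x, HasDerivAt (iprim ψ (j + 1)) (iprim ψ j x) x := fun x =>
      intervalIntegral.integral_hasDerivAt_right
        (hB.smooth.continuous.intervalIntegrable _ _)
        (hB.smooth.continuous.stronglyMeasurableAtFilter _ _) hB.smooth.continuous.continuousAt
    have hder : deriv (iprim ψ (j + 1)) = iprim ψ j := funext fun x => (hd x).deriv
    have hB' : IsBump (iprim ψ (j + 1)) := by
      refine ⟨contDiff_infty_iff_deriv.2 ⟨fun x => (hd x).differentiableAt, hder ▸ hB.smooth⟩,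
        fun σ hσ => ?_⟩
      rw [mem_Icc, not_and_or, not_le, not_le] at hσ
      change ∫ r in (0 : ℝ)..σ, iprim ψ j r = 0
      rcases hσ with h | h
      · refine intervalIntegral.integral_zero_ae (Eventually.of_forall fun x hx => ?_)
        refine hB.support x fun hx' => ?_
        have := hx.2
        have := hx'.1
        rw [le_max_iff] at *
        rcases ‹x ≤ 0 ∨ x ≤ σ› with h' | h' <;> linarith
      · rw [intervalIntegral.integral_of_le (by linarith),
          setIntegral_eq_integral_of_forall_compl_eq_zero]
        · simpa using hM 0 (by omega)
        · exact fun x hx => hB.support x fun hx' => hx ⟨by linarith [hx'.1], by linarith [hx'.2]⟩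
    refine ⟨hB', fun i hi => ?_⟩
    have h := integral_pow_succ_mul_deriv hB' (i + 1)
    rw [hder, hM (i + 1) (by omega), Nat.add_sub_cancel] at h
    have hne : ((i + 1 : ℕ) : ℝ) ≠ 0 := by positivity
    have := neg_eq_zero.1 h.symm
    exact (mul_eq_zero.1 this).resolve_left hne

lemma integral_sub_pow_mul_iprim {ψ : ℝ → ℝ} (hψ : Continuous ψ) (j : ℕ) : ∀ (a : ℕ) (σ : ℝ),
    ∫ r in (0 : ℝ)..σ, (σ - r) ^ j / (j.factorial : ℝ) * iprim ψ a r = iprim ψ (a + j + 1) σ := by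
  have hc : ∀ a, Continuous (iprim ψ a) := by
    intro a
    induction a with
    | zero => exact hψ
    | succ a ih =>
      exact intervalIntegral.continuous_primitive (μ := volume)
        (fun _ _ => ih.intervalIntegrable _ _) 0
  induction j with
  | zero => intro a σ; simp [iprim]
  | succ j ih =>
    intro a σ
    have h := intervalIntegral.integral_mul_deriv_eq_deriv_mul (a := 0) (b := σ)
      (u := fun r => (σ - r) ^ (j + 1) / ((j + 1).factorial : ℝ))
      (u' := fun r => -((σ - r) ^ j / (j.factorial : ℝ))) (v := iprim ψ (a + 1)) (v' := iprim ψ a)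
      (fun x _ => by
        have h1 := (((hasDerivAt_id x).const_sub σ).pow (j + 1)).div_const
          (((j + 1).factorial : ℕ) : ℝ)
        refine h1.congr_deriv ?_
        rw [Nat.factorial_succ]
        have : ((j : ℝ) + 1) ≠ 0 := by positivity
        have : (j.factorial : ℝ) ≠ 0 := by positivity
        push_cast
        simp only [id, Nat.add_sub_cancel]
        field_simp)
      (fun x _ => intervalIntegral.integral_hasDerivAt_right
        ((hc a).intervalIntegrable _ _) ((hc a).stronglyMeasurableAtFilter _ _)
        (hc a).continuousAt)
      (by apply Continuous.intervalIntegrable; fun_prop) ((hc a).intervalIntegrable _ _)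
    rw [h]
    have h0 : iprim ψ (a + 1) 0 = 0 := by simp [iprim]
    rw [h0]
    simp only [sub_self, ne_eq, Nat.add_eq_zero_iff, one_ne_zero, and_false, not_false_eq_true,
      zero_pow, zero_div, zero_mul, mul_zero, zero_sub, neg_mul, intervalIntegral.integral_neg,
      neg_neg, ih (a + 1) σ]
    congr 1; omega

namespace IsProfile

variable {b h : ℕ} {φ : ℝ → ℝ}

lemma primitive_eq (hφ : IsProfile b φ) (hh : 1 ≤ h) : primitive h φ = iprim (dil φ) h := by
  obtain ⟨j, rfl⟩ : ∃ j, h = j + 1 := ⟨h - 1, by omega⟩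
  have hD := hφ.isBump.dil
  funext σ
  have h1 := integral_sub_pow_mul_iprim hD.smooth.continuous j 0 σ
  rw [zero_add] at h1
  rw [← h1]
  simp only [primitive, Nat.add_sub_cancel, iprim]
  have hz : ∀ r < 1 / 2, dil φ r = 0 := fun r hr => hD.support r fun h => by linarith [h.1]
  rcases le_or_gt 0 σ with h0 | h0
  · rw [intervalIntegral.integral_of_le h0]
    refine (setIntegral_eq_of_subset_of_forall_sdiff_eq_zero measurableSet_Iic
      (fun x hx => hx.2) fun x hx => ?_)
    have : x ≤ 0 := by
      by_contra hneg
      exact hx.2 ⟨not_le.1 hneg, hx.1⟩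
    have := hz x (by linarith)
    simp only [dil] at this
    rw [this, mul_zero]
  · rw [intervalIntegral.integral_zero_ae]
    · refine setIntegral_eq_zero_of_forall_eq_zero fun x hx => ?_
      have := hz x (by have := mem_Iic.1 hx; linarith)
      simp only [dil] at this
      rw [this, mul_zero]
    · refine Eventually.of_forall fun x hx => ?_
      have h2 := hx.2
      rw [hz x (by rw [le_max_iff] at h2; rcases h2 with h2 | h2 <;> linarith), mul_zero]

lemma isBump_primitive (hφ : IsProfile (2 * h) φ) (hh : 1 ≤ h) :
    IsBump (primitive h φ) ∧ ∀ i < h, ∫ x, x ^ i * primitive h φ x = 0 := by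
  have hm : ∀ i < 2 * h + 1, ∫ x, x ^ i * dil φ x = 0 := fun i hi => by
    rw [integral_pow_mul_dil hφ.isBump]
    rcases Nat.eq_zero_or_pos i with rfl | h0
    · simp
    · rw [hφ.moments i h0 (by omega)]; simp
  have := iprim_isBump hφ.isBump.dil hm h (by omega)
  rw [hφ.primitive_eq hh]
  exact ⟨this.1, fun i hi => this.2 i (by omega)⟩

end IsProfile

end Parabolic

namespace Parabolic

section AddIterate

variable {E : Type*} [NormedAddCommGroup E] [NormedSpace ℝ E] {A : E →ₗ.[ℝ] E}

lemma app_add {x y : E} (hx : x ∈ A.domain) (hy : y ∈ A.domain) :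
    app A (x + y) = app A x + app A y := by
  rw [app_of_mem hx, app_of_mem hy, app_of_mem (A.domain.add_mem hx hy), ← LinearPMap.map_add]
  rfl

lemma app_smul {x : E} (r : ℝ) (hx : x ∈ A.domain) : app A (r • x) = r • app A x := by
  rw [app_of_mem hx, app_of_mem (A.domain.smul_mem r hx), ← LinearPMap.map_smul]
  rfl

lemma iterate_app_add {k : ℕ} {x y : E} (hx : PowDom A k x) (hy : PowDom A k y) :
    (app A)^[k] (x + y) = (app A)^[k] x + (app A)^[k] y := by
  induction k with
  | zero => rfl
  | succ k ih =>
    rw [Function.iterate_succ_apply', Function.iterate_succ_apply', Function.iterate_succ_apply',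
      ih (fun j hj => hx j (by omega)) fun j hj => hy j (by omega),
      app_add (hx k (by omega)) (hy k (by omega))]

lemma iterate_app_smul {k : ℕ} {x : E} (r : ℝ) (hx : PowDom A k x) :
    (app A)^[k] (r • x) = r • (app A)^[k] x := by
  induction k with
  | zero => rfl
  | succ k ih =>
    rw [Function.iterate_succ_apply', Function.iterate_succ_apply',
      ih (fun j hj => hx j (by omega)), app_smul r (hx k (by omega))]

end AddIterate

lemma exists_forall_le (N : ℕ) {P : ℕ → ℝ → Prop}
    (h : ∀ q, ∃ C, 0 ≤ C ∧ P q C) (hmono : ∀ q C C', C ≤ C' → P q C → P q C') :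
    ∃ C, 0 ≤ C ∧ ∀ q ≤ N, P q C := by
  choose C hC0 hC using h
  refine ⟨∑ q ∈ Finset.range (N + 1), C q, Finset.sum_nonneg fun q _ => hC0 q, fun q hq => ?_⟩
  exact hmono q _ _ (Finset.single_le_sum (f := C) (fun q _ => hC0 q)
    (Finset.mem_range.2 (by omega))) (hC q)

lemma hasDerivAt_of_sq_bound {Φ : ℝ → ℝ} {t D K ε : ℝ} (hε : 0 < ε)
    (h : ∀ s, |s - t| < ε → |Φ s - Φ t - (s - t) * D| ≤ K * |s - t| ^ 2) : HasDerivAt Φ D t := by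
  rw [hasDerivAt_iff_isLittleO]
  have h1 : (fun s => Φ s - Φ t - (s - t) • D) =O[𝓝 t] fun s => (s - t) ^ 2 := by
    refine Asymptotics.IsBigO.of_bound K ?_
    filter_upwards [Metric.ball_mem_nhds t hε] with s hs
    rw [Metric.mem_ball, Real.dist_eq] at hs
    rw [Real.norm_eq_abs, Real.norm_eq_abs, abs_pow, smul_eq_mul]
    exact h s hs
  refine h1.trans_isLittleO ?_
  have h2 : (fun x : ℝ => x ^ 2) =o[𝓝 0] fun x => x := by
    simpa using Asymptotics.isLittleO_pow_id (𝕜 := ℝ) (n := 2) (by norm_num)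
  have h3 : Tendsto (fun s : ℝ => s - t) (𝓝 t) (𝓝 0) := by
    have : Continuous fun s : ℝ => s - t := by fun_prop
    simpa using this.tendsto t
  exact h2.comp_tendsto h3

lemma IsKer.const_mul {k : ℝ → ℝ} (hk : IsKer k) (r : ℝ) : IsKer fun s => r * k s :=
  ⟨continuous_const.mul hk.cont, hk.cpt.mul_left (f := fun _ => r),
    fun s hs => by rw [hk.causal s hs, mul_zero]⟩

lemma IsKer.sub {k k' : ℝ → ℝ} (hk : IsKer k) (hk' : IsKer k') : IsKer fun s => k s - k' s :=
  ⟨hk.cont.sub hk'.cont, hk.cpt.sub hk'.cpt,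
    fun s hs => by rw [hk.causal s hs, hk'.causal s hs, sub_zero]⟩

variable {M : Type*} [MetricSpace M] [MeasurableSpace M] {μ : Measure M} {ℓ₀ : ℕ}

/-- Smooth curves with compact support. -/
structure IsSmoothCurve (χ : ℝ → Lp ℝ 2 μ) : Prop where
  smooth : ContDiff ℝ ((⊤ : ℕ∞) : WithTop ℕ∞) χ
  cpt : HasCompactSupport χ

namespace IsSmoothCurve

variable {χ : ℝ → Lp ℝ 2 μ}

lemma isCurve (h : IsSmoothCurve χ) : IsCurve χ := ⟨h.smooth.continuous, h.cpt⟩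

lemma deriv (h : IsSmoothCurve χ) : IsSmoothCurve (deriv χ) :=
  ⟨(contDiff_infty_iff_deriv.1 h.smooth).2, h.cpt.deriv⟩

lemma iteratedDeriv (h : IsSmoothCurve χ) (n : ℕ) : IsSmoothCurve (iteratedDeriv n χ) := by
  induction n with
  | zero => simpa using h
  | succ n ih => rw [iteratedDeriv_succ]; exact ih.deriv

lemma hasDerivAt (h : IsSmoothCurve χ) (τ : ℝ) : HasDerivAt χ (_root_.deriv χ τ) τ :=
  (h.smooth.differentiable (by simp) τ).hasDerivAt

lemma opK [BorelSpace M] [SecondCountableTopology M] [SigmaFinite μ] {k : ℝ → ℝ} (hk : IsKer k)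
    (h : IsSmoothCurve χ) (R : Lp ℝ 2 μ →L[ℝ] Lp ℝ 2 μ) :
    IsSmoothCurve (opK R k χ) := by
  refine ⟨?_, (h.isCurve.opK hk R).cpt⟩
  have e : Parabolic.opK R k χ = fun σ => R.adjoint
      (convolution (fun s => k (-s)) χ (ContinuousLinearMap.lsmul ℝ ℝ) volume σ) :=
    funext fun σ => opK_eq_convolution R k χ σ
  rw [e]
  exact R.adjoint.contDiff.comp (h.cpt.contDiff_convolution_right _
    (hk.cont.comp continuous_neg).locallyIntegrable h.smooth)

lemma deriv_opK [BorelSpace M] [SecondCountableTopology M] [SigmaFinite μ] {k : ℝ → ℝ} (hk : IsKer k)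
    (h : IsSmoothCurve χ) (R : Lp ℝ 2 μ →L[ℝ] Lp ℝ 2 μ) :
    _root_.deriv (Parabolic.opK R k χ) = Parabolic.opK R k (_root_.deriv χ) := by
  funext σ
  have e : Parabolic.opK R k χ = fun σ => R.adjoint
      (convolution (fun s => k (-s)) χ (ContinuousLinearMap.lsmul ℝ ℝ) volume σ) :=
    funext fun σ => opK_eq_convolution R k χ σ
  rw [e, opK_eq_convolution]
  refine HasDerivAt.deriv ?_
  exact R.adjoint.hasFDerivAt.comp_hasDerivAt σ (h.cpt.hasDerivAt_convolution_right
    (ContinuousLinearMap.lsmul ℝ ℝ) (hk.cont.comp continuous_neg).locallyIntegrable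
    (h.smooth.of_le (by exact_mod_cast le_top)) σ)

lemma iteratedDeriv_opK [BorelSpace M] [SecondCountableTopology M] [SigmaFinite μ] {k : ℝ → ℝ} (hk : IsKer k)
    (h : IsSmoothCurve χ) (R : Lp ℝ 2 μ →L[ℝ] Lp ℝ 2 μ) (n : ℕ) :
    _root_.iteratedDeriv n (Parabolic.opK R k χ) =
      Parabolic.opK R k (_root_.iteratedDeriv n χ) := by
  induction n with
  | zero => simp
  | succ n ih => rw [iteratedDeriv_succ, ih, (h.iteratedDeriv n).deriv_opK hk R, iteratedDeriv_succ]

end IsSmoothCurve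

variable [BorelSpace M] [SecondCountableTopology M]

lemma wn_opK_le [SigmaFinite μ] {a C : ℝ} {R : Lp ℝ 2 μ →L[ℝ] Lp ℝ 2 μ} (hR : WB a C R)
    {w : M → ℝ} (hw : IsWt a w) {p : ℝ≥0∞} (hp : GoodExp p) {k : ℝ → ℝ} (hk : IsKer k)
    (χ : ℝ → Lp ℝ 2 μ) {B : ℝ≥0∞} (hB : ∀ τ, wn p w (χ τ) ≤ B) (σ : ℝ) :
    wn p w (opK R k χ σ) ≤ ENNReal.ofReal (C * ∫ s, |k s|) * B := by
  rw [ENNReal.ofReal_mul hR.nonneg, ← hk.lintegral_eq, mul_assoc]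
  refine (hR.le w hw p hp _).trans ?_
  gcongr
  refine (wn_integral_le hp hw _).trans ?_
  calc ∫⁻ τ, wn p w (k (τ - σ) • χ τ) ≤ ∫⁻ τ, ‖k (τ - σ)‖ₑ * B :=
        lintegral_mono fun τ => by rw [wn_smul]; gcongr; exact hB τ
    _ = _ := by
        have hm : Measurable fun τ => ‖k (τ - σ)‖ₑ :=
          (hk.cont.comp (continuous_id.sub continuous_const)).measurable.enorm
        rw [lintegral_mul_const _ hm, lintegral_sub_right_eq_self (fun s => ‖k s‖ₑ) σ]

namespace HeatSystem

variable (S : HeatSystem μ ℓ₀) {o : M}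

/-- Sequences of operators with `Z_q L ⊂ Z_{q+1}` and bounds in all weighted spaces. -/
structure Chain (Z : ℕ → Lp ℝ 2 μ →L[ℝ] Lp ℝ 2 μ) : Prop where
  step : ∀ q, ∀ u ∈ S.L.domain, Z q (app S.L u) = Z (q + 1) u
  wb : ∀ a, 0 ≤ a → ∀ q, ∃ C, WB a C (Z q)

variable {S}

namespace Chain

variable {Z Z' : ℕ → Lp ℝ 2 μ →L[ℝ] Lp ℝ 2 μ}

lemma smul (h : S.Chain Z) (r : ℝ) : S.Chain fun q => r • Z q :=
  ⟨fun q u hu => by simp [h.step q u hu], fun a ha q => by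
    obtain ⟨C, hC⟩ := h.wb a ha q
    exact ⟨_, hC.smul r⟩⟩

lemma add (h : S.Chain Z) (h' : S.Chain Z') : S.Chain fun q => Z q + Z' q :=
  ⟨fun q u hu => by simp [h.step q u hu, h'.step q u hu], fun a ha q => by
    obtain ⟨C, hC⟩ := h.wb a ha q
    obtain ⟨C', hC'⟩ := h'.wb a ha q
    exact ⟨_, hC.add hC'⟩⟩

lemma sub (h : S.Chain Z) (h' : S.Chain Z') : S.Chain fun q => Z q - Z' q := by
  have := h.add (h'.smul (-1))
  simpa only [neg_smul, one_smul, ← sub_eq_add_neg] using this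

variable [SigmaFinite μ]

lemma adjoint_step (hZ : S.Chain Z) (q : ℕ) (v : Lp ℝ 2 μ) :
    (Z q).adjoint v ∈ S.L.adjoint.domain ∧
      app S.L.adjoint ((Z q).adjoint v) = (Z (q + 1)).adjoint v := by
  have h : ∀ u : S.L.domain, inner ℝ ((Z (q + 1)).adjoint v) (u : Lp ℝ 2 μ) =
      inner ℝ ((Z q).adjoint v) (S.L u) := fun u => by
    rw [ContinuousLinearMap.adjoint_inner_left, ContinuousLinearMap.adjoint_inner_left,
      ← hZ.step q u u.2, app_of_mem u.2]
  have hm := LinearPMap.mem_adjoint_domain_of_exists (T := S.L) _ ⟨_, h⟩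
  refine ⟨hm, ?_⟩
  rw [app_of_mem hm]
  exact LinearPMap.adjoint_apply_eq S.dense_domain ⟨_, hm⟩ h

lemma iterate_adjoint (hZ : S.Chain Z) (k : ℕ) (v : Lp ℝ 2 μ) :
    (app S.L.adjoint)^[k] ((Z 0).adjoint v) = (Z k).adjoint v := by
  induction k with
  | zero => rfl
  | succ k ih => rw [Function.iterate_succ_apply', ih, (hZ.adjoint_step k v).2]

lemma powDom_adjoint (hZ : S.Chain Z) (k : ℕ) (v : Lp ℝ 2 μ) :
    PowDom S.L.adjoint k ((Z 0).adjoint v) := fun j _ => by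
  rw [hZ.iterate_adjoint j v]; exact (hZ.adjoint_step j v).1

end Chain

variable {χ χ' : ℝ → Lp ℝ 2 μ}

lemma IsTest.isSmoothCurve (hχ : S.IsTest o χ) : IsSmoothCurve χ := ⟨hχ.smooth 0, hχ.compact⟩

lemma IsTest.isCurve (hχ : S.IsTest o χ) : IsCurve χ := hχ.isSmoothCurve.isCurve

lemma adjPow_add (hχ : S.IsTest o χ) (hχ' : S.IsTest o χ') (k : ℕ) :
    S.adjPow k (χ + χ') = S.adjPow k χ + S.adjPow k χ' :=
  funext fun τ => iterate_app_add (hχ.domain k τ) (hχ'.domain k τ)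

lemma adjPow_smul (hχ : S.IsTest o χ) (r : ℝ) (k : ℕ) : S.adjPow k (r • χ) = r • S.adjPow k χ :=
  funext fun τ => iterate_app_smul r (hχ.domain k τ)

lemma powDom_of_iterate {A : Lp ℝ 2 μ →ₗ.[ℝ] Lp ℝ 2 μ} {x y : Lp ℝ 2 μ} (hx : ∀ k, PowDom A k x)
    (hy : ∀ k, PowDom A k y) (k : ℕ) : PowDom A k (x + y) := fun j _ => by
  rw [iterate_app_add (hx j) (hy j)]
  exact A.domain.add_mem (hx (j + 1) j (by omega)) (hy (j + 1) j (by omega))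

lemma IsTest.add (hχ : S.IsTest o χ) (hχ' : S.IsTest o χ') : S.IsTest o (χ + χ') := by
  refine ⟨hχ.compact.add hχ'.compact, fun k τ => powDom_of_iterate (fun k => hχ.domain k τ)
    (fun k => hχ'.domain k τ) k, fun k => ?_, fun a n k => ?_⟩
  · rw [adjPow_add hχ hχ']; exact (hχ.smooth k).add (hχ'.smooth k)
  · refine lt_of_le_of_lt ?_ (ENNReal.add_lt_top.2 ⟨hχ.decay a n k, hχ'.decay a n k⟩)
    refine iSup_le fun τ => ?_
    rw [adjPow_add hχ hχ', iteratedDeriv_add ((hχ.smooth k).contDiffAt.of_le (by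
      exact_mod_cast le_top)) ((hχ'.smooth k).contDiffAt.of_le (by exact_mod_cast le_top))]
    refine (wn_add_le (Or.inr rfl) (isWt_exp o a.cast_nonneg) _ _).trans (add_le_add ?_ ?_)
    · exact le_iSup (fun τ => eLpNorm (fun x => Real.exp (a * dist o x) *
        (iteratedDeriv n (S.adjPow k χ) τ) x) 2 μ) τ
    · exact le_iSup (fun τ => eLpNorm (fun x => Real.exp (a * dist o x) *
        (iteratedDeriv n (S.adjPow k χ') τ) x) 2 μ) τ

lemma IsTest.smul (hχ : S.IsTest o χ) (r : ℝ) : S.IsTest o (r • χ) := by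
  refine ⟨hχ.compact.smul_left (f := fun _ => r), fun k τ j hj => ?_, fun k => ?_, fun a n k => ?_⟩
  · rw [Pi.smul_apply, iterate_app_smul r (hχ.domain j τ)]
    exact S.L.adjoint.domain.smul_mem r (hχ.domain (j + 1) τ j (by omega))
  · rw [adjPow_smul hχ]; exact (hχ.smooth k).const_smul r
  · refine lt_of_le_of_lt ?_ (ENNReal.mul_lt_top (enorm_lt_top (x := r)) (hχ.decay a n k))
    refine iSup_le fun τ => ?_
    rw [adjPow_smul hχ, iteratedDeriv_const_smul_field]
    refine (wn_smul 2 (fun x => Real.exp (a * dist o x)) r _).le.trans ?_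
    gcongr
    exact le_iSup (fun τ => eLpNorm (fun x => Real.exp (a * dist o x) *
        (iteratedDeriv n (S.adjPow k χ) τ) x) 2 μ) τ

lemma IsTest.zero : S.IsTest o (0 : ℝ → Lp ℝ 2 μ) := by
  have hz : ∀ j, (app S.L.adjoint)^[j] 0 = 0 := fun j => by
    induction j with
    | zero => rfl
    | succ j ih =>
      rw [Function.iterate_succ_apply', ih, app_of_mem S.L.adjoint.domain.zero_mem]
      exact S.L.adjoint.map_zero
  have ha : ∀ k, S.adjPow k (0 : ℝ → Lp ℝ 2 μ) = 0 := fun k => funext fun τ => hz k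
  refine ⟨HasCompactSupport.zero, fun k τ j _ => ?_, fun k => ?_, fun a n k => ?_⟩
  · rw [Pi.zero_apply, hz]; exact S.L.adjoint.domain.zero_mem
  · rw [ha]; exact contDiff_const
  · refine lt_of_le_of_lt (iSup_le (a := 0) fun τ => ?_) ENNReal.zero_lt_top
    rw [ha]
    have : iteratedDeriv n (0 : ℝ → Lp ℝ 2 μ) τ = 0 := by
      simp
    rw [this]
    exact (wn_zero 2 fun x => Real.exp (a * dist o x)).le

lemma IsTest.sub (hχ : S.IsTest o χ) (hχ' : S.IsTest o χ') : S.IsTest o (χ - χ') := by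
  have := hχ.add (hχ'.smul (-1))
  rwa [neg_one_smul, ← sub_eq_add_neg] at this

lemma testSeminorm_eq (a n k : ℕ) (χ : ℝ → Lp ℝ 2 μ) : S.testSeminorm o a n k χ =
    ⨆ τ, wn 2 (fun x => Real.exp (a * dist o x)) (iteratedDeriv n (S.adjPow k χ) τ) := rfl

lemma wn_le_testSeminorm (a n k : ℕ) (χ : ℝ → Lp ℝ 2 μ) (τ : ℝ) :
    wn 2 (fun x => Real.exp (a * dist o x)) (iteratedDeriv n (S.adjPow k χ) τ) ≤
      S.testSeminorm o a n k χ :=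
  le_iSup (fun τ => wn 2 (fun x => Real.exp (a * dist o x))
    (iteratedDeriv n (S.adjPow k χ) τ)) τ

lemma testSeminorm_mono {a a' : ℕ} (h : a ≤ a') (n k : ℕ) (χ : ℝ → Lp ℝ 2 μ) :
    S.testSeminorm o a n k χ ≤ S.testSeminorm o a' n k χ :=
  iSup_le fun τ => (wn_mono (fun _ => (Real.exp_pos _).le) (fun x => by gcongr) _).trans
    (wn_le_testSeminorm a' n k χ τ)

variable [SigmaFinite μ]

namespace Chain

variable {Z : ℕ → Lp ℝ 2 μ →L[ℝ] Lp ℝ 2 μ} {k : ℝ → ℝ}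

lemma adjPow_opK (hZ : S.Chain Z) (q : ℕ) (k : ℝ → ℝ) (χ : ℝ → Lp ℝ 2 μ) :
    S.adjPow q (opK (Z 0) k χ) = opK (Z q) k χ :=
  funext fun _ => hZ.iterate_adjoint q _

lemma testSeminorm_opK_le (hZ : S.Chain Z) (hk : IsKer k) (hχ : IsSmoothCurve χ) {a : ℕ} (n q : ℕ)
    {B : ℝ} (hB : WB a B (Z q)) : S.testSeminorm o a n q (opK (Z 0) k χ) ≤
      ENNReal.ofReal (B * ∫ s, |k s|) * S.testSeminorm o a n 0 χ := by
  rw [testSeminorm_eq, hZ.adjPow_opK, hχ.iteratedDeriv_opK hk]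
  exact iSup_le fun τ => wn_opK_le hB (isWt_exp o a.cast_nonneg) (Or.inr rfl) hk _
    (fun τ => wn_le_testSeminorm a n 0 χ τ) τ

lemma isTest_opK (hZ : S.Chain Z) (hk : IsKer k) (hχ : S.IsTest o χ) :
    S.IsTest o (opK (Z 0) k χ) := by
  refine ⟨(hχ.isCurve.opK hk _).cpt, fun q τ => hZ.powDom_adjoint q _, fun q => ?_,
    fun a n q => ?_⟩
  · rw [hZ.adjPow_opK]; exact (hχ.isSmoothCurve.opK hk _).smooth
  · obtain ⟨C, hC⟩ := hZ.wb a a.cast_nonneg q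
    exact (hZ.testSeminorm_opK_le hk hχ.isSmoothCurve n q hC).trans_lt
      (ENNReal.mul_lt_top ENNReal.ofReal_lt_top (hχ.decay a n 0))

end Chain

lemma chain_vlt (hμ : VolumeDoubling μ) (J : List (Fin ℓ₀)) (p : ℕ) {t : ℝ} (ht : 0 < t)
    (ht2 : t ≤ 2) : S.Chain fun q => S.vlt J (p + q) t :=
  ⟨fun q u hu => S.vlt_L hμ J (p + q) ht ht2 hu, fun a ha q => by
    obtain ⟨C, _, hC⟩ := S.exists_wB_vlt hμ J (p + q) ha
    exact ⟨_, hC t ht ht2⟩⟩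

lemma IsTest.exists_support (hχ : S.IsTest o χ) : ∃ τ₁, 0 ≤ τ₁ ∧ ∀ τ, τ₁ < |τ| → χ τ = 0 := by
  obtain ⟨r, hr⟩ := hχ.compact.isCompact.isBounded.subset_closedBall 0
  refine ⟨max r 0, le_max_right _ _, fun τ hτ => image_eq_zero_of_notMem_tsupport fun h => ?_⟩
  have := hr h
  rw [mem_closedBall_zero_iff, Real.norm_eq_abs] at this
  exact absurd (lt_of_le_of_lt (le_max_left r 0) hτ) (not_lt.2 this)

lemma opK_eq_zero_of_support {R : Lp ℝ 2 μ →L[ℝ] Lp ℝ 2 μ} {k : ℝ → ℝ}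
    (hk : ∀ x, x ∉ Icc (0 : ℝ) 4 → k x = 0) {τ₁ : ℝ} (hχ : ∀ τ, τ₁ < |τ| → χ τ = 0) {σ : ℝ}
    (hσ : τ₁ + 4 < |σ|) : opK R k χ σ = 0 := by
  have : ∀ τ, k (τ - σ) • χ τ = 0 := fun τ => by
    by_cases h1 : τ - σ ∈ Icc (0 : ℝ) 4
    · rw [hχ τ, smul_zero]
      have h2 : |τ - σ| ≤ 4 := by rw [abs_of_nonneg h1.1]; exact h1.2
      have h3 := abs_sub_abs_le_abs_sub σ τ
      rw [abs_sub_comm] at h3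
      linarith
    · rw [hk _ h1, zero_smul]
  simp [opK, this]

/-- Continuity of a distribution along smoothing operators. -/
lemma IsDistribution.exists_bound {f : (ℝ → Lp ℝ 2 μ) → ℝ} (hf : S.IsDistribution o f)
    (hχ : S.IsTest o χ) : ∃ (N : ℕ) (C : ℝ), 0 ≤ C ∧ ∀ Z, S.Chain Z → ∀ k, IsKer k →
      (∀ x, x ∉ Icc (0 : ℝ) 4 → k x = 0) → ∀ B, (∀ q ≤ N, WB N B (Z q)) →
      |f (opK (Z 0) k χ)| ≤ C * (B * ∫ s, |k s|) := by
  obtain ⟨τ₁, hτ₁, hsupp⟩ := hχ.exists_support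
  obtain ⟨N, C, hC⟩ := hf.continuous (τ₁ + 4)
  set A : ℝ≥0∞ := ∑ n ∈ Finset.range (N + 1), S.testSeminorm o N n 0 χ with hA
  have hAtop : A ≠ ∞ := ENNReal.sum_ne_top.2 fun n _ => (hχ.decay N n 0).ne
  refine ⟨N, C * A.toReal, by positivity, fun Z hZ k hk hk4 B hB => ?_⟩
  have hB0 := (hB 0 (Nat.zero_le _)).nonneg
  have hI : 0 ≤ ∫ s, |k s| := integral_nonneg fun _ => abs_nonneg _
  have h := hC (opK (Z 0) k χ) (hZ.isTest_opK hk hχ)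
    (fun τ hτ => opK_eq_zero_of_support hk4 hsupp hτ)
    (Real.toNNReal (B * ∫ s, |k s|) * A.toNNReal) (fun a ha n hn q hq => ?_)
  · refine h.trans_eq ?_
    rw [NNReal.coe_mul]
    rw [Real.coe_toNNReal _ (by positivity), ENNReal.coe_toNNReal_eq_toReal]
    ring
  · refine (hZ.testSeminorm_opK_le hk hχ.isSmoothCurve n q
      ((hB q hq).anti (by exact_mod_cast ha))).trans ?_
    rw [ENNReal.coe_mul, ENNReal.coe_toNNReal hAtop]
    gcongr
    · exact le_rfl
    · refine (testSeminorm_mono ha n 0 χ).trans ?_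
      exact Finset.single_le_sum (f := fun n => S.testSeminorm o N n 0 χ) (fun _ _ => zero_le)
        (Finset.mem_range.2 (by omega))

/-- Linearity on test functions. -/
structure IsLin (S : HeatSystem μ ℓ₀) (o : M) (F : (ℝ → Lp ℝ 2 μ) → ℝ) : Prop where
  add : ∀ χ₁ χ₂, S.IsTest o χ₁ → S.IsTest o χ₂ → F (χ₁ + χ₂) = F χ₁ + F χ₂
  smul : ∀ (r : ℝ) χ, S.IsTest o χ → F (r • χ) = r * F χ

lemma IsDistribution.isLin {f : (ℝ → Lp ℝ 2 μ) → ℝ} (hf : S.IsDistribution o f) : S.IsLin o f :=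
  ⟨hf.add, hf.smul⟩

lemma IsLin.sub {f : (ℝ → Lp ℝ 2 μ) → ℝ} (hf : S.IsLin o f) (hχ : S.IsTest o χ)
    (hχ' : S.IsTest o χ') : f (χ - χ') = f χ - f χ' := by
  have h := hf.add χ ((-1 : ℝ) • χ') hχ (hχ'.smul (-1))
  have h2 := hf.smul (-1) χ' hχ'
  rw [neg_one_smul] at h h2
  rw [sub_eq_add_neg, h, h2]; ring

lemma IsLin.sum {f : (ℝ → Lp ℝ 2 μ) → ℝ} (hf : S.IsLin o f) {ι : Type*} (s : Finset ι) (c : ι → ℝ)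
    {χ : ι → ℝ → Lp ℝ 2 μ} (hχ : ∀ i ∈ s, S.IsTest o (χ i)) :
    S.IsTest o (∑ i ∈ s, c i • χ i) ∧ f (∑ i ∈ s, c i • χ i) = ∑ i ∈ s, c i * f (χ i) := by
  classical
  induction s using Finset.induction_on with
  | empty =>
    refine ⟨by simpa using IsTest.zero, ?_⟩
    have := hf.smul 0 0 IsTest.zero
    simpa using this
  | insert i s hi ih =>
    obtain ⟨h1, h2⟩ := ih fun j hj => hχ j (Finset.mem_insert_of_mem hj)
    have h3 := hχ i (Finset.mem_insert_self i s)
    rw [Finset.sum_insert hi, Finset.sum_insert hi]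
    exact ⟨(h3.smul _).add h1, by rw [hf.add _ _ (h3.smul _) h1, hf.smul _ _ h3, h2]⟩

/-- The action of a distribution on a mollified test function is differentiable in the scale. -/
lemma IsDistribution.hasDerivAt {f : (ℝ → Lp ℝ 2 μ) → ℝ} (hμ : VolumeDoubling μ)
    (hf : S.IsDistribution o f) (hχ : S.IsTest o χ) {m : ℝ → ℝ} (hm : IsBump m)
    (J : List (Fin ℓ₀)) (p : ℕ) {t : ℝ} (ht : 0 < t) (ht2 : t < 2) :
    HasDerivAt (fun t => f (opK (S.vlt J p t) (scaled m t) χ))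
      (-f (opK (S.vlt J (p + 1) t) (scaled m t) χ) -
        t⁻¹ * f (opK (S.vlt J p t) (scaled (dil m) t) χ)) t := by
  obtain ⟨N, C, hC0, hC⟩ := hf.exists_bound hχ
  have hN : (0 : ℝ) ≤ N := N.cast_nonneg
  set δ := t / 2 with hδ
  have hδ0 : 0 < δ := by positivity
  have htm : t ∈ Ico δ 2 := ⟨by linarith, ht2⟩
  obtain ⟨A₁, hA₁, hA⟩ := exists_forall_le N
    (P := fun q C => ∀ s ∈ Ico δ 2, ∀ s' ∈ Ico δ 2, WB N (C * |s' - s| ^ 2)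
        (S.vlt J (p + q) s' - S.vlt J (p + q) s - (s' - s) • -S.vlt J (p + q + 1) s))
    (fun q => S.exists_wB_vlt_sub_two hμ J (p + q) hN hδ0)
    (fun q C C' h hP s hs s' hs' => (hP s hs s' hs').mono (by gcongr))
  obtain ⟨A₂, hA₂, hA'⟩ := exists_forall_le (N + 1)
    (P := fun q C => WB N C (S.vlt J (p + q) t))
    (fun q => by
      obtain ⟨C, hC0, hC⟩ := S.exists_wB_vlt hμ J (p + q) hN
      exact ⟨_, by positivity, hC t ht ht2.le⟩)
    (fun q C C' h hP => hP.mono h)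
  obtain ⟨D₁, hD₁, hD⟩ := exists_integral_scaled_sub_le_two hm hδ0
  obtain ⟨D₂, hD₂, hD'⟩ := exists_integral_scaled_sub_le hm hδ0
  set I := ∫ x, |m x| with hI
  have hI0 : 0 ≤ I := integral_nonneg fun _ => abs_nonneg _
  refine hasDerivAt_of_sq_bound (ε := min δ (2 - t)) (K := C * (A₁ * I) + C * (A₂ * D₁) +
    C * (A₂ * D₂)) (lt_min hδ0 (by linarith)) fun s hs => ?_
  have hs1 := abs_lt.1 (hs.trans_le (min_le_left _ _))
  have hs2 := abs_lt.1 (hs.trans_le (min_le_right _ _))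
  have hsm : s ∈ Ico δ 2 := ⟨by linarith [hs1.1], by linarith [hs2.2]⟩
  have hs0 : 0 < s := hδ0.trans_le hsm.1
  have c1 := chain_vlt (S := S) hμ J p ht ht2.le
  have c2 := chain_vlt (S := S) hμ J p hs0 hsm.2.le
  have c3 : S.Chain fun q => S.vlt J (p + 1 + q) t := chain_vlt (S := S) hμ J (p + 1) ht ht2.le
  have e3 : ∀ q, S.vlt J (p + q + 1) t = S.vlt J (p + 1 + q) t := fun q => by congr 1; omega
  have cA : S.Chain fun q =>
      S.vlt J (p + q) s - S.vlt J (p + q) t - (s - t) • -S.vlt J (p + q + 1) t := by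
    simp only [e3, ← neg_one_smul ℝ (S.vlt J (p + 1 + _) t)]
    exact (c2.sub c1).sub ((c3.smul (-1)).smul (s - t))
  have k1 := hm.isKer ht
  have k2 := hm.isKer hs0
  have k3 := (hm.dil.isKer ht).const_mul (-t⁻¹)
  have kd := k2.sub k1
  have kB := kd.sub (k3.const_mul (s - t))
  have hz1 : ∀ x, x ∉ Icc (0 : ℝ) 4 → scaled m t x = 0 := fun x hx =>
    scaled_eq_zero_of_le hm ht ht2.le hx
  have hz2 : ∀ x, x ∉ Icc (0 : ℝ) 4 → scaled m s x = 0 := fun x hx =>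
    scaled_eq_zero_of_le hm hs0 hsm.2.le hx
  have hz3 : ∀ x, x ∉ Icc (0 : ℝ) 4 → scaled (dil m) t x = 0 := fun x hx =>
    scaled_eq_zero_of_le hm.dil ht ht2.le hx
  have b1 := hC _ cA _ k2 hz2 (A₁ * |s - t| ^ 2) (fun q hq => hA q hq t htm s hsm)
  have b2 := hC _ c1 _ kB (fun x hx => by simp [hz1 x hx, hz2 x hx, hz3 x hx]) A₂
    (fun q hq => hA' q (by omega))
  have b3 := hC _ c3 _ kd (fun x hx => by simp [hz1 x hx, hz2 x hx]) A₂
    (fun q hq => by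
      have := hA' (q + 1) (by omega)
      rwa [show p + (q + 1) = p + 1 + q by omega] at this)
  rw [integral_abs_scaled m hs0] at b1
  have b2' := b2.trans (mul_le_mul_of_nonneg_left (mul_le_mul_of_nonneg_left
    (hD s t hsm.1 htm.1 hsm.2.le ht2.le) hA₂) hC0)
  have b3' := b3.trans (mul_le_mul_of_nonneg_left (mul_le_mul_of_nonneg_left
    (hD' s t hsm.1 htm.1 hsm.2.le ht2.le) hA₂) hC0)
  have hl := hf.isLin
  have T := fun {Z : ℕ → Lp ℝ 2 μ →L[ℝ] Lp ℝ 2 μ} (hZ : S.Chain Z) {k : ℝ → ℝ} (hk : IsKer k) =>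
    hZ.isTest_opK hk hχ
  simp only [add_zero] at *
  have x1 : f (opK (S.vlt J p s - S.vlt J p t - (s - t) • -S.vlt J (p + 1) t) (scaled m s) χ) =
      f (opK (S.vlt J p s) (scaled m s) χ) - f (opK (S.vlt J p t) (scaled m s) χ) +
        (s - t) * f (opK (S.vlt J (p + 1) t) (scaled m s) χ) := by
    have t1 : S.IsTest o (opK (S.vlt J p s) (scaled m s) χ) := T c2 k2
    have t2 : S.IsTest o (opK (S.vlt J p t) (scaled m s) χ) := T c1 k2
    have t3 : S.IsTest o (opK (S.vlt J (p + 1) t) (scaled m s) χ) := T c3 k2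
    have e : opK (S.vlt J p s - S.vlt J p t - (s - t) • -S.vlt J (p + 1) t) (scaled m s) χ =
        opK (S.vlt J p s) (scaled m s) χ - opK (S.vlt J p t) (scaled m s) χ -
          (-(s - t)) • opK (S.vlt J (p + 1) t) (scaled m s) χ := by
      rw [smul_neg, ← neg_smul, opK_sub_left, opK_sub_left, opK_smul_left]
    rw [e, hl.sub (t1.sub t2) (t3.smul _), hl.sub t1 t2, hl.smul _ _ t3]; ring
  have x2 : f (opK (S.vlt J p t) (fun x => scaled m s x - scaled m t x -
        (s - t) * (-t⁻¹ * scaled (dil m) t x)) χ) =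
      f (opK (S.vlt J p t) (scaled m s) χ) - f (opK (S.vlt J p t) (scaled m t) χ) +
        (s - t) * (t⁻¹ * f (opK (S.vlt J p t) (scaled (dil m) t) χ)) := by
    have t1 : S.IsTest o (opK (S.vlt J p t) (scaled m s) χ) := T c1 k2
    have t2 : S.IsTest o (opK (S.vlt J p t) (scaled m t) χ) := T c1 k1
    have t3 : S.IsTest o (opK (S.vlt J p t) (scaled (dil m) t) χ) := T c1 (hm.dil.isKer ht)
    rw [opK_sub_ker kd.cont (k3.const_mul (s - t)).cont hχ.isCurve,
      opK_sub_ker k2.cont k1.cont hχ.isCurve, opK_smul_ker, opK_smul_ker,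
      hl.sub (t1.sub t2) ((t3.smul _).smul _), hl.sub t1 t2, hl.smul _ _ (t3.smul _),
      hl.smul _ _ t3]; ring
  have x3 : f (opK (S.vlt J (p + 1) t) (fun x => scaled m s x - scaled m t x) χ) =
      f (opK (S.vlt J (p + 1) t) (scaled m s) χ) - f (opK (S.vlt J (p + 1) t) (scaled m t) χ) := by
    have t1 : S.IsTest o (opK (S.vlt J (p + 1) t) (scaled m s) χ) := T c3 k2
    have t2 : S.IsTest o (opK (S.vlt J (p + 1) t) (scaled m t) χ) := T c3 k1
    rw [opK_sub_ker k2.cont k1.cont hχ.isCurve, hl.sub t1 t2]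
  rw [x1] at b1
  rw [x2] at b2'
  rw [x3] at b3'
  set u1 := f (opK (S.vlt J p s) (scaled m s) χ)
  set u2 := f (opK (S.vlt J p t) (scaled m s) χ)
  set u3 := f (opK (S.vlt J (p + 1) t) (scaled m s) χ)
  set u4 := f (opK (S.vlt J p t) (scaled m t) χ)
  set u5 := f (opK (S.vlt J p t) (scaled (dil m) t) χ)
  set u6 := f (opK (S.vlt J (p + 1) t) (scaled m t) χ)
  have e : u1 - u4 - (s - t) * (-u6 - t⁻¹ * u5) = (u1 - u2 + (s - t) * u3) +
      (u2 - u4 + (s - t) * (t⁻¹ * u5)) - (s - t) * (u3 - u6) := by ring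
  rw [e]
  have b4 : |(s - t) * (u3 - u6)| ≤ |s - t| * (C * (A₂ * (D₂ * |s - t|))) := by
    rw [abs_mul]; gcongr
  calc _ ≤ |u1 - u2 + (s - t) * u3| + |u2 - u4 + (s - t) * (t⁻¹ * u5)| +
        |(s - t) * (u3 - u6)| := (abs_sub _ _).trans (add_le_add_left (abs_add_le _ _) _)
    _ ≤ _ := add_le_add (add_le_add b1 b2') b4
    _ = _ := by ring

end HeatSystem

end Parabolic

namespace Parabolic

lemma sum_taylor_telescope (y : ℕ → ℝ) (s : ℝ) (m : ℕ) : ∑ i ∈ Finset.range (m + 1),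
    ((i : ℝ) * s ^ (i - 1) / (i.factorial : ℝ) * y i + s ^ i / (i.factorial : ℝ) * -y (i + 1)) =
      -(s ^ m / (m.factorial : ℝ) * y (m + 1)) := by
  induction m with
  | zero => simp
  | succ m ih =>
    rw [Finset.sum_range_succ, ih, Nat.factorial_succ]
    have : (m.factorial : ℝ) ≠ 0 := by positivity
    have : (m : ℝ) + 1 ≠ 0 := by positivity
    push_cast
    field_simp
    ring

variable {M : Type*} [MetricSpace M] [MeasurableSpace M] {μ : Measure M} {ℓ₀ : ℕ}
  [BorelSpace M] [SecondCountableTopology M]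

/-- Weighted `L¹` norms are controlled by exponentially weighted `L²` norms. -/
lemma VolumeDoubling.exists_wn_one_le (hμ : VolumeDoubling μ) (o : M) : ∃ K : ℝ≥0∞, K ≠ ∞ ∧
    ∀ a w, IsWt a w → ∀ N : ℕ, a + 1 ≤ N → ∀ v : Lp ℝ 2 μ,
      wn 1 w v ≤ ENNReal.ofReal (w o) * K * wn 2 (fun x => Real.exp (N * dist o x)) v := by
  refine ⟨eLpNorm (fun x => Real.exp (-dist o x)) 2 μ, ?_, fun a w hw N hN v => ?_⟩
  · rw [← lt_top_iff_ne_top, eLpNorm_lt_top_iff_lintegral_rpow_enorm_lt_top (by norm_num)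
      (by norm_num)]
    refine lt_of_le_of_lt (lintegral_mono fun x => ?_)
      (hμ.lintegral_exp_lt_top o (a := 2) (by norm_num))
    rw [← ofReal_norm, Real.norm_of_nonneg (Real.exp_pos _).le,
      ENNReal.ofReal_rpow_of_pos (Real.exp_pos _), ← Real.exp_mul]
    refine ENNReal.ofReal_le_ofReal (Real.exp_le_exp.2 ?_)
    simp only [ENNReal.toReal_ofNat]; linarith
  · have hm : ∀ r : ℝ, Continuous fun x => Real.exp (r * dist o x) := fun r => by fun_prop
    have h1 : wn 1 w v ≤ ENNReal.ofReal (w o) *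
        eLpNorm ((fun x => Real.exp (-dist o x)) • fun x => Real.exp (N * dist o x) * v x) 1 μ := by
      have e : ENNReal.ofReal (w o) = ‖w o‖ₑ := by
        rw [← ofReal_norm, Real.norm_of_nonneg (hw.pos o).le]
      rw [e, ← eLpNorm_const_smul]
      refine eLpNorm_mono fun x => ?_
      simp only [Pi.smul_apply, smul_eq_mul, Pi.mul_apply]
      rw [norm_mul, norm_mul, norm_mul, norm_mul, Real.norm_of_nonneg (hw.pos x).le,
        Real.norm_of_nonneg (hw.pos o).le, Real.norm_of_nonneg (Real.exp_pos _).le,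
        Real.norm_of_nonneg (Real.exp_pos _).le, ← mul_assoc, ← mul_assoc]
      gcongr
      rw [mul_assoc, ← Real.exp_add, mul_comm]
      refine (hw.le x o).trans ?_
      have := (hw.pos o).le
      have hd : 0 ≤ dist o x := dist_nonneg
      rw [dist_comm]
      gcongr
      nlinarith
    refine h1.trans ?_
    rw [mul_assoc]
    gcongr
    refine eLpNorm_smul_le_mul_eLpNorm (p := 2) (q := 2) (r := 1) ?_ ?_
    · exact (hm N).aestronglyMeasurable.mul (Lp.aestronglyMeasurable v)
    · have := hm (-1)
      simp only [neg_mul, one_mul] at this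
      exact this.aestronglyMeasurable

variable [SigmaFinite μ]

lemma crvNorm_le_of_support {W : M × ℝ → ℝ} {χ : ℝ → Lp ℝ 2 μ} {B : ℝ≥0∞}
    (hB : ∀ τ, wn 1 (fun x => W (x, τ)) (χ τ) ≤ B) {r : ℝ} (hχ : ∀ τ, r < |τ| → χ τ = 0) :
    crvNorm W χ ≤ ENNReal.ofReal (2 * r) * B := by
  have h : ∀ τ, wn 1 (fun x => W (x, τ)) (χ τ) ≤ (Icc (-r) r).indicator (fun _ => B) τ := by
    intro τ
    by_cases hτ : τ ∈ Icc (-r) r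
    · rw [indicator_of_mem hτ]; exact hB τ
    · rw [hχ τ (not_le.1 fun h => hτ (abs_le.1 h)), wn_zero]; exact zero_le
  refine (lintegral_mono h).trans ?_
  rw [lintegral_indicator measurableSet_Icc, setLIntegral_const, Real.volume_Icc, mul_comm]
  gcongr
  linarith

lemma crvNorm_sum_le {a : ℝ} {W : M × ℝ → ℝ} (hW : IsReg a W) {ι : Type*} (s : Finset ι)
    (c : ι → ℝ) {χ : ι → ℝ → Lp ℝ 2 μ} (hχ : ∀ i ∈ s, IsCurve (χ i)) :
    IsCurve (∑ i ∈ s, c i • χ i) ∧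
      crvNorm W (∑ i ∈ s, c i • χ i) ≤ ∑ i ∈ s, ‖c i‖ₑ * crvNorm W (χ i) := by
  classical
  induction s using Finset.induction_on with
  | empty =>
    refine ⟨⟨continuous_const, HasCompactSupport.zero⟩, ?_⟩
    simp [crvNorm, wn_zero]
  | insert i s hi ih =>
    obtain ⟨h1, h2⟩ := ih fun j hj => hχ j (Finset.mem_insert_of_mem hj)
    have h3 := hχ i (Finset.mem_insert_self i s)
    rw [Finset.sum_insert hi, Finset.sum_insert hi]
    refine ⟨(h3.smul _).add h1, (crvNorm_add_le (h3.smul _) hW).trans ?_⟩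
    rw [crvNorm_smul]
    gcongr

/-- Cancellation in time against a smooth curve. -/
lemma wn_integral_moments_le {a : ℝ} {W : M × ℝ → ℝ} (hW : IsReg a W) {n : ℝ → ℝ} (hn : IsBump n)
    {A : ℝ} (hA : ∀ x, |n x| ≤ A) {κ : ℕ} (hmom : ∀ i < κ, ∫ x, x ^ i * n x = 0)
    {χ : ℝ → Lp ℝ 2 μ} (hχ : IsSmoothCurve χ) {G : ℝ≥0∞} (hG' : G ≠ ∞)
    (hG : ∀ τ, wn 1 (fun x => W (x, τ)) (iteratedDeriv κ χ τ) ≤ G) {t : ℝ} (ht : 0 < t) (σ : ℝ) :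
    wn 1 (fun x => W (x, σ)) (∫ τ, scaled n t (τ - σ) • χ τ) ≤
      ENNReal.ofReal (2 * 2 ^ κ * A * t ^ κ) * G := by
  have hA0 : 0 ≤ A := (abs_nonneg _).trans (hA 0)
  have hpq : DualPair 1 ∞ := Or.inl ⟨rfl, rfl⟩
  refine wn_le_of_dual hpq (hW.wt σ) _ _ fun ψ hψ => ?_
  set Ψ := wn ∞ (fun x => (W (x, σ))⁻¹) ψ with hΨ
  have hint := integrable_smul_curve (hn.isKer ht).cont hχ.isCurve σ
  rw [← integral_inner hint ψ]
  have e : ∫ τ, inner ℝ ψ (scaled n t (τ - σ) • χ τ) =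
      ∫ s, n s * (fun y => inner ℝ ψ (χ (σ + y)) : ℝ → ℝ) (t * s) := by
    rw [← integral_scaled_mul n (fun y => (inner ℝ ψ (χ (σ + y)) : ℝ)) ht,
      ← integral_sub_right_eq_self (fun y => scaled n t y * inner ℝ ψ (χ (σ + y))) σ]
    refine integral_congr_ae (Eventually.of_forall fun τ => ?_)
    simp only [inner_smul_right, add_sub_cancel]
  have hb := abs_integral_moments_le hn.smooth.continuous hn.support hA hmom
    (G := (Ψ * G).toReal)
    (fun j y => inner ℝ ψ (iteratedDeriv j χ (σ + y))) (fun j _ x => ?_) ?_ (fun x hx => ?_) ht.le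
  · rw [e, ← ofReal_norm, Real.norm_eq_abs]
    refine (ENNReal.ofReal_le_ofReal (by simpa only [iteratedDeriv_zero] using hb)).trans ?_
    have : 2 * 2 ^ κ * A * (Ψ * G).toReal * t ^ κ =
      2 * 2 ^ κ * A * t ^ κ * (Ψ * G).toReal := by ring
    rw [this, ENNReal.ofReal_mul (by positivity), ENNReal.ofReal_toReal
      (ENNReal.mul_ne_top hψ hG')]
    exact le_of_eq (by ring)
  · have h1 := ((hχ.iteratedDeriv j).hasDerivAt (σ + x)).comp_const_add σ x
    have h2 := (innerSL ℝ ψ).hasFDerivAt.comp_hasDerivAt x h1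
    rw [← iteratedDeriv_succ] at h2
    exact h2
  · simp only [iteratedDeriv_zero]
    exact continuous_const.inner (hχ.smooth.continuous.comp (by fun_prop))
  · have h1 := enorm_inner_le hpq (hW.wt σ) ψ (iteratedDeriv κ χ (σ + x))
    have h2 : wn 1 (fun y => W (y, σ)) (iteratedDeriv κ χ (σ + x)) ≤ G :=
      (wn_mono (fun y => (hW.pos _).le) (fun y => hW.mono y (by linarith)) _).trans (hG (σ + x))
    have h3 := ENNReal.toReal_mono (ENNReal.mul_ne_top hψ hG') (h1.trans (mul_le_mul_right h2 _))
    rwa [toReal_enorm, Real.norm_eq_abs] at h3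

namespace HeatSystem

variable {S : HeatSystem μ ℓ₀} {o : M} {χ : ℝ → Lp ℝ 2 μ}

lemma adjPow_eq_zero (k : ℕ) {τ : ℝ} (h : χ τ = 0) : S.adjPow k χ τ = 0 := by
  have hz : ∀ j, (app S.L.adjoint)^[j] 0 = 0 := fun j => by
    induction j with
    | zero => rfl
    | succ j ih =>
      rw [Function.iterate_succ_apply', ih, app_of_mem S.L.adjoint.domain.zero_mem]
      exact S.L.adjoint.map_zero
  unfold adjPow
  rw [h, hz]

lemma iteratedDeriv_adjPow_eq_zero (n k : ℕ) {r : ℝ} (h : ∀ τ, r < |τ| → χ τ = 0) {τ : ℝ}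
    (hτ : r < |τ|) : iteratedDeriv n (S.adjPow k χ) τ = 0 := by
  have h1 : S.adjPow k χ =ᶠ[𝓝 τ] fun _ => 0 := by
    filter_upwards [(isOpen_lt continuous_const continuous_abs).mem_nhds hτ] with σ hσ
    exact adjPow_eq_zero k (h σ hσ)
  rw [h1.iteratedDeriv_eq n, iteratedDeriv_fun_const_zero]

/-- Weighted `L¹` norms of test functions are controlled by the seminorms. -/
lemma exists_wn_test_le (hμ : VolumeDoubling μ) (o : M) {a : ℝ} {W : M × ℝ → ℝ} (hW : IsReg a W)
    (r : ℝ) : ∃ (N : ℕ) (C : ℝ), 0 ≤ C ∧ ∀ χ, S.IsTest o χ → (∀ τ, r < |τ| → χ τ = 0) →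
      ∀ n k τ, wn 1 (fun x => W (x, τ)) (iteratedDeriv n (S.adjPow k χ) τ) ≤
        ENNReal.ofReal C * S.testSeminorm o N n k χ := by
  obtain ⟨K, hK, hwn⟩ := hμ.exists_wn_one_le o
  obtain ⟨N, hN⟩ := exists_nat_ge (a + 1)
  refine ⟨N, W (o, r) * K.toReal, mul_nonneg (hW.pos _).le ENNReal.toReal_nonneg,
    fun χ hχ hs n k τ => ?_⟩
  rcases lt_or_ge r |τ| with h | h
  · rw [iteratedDeriv_adjPow_eq_zero n k hs h, wn_zero]; exact zero_le
  · refine (hwn a _ (hW.wt τ) N hN _).trans ?_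
    rw [ENNReal.ofReal_mul (hW.pos _).le, ENNReal.ofReal_toReal hK]
    gcongr
    · exact hW.mono o ((le_abs_self τ).trans h)
    · exact wn_le_testSeminorm N n k χ τ

lemma exists_crvNorm_test_le (hμ : VolumeDoubling μ) (o : M) {a : ℝ} {W : M × ℝ → ℝ}
    (hW : IsReg a W) (r : ℝ) : ∃ (N : ℕ) (C : ℝ), 0 ≤ C ∧ ∀ χ, S.IsTest o χ →
      (∀ τ, r < |τ| → χ τ = 0) → ∀ k,
      crvNorm W (S.adjPow k χ) ≤ ENNReal.ofReal C * S.testSeminorm o N 0 k χ := by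
  obtain ⟨N, C, hC, h⟩ := exists_wn_test_le (S := S) hμ o hW r
  refine ⟨N, max (2 * r) 0 * C, by positivity, fun χ hχ hs k => ?_⟩
  refine (crvNorm_le_of_support (r := r) (fun τ => by simpa using h χ hχ hs 0 k τ)
    fun τ hτ => adjPow_eq_zero k (hs τ hτ)).trans ?_
  rw [ENNReal.ofReal_mul (le_max_right _ _), mul_assoc]
  gcongr
  exact le_max_left _ _

lemma IsTest.crvNorm_ne_top (hμ : VolumeDoubling μ) (hχ : S.IsTest o χ) {a : ℝ} {W : M × ℝ → ℝ}
    (hW : IsReg a W) : crvNorm W χ ≠ ∞ := by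
  obtain ⟨r, _, hr⟩ := hχ.exists_support
  obtain ⟨N, C, _, h⟩ := exists_crvNorm_test_le (S := S) hμ o hW r
  exact ne_top_of_le_ne_top (ENNReal.mul_ne_top ENNReal.ofReal_ne_top (hχ.decay N 0 0).ne)
    (h χ hχ hr 0)

/-- Cancellation in space: the operators `e^{-tL} t^{|I|/2} V_I` are small on smooth vectors. -/
lemma exists_wn_ert_le (hμ : VolumeDoubling μ) (I : List (Fin ℓ₀)) (q κ : ℕ)
    (hκ : 2 * κ ≤ I.length + 2 * q) {a : ℝ} (ha : 0 ≤ a) : ∃ C : ℝ, 0 ≤ C ∧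
    ∀ t, 0 < t → t ≤ 1 → ∀ w, IsWt a w → ∀ v : Lp ℝ 2 μ, PowDom S.L.adjoint (κ + 1) v →
      ∀ B : ℝ, (∀ i ≤ κ + 1, wn 1 w ((app S.L.adjoint)^[i] v) ≤ ENNReal.ofReal B) →
      wn 1 w ((S.ert I q t).adjoint v) ≤ ENNReal.ofReal (C * t ^ κ * B) := by
  obtain ⟨C₀, hC₀, hC⟩ := S.exists_wB_elt_comp_ert hμ [] I 0 q ha
  refine ⟨(κ + 1) * C₀ + C₀, by positivity, fun t ht ht1 w hw v hv B hB => ?_⟩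
  have hpq : DualPair 1 ∞ := Or.inl ⟨rfl, rfl⟩
  refine wn_le_of_dual hpq hw _ _ fun ψ hψ => ?_
  set Ψ := wn ∞ (fun x => (w x)⁻¹) ψ with hΨ
  set B' := max B 0 with hB'
  have hBB : ENNReal.ofReal B = ENNReal.ofReal B' := by
    rcases le_total B 0 with h | h <;> simp [hB', h, ENNReal.ofReal_of_nonpos]
  set x := S.ert I q t ψ with hx
  have hTs : ∀ s, 0 < s → s ≤ 1 → ∀ i ≤ κ + 1,
      |inner ℝ (S.T s x) ((app S.L.adjoint)^[i] v)| ≤ Ψ.toReal * (C₀ * (t / s) ^ κ * B') := by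
    intro s hs hs1 i hi
    have hwb : WB a (C₀ * (t / s) ^ κ) ((S.T s).comp (S.ert I q t)) := by
      have h := hC s t hs hs1 ht ht1
      rw [S.elt_nil hμ 0 hs (by linarith)] at h
      have e : S.ert [] 0 s = S.T s := by
        rw [← S.opD_zero hμ hs (by linarith), ← S.rlt_nil hμ 0 hs (by linarith)]
        simp [ert]
      rw [e] at h
      refine h.mono ?_
      have h1 : t / (s + t) ≤ 1 := by rw [div_le_one (by positivity)]; linarith
      have h0 : 0 < t / (s + t) := by positivity
      have h2 : (t / (s + t)) ^ ((I.length : ℝ) / 2 + q) ≤ (t / s) ^ κ := by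
        have : (κ : ℝ) ≤ (I.length : ℝ) / 2 + q := by
          have : (2 * κ : ℝ) ≤ I.length + 2 * q := by exact_mod_cast hκ
          linarith
        refine (Real.rpow_le_rpow_of_exponent_ge h0 h1 this).trans ?_
        rw [Real.rpow_natCast]
        gcongr
        linarith
      simp only [List.length_nil, Nat.cast_zero, zero_div, add_zero, Real.rpow_zero, mul_one]
      gcongr
    have h1 := hwb.enorm_inner_le hpq hw ψ ((app S.L.adjoint)^[i] v)
    have h2 := h1.trans (mul_le_mul_right (mul_le_mul_right (hB i hi) _) _)
    rw [hBB, ← ENNReal.ofReal_mul (by positivity)] at h2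
    have h3 := ENNReal.toReal_mono (ENNReal.mul_ne_top hψ ENNReal.ofReal_ne_top) h2
    rwa [toReal_enorm, Real.norm_eq_abs, ENNReal.toReal_mul,
      ENNReal.toReal_ofReal (by positivity)] at h3
  set g : ℝ → ℝ := fun s => ∑ i ∈ Finset.range (κ + 1), s ^ i / (i.factorial : ℝ) *
    inner ℝ (S.T s x) ((app S.L.adjoint)^[i] v) with hg
  have hL : ∀ s, 0 < s → s ≤ 2 → ∀ i < κ + 1, inner ℝ (S.opD 1 s x) ((app S.L.adjoint)^[i] v) =
      inner ℝ (S.T s x) ((app S.L.adjoint)^[i + 1] v) := by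
    intro s hs hs2 i hi
    rw [S.opD_apply hμ 1 hs hs2, Function.iterate_one, Function.iterate_succ_apply']
    have hm := hv i hi
    have hd := S.T_mem_domain_of_pos hs x
    have := LinearPMap.adjoint_isFormalAdjoint S.dense_domain ⟨_, hm⟩ ⟨_, hd⟩
    rw [app_of_mem hm, app_of_mem hd, real_inner_comm, ← this, real_inner_comm]
  have hgd : ∀ s, 0 < s → s ≤ 1 → HasDerivAt g
      (-(s ^ κ / (κ.factorial : ℝ) * inner ℝ (S.T s x) ((app S.L.adjoint)^[κ + 1] v))) s := by
    intro s hs hs1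
    set y : ℕ → ℝ := fun i => inner ℝ (S.T s x) ((app S.L.adjoint)^[i] v) with hy
    have h1 : HasDerivAt g (∑ i ∈ Finset.range (κ + 1),
        ((i : ℝ) * s ^ (i - 1) / (i.factorial : ℝ) * y i + s ^ i / (i.factorial : ℝ) * -y (i + 1)))
        s := by
      refine HasDerivAt.fun_sum fun i hi => ?_
      have hd1 : HasDerivAt (fun s : ℝ => s ^ i / (i.factorial : ℝ))
          ((i : ℝ) * s ^ (i - 1) / (i.factorial : ℝ)) s := (hasDerivAt_pow i s).div_const _
      have hd2 := (S.hasDerivAt_T hμ hs (by linarith) x).inner ℝ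
        (hasDerivAt_const s ((app S.L.adjoint)^[i] v))
      rw [inner_zero_right, zero_add, inner_neg_left,
        hL s hs (by linarith) i (Finset.mem_range.1 hi)] at hd2
      exact hd1.mul hd2
    exact h1.congr_deriv (sum_taylor_telescope y s κ)
  have hΨ0 : 0 ≤ Ψ.toReal := ENNReal.toReal_nonneg
  have hB0 : 0 ≤ B' := le_max_right _ _
  have hg1 : |g 1| ≤ Ψ.toReal * ((κ + 1) * C₀ * t ^ κ * B') := by
    refine (Finset.abs_sum_le_sum_abs _ _).trans ?_
    calc _ ≤ ∑ _i ∈ Finset.range (κ + 1), Ψ.toReal * (C₀ * t ^ κ * B') := by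
          refine Finset.sum_le_sum fun i hi => ?_
          have h1 := hTs 1 one_pos le_rfl i (Finset.mem_range.1 hi).le
          rw [div_one] at h1
          rw [one_pow, abs_mul, abs_of_pos (by positivity)]
          have h2 : (1 : ℝ) / (i.factorial : ℝ) ≤ 1 := by
            rw [div_le_one (by positivity)]
            exact_mod_cast Nat.factorial_pos i
          calc _ ≤ 1 * (Ψ.toReal * (C₀ * t ^ κ * B')) :=
                mul_le_mul h2 h1 (abs_nonneg _) zero_le_one
            _ = _ := one_mul _
      _ = _ := by rw [Finset.sum_const, Finset.card_range, nsmul_eq_mul]; push_cast; ring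
  have hgs : ∀ s ∈ Ioo (0 : ℝ) 1, |g s| ≤ Ψ.toReal * (((κ + 1) * C₀ + C₀) * t ^ κ * B') := by
    intro s hs
    have h1 := Convex.norm_image_sub_le_of_norm_hasDerivWithin_le (f := g)
      (s := Icc s 1) (C := Ψ.toReal * (C₀ * t ^ κ * B'))
      (fun y hy => (hgd y (hs.1.trans_le hy.1) hy.2).hasDerivWithinAt)
      (fun y hy => ?_) (convex_Icc s 1) (right_mem_Icc.2 hs.2.le) (left_mem_Icc.2 hs.2.le)
    · rw [Real.norm_eq_abs, Real.norm_eq_abs] at h1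
      have h2 : |s - 1| ≤ 1 := by rw [abs_le]; constructor <;> linarith [hs.1, hs.2]
      have h3 : 0 ≤ Ψ.toReal * (C₀ * t ^ κ * B') := by positivity
      have h4 := abs_sub_abs_le_abs_sub (g s) (g 1)
      nlinarith
    · have hy0 := hs.1.trans_le hy.1
      rw [norm_neg, Real.norm_eq_abs, abs_mul, abs_of_pos (by positivity)]
      have h2 : y ^ κ / (κ.factorial : ℝ) ≤ y ^ κ := div_le_self (by positivity) (by
        exact_mod_cast Nat.factorial_pos κ)
      calc _ ≤ y ^ κ * (Ψ.toReal * (C₀ * (t / y) ^ κ * B')) :=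
            mul_le_mul h2 (hTs y hy0 hy.2 _ le_rfl) (abs_nonneg _) (by positivity)
        _ = _ := by rw [div_pow]; field_simp
  have hlim : Tendsto g (𝓝[>] 0) (𝓝 (inner ℝ x v)) := by
    have h1 : Tendsto g (𝓝[>] 0) (𝓝 (∑ i ∈ Finset.range (κ + 1), (0 : ℝ) ^ i / (i.factorial : ℝ) *
        inner ℝ x ((app S.L.adjoint)^[i] v))) := by
      refine tendsto_finsetSum _ fun i _ => Tendsto.mul ?_ ((S.T_continuous x).inner
        tendsto_const_nhds)
      exact (((continuous_pow i).tendsto (0 : ℝ)).div_const _).mono_left nhdsWithin_le_nhds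
    rw [Finset.sum_range_succ'] at h1
    simpa using h1
  have hfin : |inner ℝ x v| ≤ Ψ.toReal * (((κ + 1) * C₀ + C₀) * t ^ κ * B') := by
    refine le_of_tendsto hlim.abs ?_
    filter_upwards [Ioo_mem_nhdsGT one_pos] with s hs using hgs s hs
  rw [ContinuousLinearMap.adjoint_inner_right, ← ofReal_norm, Real.norm_eq_abs]
  refine (ENNReal.ofReal_le_ofReal hfin).trans ?_
  rw [ENNReal.ofReal_mul hΨ0, ENNReal.ofReal_toReal hψ,
    ENNReal.ofReal_mul (p := ((κ + 1) * C₀ + C₀) * t ^ κ) (by positivity),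
    ENNReal.ofReal_mul (p := ((κ + 1) * C₀ + C₀) * t ^ κ) (by positivity), hBB]

end HeatSystem

end Parabolic

namespace Parabolic

lemma abs_rpow_sub_le {e δ s t : ℝ} (he : 0 ≤ e) (hδ : 0 < δ) (hs : s ∈ Icc δ 1)
    (ht : t ∈ Icc δ 1) : |s ^ e - t ^ e| ≤ e * δ⁻¹ * |s - t| := by
  refine Convex.norm_image_sub_le_of_norm_hasDerivWithin_le (f := fun s : ℝ => s ^ e)
    (s := Icc δ 1) (f' := fun s => e * s ^ (e - 1)) (fun u hu =>
      (Real.hasDerivAt_rpow_const (Or.inl (hδ.trans_le hu.1).ne')).hasDerivWithinAt)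
    (fun u hu => ?_) (convex_Icc δ 1) ht hs
  have hu0 := hδ.trans_le hu.1
  rw [Real.norm_of_nonneg (by positivity), Real.rpow_sub_one hu0.ne', div_eq_mul_inv]
  have h1 : u ^ e ≤ 1 := Real.rpow_le_one hu0.le hu.2 he
  have h2 : u⁻¹ ≤ δ⁻¹ := inv_anti₀ hδ hu.1
  have h3 : 0 < u⁻¹ := inv_pos.2 hu0
  have h4 : u ^ e * u⁻¹ ≤ 1 * δ⁻¹ := mul_le_mul h1 h2 h3.le zero_le_one
  rw [one_mul] at h4
  gcongr

variable {M : Type*} [MetricSpace M] [MeasurableSpace M] {μ : Measure M} {ℓ₀ : ℕ}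
  [BorelSpace M] [SecondCountableTopology M] [SigmaFinite μ]

lemma tn_add_le {χ χ' : ℝ → Lp ℝ 2 μ} (hχ : IsCurve χ) {a : ℝ} {W : M × ℝ → ℝ} (hW : IsReg a W)
    (h : crvNorm W χ ≠ ∞) (h' : crvNorm W χ' ≠ ∞) : tn W (χ + χ') ≤ tn W χ + tn W χ' := by
  unfold tn
  rw [← ENNReal.toReal_add h h']
  exact ENNReal.toReal_mono (ENNReal.add_ne_top.2 ⟨h, h'⟩) (crvNorm_add_le hχ hW)

/-- Parameters of an operator `∑_{i<c} a_i (tL)^{q+i} e^{-tL} (t^{|I|/2} V_I)`. -/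
structure RightFam (ℓ₀ : ℕ) where
  I : List (Fin ℓ₀)
  q : ℕ
  c : ℕ
  a : ℕ → ℝ

namespace HeatSystem

variable {S : HeatSystem μ ℓ₀} {o : M}

/-- The operator `∑_{i<c} a_i (tL)^{q+i} e^{-tL} (t^{|I|/2} V_I)`. -/
noncomputable def rop (S : HeatSystem μ ℓ₀) (R : RightFam ℓ₀) (t : ℝ) :
    Lp ℝ 2 μ →L[ℝ] Lp ℝ 2 μ :=
  ∑ i ∈ Finset.range R.c, R.a i • S.ert R.I (R.q + i) t

lemma exists_wB_rop (hμ : VolumeDoubling μ) (R : RightFam ℓ₀) {a : ℝ} (ha : 0 ≤ a) :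
    ∃ C : ℝ, 0 ≤ C ∧ ∀ t, 0 < t → t ≤ 2 → WB a C (S.rop R t) := by
  choose C hC0 hC using fun i => S.exists_wB_ert hμ R.I (R.q + i) ha
  exact ⟨∑ i ∈ Finset.range R.c, |R.a i| * C i,
    Finset.sum_nonneg fun i _ => mul_nonneg (abs_nonneg _) (hC0 i),
    fun t ht ht2 => WB.sum _ fun i _ => (hC i t ht ht2).smul _⟩

lemma exists_wB_ert_sub (hμ : VolumeDoubling μ) (I : List (Fin ℓ₀)) (q : ℕ) {a : ℝ} (ha : 0 ≤ a)
    {δ : ℝ} (hδ : 0 < δ) : ∃ C : ℝ, 0 ≤ C ∧ ∀ s ∈ Icc δ 1, ∀ t ∈ Icc δ 1,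
      WB a (C * |s - t|) (S.ert I q s - S.ert I q t) := by
  obtain ⟨C₁, hC₁, h₁⟩ := S.exists_wB_rlt_sub hμ I q ha hδ
  obtain ⟨C₂, hC₂, h₂⟩ := S.exists_wB_rlt hμ I q ha
  set e := (I.length : ℝ) / 2 + q with he
  have he0 : 0 ≤ e := by positivity
  refine ⟨C₁ + e * δ⁻¹ * (C₂ * δ ^ (-e)), by positivity, fun s hs t ht => ?_⟩
  have hs0 := hδ.trans_le hs.1
  have ht0 := hδ.trans_le ht.1
  have hcoef : ∀ x : ℝ, 0 < x → x ^ ((I.length : ℝ) / 2) * x ^ q = x ^ e := fun x hx => by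
    rw [he, Real.rpow_add hx, Real.rpow_natCast]
  have e1 : S.ert I q s - S.ert I q t =
      (s ^ e) • (S.rlt I q s - S.rlt I q t) + (s ^ e - t ^ e) • S.rlt I q t := by
    simp only [ert, hcoef s hs0, hcoef t ht0, smul_sub, sub_smul]
    abel
  rw [e1]
  have w1 := (h₁ t ⟨ht.1, by linarith [ht.2]⟩ s ⟨hs.1, by linarith [hs.2]⟩).smul (s ^ e)
  have w2 := (h₂ t ht0 (by linarith [ht.2])).smul (s ^ e - t ^ e)
  refine (w1.add w2).mono ?_
  have hse : |s ^ e| ≤ 1 := by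
    rw [abs_of_nonneg (by positivity)]; exact Real.rpow_le_one hs0.le hs.2 he0
  have hd := abs_rpow_sub_le he0 hδ hs ht
  have hte : t ^ (-e) ≤ δ ^ (-e) := rpow_neg_le_of_le hδ ht.1 he0
  calc _ ≤ 1 * (C₁ * |s - t|) + e * δ⁻¹ * |s - t| * (C₂ * δ ^ (-e)) := by gcongr
    _ = _ := by ring

/-- Local Lipschitz continuity in the scale of the mollification of curves. -/
lemma exists_tn_rop_sub_le (hμ : VolumeDoubling μ) (R : RightFam ℓ₀) {n : ℝ → ℝ} (hn : IsBump n)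
    {a : ℝ} {W : M × ℝ → ℝ} (ha : 0 ≤ a) (hW : IsReg a W) {δ : ℝ} (hδ : 0 < δ) :
    ∃ D : ℝ, 0 ≤ D ∧ ∀ s ∈ Icc δ 1, ∀ t ∈ Icc δ 1, ∀ χ : ℝ → Lp ℝ 2 μ, IsCurve χ →
      crvNorm W χ ≠ ∞ →
      tn W (opK (S.rop R s) (scaled n s) χ - opK (S.rop R t) (scaled n t) χ) ≤
        D * |s - t| * tn W χ := by
  choose C hC0 hC using fun i => exists_wB_ert_sub (S := S) hμ R.I (R.q + i) ha hδ
  obtain ⟨C₂, hC₂, h₂⟩ := exists_wB_rop (S := S) hμ R ha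
  obtain ⟨D, hD0, hD⟩ := exists_integral_scaled_sub_le hn hδ
  set C₁ := ∑ i ∈ Finset.range R.c, |R.a i| * C i with hC₁
  have hC₁0 : 0 ≤ C₁ := Finset.sum_nonneg fun i _ => mul_nonneg (abs_nonneg _) (hC0 i)
  set A := ∫ x, |n x| with hA
  have hA0 : 0 ≤ A := integral_nonneg fun _ => abs_nonneg _
  refine ⟨C₁ * A + C₂ * D, by positivity, fun s hs t ht χ hχ hfin => ?_⟩
  have hs0 := hδ.trans_le hs.1
  have ht0 := hδ.trans_le ht.1
  have w1 : WB a (C₁ * |s - t|) (S.rop R s - S.rop R t) := by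
    have e : S.rop R s - S.rop R t = ∑ i ∈ Finset.range R.c,
        R.a i • (S.ert R.I (R.q + i) s - S.ert R.I (R.q + i) t) := by
      simp only [rop, smul_sub, Finset.sum_sub_distrib]
    rw [e]
    refine (WB.sum _ fun i _ => (hC i s hs t ht).smul (R.a i)).mono (le_of_eq ?_)
    rw [hC₁, Finset.sum_mul]
    exact Finset.sum_congr rfl fun i _ => by ring
  have k1 := hn.isKer hs0
  have k2 := hn.isKer ht0
  have e : opK (S.rop R s) (scaled n s) χ - opK (S.rop R t) (scaled n t) χ =
      opK (S.rop R s - S.rop R t) (scaled n s) χ +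
        opK (S.rop R t) (fun x => scaled n s x - scaled n t x) χ := by
    rw [opK_sub_left, opK_sub_ker k1.cont k2.cont hχ]; abel
  rw [e]
  have w2 := h₂ t ht0 (by linarith [ht.2])
  refine (tn_add_le (hχ.opK k1 _) hW (crvNorm_opK_ne_top w1 hW k1 hχ hfin)
    (crvNorm_opK_ne_top w2 hW (k1.sub k2) hχ hfin)).trans ?_
  have b1 := tn_opK_le w1 hW k1 hχ hfin
  have b2 := tn_opK_le w2 hW (k1.sub k2) hχ hfin
  rw [integral_abs_scaled n hs0] at b1
  have hT := tn_nonneg W χ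
  calc _ ≤ C₁ * |s - t| * A * tn W χ + C₂ * (D * |s - t|) * tn W χ := by
        refine add_le_add b1 (b2.trans ?_)
        gcongr
        exact hD s t hs.1 ht.1 (by linarith [hs.2]) (by linarith [ht.2])
    _ = _ := by ring

/-- A right family gains `t^κ` on smooth functions, by cancellation in space or in time. -/
def Gain (R : RightFam ℓ₀) (n : ℝ → ℝ) (κ : ℕ) : Prop :=
  2 * κ ≤ R.I.length + 2 * R.q ∨ ∀ i < κ, ∫ x, x ^ i * n x = 0

/-- Decay of mollified test functions as the scale tends to zero. -/
lemma exists_crvNorm_rop_le (hμ : VolumeDoubling μ) (o : M) (R : RightFam ℓ₀) {n : ℝ → ℝ}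
    (hn : IsBump n) {κ : ℕ} (hg : Gain R n κ) {a : ℝ} {W : M × ℝ → ℝ} (ha : 0 ≤ a)
    (hW : IsReg a W) (r : ℝ) :
    ∃ (N : ℕ) (C : ℝ), 0 ≤ C ∧ ∀ χ, S.IsTest o χ → (∀ τ, r < |τ| → χ τ = 0) → ∀ B : ℝ≥0,
      (∀ a ≤ N, ∀ n ≤ N, ∀ k ≤ N, S.testSeminorm o a n k χ ≤ B) → ∀ t, 0 < t → t ≤ 1 →
        crvNorm W (opK (S.rop R t) (scaled n t) χ) ≤ ENNReal.ofReal (C * B * t ^ κ) := by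
  obtain ⟨N₀, C₀, hC₀, h₀⟩ := exists_wn_test_le (S := S) hμ o hW r
  rcases hg with hg | hg
  · choose C hC0 hC using fun i =>
      exists_wn_ert_le (S := S) hμ R.I (R.q + i) κ (by omega) ha
    set A := ∫ x, |n x| with hA
    have hA0 : 0 ≤ A := integral_nonneg fun _ => abs_nonneg _
    refine ⟨max N₀ (κ + 1), ∑ i ∈ Finset.range R.c, |R.a i| * (A * (2 * max r 0 * (C i * C₀))),
      Finset.sum_nonneg fun i _ => ?_, fun χ hχ hs B hB t ht ht1 => ?_⟩
    · have := hC0 i; positivity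
    have hk := hn.isKer ht
    have hone : WB a 1 (ContinuousLinearMap.id ℝ (Lp ℝ 2 μ)) := WB.one a
    have key : ∀ i, crvNorm W (opK (S.ert R.I (R.q + i) t) (scaled n t) χ) ≤
        ENNReal.ofReal (A * (2 * max r 0 * (C i * C₀) * B * t ^ κ)) := by
      intro i
      set T := S.ert R.I (R.q + i) t with hT
      have hcv : IsCurve fun τ => T.adjoint (χ τ) :=
        ⟨T.adjoint.continuous.comp hχ.isCurve.cont, hχ.compact.comp_left (map_zero _)⟩
      have e : opK T (scaled n t) χ =
          opK (ContinuousLinearMap.id ℝ (Lp ℝ 2 μ)) (scaled n t) fun τ => T.adjoint (χ τ) := by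
        funext σ
        have hid : ∀ v : Lp ℝ 2 μ, (ContinuousLinearMap.id ℝ (Lp ℝ 2 μ)).adjoint v = v := fun v =>
          ext_inner_left ℝ fun u => by simp [ContinuousLinearMap.adjoint_inner_right]
        simp only [opK, hid]
        rw [← ContinuousLinearMap.integral_comp_comm _
          (integrable_smul_curve hk.cont hχ.isCurve σ)]
        simp only [map_smul]
      rw [e]
      refine (crvNorm_opK_le hone hW hk.cont hk.causal hcv).trans ?_
      rw [hk.lintegral_eq, integral_abs_scaled n ht, ENNReal.ofReal_one, one_mul,
        ENNReal.ofReal_mul hA0]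
      gcongr
      have hwn : ∀ τ, wn 1 (fun x => W (x, τ)) (T.adjoint (χ τ)) ≤
          ENNReal.ofReal (C i * t ^ κ * (C₀ * B)) := by
        intro τ
        refine hC i t ht ht1 _ (hW.wt τ) (χ τ) (hχ.domain (κ + 1) τ) (C₀ * B) fun j hj => ?_
        have h1 := h₀ χ hχ hs 0 j τ
        rw [iteratedDeriv_zero] at h1
        refine h1.trans ?_
        rw [ENNReal.ofReal_mul hC₀, ENNReal.ofReal_coe_nnreal]
        gcongr
        exact hB N₀ (le_max_left _ _) 0 (Nat.zero_le _) j (hj.trans (le_max_right _ _))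
      refine (crvNorm_le_of_support (r := max r 0) hwn fun τ hτ => ?_).trans ?_
      · rw [hs τ ((le_max_left _ _).trans_lt hτ), map_zero]
      · rw [← ENNReal.ofReal_mul (by positivity)]
        exact ENNReal.ofReal_le_ofReal (le_of_eq (by ring))
    have e : opK (S.rop R t) (scaled n t) χ = ∑ i ∈ Finset.range R.c,
        R.a i • opK (S.ert R.I (R.q + i) t) (scaled n t) χ := opK_sum_left _ _ _
    rw [e]
    refine (crvNorm_sum_le hW _ _ fun i _ => hχ.isCurve.opK hk _).2.trans ?_
    calc _ ≤ ∑ i ∈ Finset.range R.c, ENNReal.ofReal (|R.a i| *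
          (A * (2 * max r 0 * (C i * C₀) * B * t ^ κ))) := by
          refine Finset.sum_le_sum fun i _ => ?_
          rw [ENNReal.ofReal_mul (abs_nonneg _), ← Real.norm_eq_abs, ofReal_norm]
          gcongr
          exact key i
      _ = _ := by
          rw [← ENNReal.ofReal_sum_of_nonneg]
          · congr 1
            rw [Finset.sum_mul, Finset.sum_mul]
            exact Finset.sum_congr rfl fun i _ => by ring
          · intro i _
            have := hC0 i
            positivity
  · obtain ⟨C₁, hC₁, h₁⟩ := exists_wB_rop (S := S) hμ R ha
    obtain ⟨A, hA0, hA⟩ := hn.exists_bound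
    refine ⟨max N₀ κ, 2 * (max r 0 + 4) * (C₁ * (2 * 2 ^ κ * A * C₀)), by positivity,
      fun χ hχ hs B hB t ht ht1 => ?_⟩
    have hG : ∀ τ, wn 1 (fun x => W (x, τ)) (iteratedDeriv κ χ τ) ≤ ENNReal.ofReal (C₀ * B) := by
      intro τ
      refine (h₀ χ hχ hs κ 0 τ).trans ?_
      rw [ENNReal.ofReal_mul hC₀, ENNReal.ofReal_coe_nnreal]
      gcongr
      exact hB N₀ (le_max_left _ _) κ (le_max_right _ _) 0 (Nat.zero_le _)
    refine (crvNorm_le_of_support (r := max r 0 + 4)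
      (B := ENNReal.ofReal (C₁ * (2 * 2 ^ κ * A * t ^ κ * (C₀ * B)))) (fun σ => ?_)
      fun σ hσ => ?_).trans ?_
    · refine ((h₁ t ht (by linarith)).le _ (hW.wt σ) 1 (Or.inl rfl) _).trans ?_
      rw [ENNReal.ofReal_mul hC₁, ENNReal.ofReal_mul (by positivity)]
      gcongr
      exact wn_integral_moments_le hW hn hA hg hχ.isSmoothCurve ENNReal.ofReal_ne_top hG ht σ
    · exact opK_eq_zero_of_support (fun x hx => scaled_eq_zero_of_le hn ht (by linarith) hx)
        (fun τ hτ => hs τ ((le_max_left _ _).trans_lt hτ)) hσ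
    · rw [← ENNReal.ofReal_mul (by positivity)]
      exact ENNReal.ofReal_le_ofReal (le_of_eq (by ring))

/-- The gain from comparing the scale `t` with the scale `r`. -/
noncomputable def scaleGain (k κ : ℕ) (r t : ℝ) : ℝ :=
  if r ≤ t then (r / t) ^ ((k : ℝ) / 2) else (t / r) ^ κ

lemma exists_integral_kc_le {n : ℝ → ℝ} (hn : IsBump n) (b : ℕ) {κ : ℕ} (hκ : κ ≤ b)
    (hmom : ∀ i < κ, ∫ x, x ^ i * n x = 0) : ∃ C : ℝ, 0 ≤ C ∧ ∀ m, IsBump m → ∀ k ≤ b,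
      (∀ i < k, ∫ x, x ^ i * m x = 0) → (∀ i ≤ b, ∀ x, |iteratedDeriv i m x| ≤ 1) →
      ∀ r t, 0 < r → 0 < t → ∫ s, |kc (scaled m r) (scaled n t) s| ≤
        C * if r ≤ t then (r / t) ^ k else (t / r) ^ κ := by
  obtain ⟨G, hG0, hG⟩ := hn.exists_bound_iteratedDeriv b
  refine ⟨8 * 2 ^ b * G, by positivity, fun m hm k hk hmm hm1 r t hr ht => ?_⟩
  have h2 : ∀ j ≤ b, (2 : ℝ) ^ j ≤ 2 ^ b := fun j hj => pow_le_pow_right₀ (by norm_num) hj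
  split_ifs with h
  · refine (integral_abs_kc_le hm hn (A := 1) (fun x => by simpa using hm1 0 (Nat.zero_le _) x) hmm
      (hG k hk) hr h).trans ?_
    have := h2 k hk
    calc _ ≤ 8 * 2 ^ b * 1 * G * (r / t) ^ k := by gcongr
      _ = _ := by ring
  · rw [kc_comm]
    refine (integral_abs_kc_le hn hm (A := G) (fun x => by simpa using hG 0 (Nat.zero_le _) x) hmom
      (hm1 κ hκ) ht (not_le.1 h).le).trans ?_
    have := h2 κ hκ
    calc _ ≤ 8 * 2 ^ b * G * 1 * (t / r) ^ κ := by gcongr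
      _ = _ := by ring

lemma rpow_le_of_pow {x e : ℝ} {κ : ℕ} (hx0 : 0 < x) (hx : x ≤ 1) (h : (κ : ℝ) ≤ e) :
    x ^ e ≤ x ^ κ := by
  rw [← Real.rpow_natCast]
  exact Real.rpow_le_rpow_of_exponent_ge hx0 hx h

/-- Almost orthogonality of standard families and right families. -/
lemma exists_tn_rop_pre_le (hμ : VolumeDoubling μ) (R : RightFam ℓ₀) {n : ℝ → ℝ}
    (hn : IsBump n) {b κ : ℕ} (hκ : κ ≤ b) (hg : Gain R n κ) {a : ℝ} {W : M × ℝ → ℝ}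
    (ha : 0 ≤ a) (hW : IsReg a W) :
    ∃ C : ℝ, 0 ≤ C ∧ ∀ (Q : StdFamily ℓ₀) (k : ℕ), k ≤ 2 * b → Q.IsStGC b k →
      ∀ r t, 0 < r → r ≤ 1 → 0 < t → t ≤ 1 → ∀ χ : ℝ → Lp ℝ 2 μ, IsCurve χ → crvNorm W χ ≠ ∞ →
        tn W (opK (S.rop R t) (scaled n t) (opAdj (S.pre Q.J Q.n Q.c r) Q.m r χ)) ≤
          C * scaleGain k κ r t * tn W χ := by
  choose C₀ hC₀ hC using fun (J : List (Fin ℓ₀)) (p i : ℕ) =>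
    S.exists_wB_elt_comp_ert hμ J R.I p (R.q + i) ha
  set F : Finset (List (Fin ℓ₀)) := (List.finite_length_le (Fin ℓ₀) (2 * b)).toFinset with hF
  set C₁ : ℝ := ∑ J ∈ F, ∑ p ∈ Finset.range (2 * b), ∑ i ∈ Finset.range R.c, C₀ J p i with hC₁
  have hC₁0 : 0 ≤ C₁ := Finset.sum_nonneg fun J _ => Finset.sum_nonneg fun p _ =>
    Finset.sum_nonneg fun i _ => hC₀ J p i
  have hle : ∀ J ∈ F, ∀ p < 2 * b, ∀ i < R.c, C₀ J p i ≤ C₁ := fun J hJ p hp i hi => by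
    refine (Finset.single_le_sum (f := fun i => C₀ J p i) (fun i _ => hC₀ J p i)
      (Finset.mem_range.2 hi)).trans ?_
    refine (Finset.single_le_sum (f := fun p => ∑ i ∈ Finset.range R.c, C₀ J p i)
      (fun p _ => Finset.sum_nonneg fun i _ => hC₀ J p i) (Finset.mem_range.2 hp)).trans ?_
    exact Finset.single_le_sum (f := fun J => ∑ p ∈ Finset.range (2 * b),
      ∑ i ∈ Finset.range R.c, C₀ J p i) (fun J _ => Finset.sum_nonneg fun p _ =>
        Finset.sum_nonneg fun i _ => hC₀ J p i) hJ
  clear_value C₁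
  set A : ℝ := ∑ i ∈ Finset.range R.c, |R.a i| with hA
  have hA0 : 0 ≤ A := Finset.sum_nonneg fun i _ => abs_nonneg _
  obtain ⟨κ₁, κ₂, hκ₁, hκ₂, hm2, hmin⟩ : ∃ κ₁ κ₂ : ℕ, 2 * κ₁ ≤ R.I.length + 2 * R.q ∧ κ₂ ≤ b ∧
      (∀ i < κ₂, ∫ x, x ^ i * n x = 0) ∧ κ₁ + κ₂ = κ := by
    rcases hg with h | h
    · exact ⟨κ, 0, h, Nat.zero_le _, fun i hi => absurd hi (Nat.not_lt_zero i), rfl⟩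
    · exact ⟨0, κ, Nat.zero_le _, hκ, h, zero_add κ⟩
  obtain ⟨K, hK0, hK⟩ := exists_integral_kc_le hn b hκ₂ hm2
  refine ⟨b * A * C₁ * K, by positivity, fun Q k hk hQ r t hr hr1 ht ht1 χ hχ hfin => ?_⟩
  have hord := hQ.order
  have hc := hQ.c_le
  have hc1 := hQ.c_pos
  have hmb : IsBump Q.m := ⟨hQ.smooth, hQ.support⟩
  have kr := hmb.isKer hr
  have kt := hn.isKer ht
  set γ₁ : ℝ := if r ≤ t then (r / t) ^ ((Q.J.length : ℝ) / 2 + Q.n) else (t / r) ^ κ₁ with hγ₁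
  have hγ₁0 : 0 ≤ γ₁ := by rw [hγ₁]; split_ifs <;> positivity
  have hcomp : ∀ i < Q.c, ∀ j < R.c,
      WB a (C₁ * γ₁) ((S.elt Q.J (Q.n + i) r).comp (S.ert R.I (R.q + j) t)) := by
    intro i hi j hj
    refine (hC Q.J (Q.n + i) j r t hr hr1 ht ht1).mono ?_
    have hCle := hle Q.J (by rw [hF]; simp; omega) (Q.n + i) (by omega) j hj
    have hx0 : 0 < r / (r + t) := by positivity
    have hx1 : r / (r + t) ≤ 1 := by rw [div_le_one (by positivity)]; linarith
    have hy0 : 0 < t / (r + t) := by positivity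
    have hy1 : t / (r + t) ≤ 1 := by rw [div_le_one (by positivity)]; linarith
    have hX1 : (r / (r + t)) ^ ((Q.J.length : ℝ) / 2 + (Q.n + i : ℕ)) ≤ 1 :=
      Real.rpow_le_one hx0.le hx1 (by positivity)
    have hY1 : (t / (r + t)) ^ ((R.I.length : ℝ) / 2 + (R.q + j : ℕ)) ≤ 1 :=
      Real.rpow_le_one hy0.le hy1 (by positivity)
    have hX0 : 0 ≤ (r / (r + t)) ^ ((Q.J.length : ℝ) / 2 + (Q.n + i : ℕ)) := by positivity
    have hY0 : 0 ≤ (t / (r + t)) ^ ((R.I.length : ℝ) / 2 + (R.q + j : ℕ)) := by positivity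
    have hc0 := hC₀ Q.J (Q.n + i) j
    rw [mul_assoc]
    refine mul_le_mul hCle ?_ (by positivity) hC₁0
    rw [hγ₁]
    split_ifs with h
    · refine (mul_le_of_le_one_right hX0 hY1).trans ?_
      refine (Real.rpow_le_rpow_of_exponent_ge hx0 hx1 (z := (Q.J.length : ℝ) / 2 + Q.n)
        (by push_cast; linarith [(Nat.cast_nonneg i : (0 : ℝ) ≤ i)])).trans ?_
      refine Real.rpow_le_rpow hx0.le ?_ (by positivity)
      gcongr; linarith
    · refine (mul_le_of_le_one_left hY0 hX1).trans ?_
      refine (rpow_le_of_pow hy0 hy1 (κ := κ₁) ?_).trans ?_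
      · have : (2 * κ₁ : ℝ) ≤ R.I.length + 2 * R.q := by exact_mod_cast hκ₁
        push_cast
        linarith [(Nat.cast_nonneg j : (0 : ℝ) ≤ j)]
      · gcongr; linarith
  have hwb : WB a (b * A * C₁ * γ₁) ((S.pre Q.J Q.n Q.c r).comp (S.rop R t)) := by
    have e : (S.pre Q.J Q.n Q.c r).comp (S.rop R t) = ∑ i ∈ Finset.range Q.c,
        ∑ j ∈ Finset.range R.c, ((i.factorial : ℝ)⁻¹ * R.a j) •
          (S.elt Q.J (Q.n + i) r).comp (S.ert R.I (R.q + j) t) := by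
      rw [S.pre_eq hμ Q.J Q.n Q.c hr (by linarith)]
      ext1 u
      simp only [rop, ContinuousLinearMap.comp_apply, sum_apply, smul_apply, map_sum, map_smul,
        Finset.smul_sum, smul_smul]
      rw [Finset.sum_comm]
      simp only [mul_comm]
    rw [e]
    refine (WB.sum _ fun i hi => WB.sum _ fun j hj => (hcomp i (Finset.mem_range.1 hi) j
      (Finset.mem_range.1 hj)).smul _).mono ?_
    calc _ ≤ ∑ _i ∈ Finset.range Q.c, A * (C₁ * γ₁) := by
          refine Finset.sum_le_sum fun i _ => ?_
          rw [hA, Finset.sum_mul]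
          refine Finset.sum_le_sum fun j _ => ?_
          rw [abs_mul, abs_of_pos (by positivity)]
          have : ((i.factorial : ℝ))⁻¹ ≤ 1 :=
            inv_le_one_of_one_le₀ (by exact_mod_cast Nat.factorial_pos i)
          gcongr
          exact mul_le_of_le_one_left (abs_nonneg _) this
      _ = Q.c * (A * (C₁ * γ₁)) := by
          rw [Finset.sum_const, Finset.card_range, nsmul_eq_mul]
      _ ≤ b * (A * (C₁ * γ₁)) := by
          have : (Q.c : ℝ) ≤ b := by exact_mod_cast hc
          gcongr
      _ = _ := by ring
  rw [opAdj_eq, opK_opK kr kt hχ]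
  refine (tn_opK_le hwb hW (kr.kc kt) hχ hfin).trans ?_
  have hkc := hK Q.m hmb Q.k (by omega) hQ.moments hQ.bounded r t hr ht
  have hT := tn_nonneg W χ
  calc _ ≤ b * A * C₁ * γ₁ * (K * if r ≤ t then (r / t) ^ Q.k else (t / r) ^ κ₂) * tn W χ := by
        gcongr
    _ = b * A * C₁ * K * (γ₁ * if r ≤ t then (r / t) ^ Q.k else (t / r) ^ κ₂) * tn W χ := by ring
    _ = _ := by
        congr 2
        rw [hγ₁, scaleGain]
        split_ifs with h
        · rw [← Real.rpow_natCast, ← Real.rpow_add (by positivity)]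
          congr 1
          have : (Q.J.length : ℝ) + 2 * Q.n + 2 * Q.k = k := by exact_mod_cast hord
          linarith
        · rw [← pow_add, hmin]

end HeatSystem

end Parabolic

namespace Parabolic

section Duality

variable {α : Type*} [MeasurableSpace α] {ν : Measure α}

/-- Continuous functionals on `L¹` of a finite measure have bounded densities. -/
lemma exists_density [IsFiniteMeasure ν] (G : Lp ℝ 1 ν →L[ℝ] ℝ) :
    ∃ k : α → ℝ, Measurable k ∧ (∀ᵐ x ∂ν, |k x| ≤ ‖G‖) ∧ ∀ f, G f = ∫ x, k x * f x ∂ν := by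
  let j : Lp ℝ 2 ν →ₗ[ℝ] Lp ℝ 1 ν :=
    { toFun := fun f => ((Lp.memLp f).mono_exponent one_le_two).toLp _
      map_add' := fun f g => by
        refine Lp.ext ?_
        refine (MemLp.coeFn_toLp _).trans ((Lp.coeFn_add f g).trans ?_)
        refine EventuallyEq.trans ?_ (Lp.coeFn_add _ _).symm
        exact ((MemLp.coeFn_toLp _).add (MemLp.coeFn_toLp _)).symm
      map_smul' := fun r f => by
        refine Lp.ext ?_
        refine (MemLp.coeFn_toLp _).trans ((Lp.coeFn_smul r f).trans ?_)
        refine EventuallyEq.trans ?_ (Lp.coeFn_smul _ _).symm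
        exact ((MemLp.coeFn_toLp _).const_smul r).symm }
  have hj : ∀ f : Lp ℝ 2 ν, ⇑(j f) =ᵐ[ν] f := fun f =>
    MemLp.coeFn_toLp ((Lp.memLp f).mono_exponent one_le_two)
  set K : ℝ := (ν univ ^ (1 / 2 : ℝ)).toReal with hK
  have hjn : ∀ f : Lp ℝ 2 ν, ‖j f‖ ≤ K * ‖f‖ := fun f => by
    have h := eLpNorm_le_eLpNorm_mul_rpow_measure_univ (μ := ν) (one_le_two (α := ℝ≥0∞))
      (Lp.aestronglyMeasurable f)
    have e : (1 / (1 : ℝ≥0∞).toReal - 1 / (2 : ℝ≥0∞).toReal : ℝ) = 1 / 2 := by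
      simp; norm_num
    rw [e] at h
    have hfin : eLpNorm f 2 ν * ν univ ^ (1 / 2 : ℝ) ≠ ∞ :=
      ENNReal.mul_ne_top (Lp.memLp f).2.ne
        (ENNReal.rpow_ne_top_of_nonneg (by norm_num) (measure_ne_top _ _))
    have h1 := ENNReal.toReal_mono hfin h
    rw [ENNReal.toReal_mul] at h1
    rw [Lp.norm_def, Lp.norm_def, eLpNorm_congr_ae (hj f), mul_comm]
    exact h1
  set J := j.mkContinuous K hjn with hJ
  set k₀ := (InnerProductSpace.toDual ℝ (Lp ℝ 2 ν)).symm (G.comp J) with hk₀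
  have hk : ∀ f, inner ℝ k₀ f = G (j f) := fun f => by
    rw [hk₀, InnerProductSpace.toDual_symm_apply]; rfl
  have hkm : Measurable k₀ := (Lp.stronglyMeasurable k₀).measurable
  have hkint : Integrable k₀ ν := (Lp.memLp k₀).integrable one_le_two
  have hind : ∀ (s : Set α) (hs : MeasurableSet s) (c : ℝ),
      G (indicatorConstLp 1 hs (measure_ne_top ν s) c) = c * ∫ x in s, k₀ x ∂ν := by
    intro s hs c
    have e : j (indicatorConstLp 2 hs (measure_ne_top ν s) c) =
        indicatorConstLp 1 hs (measure_ne_top ν s) c :=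
      Lp.ext ((hj _).trans (indicatorConstLp_coeFn.trans indicatorConstLp_coeFn.symm))
    rw [← e, ← hk, real_inner_comm, L2.inner_indicatorConstLp_eq_setIntegral_inner,
      ← integral_const_mul]
    refine integral_congr_ae (Eventually.of_forall fun x => ?_)
    simp [mul_comm]
  have hle : ∀ s, MeasurableSet s → |∫ x in s, k₀ x ∂ν| ≤ ‖G‖ * ν.real s := by
    intro s hs
    have h := G.le_opNorm (indicatorConstLp 1 hs (measure_ne_top ν s) (1 : ℝ))
    rw [hind s hs 1, one_mul, Real.norm_eq_abs, norm_indicatorConstLp one_ne_zero ENNReal.one_ne_top]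
      at h
    simpa using h
  have hb : ∀ᵐ x ∂ν, |k₀ x| ≤ ‖G‖ := by
    have h1 : (k₀ : α → ℝ) ≤ᵐ[ν] fun _ => ‖G‖ :=
      ae_le_of_forall_setIntegral_le hkint (integrable_const _) fun s hs _ => by
        rw [setIntegral_const, smul_eq_mul, mul_comm]
        exact (le_abs_self _).trans (hle s hs)
    have h2 : (fun x => -k₀ x) ≤ᵐ[ν] fun _ => ‖G‖ :=
      ae_le_of_forall_setIntegral_le hkint.neg (integrable_const _) fun s hs _ => by
        rw [setIntegral_const, smul_eq_mul, mul_comm]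
        have := hle s hs
        simp only [Pi.neg_apply, integral_neg]
        exact (neg_le_abs _).trans this
    filter_upwards [h1, h2] with x a1 a2
    exact abs_le.2 ⟨by linarith, a1⟩
  have hI : ∀ f : Lp ℝ 1 ν, Integrable (fun x => k₀ x * f x) ν := fun f =>
    (L1.integrable_coeFn f).bdd_mul hkm.aestronglyMeasurable (by simpa using hb)
  refine ⟨k₀, hkm, hb, fun f => ?_⟩
  induction f using Lp.induction ENNReal.one_ne_top with
  | @indicatorConst c s hs hνs =>
    rw [Lp.simpleFunc.coe_indicatorConst]
    refine (hind _ hs c).trans ?_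
    rw [← integral_const_mul, ← integral_indicator hs]
    refine integral_congr_ae ?_
    filter_upwards [indicatorConstLp_coeFn (p := 1) (hs := hs) (hμs := hνs.ne) (c := c)] with x hx
    rw [hx]
    by_cases h : x ∈ s
    · rw [indicator_of_mem h, indicator_of_mem h, mul_comm]
    · rw [indicator_of_notMem h, indicator_of_notMem h, mul_zero]
  | add hf hg hdisj h1 h2 =>
    rw [map_add, h1, h2, ← integral_add (hI _) (hI _)]
    refine integral_congr_ae ?_
    filter_upwards [Lp.coeFn_add (hf.toLp _) (hg.toLp _)] with x hx
    rw [hx, Pi.add_apply, mul_add]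
  | isClosed =>
    refine isClosed_eq G.continuous ?_
    have hlip : ∀ f g : Lp ℝ 1 ν, dist (∫ x, k₀ x * f x ∂ν) (∫ x, k₀ x * g x ∂ν) ≤
        ‖G‖ * dist f g := by
      intro f g
      rw [Real.dist_eq, ← integral_sub (hI f) (hI g), dist_eq_norm, L1.norm_eq_integral_norm,
        ← integral_const_mul]
      refine abs_integral_le_integral_abs.trans (integral_mono_ae ((hI f).sub (hI g)).abs
        ((L1.integrable_coeFn _).norm.const_mul _) ?_)
      filter_upwards [hb, Lp.coeFn_sub f g] with x a1 a2
      rw [a2, Pi.sub_apply, ← mul_sub, abs_mul, Real.norm_eq_abs]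
      gcongr
    exact (LipschitzWith.of_dist_le_mul (K := ‖G‖₊) hlip).continuous

/-- Functionals of functions that are bounded in `L¹(W)` are given by a function bounded by `W`. -/
lemma exists_density_of_linear [SigmaFinite ν] {V : Type*} [AddCommGroup V] [Module ℝ V]
    (F : V →ₗ[ℝ] ℝ) (X : V → α → ℝ) {W : α → ℝ} (hW : Measurable W) (hW0 : ∀ x, 0 < W x)
    (hX : ∀ v, Integrable (fun x => W x * X v x) ν)
    (hadd : ∀ v v', X (v + v') =ᵐ[ν] X v + X v') (hsmul : ∀ (r : ℝ) v, X (r • v) =ᵐ[ν] r • X v)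
    {B : ℝ} (hB0 : 0 ≤ B) (hB : ∀ v, |F v| ≤ B * ∫ x, |W x * X v x| ∂ν) :
    ∃ U : α → ℝ, Measurable U ∧ (∀ᵐ x ∂ν, |U x| ≤ B * W x) ∧
      ∀ v, F v = ∫ x, U x * X v x ∂ν := by
  obtain ⟨g, hg0, hgm, hg1⟩ := exists_pos_lintegral_lt_of_sigmaFinite ν one_ne_zero
  set m := ν.withDensity fun x => (g x : ℝ≥0∞) with hm
  have hfin : IsFiniteMeasure m := isFiniteMeasure_withDensity (hg1.trans ENNReal.one_lt_top).ne
  have hac : m ≪ ν := withDensity_absolutelyContinuous _ _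
  have hgne : ∀ x, (g x : ℝ) ≠ 0 := fun x => by exact_mod_cast (hg0 x).ne'
  set Y : V → α → ℝ := fun v x => (g x : ℝ)⁻¹ * (W x * X v x) with hY
  have hYg : ∀ v x, g x • Y v x = W x * X v x := fun v x => by
    rw [hY, NNReal.smul_def, smul_eq_mul, mul_inv_cancel_left₀ (hgne x)]
  have hYint : ∀ v, Integrable (Y v) m := fun v => by
    rw [hm, integrable_withDensity_iff_integrable_smul hgm]
    simpa only [hYg] using hX v
  let j : V →ₗ[ℝ] Lp ℝ 1 m :=
    { toFun := fun v => (memLp_one_iff_integrable.2 (hYint v)).toLp _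
      map_add' := fun v v' => by
        refine Lp.ext ((MemLp.coeFn_toLp _).trans ?_)
        refine EventuallyEq.trans ?_ (Lp.coeFn_add _ _).symm
        refine EventuallyEq.trans ?_ ((MemLp.coeFn_toLp _).add (MemLp.coeFn_toLp _)).symm
        filter_upwards [hac.ae_le (hadd v v')] with x hx
        simp only [hY, hx, Pi.add_apply]; ring
      map_smul' := fun r v => by
        refine Lp.ext ((MemLp.coeFn_toLp _).trans ?_)
        refine EventuallyEq.trans ?_ (Lp.coeFn_smul _ _).symm
        refine EventuallyEq.trans ?_ ((MemLp.coeFn_toLp _).const_smul r).symm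
        filter_upwards [hac.ae_le (hsmul r v)] with x hx
        simp only [hY, hx, Pi.smul_apply, smul_eq_mul, RingHom.id_apply]; ring }
  have hj : ∀ v, ⇑(j v) =ᵐ[m] Y v := fun v =>
    MemLp.coeFn_toLp (memLp_one_iff_integrable.2 (hYint v))
  have hjn : ∀ v, ‖j v‖ = ∫ x, |W x * X v x| ∂ν := fun v => by
    have e : (fun x => ‖j v x‖) =ᵐ[m] fun x => ‖Y v x‖ := (hj v).fun_comp norm
    rw [L1.norm_eq_integral_norm, integral_congr_ae e, hm,
      integral_withDensity_eq_integral_smul hgm]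
    refine integral_congr_ae (Eventually.of_forall fun x => ?_)
    simp only [Function.comp, ← hYg, NNReal.smul_def, smul_eq_mul, abs_mul, NNReal.abs_eq,
      Real.norm_eq_abs]
  have hker : LinearMap.ker j ≤ LinearMap.ker F := fun v hv => by
    rw [LinearMap.mem_ker] at hv ⊢
    have h := hB v
    rw [← hjn, hv, norm_zero, mul_zero] at h
    exact abs_nonpos_iff.1 h
  set G₀ : LinearMap.range j →ₗ[ℝ] ℝ :=
    ((LinearMap.ker j).liftQ F hker).comp j.quotKerEquivRange.symm.toLinearMap with hG₀
  have hG₀j : ∀ v, G₀ ⟨j v, LinearMap.mem_range_self j v⟩ = F v := fun v => by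
    rw [hG₀, LinearMap.comp_apply, LinearEquiv.coe_coe,
      LinearMap.quotKerEquivRange_symm_apply_image]
    rfl
  have hG₀b : ∀ y, ‖G₀ y‖ ≤ B * ‖y‖ := by
    rintro ⟨y, v, rfl⟩
    rw [hG₀j, Real.norm_eq_abs]
    refine (hB v).trans_eq ?_
    rw [← hjn]; rfl
  obtain ⟨G, hG, hGn⟩ := exists_extension_norm_eq (LinearMap.range j) (G₀.mkContinuous B hG₀b)
  obtain ⟨k, hkm, hkb, hk⟩ := exists_density G
  have hGB : ‖G‖ ≤ B := hGn.le.trans (LinearMap.mkContinuous_norm_le _ hB0 _)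
  refine ⟨fun x => k x * W x, hkm.mul hW, ?_, fun v => ?_⟩
  · have hkb' := (ae_withDensity_iff hgm.coe_nnreal_ennreal).1 hkb
    filter_upwards [hkb'] with x hx
    rw [abs_mul, abs_of_pos (hW0 x)]
    have := (hx (by simpa using (hg0 x).ne')).trans hGB
    have := (hW0 x).le
    gcongr
  · have h1 := hG ⟨j v, LinearMap.mem_range_self j v⟩
    rw [LinearMap.mkContinuous_apply, hG₀j] at h1
    have e : (fun x => k x * j v x) =ᵐ[m] fun x => k x * Y v x := by
      filter_upwards [hj v] with x hx
      rw [hx]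
    rw [← h1, hk, integral_congr_ae e, hm, integral_withDensity_eq_integral_smul hgm]
    refine integral_congr_ae (Eventually.of_forall fun x => ?_)
    simp only []
    rw [mul_comm (k x) (Y v x), ← smul_mul_assoc, hYg]
    ring

lemma setIntegral_eq_zero_of_rectangles {α β : Type*} [MeasurableSpace α] [MeasurableSpace β]
    {ν : Measure (α × β)} {f : α × β → ℝ} (hf : Integrable f ν)
    (h : ∀ s t, MeasurableSet s → MeasurableSet t → ∫ e in s ×ˢ t, f e ∂ν = 0) : f =ᵐ[ν] 0 := by
  have huniv : ∫ e, f e ∂ν = 0 := by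
    have := h univ univ MeasurableSet.univ MeasurableSet.univ
    rwa [univ_prod_univ, setIntegral_univ] at this
  have key : ∀ S, MeasurableSet S → ∫ e in S, f e ∂ν = 0 := by
    intro S hS
    induction S, hS using MeasurableSpace.induction_on_inter generateFrom_prod.symm
      isPiSystem_prod with
    | empty => simp
    | basic t ht =>
      obtain ⟨a, ha, b, hb, rfl⟩ := ht
      exact h a b ha hb
    | compl t ht ih =>
      have := integral_add_compl ht hf
      rwa [ih, huniv, zero_add] at this
    | iUnion g hd hm ih =>
      rw [integral_iUnion hm hd hf.integrableOn]
      simp [ih]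
  exact hf.ae_eq_zero_of_forall_setIntegral_eq_zero fun S hS _ => key S hS

end Duality

end Parabolic

namespace Parabolic

variable {M : Type*} [MetricSpace M] [MeasurableSpace M] {μ : Measure M} {ℓ₀ : ℕ}
  [BorelSpace M] [SecondCountableTopology M]

section Joint

variable [SigmaFinite μ] {χ χ' : ℝ → Lp ℝ 2 μ}

lemma ae_eq_of_slices {X X' : M × ℝ → ℝ} (hX : Measurable X) (hX' : Measurable X')
    (h : ∀ τ, (fun x => X (x, τ)) =ᵐ[μ] fun x => X' (x, τ)) : X =ᵐ[μ.prod volume] X' := by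
  have hm : Measurable fun e => ‖X e - X' e‖ₑ := (hX.sub hX').enorm
  have h0 : ∫⁻ e, ‖X e - X' e‖ₑ ∂(μ.prod volume) = 0 := by
    rw [lintegral_prod_symm' _ hm]
    refine (lintegral_congr fun τ => ?_).trans lintegral_zero
    refine (lintegral_eq_zero_iff (hm.comp measurable_prodMk_right)).2 ?_
    filter_upwards [h τ] with x hx
    simp [hx]
  rw [lintegral_eq_zero_iff hm] at h0
  filter_upwards [h0] with e he
  simpa [sub_eq_zero] using he

lemma tn_eq {X : M × ℝ → ℝ} (hXm : Measurable X) (hX : ∀ τ, (fun x => X (x, τ)) =ᵐ[μ] χ τ)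
    {a : ℝ} {W : M × ℝ → ℝ} (hW : IsReg a W) :
    tn W χ = ∫ e, |W e * X e| ∂(μ.prod volume) := by
  unfold tn
  rw [crvNorm_eq hXm hX hW]
  exact (integral_norm_eq_lintegral_enorm (hW.measurable.mul hXm).aestronglyMeasurable).symm

lemma BddBy.mono {W W' : M × ℝ → ℝ} {N N' : ℝ} {u : M × ℝ → ℝ} (hu : BddBy μ W N u)
    (h : ∀ e, N * W e ≤ N' * W' e) : BddBy μ W' N' u :=
  ⟨hu.meas, hu.le.mono fun e he => he.trans (h e)⟩

lemma BddBy.congr {W : M × ℝ → ℝ} {N : ℝ} {u u' : M × ℝ → ℝ} (hu : BddBy μ W N u)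
    (h : u' =ᵐ[μ.prod volume] u) : BddBy μ W N u' :=
  ⟨hu.meas.congr h.symm, by filter_upwards [hu.le, h] with e a1 a2; rwa [a2]⟩

lemma BddBy.mul {W W' : M × ℝ → ℝ} {N N' : ℝ} {u u' : M × ℝ → ℝ}
    (hu : BddBy μ W N u) (hu' : BddBy μ W' N' u') : BddBy μ (W * W') (N * N') (u * u') :=
  ⟨hu.meas.mul hu'.meas, by
    filter_upwards [hu.le, hu'.le] with e a1 a2
    rw [Pi.mul_apply, Pi.mul_apply, abs_mul]
    have := mul_le_mul a1 a2 (abs_nonneg _) ((abs_nonneg _).trans a1)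
    linarith⟩

lemma BddBy.sub {W : M × ℝ → ℝ} {N N' : ℝ} {u u' : M × ℝ → ℝ}
    (hu : BddBy μ W N u) (hu' : BddBy μ W N' u') : BddBy μ W (N + N') (u - u') :=
  ⟨hu.meas.sub hu'.meas, by
    filter_upwards [hu.le, hu'.le] with e a1 a2
    rw [Pi.sub_apply]
    have := abs_sub (u e) (u' e)
    linarith⟩

end Joint

lemma wn_indicatorConstLp_ne_top (o : M) {a : ℝ} {w : M → ℝ} (hw : IsWt a w) {p : ℝ≥0∞}
    {A : Set M} (hA : MeasurableSet A) (hμA : μ A ≠ ∞) {r : ℝ} (hAr : A ⊆ Metric.ball o r) :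
    wn p w (indicatorConstLp 2 hA hμA (1 : ℝ)) ≠ ∞ := by
  set C := Real.exp (a * r) * w o with hC
  have h : ∀ᵐ x ∂μ, ‖w x * (indicatorConstLp 2 hA hμA (1 : ℝ)) x‖ ≤
      ‖A.indicator (fun _ => C) x‖ := by
    filter_upwards [indicatorConstLp_coeFn (p := 2) (hs := hA) (hμs := hμA) (c := (1 : ℝ))]
      with x hx
    rw [hx]
    by_cases hxA : x ∈ A
    · rw [indicator_of_mem hxA, indicator_of_mem hxA, mul_one, Real.norm_of_nonneg (hw.pos x).le,
        Real.norm_of_nonneg (mul_pos (Real.exp_pos _) (hw.pos o)).le]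
      have h1 := hw.nonneg
      have h2 := (hw.pos o).le
      have h3 : dist x o ≤ r := (Metric.mem_ball.1 (hAr hxA)).le
      exact (hw.le x o).trans (by gcongr)
    · simp [indicator_of_notMem hxA]
  exact ((memLp_indicator_const p hA C (Or.inr hμA)).2.trans_le'
    (eLpNorm_mono_ae h)).ne

namespace HeatSystem

variable {S : HeatSystem μ ℓ₀} {o : M}

/-- The space of test functions. -/
def tests (S : HeatSystem μ ℓ₀) (o : M) : Submodule ℝ (ℝ → Lp ℝ 2 μ) where
  carrier := {χ | S.IsTest o χ}
  add_mem' h h' := h.add h'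
  zero_mem' := IsTest.zero
  smul_mem' r _ h := h.smul r

variable [SigmaFinite μ]

/-- Functionals that are bounded in `L¹(W)` are functions bounded by `W`. -/
lemma IsLin.exists_repr (hμ : VolumeDoubling μ) {F : (ℝ → Lp ℝ 2 μ) → ℝ} (hF : S.IsLin o F)
    {a B : ℝ} {W : M × ℝ → ℝ} (hW : IsReg a W) (hB0 : 0 ≤ B)
    (hB : ∀ χ, S.IsTest o χ → |F χ| ≤ B * tn W χ) :
    ∃ U, S.IsRepr o F U ∧ BddBy μ W B U := by
  choose X hXm hX using fun v : S.tests o => (show S.IsTest o v.1 from v.2).isCurve.exists_joint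
  have hint : ∀ v, Integrable (fun e => W e * X v e) (μ.prod volume) := fun v =>
    ⟨(hW.measurable.mul (hXm v)).aestronglyMeasurable, by
      have h := (show S.IsTest o v.1 from v.2).crvNorm_ne_top hμ hW
      rw [crvNorm_eq (hXm v) (hX v) hW] at h
      exact h.lt_top⟩
  obtain ⟨U, hUm, hUb, hU⟩ := exists_density_of_linear (ν := μ.prod (volume : Measure ℝ))
    (V := S.tests o)
    { toFun := fun v => F v.1
      map_add' := fun v v' => hF.add _ _ v.2 v'.2
      map_smul' := fun r v => hF.smul r _ v.2 } X hW.measurable hW.pos hint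
    (fun v v' => ae_eq_of_slices (hXm _) ((hXm v).add (hXm v')) fun τ => by
      filter_upwards [hX (v + v') τ, hX v τ, hX v' τ, Lp.coeFn_add (v.1 τ) (v'.1 τ)]
        with x a1 a2 a3 a4
      rw [a1, Pi.add_apply, a2, a3, Submodule.coe_add, Pi.add_apply v.1, a4, Pi.add_apply])
    (fun r v => ae_eq_of_slices (hXm _) ((hXm v).const_smul r) fun τ => by
      filter_upwards [hX (r • v) τ, hX v τ, Lp.coeFn_smul r (v.1 τ)] with x a1 a2 a4
      rw [a1, Pi.smul_apply, a2, Submodule.coe_smul, Pi.smul_apply r v.1, a4, Pi.smul_apply])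
    hB0 (fun v => (hB v.1 v.2).trans_eq (by rw [tn_eq (hXm v) (hX v) hW]))
  have hUB : BddBy μ W B U := ⟨hUm.aestronglyMeasurable, hUb⟩
  refine ⟨U, ⟨hUm.aestronglyMeasurable, fun χ hχ => ?_⟩, hUB⟩
  rw [(hUB.pair_eq hW (hχ.crvNorm_ne_top hμ hW) (hXm ⟨χ, hχ⟩) (hX ⟨χ, hχ⟩)).2.1]
  exact hU ⟨χ, hχ⟩

lemma isTest_smul_T_adjoint (hμ : VolumeDoubling μ) {η : ℝ → ℝ}
    (hη : ContDiff ℝ ((⊤ : ℕ∞) : WithTop ℕ∞) η) (hηc : HasCompactSupport η) {s : ℝ} (hs : 0 < s)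
    (hs2 : s ≤ 2) {g : Lp ℝ 2 μ}
    (hg : ∀ a : ℕ, wn 2 (fun x => Real.exp (a * dist o x)) g ≠ ∞) :
    S.IsTest o fun τ => η τ • (S.T s).adjoint g := by
  have hZ := S.chain_vlt hμ [] 0 hs hs2
  have h0 : (fun τ => η τ • (S.T s).adjoint g) = fun τ => (S.vlt [] (0 + 0) s).adjoint (η τ • g) := by
    funext τ
    rw [S.vlt_nil hμ _ hs hs2, S.opD_zero hμ hs hs2, map_smul]
  have hk : ∀ k, S.adjPow k (fun τ => η τ • (S.T s).adjoint g) =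
      fun τ => η τ • (S.vlt [] (0 + k) s).adjoint g := fun k => by
    funext τ
    rw [h0]
    exact (hZ.iterate_adjoint k _).trans (map_smul _ _ _)
  refine ⟨hηc.smul_right, fun k τ => ?_, fun k => ?_, fun a n k => ?_⟩
  · rw [congrFun h0 τ]; exact hZ.powDom_adjoint k _
  · rw [hk]; exact hη.smul contDiff_const
  · obtain ⟨C, -, hC⟩ := S.exists_wB_vlt hμ [] (0 + k) (Nat.cast_nonneg a)
    have hcn : HasCompactSupport (iteratedDeriv n η) := by
      induction n with
      | zero => simpa using hηc
      | succ n ih => rw [iteratedDeriv_succ]; exact ih.deriv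
    obtain ⟨K, hK⟩ := hcn.exists_bound_of_continuous
      (hη.continuous_iteratedDeriv n (by exact_mod_cast le_top))
    rw [testSeminorm_eq]
    have hwt := isWt_exp o (Nat.cast_nonneg (α := ℝ) a)
    have hfin : wn 2 (fun x => Real.exp (a * dist o x)) ((S.vlt [] (0 + k) s).adjoint g) ≠ ∞ :=
      ne_top_of_le_ne_top (ENNReal.mul_ne_top ENNReal.ofReal_ne_top (hg a))
        ((hC s hs hs2).le _ hwt 2 (Or.inr rfl) g)
    refine (iSup_le fun τ => ?_ : _ ≤ ENNReal.ofReal K *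
      wn 2 (fun x => Real.exp (a * dist o x)) ((S.vlt [] (0 + k) s).adjoint g)).trans_lt
        (ENNReal.mul_lt_top ENNReal.ofReal_lt_top hfin.lt_top)
    rw [hk, iteratedDeriv_smul_const ((hη.of_le (by exact_mod_cast le_top)).contDiffAt), wn_smul,
      ← ofReal_norm]
    gcongr
    exact hK τ

lemma integral_mul_eq_zero_of_T (hμ : VolumeDoubling μ) (o : M) {a C : ℝ} {w : M → ℝ}
    (hw : IsWt a w) (hC : 0 ≤ C) {U : M → ℝ} (hU : Measurable U) (hUb : ∀ᵐ x ∂μ, |U x| ≤ C * w x)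
    {g : Lp ℝ 2 μ} (hg : wn 1 (fun x => w x * Real.exp (1 * dist o x)) g ≠ ∞)
    {s : ℕ → ℝ} (hs : ∀ n, 0 < s n ∧ s n ≤ 2) (hs0 : Tendsto s atTop (𝓝[>] 0))
    (h : ∀ n, ∫ x, U x * (S.T (s n)).adjoint g x ∂μ = 0) : ∫ x, U x * g x ∂μ = 0 := by
  set w' : M → ℝ := fun x => w x * Real.exp (1 * dist o x) with hw'
  have hwt' : IsWt (a + 1) w' := hw.mul (isWt_exp o zero_le_one)
  obtain ⟨C', hC'0, hC'⟩ := S.exists_wB_T hμ hwt'.nonneg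
  have hmeas : ∀ v : Lp ℝ 2 μ, AEStronglyMeasurable (fun x => U x * v x) μ := fun v =>
    hU.aestronglyMeasurable.mul (Lp.aestronglyMeasurable v)
  have hww' : ∀ x, w x ≤ w' x := fun x =>
    le_mul_of_one_le_right (hw.pos x).le (Real.one_le_exp (by positivity))
  have htail : ∀ (n : ℕ) (v : Lp ℝ 2 μ), wn 1 w' v ≠ ∞ →
      |∫ x, (Metric.ball o n).indicator U x * v x ∂μ - ∫ x, U x * v x ∂μ| ≤
        C * Real.exp (-n) * (wn 1 w' v).toReal := by
    intro n v hv
    have hb : ∀ᵐ x ∂μ, ‖((Metric.ball o n).indicator U x - U x) * v x‖ₑ ≤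
        ENNReal.ofReal (C * Real.exp (-n)) * ‖w' x * v x‖ₑ := by
      filter_upwards [hUb] with x hx
      rw [← ofReal_norm, ← ofReal_norm, ← ENNReal.ofReal_mul (by positivity)]
      refine ENNReal.ofReal_le_ofReal ?_
      rw [norm_mul, norm_mul, Real.norm_of_nonneg (hwt'.pos x).le, ← mul_assoc]
      gcongr
      by_cases hxn : x ∈ Metric.ball o n
      · rw [indicator_of_mem hxn, sub_self, norm_zero]
        have := (hwt'.pos x).le
        positivity
      · rw [indicator_of_notMem hxn, zero_sub, norm_neg, Real.norm_eq_abs]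
        refine hx.trans ?_
        have h1 : (n : ℝ) ≤ dist o x := by
          rw [Metric.mem_ball, not_lt, dist_comm] at hxn; exact hxn
        have h2 : 1 ≤ Real.exp (-n) * Real.exp (1 * dist o x) := by
          rw [← Real.exp_add]; exact Real.one_le_exp (by linarith)
        have h3 := (hw.pos x).le
        calc C * w x ≤ C * w x * (Real.exp (-n) * Real.exp (1 * dist o x)) :=
              le_mul_of_one_le_right (by positivity) h2
          _ = _ := by rw [hw']; ring
    have hle : ∫⁻ x, ‖((Metric.ball o n).indicator U x - U x) * v x‖ₑ ∂μ ≤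
        ENNReal.ofReal (C * Real.exp (-n)) * wn 1 w' v := by
      refine (lintegral_mono_ae hb).trans_eq ?_
      rw [lintegral_const_mul' _ _ ENNReal.ofReal_ne_top, wn, eLpNorm_one_eq_lintegral_enorm]
    have hI : Integrable (fun x => U x * v x) μ := by
      have h1 : MemLp (fun x => w' x * v x) 1 μ := ⟨hwt'.continuous.aestronglyMeasurable.mul
        (Lp.aestronglyMeasurable v), hv.lt_top⟩
      refine ((memLp_one_iff_integrable.1 h1).norm.const_mul C).mono' (hmeas v) ?_
      filter_upwards [hUb] with x hx
      rw [norm_mul, norm_mul, Real.norm_of_nonneg (hwt'.pos x).le, ← mul_assoc]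
      gcongr
      exact hx.trans (by gcongr; exact hww' x)
    have hI' : Integrable (fun x => (Metric.ball o n).indicator U x * v x) μ := by
      refine hI.mono ((hU.indicator Metric.isOpen_ball.measurableSet).aestronglyMeasurable.mul
        (Lp.aestronglyMeasurable v)) (Eventually.of_forall fun x => ?_)
      rw [norm_mul, norm_mul]
      gcongr
      exact norm_indicator_le_norm_self _ _
    rw [← integral_sub hI' hI]
    have h1 := ENNReal.toReal_mono (ENNReal.mul_ne_top ENNReal.ofReal_ne_top hv)
      ((enorm_integral_le_lintegral_enorm _).trans hle)
    rw [toReal_enorm, ENNReal.toReal_mul, ENNReal.toReal_ofReal (by positivity),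
      Real.norm_eq_abs] at h1
    simpa only [sub_mul] using h1
  set K := (wn 1 w' g).toReal with hK
  have hmain : ∀ n : ℕ, |∫ x, U x * g x ∂μ| ≤ C * (C' + 1) * K * Real.exp (-n) := by
    intro n
    have hmem : MemLp ((Metric.ball o n).indicator U) 2 μ := by
      have hfin : μ (Metric.ball o n) ≠ ∞ := by
        rcases Nat.eq_zero_or_pos n with rfl | hn
        · simp
        · exact (hμ.1 o n (by exact_mod_cast hn)).2.ne
      refine (memLp_indicator_const 2 Metric.isOpen_ball.measurableSet
        (C * (Real.exp (a * n) * w o)) (Or.inr hfin)).mono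
        (hU.indicator Metric.isOpen_ball.measurableSet).aestronglyMeasurable ?_
      filter_upwards [hUb] with x hx
      by_cases hxn : x ∈ Metric.ball o n
      · rw [indicator_of_mem hxn, indicator_of_mem hxn, Real.norm_eq_abs]
        refine hx.trans ((mul_le_mul_of_nonneg_left ?_ hC).trans (le_abs_self _))
        have h1 := hw.nonneg
        have h2 := (hw.pos o).le
        have h3 : dist x o ≤ n := (Metric.mem_ball.1 hxn).le
        exact (hw.le x o).trans (by gcongr)
      · simp [indicator_of_notMem hxn]
    set Ψ : Lp ℝ 2 μ := hmem.toLp _ with hΨ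
    have hin : ∀ v : Lp ℝ 2 μ, inner ℝ Ψ v = ∫ x, (Metric.ball o n).indicator U x * v x ∂μ := by
      intro v
      rw [L2.inner_def]
      refine integral_congr_ae ?_
      filter_upwards [hmem.coeFn_toLp] with x hx
      rw [hΨ, hx]; simp [mul_comm]
    have hlim : Tendsto (fun k => inner ℝ Ψ ((S.T (s k)).adjoint g)) atTop
        (𝓝 (inner ℝ Ψ g)) := by
      have := ((S.T_continuous Ψ).comp hs0).inner (𝕜 := ℝ) (tendsto_const_nhds (x := g))
      refine this.congr fun k => ?_
      rw [ContinuousLinearMap.adjoint_inner_right, Function.comp_apply]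
    have hb : ∀ k, |inner ℝ Ψ ((S.T (s k)).adjoint g)| ≤ C * Real.exp (-n) * (C' * K) := by
      intro k
      have hle := (hC' (s k) (hs k).1 (hs k).2).le w' hwt' 1 (Or.inl rfl) g
      have hfin := ENNReal.mul_ne_top (ENNReal.ofReal_ne_top (r := C')) hg
      have h1 := htail n _ (ne_top_of_le_ne_top hfin hle)
      rw [h k, sub_zero, ← hin] at h1
      refine h1.trans ?_
      gcongr
      have h2 := ENNReal.toReal_mono hfin hle
      rwa [ENNReal.toReal_mul, ENNReal.toReal_ofReal hC'0] at h2
    have h1 := le_of_tendsto' hlim.abs hb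
    have h2 := htail n g hg
    rw [← hin] at h2
    have h3 := abs_sub_abs_le_abs_sub (∫ x, U x * g x ∂μ) (inner ℝ Ψ g)
    rw [abs_sub_comm] at h3
    nlinarith
  have hlim : Tendsto (fun n : ℕ => C * (C' + 1) * K * Real.exp (-n)) atTop (𝓝 0) := by
    have := (Real.tendsto_exp_neg_atTop_nhds_zero.comp tendsto_natCast_atTop_atTop).const_mul
      (C * (C' + 1) * K)
    simpa using this
  exact abs_nonpos_iff.1 (ge_of_tendsto' hlim hmain)

end HeatSystem

end Parabolic

namespace Parabolic

variable {M : Type*} [MetricSpace M] [MeasurableSpace M] {μ : Measure M} {ℓ₀ : ℕ}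

lemma IsReg.isSpaceTimeWeight {a : ℝ} {W : M × ℝ → ℝ} (hW : IsReg a W) (h1 : ∀ e, 1 ≤ W e) :
    IsSpaceTimeWeight W :=
  ⟨h1, hW.mono, a, 1, fun x y τ => by
    have := (hW.wt τ).le x y
    rw [neg_mul, Real.exp_neg, ← div_eq_mul_inv, div_le_iff₀ (Real.exp_pos _)]
    linarith⟩

lemma wNorm_le_iff {ω u : M × ℝ → ℝ} (hω : ∀ e, 0 < ω e) {N : ℝ} (hN : 0 ≤ N) :
    wNorm μ ω u ≤ ENNReal.ofReal N ↔ ∀ᵐ e ∂(μ.prod volume), |u e| ≤ N * ω e := by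
  unfold wNorm eLpNormEssSup
  have key : ∀ e, ‖(ω e)⁻¹ * u e‖ₑ ≤ ENNReal.ofReal N ↔ |u e| ≤ N * ω e := fun e => by
    rw [← ofReal_norm, ENNReal.ofReal_le_ofReal_iff hN, norm_mul, norm_inv,
      Real.norm_of_nonneg (hω e).le, Real.norm_eq_abs, inv_mul_le_iff₀ (hω e), mul_comm]
  constructor
  · intro h
    filter_upwards [ae_le_essSup (μ := μ.prod volume) (f := fun e => ‖(ω e)⁻¹ * u e‖ₑ)] with e he
    exact (key e).1 (he.trans h)
  · intro h
    exact essSup_le_of_ae_le _ (h.mono fun e he => (key e).2 he)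

variable [BorelSpace M] [SecondCountableTopology M] [SigmaFinite μ]

lemma BddBy.integrable_mul {a N : ℝ} {W u : M × ℝ → ℝ} (hW : IsReg a W) (hu : Measurable u)
    (hub : ∀ᵐ e ∂(μ.prod volume), |u e| ≤ N * W e) {v : Lp ℝ 2 μ}
    (hv : ∀ τ, wn 1 (fun x => W (x, τ)) v ≠ ∞) :
    LocallyIntegrable (fun τ => ∫ x, u (x, τ) * v x ∂μ) := by
  have hvm : Measurable (v : M → ℝ) := (Lp.stronglyMeasurable v).measurable
  have hm : Measurable fun e : M × ℝ => u e * v e.1 := hu.mul (hvm.comp measurable_fst)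
  have hsm : AEStronglyMeasurable (fun τ => ∫ x, u (x, τ) * v x ∂μ) volume :=
    (hm.stronglyMeasurable.integral_prod_left' (μ := μ)).aestronglyMeasurable
  rw [locallyIntegrable_iff]
  intro K hK
  obtain ⟨r, hr⟩ := hK.isBounded.subset_closedBall (0 : ℝ)
  refine (Measure.integrableOn_of_bounded (M := (ENNReal.ofReal N *
    wn 1 (fun x => W (x, r)) v).toReal) (isCompact_Icc (a := -r) (b := r)).measure_ne_top hsm
      ?_).mono_set (by simpa [Real.closedBall_eq_Icc] using hr)
  have hub' : ∀ᵐ τ : ℝ, ∀ᵐ x ∂μ, |u (x, τ)| ≤ N * W (x, τ) := by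
    have hs : MeasurableSet {e : M × ℝ | |u e| ≤ N * W e} :=
      measurableSet_le (by simpa using hu.norm) (hW.measurable.const_mul N)
    exact Measure.ae_ae_comm (p := fun x τ => |u (x, τ)| ≤ N * W (x, τ)) hs |>.1
      (Measure.ae_ae_of_ae_prod hub)
  filter_upwards [ae_restrict_of_ae hub', ae_restrict_mem measurableSet_Icc] with τ hτ hmem
  rw [← toReal_enorm]
  refine ENNReal.toReal_mono (ENNReal.mul_ne_top ENNReal.ofReal_ne_top (hv r))
    ((enorm_integral_le_lintegral_enorm _).trans ?_)
  rw [wn, eLpNorm_one_eq_lintegral_enorm, ← lintegral_const_mul' _ _ ENNReal.ofReal_ne_top]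
  refine lintegral_mono_ae ?_
  filter_upwards [hτ] with x hx
  have hp := hW.pos (x, τ)
  have hN : 0 ≤ N := by
    have := (abs_nonneg _).trans hx
    by_contra hneg
    nlinarith
  rw [← ofReal_norm, ← ofReal_norm, ← ENNReal.ofReal_mul hN, norm_mul, norm_mul, ← mul_assoc,
    Real.norm_of_nonneg (hW.pos _).le, Real.norm_eq_abs (u _)]
  refine ENNReal.ofReal_le_ofReal ?_
  gcongr
  exact hx.trans (by gcongr; exact hW.mono x hmem.2)

namespace HeatSystem

variable {S : HeatSystem μ ℓ₀} {o : M}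

lemma pair_eq_zero_slice (hμ : VolumeDoubling μ) {a N : ℝ} {W u : M × ℝ → ℝ} (hW : IsReg a W)
    (hu : Measurable u) (hub : ∀ᵐ e ∂(μ.prod volume), |u e| ≤ N * W e) (hN : 0 ≤ N)
    (h : ∀ χ, S.IsTest o χ → pair u χ = 0) {g : Lp ℝ 2 μ}
    (hg : ∀ a w, IsWt a w → ∀ p, GoodExp p → wn p w g ≠ ∞) :
    ∀ᵐ τ : ℝ, ∫ x, u (x, τ) * g x ∂μ = 0 := by
  have hub' : ∀ᵐ τ : ℝ, ∀ᵐ x ∂μ, |u (x, τ)| ≤ N * W (x, τ) := by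
    have hs : MeasurableSet {e : M × ℝ | |u e| ≤ N * W e} :=
      measurableSet_le (by simpa using hu.norm) (hW.measurable.const_mul N)
    exact Measure.ae_ae_comm (p := fun x τ => |u (x, τ)| ≤ N * W (x, τ)) hs |>.1
      (Measure.ae_ae_of_ae_prod hub)
  have key : ∀ s, 0 < s → s ≤ 2 → ∀ᵐ τ : ℝ, ∫ x, u (x, τ) * (S.T s).adjoint g x ∂μ = 0 := by
    intro s hs hs2
    refine ae_eq_zero_of_integral_contDiff_smul_eq_zero
      (BddBy.integrable_mul hW hu hub fun τ => ?_) fun η hη hηc => ?_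
    · obtain ⟨C, -, hC⟩ := S.exists_wB_T hμ (hW.wt 0).nonneg
      exact ne_top_of_le_ne_top (ENNReal.mul_ne_top ENNReal.ofReal_ne_top
        (hg _ _ (hW.wt τ) 1 (Or.inl rfl))) ((hC s hs hs2).le _ (hW.wt τ) 1 (Or.inl rfl) g)
    · have h1 := h _ (isTest_smul_T_adjoint (o := o) hμ hη hηc hs hs2 (g := g) fun a =>
        hg _ _ (isWt_exp o (Nat.cast_nonneg a)) 2 (Or.inr rfl))
      rw [← h1]
      refine integral_congr_ae (Eventually.of_forall fun τ => ?_)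
      simp only [smul_eq_mul, ← integral_const_mul]
      refine integral_congr_ae ?_
      filter_upwards [Lp.coeFn_smul (η τ) ((S.T s).adjoint g)] with x hx
      rw [hx, Pi.smul_apply, smul_eq_mul]; ring
  have hs : ∀ n : ℕ, 0 < 1 / ((n : ℝ) + 1) ∧ 1 / ((n : ℝ) + 1) ≤ 2 := fun n =>
    ⟨by positivity, by
      rw [div_le_iff₀ (by positivity)]
      linarith [Nat.cast_nonneg (α := ℝ) n]⟩
  have hall : ∀ᵐ τ : ℝ, ∀ n : ℕ, ∫ x, u (x, τ) * (S.T (1 / ((n : ℝ) + 1))).adjoint g x ∂μ = 0 :=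
    ae_all_iff.2 fun n => key _ (hs n).1 (hs n).2
  filter_upwards [hub', hall] with τ h1 h2
  exact S.integral_mul_eq_zero_of_T hμ o (hW.wt τ) hN (hu.comp measurable_prodMk_right) h1
    (hg _ _ ((hW.wt τ).mul (isWt_exp o zero_le_one)) 1 (Or.inl rfl)) hs
    (tendsto_nhdsWithin_iff.2 ⟨tendsto_one_div_add_atTop_nhds_zero_nat,
      Eventually.of_forall fun n => (hs n).1⟩) h2

/-- Weighted bounded functions are determined by their pairings with test functions. -/
lemma ae_eq_zero_of_pair (hμ : VolumeDoubling μ) {a N : ℝ} {W u : M × ℝ → ℝ} (hW : IsReg a W)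
    (hu : BddBy μ W N u) (hN : 0 ≤ N) (h : ∀ χ, S.IsTest o χ → pair u χ = 0) :
    u =ᵐ[μ.prod volume] 0 := by
  obtain ⟨u', hu'm, huu'⟩ : ∃ u', Measurable u' ∧ u =ᵐ[μ.prod volume] u' :=
    ⟨hu.meas.mk u, hu.meas.stronglyMeasurable_mk.measurable, hu.meas.ae_eq_mk⟩
  have hb' : BddBy μ W N u' := hu.congr huu'.symm
  have h' : ∀ χ, S.IsTest o χ → pair u' χ = 0 := fun χ hχ => by
    obtain ⟨X, hXm, hX⟩ := hχ.isCurve.exists_joint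
    have hfin := hχ.crvNorm_ne_top hμ hW
    rw [← h χ hχ, (hu.pair_eq hW hfin hXm hX).2.1, (hb'.pair_eq hW hfin hXm hX).2.1]
    refine integral_congr_ae ?_
    filter_upwards [huu'] with e he
    rw [he]
  refine huu'.trans ?_
  set D : ℕ → Set (M × ℝ) := fun n => Metric.ball o (n + 1) ×ˢ Icc (-(n : ℝ)) n with hD
  have hDm : ∀ n, MeasurableSet (D n) := fun n =>
    Metric.isOpen_ball.measurableSet.prod measurableSet_Icc
  have hball : ∀ n : ℕ, μ (Metric.ball o (n + 1 : ℝ)) ≠ ∞ := fun n =>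
    (hμ.1 o _ (by positivity)).2.ne
  have hDfin : ∀ n, (μ.prod volume) (D n) ≠ ∞ := fun n => by
    rw [hD, Measure.prod_prod]
    exact ENNReal.mul_ne_top (hball n) (by simp)
  have hDu : ⋃ n, D n = univ := by
    refine eq_univ_of_forall fun e => ?_
    obtain ⟨n, hn⟩ := exists_nat_ge (max (dist e.1 o) |e.2|)
    refine mem_iUnion.2 ⟨n, ⟨?_, ?_⟩⟩
    · rw [Metric.mem_ball]
      linarith [le_max_left (dist e.1 o) |e.2|]
    · exact abs_le.1 ((le_max_right _ _).trans hn)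
  have hint : ∀ n, IntegrableOn u' (D n) (μ.prod volume) := fun n => by
    refine Measure.integrableOn_of_bounded (M := N * (Real.exp (a * (n + 1)) * W (o, n)))
      (hDfin n) hu'm.aestronglyMeasurable ?_
    filter_upwards [ae_restrict_of_ae hb'.le, ae_restrict_mem (hDm n)] with e he hmem
    rw [Real.norm_eq_abs]
    refine he.trans ?_
    gcongr
    have h1 := (hW.wt e.2).nonneg
    have h2 := (hW.pos (o, n)).le
    have h3 : dist e.1 o ≤ n + 1 := (Metric.mem_ball.1 hmem.1).le
    exact ((hW.mono e.1 hmem.2.2).trans ((hW.wt n).le e.1 o)).trans (by gcongr)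
  have hz : ∀ n, u' =ᵐ[(μ.prod volume).restrict (D n)] 0 := fun n => by
    refine setIntegral_eq_zero_of_rectangles (hint n) fun s t hs ht => ?_
    rw [Measure.restrict_restrict (hs.prod ht), prod_inter_prod]
    have hA : MeasurableSet (s ∩ Metric.ball o (n + 1 : ℝ)) := hs.inter Metric.isOpen_ball.measurableSet
    have hμA : μ (s ∩ Metric.ball o (n + 1 : ℝ)) ≠ ∞ :=
      ne_top_of_le_ne_top (hball n) (measure_mono inter_subset_right)
    have h0 := pair_eq_zero_slice hμ hW hu'm hb'.le hN h'
      (g := indicatorConstLp 2 hA hμA (1 : ℝ)) fun a w hw p hp =>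
        wn_indicatorConstLp_ne_top o hw hA hμA inter_subset_right
    rw [← Measure.prod_restrict, integral_prod_symm]
    · refine integral_eq_zero_of_ae (ae_restrict_of_ae ?_)
      filter_upwards [h0] with τ hτ
      rw [Pi.zero_apply, ← hτ, ← integral_indicator hA]
      refine integral_congr_ae ?_
      filter_upwards [indicatorConstLp_coeFn (p := 2) (hs := hA) (hμs := hμA) (c := (1 : ℝ))]
        with x hx
      rw [hx]
      by_cases hxA : x ∈ s ∩ Metric.ball o (n + 1 : ℝ) <;> simp [hxA]
    · rw [Measure.prod_restrict]
      exact (hint n).mono_set (prod_mono inter_subset_right inter_subset_right)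
  rw [← Measure.restrict_univ (μ := μ.prod (volume : Measure ℝ)), ← hDu]
  exact (ae_restrict_iUnion_iff _ _).2 hz

lemma exists_bddBy_of_wNorm {ω u : M × ℝ → ℝ} (hω : IsSpaceTimeWeight ω)
    (hu : AEStronglyMeasurable u (μ.prod volume)) (h : wNorm μ ω u < ∞) :
    ∃ (a : ℝ) (W : M × ℝ → ℝ) (N : ℝ), IsReg a W ∧ 0 ≤ N ∧ BddBy μ W N u := by
  obtain ⟨a, c, W, -, hW, hle, -⟩ := hω.exists_isReg
  refine ⟨a, W, (wNorm μ ω u).toReal, hW, ENNReal.toReal_nonneg, hu, ?_⟩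
  have := (wNorm_le_iff (fun e => one_pos.trans_le (hω.one_le e)) ENNReal.toReal_nonneg).1
    (ENNReal.ofReal_toReal h.ne).ge
  filter_upwards [this] with e he
  refine he.trans ?_
  gcongr
  exact hle e

lemma ae_eq_of_isRepr (hμ : VolumeDoubling μ) {F : (ℝ → Lp ℝ 2 μ) → ℝ} {a a' N N' : ℝ}
    {W W' u u' : M × ℝ → ℝ} (hW : IsReg a W) (hW' : IsReg a' W') (hN : 0 ≤ N) (hN' : 0 ≤ N')
    (hu : BddBy μ W N u) (hu' : BddBy μ W' N' u') (hF : S.IsRepr o F u) (hF' : S.IsRepr o F u') :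
    u =ᵐ[μ.prod volume] u' := by
  have hWW := hW.add hW'
  have h1 : BddBy μ (W + W') N u := hu.mono fun e => by
    have := (hW'.pos e).le
    simp only [Pi.add_apply]; gcongr; linarith
  have h2 : BddBy μ (W + W') N' u' := hu'.mono fun e => by
    have := (hW.pos e).le
    simp only [Pi.add_apply]; gcongr; linarith
  have h3 := ae_eq_zero_of_pair (S := S) (o := o) hμ hWW (h1.sub h2) (add_nonneg hN hN')
    fun χ hχ => by
      rw [h1.pair_sub_left hWW h2 hχ.isCurve (hχ.crvNorm_ne_top hμ hWW), ← hF.2 χ hχ,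
        ← hF'.2 χ hχ, sub_self]
  filter_upwards [h3] with e he
  simpa [sub_eq_zero] using he

/-- The function of a functional that is bounded in `L¹(W)`. -/
lemma IsLin.toFunction (hμ : VolumeDoubling μ) {F : (ℝ → Lp ℝ 2 μ) → ℝ} (hF : S.IsLin o F)
    {a B : ℝ} {W : M × ℝ → ℝ} (hW : IsReg a W) (hW1 : ∀ e, 1 ≤ W e) (hB0 : 0 ≤ B)
    (hB : ∀ χ, S.IsTest o χ → |F χ| ≤ B * tn W χ) :
    S.IsRepr o F (S.toFunction o F) ∧ BddBy μ W B (S.toFunction o F) := by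
  obtain ⟨U, hU, hUB⟩ := hF.exists_repr hμ hW hB0 hB
  have hex : ∃ u, S.IsRepr o F u ∧ ∃ ω, IsSpaceTimeWeight ω ∧ wNorm μ ω u < ∞ :=
    ⟨U, hU, W, hW.isSpaceTimeWeight hW1,
      ((wNorm_le_iff hW.pos hB0).2 hUB.le).trans_lt ENNReal.ofReal_lt_top⟩
  have e : S.toFunction o F = hex.choose := dif_pos hex
  obtain ⟨hr, ω, hω, hfin⟩ := hex.choose_spec
  rw [← e] at hr hfin
  obtain ⟨a', W', N', hW', hN', hb'⟩ := exists_bddBy_of_wNorm hω hr.1 hfin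
  exact ⟨hr, hUB.congr (ae_eq_of_isRepr hμ hW' hW hN' hB0 hb' hUB hr hU)⟩

end HeatSystem

end Parabolic

namespace Parabolic

section Scalar

variable {Φ Φ' : ℝ → ℝ} {B e : ℝ}

lemma abs_sub_le_of_deriv_rpow (hB : 0 ≤ B)
    (hd : ∀ t ∈ Ioc (0 : ℝ) 1, HasDerivAt Φ (Φ' t) t)
    (hb : ∀ t ∈ Ioc (0 : ℝ) 1, |Φ' t| ≤ B * t ^ (e - 1)) {δ : ℝ} (hδ : 0 < δ) {s t : ℝ}
    (hs : s ∈ Icc δ 1) (ht : t ∈ Icc δ 1) : |Φ s - Φ t| ≤ B * δ ^ (-|e - 1|) * |s - t| := by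
  have hsub : Icc δ 1 ⊆ Ioc 0 1 := fun x hx => ⟨hδ.trans_le hx.1, hx.2⟩
  refine (convex_Icc δ 1).norm_image_sub_le_of_norm_hasDerivWithin_le
    (fun x hx => (hd x (hsub hx)).hasDerivWithinAt) (fun x hx => ?_) ht hs
  refine (hb x (hsub hx)).trans ?_
  gcongr
  have hx0 : 0 < x := hδ.trans_le hx.1
  calc x ^ (e - 1) ≤ x ^ (-|e - 1|) :=
        Real.rpow_le_rpow_of_exponent_ge hx0 hx.2 (neg_abs_le _)
    _ ≤ δ ^ (-|e - 1|) :=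
        Real.rpow_le_rpow_of_nonpos hδ hx.1 (neg_nonpos.2 (abs_nonneg _))

lemma abs_le_of_deriv_rpow (he : e < 0)
    (hd : ∀ t ∈ Ioc (0 : ℝ) 1, HasDerivAt Φ (Φ' t) t)
    (hb : ∀ t ∈ Ioc (0 : ℝ) 1, |Φ' t| ≤ B * t ^ (e - 1)) {t : ℝ} (ht : 0 < t) (ht1 : t ≤ 1)
    (hB : 0 ≤ B) : |Φ t| ≤ |Φ 1| + B * (-e)⁻¹ * t ^ e := by
  have hsub : Icc t 1 ⊆ Ioc 0 1 := fun x hx => ⟨ht.trans_le hx.1, hx.2⟩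
  have key : ∀ σ : ℝ, |σ| = 1 → B * (-e)⁻¹ * 1 ^ e + σ * Φ 1 ≤ B * (-e)⁻¹ * t ^ e + σ * Φ t := by
    intro σ hσ
    have hg : ∀ x ∈ Icc t 1, HasDerivAt (fun x => B * (-e)⁻¹ * x ^ e + σ * Φ x)
        (B * (-e)⁻¹ * (e * x ^ (e - 1)) + σ * Φ' x) x := fun x hx =>
      ((Real.hasDerivAt_rpow_const (Or.inl (hsub hx).1.ne')).const_mul _).add
        ((hd x (hsub hx)).const_mul σ)
    refine antitoneOn_of_deriv_nonpos (convex_Icc t 1)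
      (fun x hx => (hg x hx).continuousAt.continuousWithinAt)
      (fun x hx => (hg x (interior_subset hx)).differentiableAt.differentiableWithinAt)
      (fun x hx => ?_) ⟨le_rfl, ht1⟩ ⟨ht1, le_rfl⟩ ht1
    rw [(hg x (interior_subset hx)).deriv]
    have h1 := hb x (hsub (interior_subset hx))
    have h2 : σ * Φ' x ≤ |Φ' x| := (le_abs_self _).trans_eq (by rw [abs_mul, hσ, one_mul])
    have h3 : B * (-e)⁻¹ * (e * x ^ (e - 1)) = -(B * x ^ (e - 1)) := by
      have := he.ne
      field_simp
    rw [h3]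
    linarith
  have hpos : 0 ≤ B * (-e)⁻¹ * 1 ^ e := by
    rw [Real.one_rpow, mul_one]
    exact mul_nonneg hB (inv_nonneg.2 (by linarith))
  have h1 := key 1 (by simp)
  have h2 := key (-1) (by simp)
  have h3 := le_abs_self (Φ 1)
  have h4 := neg_abs_le (Φ 1)
  exact abs_le.2 ⟨by linarith, by linarith⟩

end Scalar

variable {M : Type*} [MetricSpace M] [MeasurableSpace M] {μ : Measure M} {ℓ₀ : ℕ}
  [BorelSpace M] [SecondCountableTopology M] [SigmaFinite μ]

namespace HeatSystem

variable {S : HeatSystem μ ℓ₀} {o : M} {χ : ℝ → Lp ℝ 2 μ} {f : (ℝ → Lp ℝ 2 μ) → ℝ}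

lemma isTest_vlt (hμ : VolumeDoubling μ) (hχ : S.IsTest o χ) (J : List (Fin ℓ₀)) (p : ℕ) {t : ℝ}
    (ht : 0 < t) (ht2 : t ≤ 2) {k : ℝ → ℝ} (hk : IsKer k) :
    S.IsTest o (opK (S.vlt J p t) k χ) :=
  (S.chain_vlt hμ J p ht ht2).isTest_opK hk hχ

lemma isTest_elt (hμ : VolumeDoubling μ) (hχ : S.IsTest o χ) (J : List (Fin ℓ₀)) (p : ℕ) {t : ℝ}
    (ht : 0 < t) (ht2 : t ≤ 2) {k : ℝ → ℝ} (hk : IsKer k) :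
    S.IsTest o (opK (S.elt J p t) k χ) := by
  rw [elt, opK_smul_left]
  exact (isTest_vlt hμ hχ J p ht ht2 hk).smul _

lemma IsLin.elt (hμ : VolumeDoubling μ) (hf : S.IsLin o f) (hχ : S.IsTest o χ)
    (J : List (Fin ℓ₀)) (p : ℕ) {t : ℝ} (ht : 0 < t) (ht2 : t ≤ 2) {k : ℝ → ℝ} (hk : IsKer k) :
    f (opK (S.elt J p t) k χ) =
      t ^ ((J.length : ℝ) / 2) * t ^ p * f (opK (S.vlt J p t) k χ) := by
  rw [HeatSystem.elt, opK_smul_left, hf.smul _ _ (isTest_vlt hμ hχ J p ht ht2 hk)]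

lemma IsLin.pre (hμ : VolumeDoubling μ) (hf : S.IsLin o f) (hχ : S.IsTest o χ)
    (J : List (Fin ℓ₀)) (n c : ℕ) {t : ℝ} (ht : 0 < t) (ht2 : t ≤ 2) {k : ℝ → ℝ} (hk : IsKer k) :
    S.IsTest o (opK (S.pre J n c t) k χ) ∧ f (opK (S.pre J n c t) k χ) =
      ∑ i ∈ Finset.range c, (i.factorial : ℝ)⁻¹ * f (opK (S.elt J (n + i) t) k χ) := by
  rw [S.pre_eq hμ J n c ht ht2, opK_sum_left]
  exact hf.sum _ _ fun i _ => isTest_elt hμ hχ J (n + i) ht ht2 hk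

lemma isTest_pre (hμ : VolumeDoubling μ) (hχ : S.IsTest o χ) (J : List (Fin ℓ₀)) (n c : ℕ) {t : ℝ}
    (ht : 0 < t) (ht2 : t ≤ 2) {k : ℝ → ℝ} (hk : IsKer k) :
    S.IsTest o (opK (S.pre J n c t) k χ) :=
  (IsLin.pre hμ (f := 0) ⟨by simp, by simp⟩ hχ J n c ht ht2 hk).1

/-- The operator `f ↦ f(opK R k ·)` preserves linearity. -/
lemma IsLin.comp_opK (hf : S.IsLin o f) {R : Lp ℝ 2 μ →L[ℝ] Lp ℝ 2 μ} {k : ℝ → ℝ} (hk : IsKer k)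
    (hR : ∀ χ, S.IsTest o χ → S.IsTest o (opK R k χ)) : S.IsLin o fun χ => f (opK R k χ) :=
  ⟨fun χ₁ χ₂ h₁ h₂ => by
    rw [opK_add_right hk.cont h₁.isCurve h₂.isCurve, hf.add _ _ (hR _ h₁) (hR _ h₂)],
  fun r χ h => by rw [opK_smul_right, hf.smul _ _ (hR _ h)]⟩

lemma scaled_add (m n : ℝ → ℝ) (t : ℝ) :
    scaled (fun σ => m σ + n σ) t = fun s => scaled m t s + scaled n t s := by
  funext s; simp only [scaled]; ring

lemma scaled_const_mul (r : ℝ) (m : ℝ → ℝ) (t : ℝ) :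
    scaled (fun σ => r * m σ) t = fun s => r * scaled m t s := by
  funext s; simp only [scaled]; ring

lemma IsDistribution.hasDerivAt_pre (hμ : VolumeDoubling μ) (hf : S.IsDistribution o f)
    (hχ : S.IsTest o χ) {m : ℝ → ℝ} (hm : IsBump m) (J : List (Fin ℓ₀)) (n c : ℕ) (lam : ℝ)
    {t : ℝ} (ht : 0 < t) (ht2 : t < 2) :
    HasDerivAt (fun t => t ^ (-((J.length : ℝ) / 2 + n + lam)) *
        f (opK (S.pre J n (c + 1) t) (scaled m t) χ))
      (-(t ^ (-((J.length : ℝ) / 2 + n + lam) - 1) *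
        ((c.factorial : ℝ)⁻¹ * f (opK (S.elt J (n + (c + 1)) t) (scaled m t) χ) +
          f (opK (S.pre J n (c + 1) t) (scaled (fun σ => lam * m σ + dil m σ) t) χ)))) t := by
  set A : ℝ := (J.length : ℝ) / 2 + n with hA
  set y : (ℝ → ℝ) → ℕ → ℝ → ℝ := fun k i t => f (opK (S.vlt J (n + i) t) (scaled k t) χ) with hy
  set Y : (ℝ → ℝ) → ℝ → ℝ := fun k t =>
    ∑ i ∈ Finset.range (c + 1), t ^ i / (i.factorial : ℝ) * y k i t with hY
  have helt : ∀ k, IsBump k → ∀ i s, 0 < s → s ≤ 2 →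
      f (opK (S.elt J (n + i) s) (scaled k s) χ) = s ^ A * s ^ i * y k i s := by
    intro k hk i s hs hs2
    rw [hf.isLin.elt hμ hχ J (n + i) hs hs2 (hk.isKer hs), hA, Real.rpow_add hs,
      Real.rpow_natCast, pow_add]
    ring
  have hpre : ∀ k, IsBump k → ∀ s, 0 < s → s ≤ 2 →
      f (opK (S.pre J n (c + 1) s) (scaled k s) χ) = s ^ A * Y k s := by
    intro k hk s hs hs2
    rw [(hf.isLin.pre hμ hχ J n (c + 1) hs hs2 (hk.isKer hs)).2, hY, Finset.mul_sum]
    refine Finset.sum_congr rfl fun i _ => ?_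
    rw [helt k hk i s hs hs2]
    ring
  have hder : HasDerivAt (Y m)
      (-(t ^ c / (c.factorial : ℝ) * y m (c + 1) t) - t⁻¹ * Y (dil m) t) t := by
    have h1 : HasDerivAt (Y m) (∑ i ∈ Finset.range (c + 1),
        ((i : ℝ) * t ^ (i - 1) / (i.factorial : ℝ) * y m i t +
          t ^ i / (i.factorial : ℝ) * (-y m (i + 1) t - t⁻¹ * y (dil m) i t))) t := by
      refine HasDerivAt.fun_sum fun i _ => ?_
      exact ((hasDerivAt_pow i t).div_const _).mul
        (hf.hasDerivAt hμ hχ hm J (n + i) ht ht2)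
    convert h1 using 1
    rw [← sum_taylor_telescope (fun i => y m i t) t c, hY, Finset.mul_sum, ← Finset.sum_sub_distrib]
    refine Finset.sum_congr rfl fun i _ => ?_
    ring
  have hG : HasDerivAt (fun s => s ^ (-lam) * Y m s) (-lam * t ^ (-lam - 1) * Y m t +
      t ^ (-lam) * (-(t ^ c / (c.factorial : ℝ) * y m (c + 1) t) - t⁻¹ * Y (dil m) t)) t :=
    (Real.hasDerivAt_rpow_const (Or.inl ht.ne')).mul hder
  have hev : (fun t => t ^ (-(A + lam)) * f (opK (S.pre J n (c + 1) t) (scaled m t) χ)) =ᶠ[𝓝 t]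
      fun s => s ^ (-lam) * Y m s := by
    filter_upwards [Ioo_mem_nhds ht ht2] with s hs
    rw [hpre m hm s hs.1 hs.2.le, ← mul_assoc, ← Real.rpow_add hs.1]
    congr 2; ring
  refine (hG.congr_of_eventuallyEq hev).congr_deriv ?_
  have hker : f (opK (S.pre J n (c + 1) t) (scaled (fun σ => lam * m σ + dil m σ) t) χ) =
      lam * (t ^ A * Y m t) + t ^ A * Y (dil m) t := by
    have hk1 := hm.isKer ht
    have hk2 := hm.dil.isKer ht
    rw [scaled_add, scaled_const_mul, opK_add_ker (hk1.const_mul lam).cont hk2.cont hχ.isCurve,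
      opK_smul_ker, hf.add _ _ ((isTest_pre hμ hχ J n _ ht ht2.le hk1).smul _)
        (isTest_pre hμ hχ J n _ ht ht2.le hk2), hf.smul _ _ (isTest_pre hμ hχ J n _ ht ht2.le hk1),
      hpre m hm t ht ht2.le, hpre _ hm.dil t ht ht2.le]
  rw [hker, helt m hm (c + 1) t ht ht2.le]
  have e1 : t ^ (-(A + lam) - 1) = t ^ (-A) * t ^ (-lam) * t⁻¹ := by
    rw [← Real.rpow_neg_one, ← Real.rpow_add ht, ← Real.rpow_add ht]; ring_nf
  have e2 : t ^ (-lam - 1) = t ^ (-lam) * t⁻¹ := by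
    rw [← Real.rpow_neg_one, ← Real.rpow_add ht]; ring_nf
  have e3 : t ^ (-A) = (t ^ A)⁻¹ := Real.rpow_neg ht.le A
  have hA0 : t ^ A ≠ 0 := (Real.rpow_pos_of_pos ht A).ne'
  rw [e1, e2, e3, pow_succ]
  field_simp
  ring

end HeatSystem

end Parabolic

namespace Parabolic

variable {M : Type*} [MetricSpace M] [MeasurableSpace M] {μ : Measure M} {ℓ₀ : ℕ}
  [BorelSpace M] [SecondCountableTopology M] [SigmaFinite μ]

namespace HeatSystem

/-- Bounds on functionals that amount to bounds on the Hölder norm. -/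
structure HolderBound (S : HeatSystem μ ℓ₀) (o : M) (b : ℕ) (α : ℝ) (W : M × ℝ → ℝ)
    (f : (ℝ → Lp ℝ 2 μ) → ℝ) (N : ℝ) : Prop where
  dist : S.IsDistribution o f
  one : ∀ (Q : StdFamily ℓ₀) (k : ℕ), k ≤ 2 * b → Q.IsStGC b k → ∀ χ, S.IsTest o χ →
    |S.stdDist Q 1 f χ| ≤ N * tn W χ
  scale : ∀ (Q : StdFamily ℓ₀) (k : ℕ), |α| < k → k ≤ 2 * b → Q.IsStGC b k → ∀ t, 0 < t → t ≤ 1 →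
    ∀ χ, S.IsTest o χ → |S.stdDist Q t f χ| ≤ N * t ^ (α / 2) * tn W χ

variable {S : HeatSystem μ ℓ₀} {o : M} {b : ℕ} {α N : ℝ} {ω W : M × ℝ → ℝ}
  {F f : (ℝ → Lp ℝ 2 μ) → ℝ}

lemma abs_le_of_distWNorm (hμ : VolumeDoubling μ) {a : ℝ} (hW : IsReg a W) (hω : ∀ e, 0 < ω e)
    (hle : ∀ e, ω e ≤ W e) (hN : 0 ≤ N) (h : S.distWNorm o ω F ≤ ENNReal.ofReal N)
    {χ : ℝ → Lp ℝ 2 μ} (hχ : S.IsTest o χ) : |F χ| ≤ N * tn W χ := by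
  have key : ∀ N' > N, |F χ| ≤ N' * tn W χ := by
    intro N' hN'
    have hlt : S.distWNorm o ω F < ENNReal.ofReal N' :=
      h.trans_lt ((ENNReal.ofReal_lt_ofReal_iff (hN.trans_lt hN')).2 hN')
    obtain ⟨u, hu⟩ := iInf_lt_iff.1 hlt
    obtain ⟨hr, hu⟩ := iInf_lt_iff.1 hu
    have hb := (wNorm_le_iff hω (hN.trans hN'.le)).1 hu.le
    have hB : BddBy μ W N' u := ⟨hr.1, hb.mono fun e he => he.trans (by
      have := hN.trans hN'.le
      gcongr; exact hle e)⟩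
    rw [hr.2 χ hχ]
    exact hB.abs_pair_le hW hχ.isCurve (hχ.crvNorm_ne_top hμ hW)
  have hlim : Tendsto (fun N' => N' * tn W χ) (𝓝[>] N) (𝓝 (N * tn W χ)) :=
    (tendsto_id.mono_left nhdsWithin_le_nhds).mul_const _
  exact ge_of_tendsto hlim (eventually_mem_nhdsWithin.mono key)

lemma IsLin.distWNorm_le (hμ : VolumeDoubling μ) (hF : S.IsLin o F) {a c : ℝ} (hW : IsReg a W)
    (hω : ∀ e, 0 < ω e) (hc : 0 ≤ c) (hle : ∀ e, W e ≤ c * ω e) (hN : 0 ≤ N)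
    (hB : ∀ χ, S.IsTest o χ → |F χ| ≤ N * tn W χ) :
    S.distWNorm o ω F ≤ ENNReal.ofReal (N * c) := by
  obtain ⟨U, hU, hUB⟩ := hF.exists_repr hμ hW hN hB
  refine (iInf₂_le U hU).trans ((wNorm_le_iff hω (by positivity)).2 ?_)
  filter_upwards [hUB.le] with e he
  calc |U e| ≤ N * W e := he
    _ ≤ N * (c * ω e) := by gcongr; exact hle e
    _ = N * c * ω e := by ring

lemma HolderBound.of_holderNorm (hμ : VolumeDoubling μ) {a : ℝ} (hW : IsReg a W)
    (hω : ∀ e, 0 < ω e) (hle : ∀ e, ω e ≤ W e) (hN : 0 ≤ N) (hf : S.IsDistribution o f)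
    (h : S.holderNorm o b α ω f ≤ ENNReal.ofReal N) : S.HolderBound o b α W f N := by
  refine ⟨hf, fun Q k hk hQ χ hχ => ?_, fun Q k hα hk hQ t ht ht1 χ hχ => ?_⟩
  · refine abs_le_of_distWNorm hμ hW hω hle hN (le_trans ?_ ((self_le_add_right _ _).trans h)) hχ
    exact le_iSup₂_of_le Q k (le_iSup₂_of_le hk hQ le_rfl)
  · have ht0 := Real.rpow_pos_of_pos ht (α / 2)
    refine abs_le_of_distWNorm hμ hW hω hle (by positivity) ?_ hχ
    have h1 : ENNReal.ofReal (t ^ (-α / 2)) * S.distWNorm o ω (S.stdDist Q t f) ≤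
        ENNReal.ofReal N := by
      refine le_trans ?_ ((self_le_add_left _ _).trans h)
      exact le_iSup₂_of_le Q k (le_iSup₂_of_le hα hk (le_iSup₂_of_le hQ t
        (le_iSup₂_of_le ht ht1 le_rfl)))
    have e : ENNReal.ofReal (t ^ (α / 2)) * ENNReal.ofReal (t ^ (-α / 2)) = 1 := by
      rw [← ENNReal.ofReal_mul ht0.le, ← Real.rpow_add ht]
      ring_nf; simp
    calc S.distWNorm o ω (S.stdDist Q t f)
        = ENNReal.ofReal (t ^ (α / 2)) *
          (ENNReal.ofReal (t ^ (-α / 2)) * S.distWNorm o ω (S.stdDist Q t f)) := by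
          rw [← mul_assoc, e, one_mul]
      _ ≤ ENNReal.ofReal (t ^ (α / 2)) * ENNReal.ofReal N := by gcongr
      _ = ENNReal.ofReal (N * t ^ (α / 2)) := by rw [← ENNReal.ofReal_mul ht0.le, mul_comm]

lemma _root_.Parabolic.StdFamily.IsStGC.isBump {Q : StdFamily ℓ₀} {k : ℕ} (hQ : Q.IsStGC b k) : IsBump Q.m :=
  ⟨hQ.smooth, hQ.support⟩

lemma HolderBound.holderNorm_le (hμ : VolumeDoubling μ) {a c : ℝ} (hW : IsReg a W)
    (hω : ∀ e, 0 < ω e) (hc : 0 ≤ c) (hle : ∀ e, W e ≤ c * ω e) (hN : 0 ≤ N)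
    (h : S.HolderBound o b α W f N) : S.holderNorm o b α ω f ≤ ENNReal.ofReal (2 * c * N) := by
  have hlin : ∀ (Q : StdFamily ℓ₀) k, Q.IsStGC b k → ∀ t, 0 < t → t ≤ 1 →
      S.IsLin o (S.stdDist Q t f) := fun Q k hQ t ht ht1 =>
    h.dist.isLin.comp_opK (R := S.pre Q.J Q.n Q.c t) (k := scaled Q.m t) (hQ.isBump.isKer ht)
      fun χ hχ => isTest_pre hμ hχ Q.J Q.n Q.c ht (by linarith) (hQ.isBump.isKer ht)
  have e : ENNReal.ofReal (2 * c * N) = ENNReal.ofReal (N * c) + ENNReal.ofReal (N * c) := by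
    rw [← ENNReal.ofReal_add (by positivity) (by positivity)]; ring_nf
  rw [e]
  refine add_le_add ?_ ?_
  · refine iSup₂_le fun Q k => iSup₂_le fun hk hQ => ?_
    exact (hlin Q k hQ 1 one_pos le_rfl).distWNorm_le hμ hW hω hc hle hN (h.one Q k hk hQ)
  · refine iSup₂_le fun Q k => iSup₂_le fun hα hk => iSup₂_le fun hQ t => iSup₂_le fun ht ht1 => ?_
    have ht0 := Real.rpow_pos_of_pos ht (α / 2)
    have h1 := (hlin Q k hQ t ht ht1).distWNorm_le hμ hW hω hc hle (by positivity)
      (h.scale Q k hα hk hQ t ht ht1)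
    calc ENNReal.ofReal (t ^ (-α / 2)) * S.distWNorm o ω (S.stdDist Q t f)
        ≤ ENNReal.ofReal (t ^ (-α / 2)) * ENNReal.ofReal (N * t ^ (α / 2) * c) := by gcongr
      _ = ENNReal.ofReal (N * c * (t ^ (-α / 2) * t ^ (α / 2))) := by
          rw [← ENNReal.ofReal_mul (by positivity)]; ring_nf
      _ = ENNReal.ofReal (N * c) := by
          rw [← Real.rpow_add ht]; ring_nf; simp

/-! ### Uniform bounds on smoothed distributions -/

/-- `(R_t ⊗ m_t^⋆) f` is bounded by a multiple of `N t^γ W`, for all `f` in the class `H · N`. -/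
def UBound (S : HeatSystem μ ℓ₀) (o : M) (H : ((ℝ → Lp ℝ 2 μ) → ℝ) → ℝ → Prop) (W : M × ℝ → ℝ)
    (γ : ℝ) (R : ℝ → Lp ℝ 2 μ →L[ℝ] Lp ℝ 2 μ) (m : ℝ → ℝ) : Prop :=
  ∃ K : ℝ, 0 ≤ K ∧ ∀ f N, 0 ≤ N → H f N → ∀ t, 0 < t → t ≤ 1 → ∀ χ, S.IsTest o χ →
    |f (opK (R t) (scaled m t) χ)| ≤ K * N * t ^ γ * tn W χ

lemma HolderBound.exists_pre (J : List (Fin ℓ₀)) (n c k : ℕ) (hc : 1 ≤ c) (hcb : c ≤ b)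
    {m : ℝ → ℝ} (hμ : VolumeDoubling μ)
    (hm : IsBump m) (hmom : ∀ i < k, ∫ x, x ^ i * m x = 0)
    (hk : J.length + 2 * n + 2 * k ≤ 2 * b) : ∃ K : ℝ, 0 ≤ K ∧ ∀ α W f N,
    S.HolderBound o b α W f N → ∀ χ, S.IsTest o χ →
      |f (opK (S.pre J n c 1) (scaled m 1) χ)| ≤ K * (N * tn W χ) ∧
      (|α| < J.length + 2 * n + 2 * k → ∀ t, 0 < t → t ≤ 1 →
        |f (opK (S.pre J n c t) (scaled m t) χ)| ≤ K * (N * t ^ (α / 2) * tn W χ)) := by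
  obtain ⟨K, hK0, hK⟩ := hm.exists_bound_iteratedDeriv b
  set Q : StdFamily ℓ₀ := ⟨J, n, k, c, fun σ => K⁻¹ * m σ⟩ with hQdef
  have hQ : Q.IsStGC b (J.length + 2 * n + 2 * k) := by
    refine ⟨rfl, hc, hcb, (hm.const_mul _).smooth, (hm.const_mul _).support, fun i hi => ?_,
      fun i hi τ => ?_⟩
    · have : (fun τ => τ ^ i * Q.m τ) = fun τ => K⁻¹ * (τ ^ i * m τ) := by
        funext τ; simp only [hQdef]; ring
      rw [this, integral_const_mul, hmom i hi, mul_zero]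
    · rw [iteratedDeriv_const_mul_field, abs_mul, abs_inv, abs_of_pos hK0,
        inv_mul_le_iff₀ hK0, mul_one]
      exact hK i hi τ
  have key : ∀ f, S.IsDistribution o f → ∀ χ, S.IsTest o χ → ∀ t, 0 < t → t ≤ 1 →
      |f (opK (S.pre J n c t) (scaled m t) χ)| = K * |S.stdDist Q t f χ| := by
    intro f hf χ hχ t ht ht1
    have e : scaled m t = fun s => K * scaled Q.m t s := by
      funext s
      simp only [scaled, hQdef]
      field_simp
    rw [e, opK_smul_ker, hf.smul _ _ (isTest_pre hμ hχ J n c ht (by linarith)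
      (hQ.isBump.isKer ht)), abs_mul, abs_of_pos hK0]
    rfl
  refine ⟨K, hK0.le, fun α W f N h χ hχ => ⟨?_, fun hα t ht ht1 => ?_⟩⟩
  · rw [key f h.dist χ hχ 1 one_pos le_rfl]
    exact mul_le_mul_of_nonneg_left (h.one Q _ hk hQ χ hχ) hK0.le
  · rw [key f h.dist χ hχ t ht ht1]
    exact mul_le_mul_of_nonneg_left (h.scale Q _ (by push_cast; exact hα) hk hQ t ht ht1 χ hχ) hK0.le

section UBound

variable {H : ((ℝ → Lp ℝ 2 μ) → ℝ) → ℝ → Prop} {γ : ℝ} {m : ℝ → ℝ}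

lemma uBound_pre (hμ : VolumeDoubling μ) (α : ℝ) (W : M × ℝ → ℝ) (J : List (Fin ℓ₀)) (n c k : ℕ)
    (hc : 1 ≤ c) (hcb : c ≤ b) (hm : IsBump m) (hmom : ∀ i < k, ∫ x, x ^ i * m x = 0)
    (hα : |α| < J.length + 2 * n + 2 * k) (hk : J.length + 2 * n + 2 * k ≤ 2 * b) :
    S.UBound o (S.HolderBound o b α W) W (α / 2) (S.pre J n c) m := by
  obtain ⟨K, hK0, hK⟩ := HolderBound.exists_pre (S := S) (o := o) J n c k hc hcb hμ hm hmom hk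
  refine ⟨K, hK0, fun f N _ h t ht ht1 χ hχ => ((hK α W f N h χ hχ).2 hα t ht ht1).trans_eq ?_⟩
  ring

lemma UBound.elt (hμ : VolumeDoubling μ) (hH : ∀ f N, 0 ≤ N → H f N → S.IsDistribution o f)
    (hm : IsBump m) {J : List (Fin ℓ₀)} {n c : ℕ} (h : S.UBound o H W γ (S.pre J n c) m)
    (h' : S.UBound o H W γ (S.pre J n (c + 1)) m) : S.UBound o H W γ (S.elt J (n + c)) m := by
  obtain ⟨K, hK0, hK⟩ := h
  obtain ⟨K', hK0', hK'⟩ := h'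
  refine ⟨c.factorial * (K' + K), by positivity, fun f N hN hf t ht ht1 χ hχ => ?_⟩
  have h1 := ((hH f N hN hf).isLin.pre hμ hχ J n c ht (by linarith) (hm.isKer ht)).2
  have h2 := ((hH f N hN hf).isLin.pre hμ hχ J n (c + 1) ht (by linarith) (hm.isKer ht)).2
  rw [Finset.sum_range_succ, ← h1] at h2
  have hc : (c.factorial : ℝ) ≠ 0 := by positivity
  have h3 : f (opK (S.elt J (n + c) t) (scaled m t) χ) = c.factorial *
      (f (opK (S.pre J n (c + 1) t) (scaled m t) χ) - f (opK (S.pre J n c t) (scaled m t) χ)) := by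
    rw [h2]; field_simp; ring
  rw [h3, abs_mul, Nat.abs_cast]
  have h4 := abs_sub (f (opK (S.pre J n (c + 1) t) (scaled m t) χ))
    (f (opK (S.pre J n c t) (scaled m t) χ))
  have h5 := hK f N hN hf t ht ht1 χ hχ
  have h6 := hK' f N hN hf t ht ht1 χ hχ
  calc _ ≤ (c.factorial : ℝ) * (K' * N * t ^ γ * tn W χ + K * N * t ^ γ * tn W χ) := by
        gcongr; linarith
    _ = _ := by ring

lemma UBound.pre (hμ : VolumeDoubling μ) (hH : ∀ f N, 0 ≤ N → H f N → S.IsDistribution o f)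
    (hm : IsBump m) {J : List (Fin ℓ₀)} {n c : ℕ}
    (h : ∀ i, S.UBound o H W γ (S.elt J (n + i)) m) : S.UBound o H W γ (S.pre J n c) m := by
  choose K hK0 hK using h
  refine ⟨∑ i ∈ Finset.range c, (i.factorial : ℝ)⁻¹ * K i,
    Finset.sum_nonneg fun i _ => mul_nonneg (by positivity) (hK0 i),
    fun f N hN hf t ht ht1 χ hχ => ?_⟩
  rw [((hH f N hN hf).isLin.pre hμ hχ J n c ht (by linarith) (hm.isKer ht)).2, Finset.sum_mul,
    Finset.sum_mul, Finset.sum_mul]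
  refine (Finset.abs_sum_le_sum_abs _ _).trans (Finset.sum_le_sum fun i _ => ?_)
  rw [abs_mul, abs_of_nonneg (by positivity), mul_assoc, mul_assoc, mul_assoc]
  have := hK i f N hN hf t ht ht1 χ hχ
  rw [mul_assoc, mul_assoc] at this
  gcongr

end UBound

/-- The functionals given by functions that are bounded by a weight. -/
def BddClass (W : M × ℝ → ℝ) (f : (ℝ → Lp ℝ 2 μ) → ℝ) (N : ℝ) : Prop :=
  ∃ g, f = pair g ∧ BddBy μ W N g

lemma BddClass.isDistribution (hμ : VolumeDoubling μ) {a : ℝ} (hW : IsReg a W) (hN : 0 ≤ N)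
    (h : BddClass W f N) : S.IsDistribution o f := by
  obtain ⟨g, rfl, hg⟩ := h
  refine ⟨fun χ χ' h h' => hg.pair_add hW h.isCurve h'.isCurve (h.crvNorm_ne_top hμ hW)
    (h'.crvNorm_ne_top hμ hW), fun r χ h => hg.pair_smul hW h.isCurve r (h.crvNorm_ne_top hμ hW),
    fun τ₀ => ?_⟩
  obtain ⟨k, C, hC0, hC⟩ := exists_crvNorm_test_le (S := S) hμ o hW τ₀
  refine ⟨k, ⟨N * C, by positivity⟩, fun χ hχ hsupp B hB => ?_⟩
  refine (hg.abs_pair_le hW hχ.isCurve (hχ.crvNorm_ne_top hμ hW)).trans ?_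
  have h1 := (hC χ hχ hsupp 0).trans (mul_le_mul_right (hB k le_rfl 0 (zero_le) 0 (zero_le)) _)
  have h2 : tn W χ ≤ C * B := by
    have := ENNReal.toReal_mono (ENNReal.mul_ne_top ENNReal.ofReal_ne_top ENNReal.coe_ne_top) h1
    rwa [ENNReal.toReal_mul, ENNReal.toReal_ofReal hC0, ENNReal.coe_toReal] at this
  change _ ≤ N * C * B
  rw [mul_assoc]
  gcongr

lemma BddClass.uBound_elt (hμ : VolumeDoubling μ) {a : ℝ} (ha : 0 ≤ a) (hW : IsReg a W)
    {m : ℝ → ℝ} (hm : IsBump m) (J : List (Fin ℓ₀)) (p : ℕ) :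
    S.UBound o (BddClass W) W 0 (S.elt J p) m := by
  obtain ⟨C, hC0, hC⟩ := S.exists_wB_elt hμ J p ha
  refine ⟨C * ∫ x, |m x|, mul_nonneg hC0 (integral_nonneg fun _ => abs_nonneg _), ?_⟩
  rintro f N hN ⟨g, rfl, hg⟩ t ht ht1 χ hχ
  have hfin := hχ.crvNorm_ne_top hμ hW
  have hR := hC t ht (by linarith)
  have hk := hm.isKer ht
  refine (hg.abs_pair_le hW (hχ.isCurve.opK hk _)
    (crvNorm_opK_ne_top hR hW hk hχ.isCurve hfin)).trans ?_
  have := tn_opK_le hR hW hk hχ.isCurve hfin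
  rw [integral_abs_scaled m ht] at this
  rw [Real.rpow_zero]
  calc _ ≤ N * (C * (∫ x, |m x|) * tn W χ) := by gcongr
    _ = _ := by ring

end HeatSystem

end Parabolic

namespace Parabolic

variable {M : Type*} [MetricSpace M] [MeasurableSpace M] {μ : Measure M} {ℓ₀ : ℕ}
  [BorelSpace M] [SecondCountableTopology M] [SigmaFinite μ]

namespace HeatSystem

/-- Families of functionals, indexed by a scale `t`, that are bounded by `B t^γ` in the dual of
`L¹(W)` and locally Lipschitz in `t`. -/
structure LeftGood (S : HeatSystem μ ℓ₀) (o : M) (W : M × ℝ → ℝ) (B γ : ℝ)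
    (F : ℝ → (ℝ → Lp ℝ 2 μ) → ℝ) : Prop where
  lin : ∀ t, 0 < t → t ≤ 1 → S.IsLin o (F t)
  bound : ∀ t, 0 < t → t ≤ 1 → ∀ χ, S.IsTest o χ → |F t χ| ≤ B * t ^ γ * tn W χ
  lip : ∀ δ, 0 < δ → ∃ D, 0 ≤ D ∧ ∀ s ∈ Icc δ 1, ∀ t ∈ Icc δ 1, ∀ χ, S.IsTest o χ →
    |F s χ - F t χ| ≤ D * |s - t| * tn W χ

variable {S : HeatSystem μ ℓ₀} {o : M} {W : M × ℝ → ℝ} {f : (ℝ → Lp ℝ 2 μ) → ℝ} {γ B : ℝ}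
  {F F' : ℝ → (ℝ → Lp ℝ 2 μ) → ℝ}

namespace LeftGood

lemma congr (h : S.LeftGood o W B γ F)
    (he : ∀ t, 0 < t → t ≤ 1 → ∀ χ, S.IsTest o χ → F' t χ = F t χ) : S.LeftGood o W B γ F' := by
  refine ⟨fun t ht ht1 => ⟨fun χ χ' h1 h2 => ?_, fun r χ h1 => ?_⟩, fun t ht ht1 χ hχ => ?_,
    fun δ hδ => ?_⟩
  · rw [he t ht ht1 _ (h1.add h2), he t ht ht1 _ h1, he t ht ht1 _ h2]
    exact (h.lin t ht ht1).add _ _ h1 h2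
  · rw [he t ht ht1 _ (h1.smul r), he t ht ht1 _ h1]
    exact (h.lin t ht ht1).smul _ _ h1
  · rw [he t ht ht1 _ hχ]
    exact h.bound t ht ht1 χ hχ
  · obtain ⟨D, hD0, hD⟩ := h.lip δ hδ
    refine ⟨D, hD0, fun s hs t ht χ hχ => ?_⟩
    rw [he s (hδ.trans_le hs.1) hs.2 χ hχ, he t (hδ.trans_le ht.1) ht.2 χ hχ]
    exact hD s hs t ht χ hχ

lemma const_mul (h : S.LeftGood o W B γ F) (r : ℝ) :
    S.LeftGood o W (|r| * B) γ fun t χ => r * F t χ := by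
  refine ⟨fun t ht ht1 => ⟨fun χ χ' h1 h2 => ?_, fun c χ h1 => ?_⟩, fun t ht ht1 χ hχ => ?_,
    fun δ hδ => ?_⟩
  · rw [(h.lin t ht ht1).add _ _ h1 h2, mul_add]
  · rw [(h.lin t ht ht1).smul _ _ h1]; ring
  · rw [abs_mul, mul_assoc, mul_assoc, ← mul_assoc B]
    exact mul_le_mul_of_nonneg_left (h.bound t ht ht1 χ hχ) (abs_nonneg _)
  · obtain ⟨D, hD0, hD⟩ := h.lip δ hδ
    refine ⟨|r| * D, by positivity, fun s hs t ht χ hχ => ?_⟩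
    rw [← mul_sub, abs_mul, mul_assoc, mul_assoc, ← mul_assoc D]
    exact mul_le_mul_of_nonneg_left (hD s hs t ht χ hχ) (abs_nonneg _)

lemma bddBy (hμ : VolumeDoubling μ) {a : ℝ} (hW : IsReg a W) (hW1 : ∀ e, 1 ≤ W e) (hB : 0 ≤ B)
    (h : S.LeftGood o W B γ F) {t : ℝ} (ht : 0 < t) (ht1 : t ≤ 1) :
    S.IsRepr o (F t) (S.toFunction o (F t)) ∧ BddBy μ W (B * t ^ γ) (S.toFunction o (F t)) :=
  (h.lin t ht ht1).toFunction hμ hW hW1 (by positivity) (h.bound t ht ht1)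

lemma exists_bddBy_sub (hμ : VolumeDoubling μ) {a : ℝ} (hW : IsReg a W) (hW1 : ∀ e, 1 ≤ W e)
    (hB : 0 ≤ B) (h : S.LeftGood o W B γ F) {δ : ℝ} (hδ : 0 < δ) : ∃ D, 0 ≤ D ∧
    ∀ s ∈ Icc δ 1, ∀ t ∈ Icc δ 1,
      BddBy μ W (D * |s - t|) (S.toFunction o (F s) - S.toFunction o (F t)) := by
  obtain ⟨D, hD0, hD⟩ := h.lip δ hδ
  refine ⟨D, hD0, fun s hs t ht => ?_⟩
  have hs0 := hδ.trans_le hs.1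
  have ht0 := hδ.trans_le ht.1
  obtain ⟨hr, hb⟩ := h.bddBy hμ hW hW1 hB hs0 hs.2
  obtain ⟨hr', hb'⟩ := h.bddBy hμ hW hW1 hB ht0 ht.2
  have hlin : S.IsLin o fun χ => F s χ - F t χ :=
    ⟨fun χ χ' h1 h2 => by
      rw [(h.lin s hs0 hs.2).add _ _ h1 h2, (h.lin t ht0 ht.2).add _ _ h1 h2]; ring,
    fun r χ h1 => by
      rw [(h.lin s hs0 hs.2).smul _ _ h1, (h.lin t ht0 ht.2).smul _ _ h1]; ring⟩
  obtain ⟨U, hU, hUB⟩ := hlin.exists_repr hμ hW (by positivity) (hD s hs t ht)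
  refine hUB.congr (ae_eq_of_isRepr hμ hW hW (by positivity) (by positivity) (hb.sub hb') hUB
    ⟨hr.1.sub hr'.1, fun χ hχ => ?_⟩ hU)
  rw [hb.pair_sub_left hW hb' hχ.isCurve (hχ.crvNorm_ne_top hμ hW), hr.2 χ hχ, hr'.2 χ hχ]

end LeftGood

section Bounds

variable {m : ℝ → ℝ} {J : List (Fin ℓ₀)} {n c : ℕ} {lam γ' B₁ B' : ℝ}

lemma abs_deriv_le {A X T : ℝ} {t : ℝ} (ht : 0 < t) (hX : |X| ≤ B' * t ^ γ' * T) :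
    |-(t ^ (-A - 1) * X)| ≤ B' * T * t ^ (γ' - A - 1) := by
  rw [abs_neg, abs_mul, abs_of_nonneg (by positivity)]
  calc _ ≤ t ^ (-A - 1) * (B' * t ^ γ' * T) := by gcongr
    _ = B' * T * (t ^ (-A - 1) * t ^ γ') := by ring
    _ = _ := by rw [← Real.rpow_add ht]; ring_nf

lemma leftGood_of_bounds (hμ : VolumeDoubling μ) (hf : S.IsDistribution o f) (hm : IsBump m)
    (hlam : 0 ≤ lam) (hB : 0 ≤ B) (hB' : 0 ≤ B')
    (hF : ∀ t, 0 < t → t ≤ 1 → ∀ χ, S.IsTest o χ →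
      |f (opK (S.pre J n (c + 1) t) (scaled m t) χ)| ≤ B * t ^ γ * tn W χ)
    (hE : ∀ t, 0 < t → t ≤ 1 → ∀ χ, S.IsTest o χ →
      |(c.factorial : ℝ)⁻¹ * f (opK (S.elt J (n + (c + 1)) t) (scaled m t) χ) +
        f (opK (S.pre J n (c + 1) t) (scaled (fun σ => lam * m σ + dil m σ) t) χ)| ≤
          B' * t ^ γ' * tn W χ) :
    S.LeftGood o W B γ fun t χ => f (opK (S.pre J n (c + 1) t) (scaled m t) χ) := by
  set A : ℝ := (J.length : ℝ) / 2 + n + lam with hA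
  have hA0 : 0 ≤ A := by positivity
  refine ⟨fun t ht ht1 => hf.isLin.comp_opK (R := S.pre J n (c + 1) t) (k := scaled m t)
    (hm.isKer ht) fun χ hχ => isTest_pre hμ hχ J n _ ht (by linarith) (hm.isKer ht), hF,
    fun δ hδ => ?_⟩
  refine ⟨B' * δ ^ (-|γ' - A - 1|) + A * δ⁻¹ * (δ ^ (-A) * (B * δ ^ (-|γ|))), by positivity,
    fun s hs t ht χ hχ => ?_⟩
  have hs0 := hδ.trans_le hs.1
  have ht0 := hδ.trans_le ht.1
  set G : ℝ → ℝ := fun t => f (opK (S.pre J n (c + 1) t) (scaled m t) χ) with hG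
  have hT := tn_nonneg W χ
  have h1 := abs_sub_le_of_deriv_rpow (Φ := fun t => t ^ (-A) * G t) (B := B' * tn W χ)
    (by positivity)
    (fun t ht => hf.hasDerivAt_pre hμ hχ hm J n c lam ht.1 (by linarith [ht.2]))
    (fun t ht => abs_deriv_le ht.1 (hE t ht.1 ht.2 χ hχ)) hδ hs ht
  have e : ∀ x, 0 < x → G x = x ^ A * (x ^ (-A) * G x) := fun x hx => by
    rw [← mul_assoc, ← Real.rpow_add hx, add_neg_cancel, Real.rpow_zero, one_mul]
  have h2 : G s - G t = s ^ A * (s ^ (-A) * G s - t ^ (-A) * G t) +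
      (s ^ A - t ^ A) * (t ^ (-A) * G t) := by
    rw [e s hs0, e t ht0, ← e s hs0, ← e t ht0]; ring_nf
    nth_rewrite 1 [e s hs0, e t ht0]; ring
  have h3 : |s ^ A| ≤ 1 := by
    rw [abs_of_nonneg (by positivity)]
    exact Real.rpow_le_one hs0.le hs.2 hA0
  have h4 : |t ^ (-A) * G t| ≤ δ ^ (-A) * (B * δ ^ (-|γ|)) * tn W χ := by
    rw [abs_mul, abs_of_nonneg (by positivity), mul_assoc]
    have h5 : t ^ (-A) ≤ δ ^ (-A) := Real.rpow_le_rpow_of_nonpos hδ ht.1 (by linarith)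
    have h6 : t ^ γ ≤ δ ^ (-|γ|) :=
      (Real.rpow_le_rpow_of_exponent_ge ht0 ht.2 (neg_abs_le _)).trans
        (Real.rpow_le_rpow_of_nonpos hδ ht.1 (neg_nonpos.2 (abs_nonneg _)))
    refine mul_le_mul h5 ((hF t ht0 ht.2 χ hχ).trans ?_) (abs_nonneg _) (by positivity)
    gcongr
  change |G s - G t| ≤ _
  rw [h2]
  refine (abs_add_le _ _).trans ?_
  rw [abs_mul, abs_mul]
  calc _ ≤ 1 * (B' * tn W χ * δ ^ (-|γ' - A - 1|) * |s - t|) +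
        A * δ⁻¹ * |s - t| * (δ ^ (-A) * (B * δ ^ (-|γ|)) * tn W χ) := by
        gcongr
        exact abs_rpow_sub_le hA0 hδ hs ht
    _ = _ := by ring

lemma abs_le_of_bounds (hμ : VolumeDoubling μ) (hf : S.IsDistribution o f) (hm : IsBump m)
    (hB₁ : 0 ≤ B₁) (hB' : 0 ≤ B') (hγ : γ < (J.length : ℝ) / 2 + n + lam)
    (hF : ∀ χ, S.IsTest o χ → |f (opK (S.pre J n (c + 1) 1) (scaled m 1) χ)| ≤ B₁ * tn W χ)
    (hE : ∀ t, 0 < t → t ≤ 1 → ∀ χ, S.IsTest o χ →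
      |(c.factorial : ℝ)⁻¹ * f (opK (S.elt J (n + (c + 1)) t) (scaled m t) χ) +
        f (opK (S.pre J n (c + 1) t) (scaled (fun σ => lam * m σ + dil m σ) t) χ)| ≤
          B' * t ^ γ * tn W χ) {t : ℝ} (ht : 0 < t) (ht1 : t ≤ 1) {χ : ℝ → Lp ℝ 2 μ}
    (hχ : S.IsTest o χ) : |f (opK (S.pre J n (c + 1) t) (scaled m t) χ)| ≤
      (B₁ + B' * ((J.length : ℝ) / 2 + n + lam - γ)⁻¹) * t ^ γ * tn W χ := by
  set A : ℝ := (J.length : ℝ) / 2 + n + lam with hA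
  have hT := tn_nonneg W χ
  set G : ℝ → ℝ := fun t => f (opK (S.pre J n (c + 1) t) (scaled m t) χ) with hG
  have h1 := abs_le_of_deriv_rpow (Φ := fun t => t ^ (-A) * G t) (B := B' * tn W χ)
    (e := γ - A) (by linarith)
    (fun t ht => hf.hasDerivAt_pre hμ hχ hm J n c lam ht.1 (by linarith [ht.2]))
    (fun t ht => abs_deriv_le ht.1 (hE t ht.1 ht.2 χ hχ)) ht ht1 (by positivity)
  simp only [Real.one_rpow, one_mul] at h1
  have e : G t = t ^ A * (t ^ (-A) * G t) := by
    rw [← mul_assoc, ← Real.rpow_add ht, add_neg_cancel, Real.rpow_zero, one_mul]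
  have h2 : t ^ A ≤ t ^ γ := Real.rpow_le_rpow_of_exponent_ge ht ht1 hγ.le
  have h3 : t ^ A * t ^ (γ - A) = t ^ γ := by rw [← Real.rpow_add ht]; ring_nf
  have hAγ : (-(γ - A))⁻¹ = (A - γ)⁻¹ := by ring_nf
  have hpos : 0 ≤ (A - γ)⁻¹ := inv_nonneg.2 (by linarith)
  change |G t| ≤ _
  rw [e, abs_mul, abs_of_nonneg (by positivity)]
  rw [hAγ] at h1
  calc _ ≤ t ^ A * (B₁ * tn W χ + B' * tn W χ * (A - γ)⁻¹ * t ^ (γ - A)) := by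
        refine mul_le_mul_of_nonneg_left (h1.trans ?_) (by positivity)
        gcongr
        exact hF χ hχ
    _ = t ^ A * (B₁ * tn W χ) + B' * tn W χ * (A - γ)⁻¹ * (t ^ A * t ^ (γ - A)) := by ring
    _ ≤ t ^ γ * (B₁ * tn W χ) + B' * tn W χ * (A - γ)⁻¹ * t ^ γ := by rw [h3]; gcongr
    _ = _ := by ring

end Bounds

section Uniform

variable {H : ((ℝ → Lp ℝ 2 μ) → ℝ) → ℝ → Prop}

/-- Uniform version of `LeftGood`, for all distributions of a class. -/
def ULeft (S : HeatSystem μ ℓ₀) (o : M) (H : ((ℝ → Lp ℝ 2 μ) → ℝ) → ℝ → Prop) (W : M × ℝ → ℝ)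
    (γ : ℝ) (R : ℝ → Lp ℝ 2 μ →L[ℝ] Lp ℝ 2 μ) (m : ℝ → ℝ) : Prop :=
  ∃ K : ℝ, 0 ≤ K ∧ ∀ f N, 0 ≤ N → H f N →
    S.LeftGood o W (K * N) γ fun t => opDist (R t) m t f

variable {m : ℝ → ℝ} {J : List (Fin ℓ₀)} {n c : ℕ} {lam : ℝ}

lemma UBound.combine (hE : S.UBound o H W γ (S.elt J (n + (c + 1))) m)
    (hD : S.UBound o H W γ (S.pre J n (c + 1)) fun σ => lam * m σ + dil m σ) :
    ∃ K : ℝ, 0 ≤ K ∧ ∀ f N, 0 ≤ N → H f N → ∀ t, 0 < t → t ≤ 1 → ∀ χ, S.IsTest o χ →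
      |(c.factorial : ℝ)⁻¹ * f (opK (S.elt J (n + (c + 1)) t) (scaled m t) χ) +
        f (opK (S.pre J n (c + 1) t) (scaled (fun σ => lam * m σ + dil m σ) t) χ)| ≤
          K * N * t ^ γ * tn W χ := by
  obtain ⟨K, hK0, hK⟩ := hE
  obtain ⟨K', hK0', hK'⟩ := hD
  refine ⟨(c.factorial : ℝ)⁻¹ * K + K', by positivity, fun f N hN hf t ht ht1 χ hχ => ?_⟩
  refine (abs_add_le _ _).trans ?_
  rw [abs_mul, abs_of_nonneg (by positivity : (0 : ℝ) ≤ (c.factorial : ℝ)⁻¹)]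
  have h1 := hK f N hN hf t ht ht1 χ hχ
  have h2 := hK' f N hN hf t ht ht1 χ hχ
  calc _ ≤ (c.factorial : ℝ)⁻¹ * (K * N * t ^ γ * tn W χ) + K' * N * t ^ γ * tn W χ := by gcongr
    _ = _ := by ring

lemma uLeft_pre (hμ : VolumeDoubling μ) (hH : ∀ f N, 0 ≤ N → H f N → S.IsDistribution o f)
    (hm : IsBump m) (hF : S.UBound o H W γ (S.pre J n (c + 1)) m)
    (hE : S.UBound o H W γ (S.elt J (n + (c + 1))) m)
    (hD : S.UBound o H W γ (S.pre J n (c + 1)) (dil m)) :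
    S.ULeft o H W γ (S.pre J n (c + 1)) m := by
  have hD' : S.UBound o H W γ (S.pre J n (c + 1)) fun σ => 0 * m σ + dil m σ := by
    simpa only [zero_mul, zero_add] using hD
  obtain ⟨K', hK0', hK'⟩ := hE.combine hD'
  obtain ⟨K, hK0, hK⟩ := hF
  exact ⟨K, hK0, fun f N hN hf => leftGood_of_bounds hμ (hH f N hN hf) hm le_rfl (by positivity)
    (by positivity) (hK f N hN hf) (hK' f N hN hf)⟩

lemma uLeft_pre_of_neg (hμ : VolumeDoubling μ)
    (hH : ∀ f N, 0 ≤ N → H f N → S.IsDistribution o f)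
    (hm : IsBump m) (hlam : 0 ≤ lam) (hγ : γ < (J.length : ℝ) / 2 + n + lam)
    (hF : ∃ K : ℝ, 0 ≤ K ∧ ∀ f N, 0 ≤ N → H f N → ∀ χ, S.IsTest o χ →
      |f (opK (S.pre J n (c + 1) 1) (scaled m 1) χ)| ≤ K * N * tn W χ)
    (hE : S.UBound o H W γ (S.elt J (n + (c + 1))) m)
    (hD : S.UBound o H W γ (S.pre J n (c + 1)) fun σ => lam * m σ + dil m σ) :
    S.ULeft o H W γ (S.pre J n (c + 1)) m := by
  obtain ⟨K', hK0', hK'⟩ := hE.combine hD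
  obtain ⟨K, hK0, hK⟩ := hF
  have hpos : 0 ≤ ((J.length : ℝ) / 2 + n + lam - γ)⁻¹ := inv_nonneg.2 (by linarith)
  refine ⟨K + K' * ((J.length : ℝ) / 2 + n + lam - γ)⁻¹, by positivity, fun f N hN hf =>
    leftGood_of_bounds hμ (hH f N hN hf) hm hlam (by positivity) (by positivity)
      (fun t ht ht1 χ hχ => ?_) (hK' f N hN hf)⟩
  refine (abs_le_of_bounds hμ (hH f N hN hf) hm (by positivity) (by positivity) hγ
    (hK f N hN hf) (hK' f N hN hf) ht ht1 hχ).trans_eq ?_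
  ring

lemma ULeft.congr {R R' : ℝ → Lp ℝ 2 μ →L[ℝ] Lp ℝ 2 μ} (h : S.ULeft o H W γ R m)
    (he : ∀ t, 0 < t → t ≤ 1 → R' t = R t) : S.ULeft o H W γ R' m := by
  obtain ⟨K, hK0, hK⟩ := h
  exact ⟨K, hK0, fun f N hN hf => (hK f N hN hf).congr fun t ht ht1 _ _ => by rw [he t ht ht1]⟩

end Uniform

end HeatSystem

end Parabolic

namespace Parabolic

variable {M : Type*} [MetricSpace M] [MeasurableSpace M] {μ : Measure M} {ℓ₀ : ℕ}
  [BorelSpace M] [SecondCountableTopology M] [SigmaFinite μ]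

namespace HeatSystem

variable {S : HeatSystem μ ℓ₀} {o : M} {W : M × ℝ → ℝ} {h : ℕ} {φ : ℝ → ℝ}

section Holder

variable {α : ℝ}

lemma uBound_elt_holder (hμ : VolumeDoubling μ) (hh : 3 ≤ h) {m : ℝ → ℝ} (hm : IsBump m) {k : ℕ}
    (hmom : ∀ i < k, ∫ x, x ^ i * m x = 0) (J : List (Fin ℓ₀)) (hJ : J.length + 2 * k ≤ 2 * h)
    (hα : |α| < 2 * h) :
    S.UBound o (S.HolderBound o (2 * h) α W) W (α / 2) (S.elt J (h + h)) m := by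
  have h1 : |α| < J.length + 2 * h + 2 * k :=
    hα.trans_le (by exact_mod_cast (by omega : 2 * h ≤ J.length + 2 * h + 2 * k))
  exact UBound.elt hμ (fun f N _ hf => hf.dist) hm
    (uBound_pre hμ α W J h h k (by omega) (by omega) hm hmom h1 (by omega))
    (uBound_pre hμ α W J h (h + 1) k (by omega) (by omega) hm hmom h1 (by omega))

lemma uLeft_pre_holder (hμ : VolumeDoubling μ) (hh : 3 ≤ h) {m : ℝ → ℝ} (hm : IsBump m) {k : ℕ}
    (hmom : ∀ i < k, ∫ x, x ^ i * m x = 0) (J : List (Fin ℓ₀)) (hJ : J.length + 2 * k ≤ 2 * h)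
    (hα : |α| < J.length + 2 * k) :
    S.ULeft o (S.HolderBound o (2 * h) α W) W (α / 2) (S.pre J 0 (2 * h)) m := by
  obtain ⟨c, hc⟩ : ∃ c, 2 * h = c + 1 := ⟨2 * h - 1, by omega⟩
  have hα2 : |α| < 2 * h := hα.trans_le (by exact_mod_cast hJ)
  have hα' : |α| < J.length + 2 * ((0 : ℕ) : ℝ) + 2 * k := by simpa using hα
  have hE := uBound_elt_holder (S := S) (o := o) (W := W) hμ hh hm hmom J hJ hα2
  have hmom' : ∀ i < k, ∫ x, x ^ i * dil m x = 0 := fun i hi => by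
    rw [integral_pow_mul_dil hm, hmom i hi]; simp
  have hF := uBound_pre (S := S) (o := o) hμ α W J 0 (2 * h) k (by omega) le_rfl hm hmom hα'
    (by omega)
  have hD := uBound_pre (S := S) (o := o) hμ α W J 0 (2 * h) k (by omega) le_rfl hm.dil hmom' hα'
    (by omega)
  rw [show h + h = 0 + (c + 1) by omega] at hE
  have hH : ∀ f N, 0 ≤ N → S.HolderBound o (2 * h) α W f N → S.IsDistribution o f :=
    fun f N _ hf => hf.dist
  generalize S.HolderBound o (2 * h) α W = H at *
  rw [hc] at hF hD ⊢
  exact uLeft_pre hμ hH hm hF hE hD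

lemma uLeft_iteratedDeriv (hμ : VolumeDoubling μ) (hh : 3 ≤ h) (hφ : IsProfile (2 * h) φ)
    (J : List (Fin ℓ₀)) (l : ℕ) (hJ : J.length + 2 * l ≤ 2 * h) (hα : |α| < J.length + 2 * l) :
    S.ULeft o (S.HolderBound o (2 * h) α W) W (α / 2) (S.pre J 0 (2 * h)) (iteratedDeriv l φ) :=
  uLeft_pre_holder hμ hh (hφ.isBump.iteratedDeriv l)
    (fun i hi => hφ.moments_iteratedDeriv l i (by omega) hi.ne) J hJ hα

lemma uLeft_primitive (hμ : VolumeDoubling μ) (hh : 3 ≤ h) (hφ : IsProfile (2 * h) φ)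
    (hα : |α| < 2 * h) :
    S.ULeft o (S.HolderBound o (2 * h) α W) W (α / 2) (S.P (2 * h)) (primitive h φ) := by
  obtain ⟨h1, h2⟩ := hφ.isBump_primitive (by omega)
  exact (uLeft_pre_holder hμ hh h1 h2 [] (by simp) (by simpa using hα)).congr
    fun t ht ht1 => S.P_eq_pre hμ _ ht (by linarith)

lemma uLeft_halfQ (hμ : VolumeDoubling μ) (hh : 3 ≤ h) (hφ : IsProfile (2 * h) φ)
    (hα : |α| < 2 * h) :
    S.ULeft o (S.HolderBound o (2 * h) α W) W (α / 2) (S.halfQ h) φ := by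
  have hm := hφ.isBump
  have hα' : |α| < ([] : List (Fin ℓ₀)).length + 2 * (h : ℝ) + 2 * ((0 : ℕ) : ℝ) := by simpa using hα
  have hpre : ∀ c, 1 ≤ c → c ≤ 2 → ∀ m, IsBump m →
      S.UBound o (S.HolderBound o (2 * h) α W) W (α / 2) (S.pre [] h c) m := fun c h1 h2 m hm =>
    uBound_pre hμ α W [] h c 0 h1 (by omega) hm (by simp) hα' (by simp; omega)
  obtain ⟨K, hK0, hK⟩ := uLeft_pre (c := 0) hμ (fun f N _ hf => hf.dist) hm
    (hpre 1 le_rfl (by omega) φ hm)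
    (UBound.elt hμ (fun f N _ hf => hf.dist) hm (hpre 1 le_rfl (by omega) φ hm)
      (hpre 2 (by omega) le_rfl φ hm)) (hpre 1 le_rfl (by omega) _ hm.dil)
  set r : ℝ := ((2 * h - 1).factorial : ℝ)⁻¹ with hr
  refine ⟨|r| * K, by positivity, fun f N hN hf => ?_⟩
  rw [mul_assoc]
  refine ((hK f N hN hf).const_mul r).congr fun t ht ht1 χ hχ => ?_
  have hk := hm.isKer ht
  change f (opK (r • S.pre [] h 1 t) (scaled φ t) χ) = _
  rw [opK_smul_left, hf.dist.smul _ _ (isTest_pre hμ hχ [] h 1 ht (by linarith) hk)]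
  rfl

/-- Negative regularity: the derivatives of the low-frequency part. -/
lemma uLeft_of_neg (hμ : VolumeDoubling μ) (hh : 3 ≤ h) (hφ : IsProfile (2 * h) φ)
    (J : List (Fin ℓ₀)) (l : ℕ) (hJ : J.length + 2 * l ≤ 2 * h) (hα0 : α < 0)
    (hα : |α| < 2 * h) :
    S.ULeft o (S.HolderBound o (2 * h) α W) W (α / 2) (S.pre J 0 (2 * h)) (iteratedDeriv l φ) := by
  obtain ⟨c, hc⟩ : ∃ c, 2 * h = c + 1 := ⟨2 * h - 1, by omega⟩
  have hm := hφ.isBump.iteratedDeriv l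
  have hmom : ∀ i < l, ∫ x, x ^ i * iteratedDeriv l φ x = 0 := fun i hi =>
    hφ.moments_iteratedDeriv l i (by omega) hi.ne
  have hE := uBound_elt_holder (S := S) (o := o) (W := W) hμ hh hm hmom J hJ hα
  have hD := uBound_pre (S := S) (o := o) (b := 2 * h) hμ α W J 0 (2 * h) h (by omega) le_rfl
    ((hm.const_mul (l : ℝ)).add hm.dil)
    (fun i hi => hφ.moments_dil_iteratedDeriv l i (by omega))
    (hα.trans_le (by push_cast; linarith [Nat.cast_nonneg (α := ℝ) J.length])) (by omega)
  obtain ⟨K, hK0, hK⟩ := HolderBound.exists_pre (S := S) (o := o) (b := 2 * h) J 0 (2 * h) l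
    (by omega) le_rfl hμ hm hmom (by omega)
  have hF : ∃ K : ℝ, 0 ≤ K ∧ ∀ f N, 0 ≤ N → S.HolderBound o (2 * h) α W f N → ∀ χ, S.IsTest o χ →
      |f (opK (S.pre J 0 (2 * h) 1) (scaled (iteratedDeriv l φ) 1) χ)| ≤ K * N * tn W χ :=
    ⟨K, hK0, fun f N _ hf χ hχ => ((hK α W f N hf χ hχ).1).trans_eq (by ring)⟩
  rw [show h + h = 0 + (c + 1) by omega] at hE
  have hH : ∀ f N, 0 ≤ N → S.HolderBound o (2 * h) α W f N → S.IsDistribution o f :=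
    fun f N _ hf => hf.dist
  generalize S.HolderBound o (2 * h) α W = H at *
  rw [hc] at hF hD ⊢
  refine uLeft_pre_of_neg (lam := l) hμ hH hm (Nat.cast_nonneg l) ?_ hF hE hD
  have := Nat.cast_nonneg (α := ℝ) J.length
  have := Nat.cast_nonneg (α := ℝ) l
  push_cast
  linarith

end Holder

lemma uLeft_bddClass (hμ : VolumeDoubling μ) {a : ℝ} (ha : 0 ≤ a) (hW : IsReg a W) {m : ℝ → ℝ}
    (hm : IsBump m) (J : List (Fin ℓ₀)) {c : ℕ} (hc : 1 ≤ c) :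
    S.ULeft o (BddClass W) W 0 (S.pre J 0 c) m := by
  obtain ⟨c, rfl⟩ : ∃ c', c = c' + 1 := ⟨c - 1, by omega⟩
  have hH : ∀ f N, 0 ≤ N → BddClass W f N → S.IsDistribution o f :=
    fun f N hN hf => BddClass.isDistribution hμ hW hN hf
  exact uLeft_pre hμ hH hm (UBound.pre hμ hH hm fun i => BddClass.uBound_elt hμ ha hW hm J _)
    (BddClass.uBound_elt hμ ha hW hm J _)
    (UBound.pre hμ hH hm.dil fun i => BddClass.uBound_elt hμ ha hW hm.dil J _)

end HeatSystem

end Parabolic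

namespace Parabolic

section Scalar

lemma rpow_le_of_mem_Icc {γ δ t : ℝ} (hδ : 0 < δ) (ht : t ∈ Icc δ 1) : t ^ γ ≤ δ ^ (-|γ|) :=
  (Real.rpow_le_rpow_of_exponent_ge (hδ.trans_le ht.1) ht.2 (neg_abs_le _)).trans
    (Real.rpow_le_rpow_of_nonpos hδ ht.1 (neg_nonpos.2 (abs_nonneg _)))

lemma continuousOn_Ioc_of_lipschitz {Φ : ℝ → ℝ}
    (h : ∀ δ, 0 < δ → ∃ D, ∀ s ∈ Icc δ 1, ∀ t ∈ Icc δ 1, |Φ s - Φ t| ≤ D * |s - t|) :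
    ContinuousOn Φ (Ioc 0 1) := by
  intro t ht
  obtain ⟨D, hD⟩ := h (t / 2) (by linarith [ht.1])
  have hc : ContinuousOn Φ (Icc (t / 2) 1) := by
    refine (LipschitzOnWith.of_dist_le_mul (K := Real.toNNReal D) fun x hx y hy => ?_).continuousOn
    rw [Real.dist_eq, Real.dist_eq]
    refine (hD x hx y hy).trans ?_
    gcongr
    exact Real.le_coe_toNNReal D
  refine (hc t ⟨by linarith [ht.1], ht.2⟩).mono_of_mem_nhdsWithin ?_
  filter_upwards [self_mem_nhdsWithin,
    mem_nhdsWithin_of_mem_nhds (Ioi_mem_nhds (by linarith [ht.1] : t / 2 < t))] with x hx hx2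
  exact ⟨hx2.le, hx.2⟩

variable {Φ : ℝ → ℝ} {T γ : ℝ}

lemma integrableOn_rpow_sub_one {e : ℝ} (he : 0 < e) {r : ℝ} (hr : 0 ≤ r) :
    IntegrableOn (fun t : ℝ => t ^ (e - 1)) (Ioc 0 r) ∧
      ∫ t in Ioc 0 r, t ^ (e - 1) = r ^ e / e := by
  have h1 := intervalIntegral.intervalIntegrable_rpow' (a := 0) (b := r) (r := e - 1) (by linarith)
  refine ⟨(intervalIntegrable_iff_integrableOn_Ioc_of_le hr).1 h1, ?_⟩
  rw [← intervalIntegral.integral_of_le hr, integral_rpow (Or.inl (by linarith))]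
  rw [sub_add_cancel, Real.zero_rpow he.ne', sub_zero]

lemma abs_integral_Ioc_zero_le {κ : ℕ} {k : ℕ} (hγ : 0 < γ + κ) {r : ℝ} (hr : 0 < r)
    (hr1 : r ≤ 1) (h : ∀ t ∈ Ioc (0 : ℝ) 1, |Φ t| ≤ T * t ^ γ * HeatSystem.scaleGain k κ r t) :
    |∫ t in Ioc 0 r, Φ t / t| ≤ T * r ^ γ * (γ + κ)⁻¹ := by
  obtain ⟨hI, hint⟩ := integrableOn_rpow_sub_one hγ hr.le
  rw [← Real.norm_eq_abs]
  refine (norm_integral_le_of_norm_le (hI.const_mul (T * r ^ (-(κ : ℝ)))) ?_).trans_eq ?_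
  · filter_upwards [ae_restrict_mem measurableSet_Ioc] with t ht
    have h1 := h t ⟨ht.1, ht.2.trans hr1⟩
    have h2 : HeatSystem.scaleGain k κ r t = t ^ (κ : ℝ) * r ^ (-(κ : ℝ)) := by
      rw [Real.rpow_neg hr.le, Real.rpow_natCast, Real.rpow_natCast, ← div_eq_mul_inv, ← div_pow]
      unfold HeatSystem.scaleGain
      split_ifs with hrt
      · rw [le_antisymm ht.2 hrt, div_self hr.ne', Real.one_rpow, one_pow]
      · rfl
    rw [norm_div, Real.norm_eq_abs, Real.norm_eq_abs, abs_of_pos ht.1, div_le_iff₀ ht.1]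
    refine h1.trans_eq ?_
    rw [h2, Real.rpow_sub_one ht.1.ne', Real.rpow_add ht.1]
    have := ht.1.ne'
    field_simp
  · rw [integral_const_mul, hint, Real.rpow_add hr, Real.rpow_neg hr.le]
    have := (Real.rpow_pos_of_pos hr (κ : ℝ)).ne'
    field_simp

lemma abs_integral_Ioc_one_le {κ : ℕ} {k : ℕ} (hk : γ < (k : ℝ) / 2) (hT : 0 ≤ T) {r : ℝ}
    (hr : 0 < r) (hr1 : r ≤ 1)
    (h : ∀ t ∈ Ioc (0 : ℝ) 1, |Φ t| ≤ T * t ^ γ * HeatSystem.scaleGain k κ r t) :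
    |∫ t in Ioc r 1, Φ t / t| ≤ T * r ^ γ * ((k : ℝ) / 2 - γ)⁻¹ := by
  set e : ℝ := γ - k / 2 with he
  have he0 : e < 0 := by rw [he]; linarith
  have hnot : (0 : ℝ) ∉ uIcc r 1 := by
    rw [uIcc_of_le hr1]; exact fun h => absurd h.1 (not_le.2 hr)
  have hI : IntegrableOn (fun t : ℝ => t ^ (e - 1)) (Ioc r 1) :=
    (intervalIntegrable_iff_integrableOn_Ioc_of_le hr1).1
      (intervalIntegral.intervalIntegrable_rpow (Or.inr hnot))
  have hint : ∫ t in Ioc r 1, t ^ (e - 1) = (1 - r ^ e) / e := by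
    rw [← intervalIntegral.integral_of_le hr1, integral_rpow (Or.inr ⟨by linarith, hnot⟩)]
    rw [sub_add_cancel, Real.one_rpow]
  rw [← Real.norm_eq_abs]
  refine (norm_integral_le_of_norm_le (hI.const_mul (T * r ^ ((k : ℝ) / 2))) ?_).trans ?_
  · filter_upwards [ae_restrict_mem measurableSet_Ioc] with t ht
    have ht0 := hr.trans ht.1
    have h1 := h t ⟨ht0, ht.2⟩
    have h2 : HeatSystem.scaleGain k κ r t = r ^ ((k : ℝ) / 2) * t ^ (-((k : ℝ) / 2)) := by
      rw [Real.rpow_neg ht0.le, ← div_eq_mul_inv, ← Real.div_rpow hr.le ht0.le]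
      exact if_pos ht.1.le
    rw [norm_div, Real.norm_eq_abs, Real.norm_eq_abs, abs_of_pos ht0, div_le_iff₀ ht0]
    refine h1.trans_eq ?_
    rw [h2, Real.rpow_sub_one ht0.ne', he, sub_eq_add_neg γ, Real.rpow_add ht0]
    have := ht0.ne'
    field_simp
  · have h3 : r ^ ((k : ℝ) / 2) * r ^ e = r ^ γ := by rw [← Real.rpow_add hr, he]; ring_nf
    have h4 : (1 - r ^ e) / e ≤ r ^ e * ((k : ℝ) / 2 - γ)⁻¹ := by
      have h5 : ((k : ℝ) / 2 - γ)⁻¹ = -e⁻¹ := by rw [← inv_neg, he]; ring_nf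
      rw [h5, div_eq_mul_inv]
      have := inv_neg''.2 he0
      nlinarith
    rw [integral_const_mul, hint]
    calc _ ≤ T * r ^ ((k : ℝ) / 2) * (r ^ e * ((k : ℝ) / 2 - γ)⁻¹) := by gcongr
      _ = _ := by rw [← h3]; ring

end Scalar

variable {M : Type*} [MetricSpace M] [MeasurableSpace M] {μ : Measure M} {ℓ₀ : ℕ}
  [BorelSpace M] [SecondCountableTopology M] [SigmaFinite μ]

lemma BddBy.add {W : M × ℝ → ℝ} {N N' : ℝ} {u u' : M × ℝ → ℝ}
    (hu : BddBy μ W N u) (hu' : BddBy μ W N' u') : BddBy μ W (N + N') (u + u') :=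
  ⟨hu.meas.add hu'.meas, by
    filter_upwards [hu.le, hu'.le] with e a1 a2
    rw [Pi.add_apply]
    have := abs_add_le (u e) (u' e)
    linarith⟩

lemma BddBy.pair_sub_right {W : M × ℝ → ℝ} {a N : ℝ} {u : M × ℝ → ℝ} {χ χ' : ℝ → Lp ℝ 2 μ}
    (hW : IsReg a W) (hu : BddBy μ W N u) (hχ : IsCurve χ) (hχ' : IsCurve χ')
    (hfin : crvNorm W χ ≠ ∞) (hfin' : crvNorm W χ' ≠ ∞) :
    pair u (χ - χ') = pair u χ - pair u χ' ∧ crvNorm W (χ - χ') ≠ ∞ := by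
  have h1 : crvNorm W ((-1 : ℝ) • χ') ≠ ∞ := by
    rw [crvNorm_smul]; exact ENNReal.mul_ne_top enorm_ne_top hfin'
  have e : χ - χ' = χ + (-1 : ℝ) • χ' := by rw [neg_one_smul, sub_eq_add_neg]
  rw [e, hu.pair_add hW hχ (hχ'.smul _) hfin h1, hu.pair_smul hW hχ' _ hfin']
  exact ⟨by ring, ne_top_of_le_ne_top (ENNReal.add_ne_top.2 ⟨hfin, h1⟩) (crvNorm_add_le hχ hW)⟩

namespace HeatSystem

/-- Families of functionals whose integral over all scales is a distribution of regularity `2γ`. -/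
structure GoodTerm (S : HeatSystem μ ℓ₀) (o : M) (b κ : ℕ) (W : M × ℝ → ℝ) (B γ : ℝ)
    (Θ : ℝ → (ℝ → Lp ℝ 2 μ) → ℝ) : Prop where
  lin : ∀ t, 0 < t → t ≤ 1 → S.IsLin o (Θ t)
  cont : ∀ χ, S.IsTest o χ → ContinuousOn (fun t => Θ t χ) (Ioc 0 1)
  decay : ∀ r, ∃ (N : ℕ) (C : ℝ), 0 ≤ C ∧ ∀ χ, S.IsTest o χ → (∀ τ, r < |τ| → χ τ = 0) →
    ∀ B' : ℝ≥0, (∀ a ≤ N, ∀ n ≤ N, ∀ k ≤ N, S.testSeminorm o a n k χ ≤ B') →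
      ∀ t, 0 < t → t ≤ 1 → |Θ t χ| ≤ C * B' * t ^ (γ + κ)
  bound : ∀ (Q : StdFamily ℓ₀) (k : ℕ), k ≤ 2 * b → Q.IsStGC b k →
    ∀ r t, 0 < r → r ≤ 1 → 0 < t → t ≤ 1 → ∀ χ, S.IsTest o χ →
      |Θ t (opAdj (S.pre Q.J Q.n Q.c r) Q.m r χ)| ≤ B * t ^ γ * scaleGain k κ r t * tn W χ

variable {S : HeatSystem μ ℓ₀} {o : M} {b κ : ℕ} {W : M × ℝ → ℝ} {B γ : ℝ}
  {Θ : ℝ → (ℝ → Lp ℝ 2 μ) → ℝ}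

namespace GoodTerm

lemma integrableOn (h : S.GoodTerm o b κ W B γ Θ) (hγ : 0 < γ + κ) {χ : ℝ → Lp ℝ 2 μ}
    (hχ : S.IsTest o χ) : IntegrableOn (fun t => Θ t χ / t) (Ioc (0 : ℝ) 1) := by
  obtain ⟨r, -, hr⟩ := hχ.exists_support
  obtain ⟨N, C, -, hC⟩ := h.decay r
  obtain ⟨B', -, hB'⟩ := exists_forall_le N (P := fun k C => ∀ a ≤ N, ∀ n ≤ N,
      S.testSeminorm o a n k χ ≤ ENNReal.ofReal C) (fun k => by
    obtain ⟨C₁, h0, hC₁⟩ := exists_forall_le N (P := fun n C => ∀ a ≤ N,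
        S.testSeminorm o a n k χ ≤ ENNReal.ofReal C)
      (fun n => ⟨(S.testSeminorm o N n k χ).toReal, ENNReal.toReal_nonneg, fun a ha => by
        rw [ENNReal.ofReal_toReal (hχ.decay N n k).ne]
        exact testSeminorm_mono ha n k χ⟩)
      (fun n C C' hCC' hh a ha => (hh a ha).trans (ENNReal.ofReal_le_ofReal hCC'))
    exact ⟨C₁, h0, fun a ha n hn => hC₁ n hn a ha⟩)
    (fun k C C' hCC' hh a ha n hn => (hh a ha n hn).trans (ENNReal.ofReal_le_ofReal hCC'))
  have hb := hC χ hχ hr (Real.toNNReal B') fun a ha n hn k hk => hB' k hk a ha n hn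
  have hI := (integrableOn_rpow_sub_one hγ zero_le_one).1
  refine (hI.const_mul (C * (Real.toNNReal B' : ℝ))).mono'
    (((h.cont χ hχ).div continuousOn_id fun t ht => ht.1.ne').aestronglyMeasurable
      measurableSet_Ioc) ?_
  filter_upwards [ae_restrict_mem measurableSet_Ioc] with t ht
  rw [norm_div, Real.norm_eq_abs, Real.norm_eq_abs, abs_of_pos ht.1, div_le_iff₀ ht.1, mul_assoc,
    Real.rpow_sub_one ht.1.ne', div_mul_cancel₀ _ ht.1.ne']
  exact hb t ht.1 ht.2

lemma isDistribution (h : S.GoodTerm o b κ W B γ Θ) (hγ : 0 < γ + κ) :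
    S.IsDistribution o fun χ => ∫ t in Ioc (0 : ℝ) 1, Θ t χ / t := by
  refine ⟨fun χ χ' hχ hχ' => ?_, fun r χ hχ => ?_, fun τ₀ => ?_⟩
  · rw [← integral_add (h.integrableOn hγ hχ) (h.integrableOn hγ hχ')]
    refine setIntegral_congr_fun measurableSet_Ioc fun t ht => ?_
    simp only [(h.lin t ht.1 ht.2).add _ _ hχ hχ', add_div]
  · rw [← integral_const_mul]
    refine setIntegral_congr_fun measurableSet_Ioc fun t ht => ?_
    simp only [(h.lin t ht.1 ht.2).smul _ _ hχ, mul_div_assoc]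
  · obtain ⟨N, C, hC0, hC⟩ := h.decay τ₀
    refine ⟨N, ⟨C * (γ + κ)⁻¹, by positivity⟩, fun χ hχ hsupp B' hB' => ?_⟩
    obtain ⟨hI, hint⟩ := integrableOn_rpow_sub_one hγ zero_le_one
    rw [← Real.norm_eq_abs]
    refine (norm_integral_le_of_norm_le (hI.const_mul (C * (B' : ℝ))) ?_).trans_eq ?_
    · filter_upwards [ae_restrict_mem measurableSet_Ioc] with t ht
      rw [norm_div, Real.norm_eq_abs, Real.norm_eq_abs, abs_of_pos ht.1, div_le_iff₀ ht.1, mul_assoc,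
        Real.rpow_sub_one ht.1.ne', div_mul_cancel₀ _ ht.1.ne']
      exact hC χ hχ hsupp B' hB' t ht.1 ht.2
    · rw [integral_const_mul, hint, Real.one_rpow]
      change _ = C * (γ + κ)⁻¹ * B'
      ring

/-- The constant in the bound of the integral over all scales. -/
noncomputable def _root_.Parabolic.scaleConst (κ : ℕ) (γ : ℝ) : ℝ :=
  (γ + κ)⁻¹ + 2 * ((⌊|2 * γ|⌋₊ : ℝ) + 1 - |2 * γ|)⁻¹

lemma holderBound (hμ : VolumeDoubling μ) (h : S.GoodTerm o b κ W B γ Θ) (hγ : 0 < γ + κ)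
    (hB : 0 ≤ B) {α : ℝ} (hα : α = 2 * γ) :
    S.HolderBound o b α W (fun χ => ∫ t in Ioc (0 : ℝ) 1, Θ t χ / t) (scaleConst κ γ * B) := by
  have hfl : 0 ≤ 2 * ((⌊|2 * γ|⌋₊ : ℝ) + 1 - |2 * γ|)⁻¹ := by
    have := Nat.lt_floor_add_one |2 * γ|
    exact mul_nonneg zero_le_two (inv_nonneg.2 (by linarith))
  have hbd : ∀ (Q : StdFamily ℓ₀) k, k ≤ 2 * b → Q.IsStGC b k → ∀ r, 0 < r → r ≤ 1 →
      ∀ χ, S.IsTest o χ → ∀ t ∈ Ioc (0 : ℝ) 1,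
        |Θ t (opAdj (S.pre Q.J Q.n Q.c r) Q.m r χ)| ≤ B * tn W χ * t ^ γ * scaleGain k κ r t :=
    fun Q k hk hQ r hr hr1 χ hχ t ht => (h.bound Q k hk hQ r t hr hr1 ht.1 ht.2 χ hχ).trans_eq
      (by ring)
  have hBT : ∀ χ : ℝ → Lp ℝ 2 μ, 0 ≤ B * tn W χ := fun χ => mul_nonneg hB (tn_nonneg W χ)
  refine ⟨h.isDistribution hγ, fun Q k hk hQ χ hχ => ?_, fun Q k hαk hk hQ r hr hr1 χ hχ => ?_⟩
  · refine (abs_integral_Ioc_zero_le hγ one_pos le_rfl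
      (hbd Q k hk hQ 1 one_pos le_rfl χ hχ)).trans ?_
    rw [Real.one_rpow, mul_one, mul_comm, ← mul_assoc]
    gcongr
    · exact tn_nonneg W χ
    · exact le_add_of_nonneg_right hfl
  · have hχ' := isTest_pre hμ hχ Q.J Q.n Q.c hr (by linarith) (hQ.isBump.isKer hr)
    rw [← opAdj_eq] at hχ'
    have hI := h.integrableOn hγ hχ'
    change |∫ t in Ioc (0 : ℝ) 1, Θ t (opAdj (S.pre Q.J Q.n Q.c r) Q.m r χ) / t| ≤ _
    rw [← Ioc_union_Ioc_eq_Ioc hr.le hr1, setIntegral_union (Ioc_disjoint_Ioc_of_le le_rfl)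
      measurableSet_Ioc (hI.mono_set (Ioc_subset_Ioc_right hr1))
      (hI.mono_set (Ioc_subset_Ioc_left hr.le))]
    rw [hα] at hαk ⊢
    have hk2 : (⌊|2 * γ|⌋₊ : ℝ) + 1 ≤ k := by
      have h1 : ⌊|2 * γ|⌋₊ < k := (Nat.floor_lt (abs_nonneg _)).2 hαk
      exact_mod_cast h1
    have hlt := Nat.lt_floor_add_one |2 * γ|
    have hle := le_abs_self (2 * γ)
    have h1 := abs_integral_Ioc_zero_le hγ hr hr1 (hbd Q k hk hQ r hr hr1 χ hχ)
    have h2 := abs_integral_Ioc_one_le (γ := γ) (k := k) (by linarith) (hBT χ) hr hr1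
      (hbd Q k hk hQ r hr hr1 χ hχ)
    have h3 : ((k : ℝ) / 2 - γ)⁻¹ ≤ 2 * ((⌊|2 * γ|⌋₊ : ℝ) + 1 - |2 * γ|)⁻¹ := by
      rw [← inv_inv (2 : ℝ), ← mul_inv]
      exact inv_anti₀ (by linarith) (by linarith)
    have h4 : (2 * γ) / 2 = γ := by ring
    rw [h4]
    refine (abs_add_le _ _).trans ((add_le_add h1 h2).trans ?_)
    unfold scaleConst
    have hT := hBT χ
    calc _ = B * tn W χ * r ^ γ * ((γ + κ)⁻¹ + ((k : ℝ) / 2 - γ)⁻¹) := by ring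
      _ ≤ B * tn W χ * r ^ γ * ((γ + κ)⁻¹ + 2 * ((⌊|2 * γ|⌋₊ : ℝ) + 1 - |2 * γ|)⁻¹) := by gcongr
      _ = _ := by ring

end GoodTerm

end HeatSystem

end Parabolic

namespace Parabolic

variable {M : Type*} [MetricSpace M] [MeasurableSpace M] {μ : Measure M} {ℓ₀ : ℕ}
  [BorelSpace M] [SecondCountableTopology M] [SigmaFinite μ]

namespace HeatSystem

variable {S : HeatSystem μ ℓ₀} {o : M} {b κ : ℕ} {W : M × ℝ → ℝ} {B B' γ : ℝ}
  {Θ Θ' : ℝ → (ℝ → Lp ℝ 2 μ) → ℝ}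

namespace GoodTerm

lemma congr (h : S.GoodTerm o b κ W B γ Θ) (he : ∀ t, 0 < t → t ≤ 1 → Θ' t = Θ t) :
    S.GoodTerm o b κ W B γ Θ' := by
  refine ⟨fun t ht ht1 => by rw [he t ht ht1]; exact h.lin t ht ht1, fun χ hχ =>
    (h.cont χ hχ).congr fun t ht => by rw [he t ht.1 ht.2], fun r => ?_,
    fun Q k hk hQ r t hr hr1 ht ht1 => by rw [he t ht ht1]; exact h.bound Q k hk hQ r t hr hr1 ht ht1⟩
  obtain ⟨N, C, hC0, hC⟩ := h.decay r
  exact ⟨N, C, hC0, fun χ hχ hr B' hB' t ht ht1 => by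
    rw [he t ht ht1]; exact hC χ hχ hr B' hB' t ht ht1⟩

lemma const_mul (h : S.GoodTerm o b κ W B γ Θ) (r : ℝ) :
    S.GoodTerm o b κ W (|r| * B) γ fun t χ => r * Θ t χ := by
  refine ⟨fun t ht ht1 => ⟨fun χ χ' h1 h2 => ?_, fun c χ h1 => ?_⟩, fun χ hχ =>
    continuousOn_const.mul (h.cont χ hχ), fun ρ => ?_, fun Q k hk hQ ρ t hρ hρ1 ht ht1 χ hχ => ?_⟩
  · rw [(h.lin t ht ht1).add _ _ h1 h2, mul_add]
  · rw [(h.lin t ht ht1).smul _ _ h1]; ring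
  · obtain ⟨N, C, hC0, hC⟩ := h.decay ρ
    refine ⟨N, |r| * C, by positivity, fun χ hχ hr B' hB' t ht ht1 => ?_⟩
    rw [abs_mul, mul_assoc, mul_assoc, ← mul_assoc C]
    exact mul_le_mul_of_nonneg_left (hC χ hχ hr B' hB' t ht ht1) (abs_nonneg _)
  · rw [abs_mul, mul_assoc |r|, mul_assoc |r|, mul_assoc |r|]
    exact mul_le_mul_of_nonneg_left (h.bound Q k hk hQ ρ t hρ hρ1 ht ht1 χ hχ) (abs_nonneg _)

lemma add (h : S.GoodTerm o b κ W B γ Θ) (h' : S.GoodTerm o b κ W B' γ Θ') :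
    S.GoodTerm o b κ W (B + B') γ fun t χ => Θ t χ + Θ' t χ := by
  refine ⟨fun t ht ht1 => ⟨fun χ χ' h1 h2 => ?_, fun c χ h1 => ?_⟩, fun χ hχ =>
    (h.cont χ hχ).add (h'.cont χ hχ), fun ρ => ?_, fun Q k hk hQ ρ t hρ hρ1 ht ht1 χ hχ => ?_⟩
  · rw [(h.lin t ht ht1).add _ _ h1 h2, (h'.lin t ht ht1).add _ _ h1 h2]; ring
  · rw [(h.lin t ht ht1).smul _ _ h1, (h'.lin t ht ht1).smul _ _ h1]; ring
  · obtain ⟨N, C, hC0, hC⟩ := h.decay ρ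
    obtain ⟨N', C', hC0', hC'⟩ := h'.decay ρ
    refine ⟨max N N', C + C', by positivity, fun χ hχ hr B' hB' t ht ht1 => ?_⟩
    have h1 := hC χ hχ hr B' (fun a ha n hn k hk => hB' a (le_max_of_le_left ha) n
      (le_max_of_le_left hn) k (le_max_of_le_left hk)) t ht ht1
    have h2 := hC' χ hχ hr B' (fun a ha n hn k hk => hB' a (le_max_of_le_right ha) n
      (le_max_of_le_right hn) k (le_max_of_le_right hk)) t ht ht1
    refine (abs_add_le _ _).trans ((add_le_add h1 h2).trans_eq ?_)
    ring
  · refine (abs_add_le _ _).trans ((add_le_add (h.bound Q k hk hQ ρ t hρ hρ1 ht ht1 χ hχ)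
      (h'.bound Q k hk hQ ρ t hρ hρ1 ht ht1 χ hχ)).trans_eq ?_)
    ring

lemma zero : S.GoodTerm o b κ W 0 γ fun _ _ => 0 :=
  ⟨fun _ _ _ => ⟨by simp, by simp⟩, fun _ _ => continuousOn_const,
    fun _ => ⟨0, 0, le_rfl, by simp⟩, by simp⟩

end GoodTerm

/-- Bilinear families that are good, uniformly over classes of distributions. -/
def UGood (S : HeatSystem μ ℓ₀) (o : M) (b κ : ℕ) (H₁ H₂ : ((ℝ → Lp ℝ 2 μ) → ℝ) → ℝ → Prop)
    (W : M × ℝ → ℝ) (γ : ℝ)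
    (Θ : ((ℝ → Lp ℝ 2 μ) → ℝ) → ((ℝ → Lp ℝ 2 μ) → ℝ) → ℝ → (ℝ → Lp ℝ 2 μ) → ℝ) : Prop :=
  ∃ C : ℝ, 0 ≤ C ∧ ∀ f g N₁ N₂, 0 ≤ N₁ → 0 ≤ N₂ → H₁ f N₁ → H₂ g N₂ →
    S.GoodTerm o b κ W (C * (N₁ * N₂)) γ (Θ f g)

namespace UGood

variable {H₁ H₂ : ((ℝ → Lp ℝ 2 μ) → ℝ) → ℝ → Prop}
  {Θ Θ' : ((ℝ → Lp ℝ 2 μ) → ℝ) → ((ℝ → Lp ℝ 2 μ) → ℝ) → ℝ → (ℝ → Lp ℝ 2 μ) → ℝ}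

lemma const_mul (h : S.UGood o b κ H₁ H₂ W γ Θ) (r : ℝ) :
    S.UGood o b κ H₁ H₂ W γ fun f g t χ => r * Θ f g t χ := by
  obtain ⟨C, hC0, hC⟩ := h
  refine ⟨|r| * C, by positivity, fun f g N₁ N₂ h1 h2 hf hg => ?_⟩
  rw [mul_assoc]
  exact (hC f g N₁ N₂ h1 h2 hf hg).const_mul r

lemma add (h : S.UGood o b κ H₁ H₂ W γ Θ) (h' : S.UGood o b κ H₁ H₂ W γ Θ') :
    S.UGood o b κ H₁ H₂ W γ fun f g t χ => Θ f g t χ + Θ' f g t χ := by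
  obtain ⟨C, hC0, hC⟩ := h
  obtain ⟨C', hC0', hC'⟩ := h'
  refine ⟨C + C', by positivity, fun f g N₁ N₂ h1 h2 hf hg => ?_⟩
  rw [add_mul]
  exact (hC f g N₁ N₂ h1 h2 hf hg).add (hC' f g N₁ N₂ h1 h2 hf hg)

lemma sum {ι : Type*} (s : Finset ι)
    {Θ : ι → ((ℝ → Lp ℝ 2 μ) → ℝ) → ((ℝ → Lp ℝ 2 μ) → ℝ) → ℝ → (ℝ → Lp ℝ 2 μ) → ℝ}
    (h : ∀ i ∈ s, S.UGood o b κ H₁ H₂ W γ (Θ i)) :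
    S.UGood o b κ H₁ H₂ W γ fun f g t χ => ∑ i ∈ s, Θ i f g t χ := by
  classical
  induction s using Finset.induction_on with
  | empty =>
    refine ⟨0, le_rfl, fun f g N₁ N₂ _ _ _ _ => ?_⟩
    simpa using GoodTerm.zero
  | insert i s hi ih =>
    simp only [Finset.sum_insert hi]
    exact (h i (Finset.mem_insert_self i s)).add (ih fun j hj => h j (Finset.mem_insert_of_mem hj))

lemma swap (h : S.UGood o b κ H₂ H₁ W γ Θ) : S.UGood o b κ H₁ H₂ W γ fun f g => Θ g f := by
  obtain ⟨C, hC0, hC⟩ := h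
  refine ⟨C, hC0, fun f g N₁ N₂ h1 h2 hf hg => ?_⟩
  rw [mul_comm N₁]
  exact hC g f N₂ N₁ h2 h1 hg hf

lemma congr (h : S.UGood o b κ H₁ H₂ W γ Θ)
    (he : ∀ f g t, 0 < t → t ≤ 1 → Θ' f g t = Θ f g t) : S.UGood o b κ H₁ H₂ W γ Θ' := by
  obtain ⟨C, hC0, hC⟩ := h
  exact ⟨C, hC0, fun f g N₁ N₂ h1 h2 hf hg => (hC f g N₁ N₂ h1 h2 hf hg).congr (he f g)⟩

end UGood

section Product

variable {W₁ W₂ : M × ℝ → ℝ} {a₁ a₂ B₁ B₂ γ₁ γ₂ : ℝ} {F G : ℝ → (ℝ → Lp ℝ 2 μ) → ℝ}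

/-- Products of good families are locally Lipschitz in the scale. -/
lemma LeftGood.exists_bddBy_mul_sub (hμ : VolumeDoubling μ) (hW₁ : IsReg a₁ W₁)
    (hW₁1 : ∀ e, 1 ≤ W₁ e) (hW₂ : IsReg a₂ W₂) (hW₂1 : ∀ e, 1 ≤ W₂ e) (hB₁ : 0 ≤ B₁) (hB₂ : 0 ≤ B₂)
    (hF : S.LeftGood o W₁ B₁ γ₁ F) (hG : S.LeftGood o W₂ B₂ γ₂ G) {δ : ℝ} (hδ : 0 < δ) :
    ∃ D, 0 ≤ D ∧ ∀ s ∈ Icc δ 1, ∀ t ∈ Icc δ 1, BddBy μ (W₁ * W₂) (D * |s - t|)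
      (S.toFunction o (F s) * S.toFunction o (G s) - S.toFunction o (F t) * S.toFunction o (G t)) := by
  obtain ⟨D₁, hD₁0, hD₁⟩ := hF.exists_bddBy_sub hμ hW₁ hW₁1 hB₁ hδ
  obtain ⟨D₂, hD₂0, hD₂⟩ := hG.exists_bddBy_sub hμ hW₂ hW₂1 hB₂ hδ
  refine ⟨D₁ * (B₂ * δ ^ (-|γ₂|)) + B₁ * δ ^ (-|γ₁|) * D₂, by positivity, fun s hs t ht => ?_⟩
  have hs0 := hδ.trans_le hs.1
  have ht0 := hδ.trans_le ht.1
  have h1 := (hD₁ s hs t ht).mul ((hG.bddBy hμ hW₂ hW₂1 hB₂ hs0 hs.2).2)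
  have h2 := ((hF.bddBy hμ hW₁ hW₁1 hB₁ ht0 ht.2).2).mul (hD₂ s hs t ht)
  have e : S.toFunction o (F s) * S.toFunction o (G s) - S.toFunction o (F t) * S.toFunction o (G t) =
      (S.toFunction o (F s) - S.toFunction o (F t)) * S.toFunction o (G s) +
        S.toFunction o (F t) * (S.toFunction o (G s) - S.toFunction o (G t)) := by ring
  rw [e]
  refine (h1.add h2).mono fun x => ?_
  have hp := mul_pos (hW₁.pos x) (hW₂.pos x)
  rw [Pi.mul_apply]
  gcongr
  have h3 := rpow_le_of_mem_Icc (γ := γ₂) hδ hs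
  have h4 := rpow_le_of_mem_Icc (γ := γ₁) hδ ht
  calc _ ≤ D₁ * |s - t| * (B₂ * δ ^ (-|γ₂|)) + B₁ * δ ^ (-|γ₁|) * (D₂ * |s - t|) := by gcongr
    _ = _ := by ring

lemma exists_goodTerm (hμ : VolumeDoubling μ) (hW₁ : IsReg a₁ W₁)
    (hW₁1 : ∀ e, 1 ≤ W₁ e) (hW₂ : IsReg a₂ W₂) (hW₂1 : ∀ e, 1 ≤ W₂ e) (R : RightFam ℓ₀)
    {n : ℝ → ℝ} (hn : IsBump n) (hκ : κ ≤ b) (hg : Gain R n κ) : ∃ C : ℝ, 0 ≤ C ∧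
    ∀ F G B₁ B₂ γ₁ γ₂, 0 ≤ B₁ → 0 ≤ B₂ → S.LeftGood o W₁ B₁ γ₁ F → S.LeftGood o W₂ B₂ γ₂ G →
      S.GoodTerm o b κ (W₁ * W₂) (C * (B₁ * B₂)) (γ₁ + γ₂) fun t χ =>
        pair (S.toFunction o (F t) * S.toFunction o (G t)) (opK (S.rop R t) (scaled n t) χ) := by
  have hW := hW₁.mul hW₂
  have ha : 0 ≤ a₁ + a₂ := (hW.wt 0).nonneg
  obtain ⟨C, hC0, hC⟩ := exists_tn_rop_pre_le (S := S) hμ R hn hκ hg ha hW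
  obtain ⟨CR, -, hCR⟩ := S.exists_wB_rop hμ R ha
  refine ⟨C, hC0, fun F G B₁ B₂ γ₁ γ₂ hB₁ hB₂ hF hG => ?_⟩
  set p : ℝ → M × ℝ → ℝ := fun t => S.toFunction o (F t) * S.toFunction o (G t) with hp
  have hpb : ∀ t, 0 < t → t ≤ 1 → BddBy μ (W₁ * W₂) (B₁ * B₂ * t ^ (γ₁ + γ₂)) (p t) := by
    intro t ht ht1
    have := ((hF.bddBy hμ hW₁ hW₁1 hB₁ ht ht1).2).mul ((hG.bddBy hμ hW₂ hW₂1 hB₂ ht ht1).2)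
    rw [Real.rpow_add ht]
    exact this.mono fun e => le_of_eq (by ring)
  have hcrv : ∀ t, 0 < t → t ≤ 1 → ∀ χ, IsCurve χ → crvNorm (W₁ * W₂) χ ≠ ∞ →
      IsCurve (opK (S.rop R t) (scaled n t) χ) ∧
      crvNorm (W₁ * W₂) (opK (S.rop R t) (scaled n t) χ) ≠ ∞ := fun t ht ht1 χ hχ hfin =>
    ⟨hχ.opK (hn.isKer ht) _, crvNorm_opK_ne_top (hCR t ht (by linarith)) hW (hn.isKer ht) hχ hfin⟩
  have hfin : ∀ χ, S.IsTest o χ → crvNorm (W₁ * W₂) χ ≠ ∞ := fun χ hχ => hχ.crvNorm_ne_top hμ hW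
  refine ⟨fun t ht ht1 => ⟨fun χ χ' hχ hχ' => ?_, fun r χ hχ => ?_⟩, fun χ hχ => ?_, fun r => ?_,
    fun Q k hk hQ r t hr hr1 ht ht1 χ hχ => ?_⟩
  · obtain ⟨h1, h2⟩ := hcrv t ht ht1 χ hχ.isCurve (hfin χ hχ)
    obtain ⟨h3, h4⟩ := hcrv t ht ht1 χ' hχ'.isCurve (hfin χ' hχ')
    rw [opK_add_right (hn.isKer ht).cont hχ.isCurve hχ'.isCurve]
    exact (hpb t ht ht1).pair_add hW h1 h3 h2 h4
  · obtain ⟨h1, h2⟩ := hcrv t ht ht1 χ hχ.isCurve (hfin χ hχ)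
    rw [opK_smul_right]
    exact (hpb t ht ht1).pair_smul hW h1 r h2
  · refine continuousOn_Ioc_of_lipschitz fun δ hδ => ?_
    obtain ⟨D₁, hD₁0, hD₁⟩ := hF.exists_bddBy_mul_sub hμ hW₁ hW₁1 hW₂ hW₂1 hB₁ hB₂ hG hδ
    obtain ⟨D₂, hD₂0, hD₂⟩ := exists_tn_rop_sub_le (S := S) hμ R hn ha hW hδ
    set K : ℝ := CR * ∫ x, |n x| with hK
    refine ⟨D₁ * (K * tn (W₁ * W₂) χ) + B₁ * B₂ * δ ^ (-|γ₁ + γ₂|) * (D₂ * tn (W₁ * W₂) χ),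
      fun s hs t ht => ?_⟩
    have hs0 := hδ.trans_le hs.1
    have ht0 := hδ.trans_le ht.1
    obtain ⟨h1, h2⟩ := hcrv s hs0 hs.2 χ hχ.isCurve (hfin χ hχ)
    obtain ⟨h3, h4⟩ := hcrv t ht0 ht.2 χ hχ.isCurve (hfin χ hχ)
    have e1 := (hpb s hs0 hs.2).pair_sub_left hW (hpb t ht0 ht.2) h1 h2
    obtain ⟨e2, hf2⟩ := (hpb t ht0 ht.2).pair_sub_right hW h1 h3 h2 h4
    have e : pair (p s) (opK (S.rop R s) (scaled n s) χ) -
        pair (p t) (opK (S.rop R t) (scaled n t) χ) =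
        pair (p s - p t) (opK (S.rop R s) (scaled n s) χ) +
        pair (p t) (opK (S.rop R s) (scaled n s) χ - opK (S.rop R t) (scaled n t) χ) := by
      rw [e1, e2]; ring
    change |pair (p s) _ - pair (p t) _| ≤ _
    rw [e]
    have b1 := (hD₁ s hs t ht).abs_pair_le hW h1 h2
    have b2 := (hpb t ht0 ht.2).abs_pair_le hW (h1.sub h3) hf2
    have b3 := tn_opK_le (hCR s hs0 (by linarith [hs.2])) hW (hn.isKer hs0) hχ.isCurve (hfin χ hχ)
    rw [integral_abs_scaled n hs0] at b3
    have b4 := hD₂ s hs t ht χ hχ.isCurve (hfin χ hχ)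
    have b5 := rpow_le_of_mem_Icc (γ := γ₁ + γ₂) hδ ht
    have hT := tn_nonneg (W₁ * W₂) χ
    have hT' := tn_nonneg (W₁ * W₂) (opK (S.rop R s) (scaled n s) χ - opK (S.rop R t) (scaled n t) χ)
    refine (abs_add_le _ _).trans ((add_le_add b1 b2).trans ?_)
    calc _ ≤ D₁ * |s - t| * (K * tn (W₁ * W₂) χ) +
          B₁ * B₂ * δ ^ (-|γ₁ + γ₂|) * (D₂ * |s - t| * tn (W₁ * W₂) χ) := by gcongr
      _ = _ := by ring
  · obtain ⟨N, C', hC0', hC'⟩ := exists_crvNorm_rop_le (S := S) hμ o R hn hg ha hW r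
    refine ⟨N, B₁ * B₂ * C', by positivity, fun χ hχ hr B' hB' t ht ht1 => ?_⟩
    obtain ⟨h1, h2⟩ := hcrv t ht ht1 χ hχ.isCurve (hfin χ hχ)
    refine ((hpb t ht ht1).abs_pair_le hW h1 h2).trans ?_
    have h3 := ENNReal.toReal_mono ENNReal.ofReal_ne_top (hC' χ hχ hr B' hB' t ht ht1)
    rw [ENNReal.toReal_ofReal (by positivity)] at h3
    rw [Real.rpow_add ht (γ₁ + γ₂), Real.rpow_natCast]
    calc _ ≤ B₁ * B₂ * t ^ (γ₁ + γ₂) * (C' * B' * t ^ κ) := by gcongr; exact h3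
      _ = _ := by ring
  · have hχ' := isTest_pre hμ hχ Q.J Q.n Q.c hr (by linarith) (hQ.isBump.isKer hr)
    rw [← opAdj_eq] at hχ'
    obtain ⟨h1, h2⟩ := hcrv t ht ht1 _ hχ'.isCurve (hfin _ hχ')
    refine ((hpb t ht ht1).abs_pair_le hW h1 h2).trans ?_
    have h3 := hC Q k hk hQ r t hr hr1 ht ht1 χ hχ.isCurve (hfin χ hχ)
    calc _ ≤ B₁ * B₂ * t ^ (γ₁ + γ₂) * (C * scaleGain k κ r t * tn (W₁ * W₂) χ) := by gcongr
      _ = _ := by ring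

variable {H₁ H₂ : ((ℝ → Lp ℝ 2 μ) → ℝ) → ℝ → Prop} {R₁ R₂ : ℝ → Lp ℝ 2 μ →L[ℝ] Lp ℝ 2 μ}
  {m₁ m₂ : ℝ → ℝ}

lemma ULeft.uGood (hμ : VolumeDoubling μ) (hW₁ : IsReg a₁ W₁)
    (hW₁1 : ∀ e, 1 ≤ W₁ e) (hW₂ : IsReg a₂ W₂) (hW₂1 : ∀ e, 1 ≤ W₂ e)
    (h₁ : S.ULeft o H₁ W₁ γ₁ R₁ m₁) (h₂ : S.ULeft o H₂ W₂ γ₂ R₂ m₂) (R : RightFam ℓ₀)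
    {n : ℝ → ℝ} (hn : IsBump n) (hκ : κ ≤ b) (hg : Gain R n κ) :
    S.UGood o b κ H₁ H₂ (W₁ * W₂) (γ₁ + γ₂) fun f g t χ =>
      pair (S.opFun o (R₁ t) m₁ t f * S.opFun o (R₂ t) m₂ t g)
        (opK (S.rop R t) (scaled n t) χ) := by
  obtain ⟨C, hC0, hC⟩ := exists_goodTerm (S := S) (o := o) hμ hW₁ hW₁1 hW₂ hW₂1 R hn hκ hg
  obtain ⟨K₁, hK₁0, hK₁⟩ := h₁
  obtain ⟨K₂, hK₂0, hK₂⟩ := h₂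
  refine ⟨C * (K₁ * K₂), by positivity, fun f g N₁ N₂ h1 h2 hf hg => ?_⟩
  have := hC _ _ _ _ _ _ (mul_nonneg hK₁0 h1) (mul_nonneg hK₂0 h2) (hK₁ f N₁ h1 hf)
    (hK₂ g N₂ h2 hg)
  rw [show C * (K₁ * K₂) * (N₁ * N₂) = C * (K₁ * N₁ * (K₂ * N₂)) by ring]
  exact this

end Product

end HeatSystem

end Parabolic

namespace Parabolic

lemma length_subword {ℓ₀ h : ℕ} (i : Fin h → Fin ℓ₀) (A : Finset (Fin (2 * h))) :
    (subword i A).length = A.card := by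
  simp [subword]

lemma card_add_card_compl_fin {h : ℕ} (A : Finset (Fin (2 * h))) : A.card + Aᶜ.card = 2 * h := by
  rw [Finset.card_add_card_compl, Fintype.card_fin]

variable {M : Type*} [MetricSpace M] [MeasurableSpace M] {μ : Measure M} {ℓ₀ : ℕ}
  [BorelSpace M] [SecondCountableTopology M] [SigmaFinite μ]

namespace HeatSystem

variable {S : HeatSystem μ ℓ₀} {o : M} {h κ : ℕ} {φ : ℝ → ℝ} {W₁ W₂ : M × ℝ → ℝ} {a₁ a₂ γ₁ γ₂ : ℝ}
  {H₁ H₂ : ((ℝ → Lp ℝ 2 μ) → ℝ) → ℝ → Prop}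

section Terms

variable (hμ : VolumeDoubling μ) (hφ : IsProfile (2 * h) φ) (hW₁ : IsReg a₁ W₁)
  (hW₁1 : ∀ e, 1 ≤ W₁ e) (hW₂ : IsReg a₂ W₂) (hW₂1 : ∀ e, 1 ≤ W₂ e)

include hμ hφ hW₁ hW₁1 hW₂ hW₂1

lemma uGood_spaceA {I J : List (Fin ℓ₀)} (hκ : 2 * κ ≤ I.length) (hκ' : κ ≤ 2 * h)
    (h₁ : S.ULeft o H₁ W₁ γ₁ (S.halfQ h) φ) (h₂ : S.ULeft o H₂ W₂ γ₂ (S.pre J 0 (2 * h)) φ) :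
    S.UGood o (2 * h) κ H₁ H₂ (W₁ * W₂) (γ₁ + γ₂) (S.spaceA o h φ I J) := by
  set R : RightFam ℓ₀ := ⟨I, 0, 2 * h, fun i => (i.factorial : ℝ)⁻¹⟩ with hR
  refine (ULeft.uGood hμ hW₁ hW₁1 hW₂ hW₂1 h₁ h₂ R hφ.isBump hκ'
    (Or.inl (by simpa [hR] using hκ))).congr fun f g t ht ht1 => ?_
  funext χ
  simp only [spaceA, opAdj_eq, rop, hR, S.post_eq hμ I (2 * h) ht (by linarith), zero_add]

lemma uGood_spaceB {I J : List (Fin ℓ₀)} (hκ : κ ≤ h)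
    (h₁ : S.ULeft o H₁ W₁ γ₁ (S.pre I 0 (2 * h)) φ)
    (h₂ : S.ULeft o H₂ W₂ γ₂ (S.pre J 0 (2 * h)) φ) :
    S.UGood o (2 * h) κ H₁ H₂ (W₁ * W₂) (γ₁ + γ₂) (S.spaceB o h φ I J) := by
  set R : RightFam ℓ₀ := ⟨[], h, 1, fun _ => ((2 * h - 1).factorial : ℝ)⁻¹⟩ with hR
  refine (ULeft.uGood hμ hW₁ hW₁1 hW₂ hW₂1 h₁ h₂ R hφ.isBump (by omega)
    (Or.inl (by simpa [hR] using hκ))).congr fun f g t ht ht1 => ?_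
  funext χ
  simp only [spaceB, opAdj_eq, rop, hR, S.halfQ_eq_ert hμ h ht (by linarith), Finset.sum_range_one,
    add_zero]

lemma uGood_timeA {k l : ℕ} (hκ : κ ≤ k) (hk : k ≤ 2 * h)
    (h₁ : S.ULeft o H₁ W₁ γ₁ (S.P (2 * h)) (primitive h φ))
    (h₂ : S.ULeft o H₂ W₂ γ₂ (S.pre [] 0 (2 * h)) (iteratedDeriv l φ)) :
    S.UGood o (2 * h) κ H₁ H₂ (W₁ * W₂) (γ₁ + γ₂) (S.timeA o h φ k l) := by
  set R : RightFam ℓ₀ := ⟨[], 0, 2 * h, fun i => (i.factorial : ℝ)⁻¹⟩ with hR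
  refine (ULeft.uGood hμ hW₁ hW₁1 hW₂ hW₂1 h₁ h₂ R (hφ.isBump.iteratedDeriv k) (by omega)
    (Or.inr fun i hi => hφ.moments_iteratedDeriv k i (by omega) (by omega))).congr
      fun f g t ht ht1 => ?_
  funext χ
  simp only [timeA, opAdj_eq, rop, hR, S.P_eq_ert hμ (2 * h) ht (by linarith), zero_add,
    ← S.P_eq_pre hμ (2 * h) ht (by linarith)]

lemma uGood_timeB {k l : ℕ} (hh : 1 ≤ h) (hκ : κ ≤ h)
    (h₁ : S.ULeft o H₁ W₁ γ₁ (S.pre [] 0 (2 * h)) (iteratedDeriv k φ))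
    (h₂ : S.ULeft o H₂ W₂ γ₂ (S.pre [] 0 (2 * h)) (iteratedDeriv l φ)) :
    S.UGood o (2 * h) κ H₁ H₂ (W₁ * W₂) (γ₁ + γ₂) (S.timeB o h φ k l) := by
  set R : RightFam ℓ₀ := ⟨[], 0, 2 * h, fun i => (i.factorial : ℝ)⁻¹⟩ with hR
  obtain ⟨hb, hmom⟩ := hφ.isBump_primitive hh
  refine (ULeft.uGood hμ hW₁ hW₁1 hW₂ hW₂1 h₁ h₂ R hb (by omega)
    (Or.inr fun i hi => hmom i (by omega))).congr fun f g t ht ht1 => ?_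
  funext χ
  simp only [timeB, opAdj_eq, rop, hR, S.P_eq_ert hμ (2 * h) ht (by linarith), zero_add,
    ← S.P_eq_pre hμ (2 * h) ht (by linarith)]

lemma uGood_paraIntegrand (hh : 3 ≤ h)
    (h₁ : S.ULeft o H₁ W₁ γ₁ (S.halfQ h) φ)
    (h₁' : S.ULeft o H₁ W₁ γ₁ (S.P (2 * h)) (primitive h φ))
    (hf : ∀ J l, J.length + 2 * l ≤ 2 * h → h < J.length + 2 * l →
      S.ULeft o H₁ W₁ γ₁ (S.pre J 0 (2 * h)) (iteratedDeriv l φ))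
    (hg : ∀ J l, J.length + 2 * l < h →
      S.ULeft o H₂ W₂ γ₂ (S.pre J 0 (2 * h)) (iteratedDeriv l φ)) :
    S.UGood o (2 * h) 2 H₁ H₂ (W₁ * W₂) (γ₁ + γ₂) (S.paraIntegrand o h φ) := by
  refine UGood.add (UGood.sum _ fun i _ => UGood.sum _ fun A hA => UGood.const_mul (UGood.add
    (UGood.const_mul ?_ _) ?_) _) (UGood.sum _ fun k hk => UGood.const_mul (UGood.add
    (UGood.const_mul ?_ _) ?_) _)
  · have hA' := (Finset.mem_filter.1 hA).2
    have hc := card_add_card_compl_fin A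
    have := hg (subword i Aᶜ).reverse 0 (by rw [List.length_reverse, length_subword]; omega)
    rw [iteratedDeriv_zero] at this
    exact uGood_spaceA hμ hφ hW₁ hW₁1 hW₂ hW₂1 (by rw [length_subword]; omega) (by omega) h₁ this
  · have hA' := (Finset.mem_filter.1 hA).2
    have hc := card_add_card_compl_fin A
    have e1 := hf (subword i A) 0 (by rw [length_subword]; omega) (by rw [length_subword]; omega)
    have e2 := hg (subword i Aᶜ) 0 (by rw [length_subword]; omega)
    rw [iteratedDeriv_zero] at e1 e2
    exact uGood_spaceB hμ hφ hW₁ hW₁1 hW₂ hW₂1 (by omega) e1 e2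
  · obtain ⟨hk1, hk2⟩ := Finset.mem_filter.1 hk
    rw [Finset.mem_range] at hk1
    exact uGood_timeA hμ hφ hW₁ hW₁1 hW₂ hW₂1 (by omega) (by omega) h₁'
      (hg [] (h - k) (by simp; omega))
  · obtain ⟨hk1, hk2⟩ := Finset.mem_filter.1 hk
    rw [Finset.mem_range] at hk1
    exact uGood_timeB hμ hφ hW₁ hW₁1 hW₂ hW₂1 (by omega) (by omega)
      (hf [] k (by simp; omega) (by simp; omega)) (hg [] (h - k) (by simp; omega))

lemma uGood_resonantIntegrand (hh : 3 ≤ h)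
    (h₁ : S.ULeft o H₁ W₁ γ₁ (S.halfQ h) φ)
    (h₁' : S.ULeft o H₁ W₁ γ₁ (S.P (2 * h)) (primitive h φ))
    (hf : ∀ J l, J.length + 2 * l ≤ 2 * h → h ≤ J.length + 2 * l →
      S.ULeft o H₁ W₁ γ₁ (S.pre J 0 (2 * h)) (iteratedDeriv l φ))
    (h₂ : S.ULeft o H₂ W₂ γ₂ (S.halfQ h) φ)
    (h₂' : S.ULeft o H₂ W₂ γ₂ (S.P (2 * h)) (primitive h φ))
    (hg : ∀ J l, J.length + 2 * l ≤ 2 * h → h ≤ J.length + 2 * l →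
      S.ULeft o H₂ W₂ γ₂ (S.pre J 0 (2 * h)) (iteratedDeriv l φ)) :
    S.UGood o (2 * h) 0 H₁ H₂ (W₁ * W₂) (γ₁ + γ₂) (S.resonantIntegrand o h φ) := by
  have eW : W₂ * W₁ = W₁ * W₂ := mul_comm _ _
  have eγ : γ₂ + γ₁ = γ₁ + γ₂ := add_comm _ _
  have hlen : ∀ (i : Fin h → Fin ℓ₀) (A : Finset (Fin (2 * h))),
      (subword i A).reverse.length = A.card := fun i A => by
    rw [List.length_reverse, length_subword]
  refine UGood.add (UGood.sum _ fun i _ => UGood.add (UGood.sum _ fun A hA => UGood.const_mul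
    (UGood.add ?_ (UGood.swap ?_)) _) (UGood.sum _ fun A hA => UGood.const_mul ?_ _))
    (UGood.add (UGood.sum _ fun k hk => UGood.const_mul (UGood.add ?_ (UGood.swap ?_)) _)
      (UGood.sum _ fun k hk => UGood.const_mul ?_ _))
  · have hA' := (Finset.mem_filter.1 hA).2
    have hc := card_add_card_compl_fin A
    have := hg (subword i Aᶜ).reverse 0 (by rw [hlen]; omega) (by rw [hlen]; omega)
    rw [iteratedDeriv_zero] at this
    exact uGood_spaceA hμ hφ hW₁ hW₁1 hW₂ hW₂1 (by omega) (by omega) h₁ this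
  · have hA' := (Finset.mem_filter.1 hA).2
    have hc := card_add_card_compl_fin A
    have := hf (subword i Aᶜ).reverse 0 (by rw [hlen]; omega) (by rw [hlen]; omega)
    rw [iteratedDeriv_zero] at this
    rw [← eW, ← eγ]
    exact uGood_spaceA hμ hφ hW₂ hW₂1 hW₁ hW₁1 (by omega) (by omega) h₂ this
  · have hA' := (Finset.mem_filter.1 hA).2
    have hc := card_add_card_compl_fin A
    have e1 := hf (subword i A) 0 (by rw [length_subword]; omega) (by rw [length_subword]; omega)
    have e2 := hg (subword i Aᶜ) 0 (by rw [length_subword]; omega) (by rw [length_subword]; omega)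
    rw [iteratedDeriv_zero] at e1 e2
    exact uGood_spaceB hμ hφ hW₁ hW₁1 hW₂ hW₂1 (by omega) e1 e2
  · obtain ⟨hk1, hk2⟩ := Finset.mem_filter.1 hk
    exact uGood_timeA hμ hφ hW₁ hW₁1 hW₂ hW₂1 (by omega) (by omega) h₁'
      (hg [] (h - k) (by simp) (by simp; omega))
  · obtain ⟨hk1, hk2⟩ := Finset.mem_filter.1 hk
    rw [← eW, ← eγ]
    exact uGood_timeA hμ hφ hW₂ hW₂1 hW₁ hW₁1 (by omega) (by omega) h₂'
      (hf [] (h - k) (by simp) (by simp; omega))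
  · obtain ⟨hk1, hk2⟩ := Finset.mem_filter.1 hk
    exact uGood_timeB hμ hφ hW₁ hW₁1 hW₂ hW₂1 (by omega) (by omega)
      (hf [] k (by simp; omega) (by simp; omega)) (hg [] (h - k) (by simp) (by simp; omega))

end Terms

end HeatSystem

end Parabolic

namespace Parabolic

variable {M : Type*} [MetricSpace M] [MeasurableSpace M] {μ : Measure M} {ℓ₀ : ℕ}
  [BorelSpace M] [SecondCountableTopology M] [SigmaFinite μ]

namespace HeatSystem

variable {S : HeatSystem μ ℓ₀} {o : M} {b h κ : ℕ} {φ : ℝ → ℝ} {W W₁ W₂ ω : M × ℝ → ℝ}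
  {a a₁ a₂ α β γ : ℝ} {H₁ H₂ : ((ℝ → Lp ℝ 2 μ) → ℝ) → ℝ → Prop}

lemma UGood.exists_holderBound {Θ : ((ℝ → Lp ℝ 2 μ) → ℝ) → ((ℝ → Lp ℝ 2 μ) → ℝ) → ℝ →
    (ℝ → Lp ℝ 2 μ) → ℝ} (hμ : VolumeDoubling μ) (hΘ : S.UGood o b κ H₁ H₂ W γ Θ)
    (hγ : 0 < γ + κ) (hα : α = 2 * γ) : ∃ C : ℝ, 0 ≤ C ∧ ∀ f g N₁ N₂, 0 ≤ N₁ → 0 ≤ N₂ →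
      H₁ f N₁ → H₂ g N₂ →
      (∀ χ, S.IsTest o χ → IntegrableOn (fun t => Θ f g t χ / t) (Ioc (0 : ℝ) 1)) ∧
      S.HolderBound o b α W (fun χ => ∫ t in Ioc (0 : ℝ) 1, Θ f g t χ / t) (C * (N₁ * N₂)) := by
  obtain ⟨C, hC0, hC⟩ := hΘ
  have hs : 0 ≤ scaleConst κ γ := by
    have := Nat.lt_floor_add_one |2 * γ|
    have h1 : 0 ≤ ((⌊|2 * γ|⌋₊ : ℝ) + 1 - |2 * γ|)⁻¹ := inv_nonneg.2 (by linarith)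
    unfold scaleConst
    positivity
  refine ⟨scaleConst κ γ * C, by positivity, fun f g N₁ N₂ h1 h2 hf hg => ?_⟩
  have hT := hC f g N₁ N₂ h1 h2 hf hg
  refine ⟨fun χ hχ => hT.integrableOn hγ hχ, ?_⟩
  rw [mul_assoc]
  exact hT.holderBound hμ hγ (by positivity) hα

lemma exists_holderNorm_le {Φ : ((ℝ → Lp ℝ 2 μ) → ℝ) → ((ℝ → Lp ℝ 2 μ) → ℝ) →
    (ℝ → Lp ℝ 2 μ) → ℝ} {A : ((ℝ → Lp ℝ 2 μ) → ℝ) → ((ℝ → Lp ℝ 2 μ) → ℝ) → Prop} {c : ℝ}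
    (hμ : VolumeDoubling μ) (hW : IsReg a W) (hω : ∀ e, 0 < ω e) (hc : 0 ≤ c)
    (hle : ∀ e, W e ≤ c * ω e)
    (h : ∃ C : ℝ, 0 ≤ C ∧ ∀ f g N₁ N₂, 0 ≤ N₁ → 0 ≤ N₂ → H₁ f N₁ → H₂ g N₂ →
      A f g ∧ S.HolderBound o b α W (Φ f g) (C * (N₁ * N₂))) :
    ∃ C : ℝ≥0, ∀ f g, ∀ N₁ N₂ : ℝ≥0∞, N₁ < ∞ → N₂ < ∞ → H₁ f N₁.toReal → H₂ g N₂.toReal →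
      A f g ∧ S.MemHolder o b α ω (Φ f g) ∧ S.holderNorm o b α ω (Φ f g) ≤ C * N₁ * N₂ := by
  obtain ⟨C, hC0, hC⟩ := h
  refine ⟨⟨2 * c * C, by positivity⟩, fun f g N₁ N₂ hN₁ hN₂ hf hg => ?_⟩
  obtain ⟨hA, hB⟩ := hC f g _ _ ENNReal.toReal_nonneg ENNReal.toReal_nonneg hf hg
  have hle := hB.holderNorm_le hμ hW hω hc hle (by positivity)
  refine ⟨hA, ⟨hB.dist, hle.trans_lt ENNReal.ofReal_lt_top⟩, hle.trans_eq ?_⟩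
  have e : 2 * c * (C * (N₁.toReal * N₂.toReal)) = 2 * c * C * N₁.toReal * N₂.toReal := by ring
  rw [e, ENNReal.ofReal_mul (by positivity), ENNReal.ofReal_mul (by positivity),
    ENNReal.ofReal_toReal hN₁.ne, ENNReal.ofReal_toReal hN₂.ne]
  congr 2
  exact ENNReal.ofReal_eq_coe_nnreal _

lemma MemHolder.holderBound (hμ : VolumeDoubling μ) (hW : IsReg a W) (hω : ∀ e, 0 < ω e)
    (hle : ∀ e, ω e ≤ W e) {f : (ℝ → Lp ℝ 2 μ) → ℝ} (hf : S.MemHolder o b α ω f) :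
    S.HolderBound o b α W f (S.holderNorm o b α ω f).toReal :=
  HolderBound.of_holderNorm hμ hW hω hle ENNReal.toReal_nonneg hf.1
    (ENNReal.ofReal_toReal hf.2.ne).ge

lemma exists_leftGood_one (hμ : VolumeDoubling μ) (hh : 1 ≤ h) (hφ : IsProfile (2 * h) φ)
    (W : M × ℝ → ℝ) (α : ℝ) : ∃ K : ℝ, 0 ≤ K ∧ ∀ f N, S.HolderBound o (2 * h) α W f N →
      S.LeftGood o W (K * N) 0 fun _ => opDist (S.P (2 * h) 1) φ 1 f := by
  obtain ⟨K, hK0, hK⟩ := HolderBound.exists_pre (S := S) (o := o) (b := 2 * h) [] 0 (2 * h) 0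
    (by omega) le_rfl hμ hφ.isBump (by simp) (by simp)
  refine ⟨K, hK0, fun f N hf => ⟨fun _ _ _ => ?_, fun t _ _ χ hχ => ?_, fun δ _ => ⟨0, le_rfl,
    fun s _ t _ χ _ => by simp⟩⟩⟩
  · rw [S.P_eq_pre hμ _ one_pos one_le_two]
    exact hf.dist.isLin.comp_opK (R := S.pre [] 0 (2 * h) 1) (k := scaled φ 1)
      (hφ.isBump.isKer one_pos) fun χ hχ =>
        isTest_pre hμ hχ [] 0 (2 * h) one_pos one_le_two (hφ.isBump.isKer one_pos)
  · rw [S.P_eq_pre hμ _ one_pos one_le_two, Real.rpow_zero, mul_one, mul_assoc]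
    exact (hK α W f N hf χ hχ).1

lemma exists_holderBound_lowFrequency (hμ : VolumeDoubling μ) (hh : 1 ≤ h)
    (hφ : IsProfile (2 * h) φ) (hW₁ : IsReg a₁ W₁) (hW₁1 : ∀ e, 1 ≤ W₁ e) (hW₂ : IsReg a₂ W₂)
    (hW₂1 : ∀ e, 1 ≤ W₂ e) : ∃ C : ℝ, 0 ≤ C ∧ ∀ f g N₁ N₂, 0 ≤ N₁ → 0 ≤ N₂ →
      S.HolderBound o (2 * h) α W₁ f N₁ → S.HolderBound o (2 * h) β W₂ g N₂ →
      S.HolderBound o (2 * h) γ (W₁ * W₂) (S.lowFrequency o h φ f g) (C * (N₁ * N₂)) := by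
  obtain ⟨K₁, hK₁0, hK₁⟩ := exists_leftGood_one (S := S) (o := o) hμ hh hφ W₁ α
  obtain ⟨K₂, hK₂0, hK₂⟩ := exists_leftGood_one (S := S) (o := o) hμ hh hφ W₂ β
  set R : RightFam ℓ₀ := ⟨[], 0, 2 * h, fun i => (i.factorial : ℝ)⁻¹⟩ with hR
  obtain ⟨C, hC0, hC⟩ := exists_goodTerm (S := S) (o := o) (b := 2 * h) (κ := 0) hμ hW₁ hW₁1 hW₂
    hW₂1 R hφ.isBump (Nat.zero_le _) (Or.inl (by simp))
  refine ⟨C * (K₁ * K₂), by positivity, fun f g N₁ N₂ h1 h2 hf hg => ?_⟩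
  have hT := hC _ _ (K₁ * N₁) (K₂ * N₂) 0 0 (by positivity) (by positivity) (hK₁ f N₁ hf)
    (hK₂ g N₂ hg)
  have e : ∀ χ, S.lowFrequency o h φ f g χ =
      pair (S.toFunction o (opDist (S.P (2 * h) 1) φ 1 f) *
        S.toFunction o (opDist (S.P (2 * h) 1) φ 1 g)) (opK (S.rop R 1) (scaled φ 1) χ) := by
    intro χ
    have : S.rop R 1 = S.P (2 * h) 1 := by
      simp only [rop, hR, S.P_eq_ert hμ (2 * h) one_pos one_le_two, zero_add]
    rw [this]; rfl
  have hF : S.lowFrequency o h φ f g = _ := funext e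
  have hB : C * (K₁ * N₁ * (K₂ * N₂)) = C * (K₁ * K₂) * (N₁ * N₂) := by ring
  have hBT : ∀ χ : ℝ → Lp ℝ 2 μ, 0 ≤ C * (K₁ * K₂) * (N₁ * N₂) * tn (W₁ * W₂) χ :=
    fun χ => mul_nonneg (by positivity) (tn_nonneg _ χ)
  have hbd : ∀ (Q : StdFamily ℓ₀) (k : ℕ), k ≤ 2 * (2 * h) → Q.IsStGC (2 * h) k → ∀ r, 0 < r →
      r ≤ 1 → ∀ χ, S.IsTest o χ → |S.lowFrequency o h φ f g (opAdj (S.pre Q.J Q.n Q.c r) Q.m r χ)|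
        ≤ C * (K₁ * K₂) * (N₁ * N₂) * tn (W₁ * W₂) χ * r ^ ((k : ℝ) / 2) := by
    intro Q k hk hQ r hr hr1 χ hχ
    have := hT.bound Q k hk hQ r 1 hr hr1 one_pos le_rfl χ hχ
    rw [hB, Real.one_rpow, scaleGain, if_pos hr1, div_one] at this
    rw [e]
    exact this.trans_eq (by ring)
  refine ⟨⟨fun χ χ' hχ hχ' => ?_, fun r χ hχ => ?_, fun τ₀ => ?_⟩, fun Q k hk hQ χ hχ => ?_,
    fun Q k hγk hk hQ r hr hr1 χ hχ => ?_⟩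
  · simp only [e]; exact (hT.lin 1 one_pos le_rfl).add _ _ hχ hχ'
  · simp only [e]; exact (hT.lin 1 one_pos le_rfl).smul _ _ hχ
  · obtain ⟨N, C', hC0', hC'⟩ := hT.decay τ₀
    refine ⟨N, ⟨C', hC0'⟩, fun χ hχ hsupp B hB => ?_⟩
    rw [e]
    refine (hC' χ hχ hsupp B hB 1 one_pos le_rfl).trans_eq ?_
    rw [Real.one_rpow, mul_one]; rfl
  · exact (hbd Q k hk hQ 1 one_pos le_rfl χ hχ).trans_eq (by rw [Real.one_rpow, mul_one])
  · refine (hbd Q k hk hQ r hr hr1 χ hχ).trans ?_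
    have h3 : r ^ ((k : ℝ) / 2) ≤ r ^ (γ / 2) := by
      refine Real.rpow_le_rpow_of_exponent_ge hr hr1 ?_
      linarith [le_abs_self γ]
    calc _ ≤ C * (K₁ * K₂) * (N₁ * N₂) * tn (W₁ * W₂) χ * r ^ (γ / 2) :=
          mul_le_mul_of_nonneg_left h3 (hBT χ)
      _ = _ := by ring

end HeatSystem

end Parabolic

theorem mainTheorem12 {M : Type*} [MetricSpace M] [CompleteSpace M] [SecondCountableTopology M]
    [MeasurableSpace M] [BorelSpace M] (μ : Measure M) (hμ : Parabolic.VolumeDoubling μ)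
    (ℓ₀ : ℕ) (S : Parabolic.HeatSystem μ ℓ₀) (o : M)
    (b h : ℕ) (hb : b = 2 * h) (hb6 : 6 ≤ b)
    (φ : ℝ → ℝ) (hφ : Parabolic.IsProfile b φ)
    (ω₁ ω₂ : M × ℝ → ℝ) (hω₁ : Parabolic.IsSpaceTimeWeight ω₁)
    (hω₂ : Parabolic.IsSpaceTimeWeight ω₂) :
    -- (a) the low-frequency part
    (∀ α β γ : ℝ, 0 < γ → ∃ C : ℝ≥0, ∀ f g : (ℝ → Lp ℝ 2 μ) → ℝ,
      S.MemHolder o b α ω₁ f → S.MemHolder o b β ω₂ g →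
        S.MemHolder o b γ (ω₁ * ω₂) (S.lowFrequency o h φ f g) ∧
        S.holderNorm o b γ (ω₁ * ω₂) (S.lowFrequency o h φ f g) ≤
          C * S.holderNorm o b α ω₁ f * S.holderNorm o b β ω₂ g) ∧
    -- (b) the paraproduct, with a bounded function `g`
    (∀ α : ℝ, -3 < α → α < 3 → ∃ C : ℝ≥0, ∀ (f : (ℝ → Lp ℝ 2 μ) → ℝ) (g : M × ℝ → ℝ),
      S.MemHolder o b α ω₁ f → AEStronglyMeasurable g (μ.prod volume) →
      Parabolic.wNorm μ ω₂ g < ∞ →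
        S.ParaConverges o h φ (Parabolic.pair g) f ∧
        S.MemHolder o b α (ω₁ * ω₂) (S.paraproduct o h φ (Parabolic.pair g) f) ∧
        S.holderNorm o b α (ω₁ * ω₂) (S.paraproduct o h φ (Parabolic.pair g) f) ≤
          C * Parabolic.wNorm μ ω₂ g * S.holderNorm o b α ω₁ f) ∧
    -- (b) the paraproduct, with a distribution `g` of negative regularity
    (∀ α β : ℝ, -3 < α → α < 3 → β < 0 → -3 < α + β → α + β < 3 →
      ∃ C : ℝ≥0, ∀ f g : (ℝ → Lp ℝ 2 μ) → ℝ,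
      S.MemHolder o b α ω₁ f → S.MemHolder o b β ω₂ g →
        S.ParaConverges o h φ g f ∧
        S.MemHolder o b (α + β) (ω₁ * ω₂) (S.paraproduct o h φ g f) ∧
        S.holderNorm o b (α + β) (ω₁ * ω₂) (S.paraproduct o h φ g f) ≤
          C * S.holderNorm o b β ω₂ g * S.holderNorm o b α ω₁ f) ∧
    -- (c) the resonant term
    (∀ α β : ℝ, α < 3 → β < 3 → 0 < α + β →
      ∃ C : ℝ≥0, ∀ f g : (ℝ → Lp ℝ 2 μ) → ℝ,
      S.MemHolder o b α ω₁ f → S.MemHolder o b β ω₂ g →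
        S.ResonantConverges o h φ f g ∧
        S.MemHolder o b (α + β) (ω₁ * ω₂) (S.resonant o h φ f g) ∧
        S.holderNorm o b (α + β) (ω₁ * ω₂) (S.resonant o h φ f g) ≤
          C * S.holderNorm o b α ω₁ f * S.holderNorm o b β ω₂ g) := by
  subst hb
  have hh : 3 ≤ h := by omega
  have hh' : (3 : ℝ) ≤ h := by exact_mod_cast hh
  haveI : IsLocallyFiniteMeasure μ :=
    ⟨fun x => ⟨Metric.ball x 1, Metric.ball_mem_nhds x one_pos, (hμ.1 x 1 one_pos).2⟩⟩
  obtain ⟨a₁, c₁, W₁, hc₁, hW₁, hle₁, hle₁'⟩ := hω₁.exists_isReg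
  obtain ⟨a₂, c₂, W₂, hc₂, hW₂, hle₂, hle₂'⟩ := hω₂.exists_isReg
  have h0₁ : ∀ e, 0 < ω₁ e := fun e => one_pos.trans_le (hω₁.one_le e)
  have h0₂ : ∀ e, 0 < ω₂ e := fun e => one_pos.trans_le (hω₂.one_le e)
  have h1₁ : ∀ e, 1 ≤ W₁ e := fun e => (hω₁.one_le e).trans (hle₁ e)
  have h1₂ : ∀ e, 1 ≤ W₂ e := fun e => (hω₂.one_le e).trans (hle₂ e)
  have ha₂ : 0 ≤ a₂ := (hW₂.wt 0).nonneg
  have hW := hW₁.mul hW₂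
  have h0 : ∀ e, 0 < (ω₁ * ω₂) e := fun e => mul_pos (h0₁ e) (h0₂ e)
  have hc : 0 ≤ c₁ * c₂ := by positivity
  have hle : ∀ e, (W₁ * W₂) e ≤ c₁ * c₂ * (ω₁ * ω₂) e := fun e => by
    have := mul_le_mul (hle₁' e) (hle₂' e) (zero_le_one.trans (h1₂ e))
      (mul_nonneg hc₁.le (h0₁ e).le)
    exact this.trans_eq (by rw [Pi.mul_apply]; ring)
  have hlt : ∀ {α : ℝ}, -3 < α → α < 3 → |α| < 2 * h := fun hα hα' =>
    (abs_lt.2 ⟨hα, hα'⟩).trans_le (by linarith)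
  have hder : ∀ {α : ℝ} (W : M × ℝ → ℝ), -3 < α → α < 3 → ∀ J l, J.length + 2 * l ≤ 2 * h →
      h ≤ J.length + 2 * l → S.ULeft o (S.HolderBound o (2 * h) α W) W (α / 2)
        (S.pre J 0 (2 * h)) (iteratedDeriv l φ) := fun W hα hα' J l hJ hJ' =>
    Parabolic.HeatSystem.uLeft_iteratedDeriv hμ hh hφ J l hJ
      ((abs_lt.2 ⟨hα, hα'⟩).trans_le (hh'.trans (by exact_mod_cast hJ')))
  refine ⟨fun α β γ _ => ?_, fun α hα hα' => ?_, fun α β hα hα' hβ hαβ hαβ' => ?_,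
    fun α β hα hβ hαβ => ?_⟩
  · obtain ⟨C₀, hC₀, hC⟩ := Parabolic.HeatSystem.exists_holderBound_lowFrequency (S := S) (o := o)
      (α := α) (β := β) (γ := γ) hμ (by omega) hφ hW₁ h1₁ hW₂ h1₂
    obtain ⟨C, hC⟩ := Parabolic.HeatSystem.exists_holderNorm_le hμ hW h0 hc hle
      (A := fun _ _ => True) ⟨C₀, hC₀, fun f g N₁ N₂ h1 h2 hf hg =>
        ⟨trivial, hC f g N₁ N₂ h1 h2 hf hg⟩⟩
    exact ⟨C, fun f g hf hg => (hC f g _ _ hf.2 hg.2 (hf.holderBound hμ hW₁ h0₁ hle₁)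
      (hg.holderBound hμ hW₂ h0₂ hle₂)).2⟩
  · have hΘ := Parabolic.HeatSystem.uGood_paraIntegrand hμ hφ hW₁ h1₁ hW₂ h1₂ hh
      (Parabolic.HeatSystem.uLeft_halfQ (S := S) (o := o) (W := W₁) hμ hh hφ (hlt hα hα'))
      (Parabolic.HeatSystem.uLeft_primitive hμ hh hφ (hlt hα hα'))
      (fun J l h1 h2 => hder W₁ hα hα' J l h1 h2.le)
      (fun J l _ => Parabolic.HeatSystem.uLeft_bddClass hμ ha₂ hW₂ (hφ.isBump.iteratedDeriv l) J
        (by omega))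
    obtain ⟨C, hC⟩ := Parabolic.HeatSystem.exists_holderNorm_le hμ hW h0 hc hle
      (hΘ.exists_holderBound hμ (α := α) (by push_cast; linarith) (by ring))
    refine ⟨C, fun f g hf hg hg' => ?_⟩
    have hb : Parabolic.BddBy μ W₂ (Parabolic.wNorm μ ω₂ g).toReal g := ⟨hg, by
      filter_upwards [(Parabolic.wNorm_le_iff h0₂ ENNReal.toReal_nonneg).1
        (ENNReal.ofReal_toReal hg'.ne).ge] with e he
      exact he.trans (mul_le_mul_of_nonneg_left (hle₂ e) ENNReal.toReal_nonneg)⟩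
    rw [mul_right_comm]
    exact hC f _ _ _ hf.2 hg' (hf.holderBound hμ hW₁ h0₁ hle₁) ⟨g, rfl, hb⟩
  · have hΘ := Parabolic.HeatSystem.uGood_paraIntegrand hμ hφ hW₁ h1₁ hW₂ h1₂ hh
      (Parabolic.HeatSystem.uLeft_halfQ (S := S) (o := o) (W := W₁) hμ hh hφ (hlt hα hα'))
      (Parabolic.HeatSystem.uLeft_primitive hμ hh hφ (hlt hα hα'))
      (fun J l h1 h2 => hder W₁ hα hα' J l h1 h2.le)
      (fun J l hJ => Parabolic.HeatSystem.uLeft_of_neg (W := W₂) hμ hh hφ J l (by omega) hβ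
        ((abs_lt.2 ⟨by linarith, by linarith⟩ : |β| < 6).trans_le (by linarith)))
    obtain ⟨C, hC⟩ := Parabolic.HeatSystem.exists_holderNorm_le hμ hW h0 hc hle
      (hΘ.exists_holderBound hμ (α := α + β) (by push_cast; linarith) (by ring))
    refine ⟨C, fun f g hf hg => ?_⟩
    rw [mul_right_comm]
    exact hC f g _ _ hf.2 hg.2 (hf.holderBound hμ hW₁ h0₁ hle₁) (hg.holderBound hμ hW₂ h0₂ hle₂)
  · have hα3 : -3 < α := by linarith
    have hβ3 : -3 < β := by linarith
    have hΘ := Parabolic.HeatSystem.uGood_resonantIntegrand hμ hφ hW₁ h1₁ hW₂ h1₂ hh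
      (Parabolic.HeatSystem.uLeft_halfQ (S := S) (o := o) hμ hh hφ (hlt hα3 hα))
      (Parabolic.HeatSystem.uLeft_primitive hμ hh hφ (hlt hα3 hα)) (hder W₁ hα3 hα)
      (Parabolic.HeatSystem.uLeft_halfQ (S := S) (o := o) hμ hh hφ (hlt hβ3 hβ))
      (Parabolic.HeatSystem.uLeft_primitive hμ hh hφ (hlt hβ3 hβ)) (hder W₂ hβ3 hβ)
    obtain ⟨C, hC⟩ := Parabolic.HeatSystem.exists_holderNorm_le hμ hW h0 hc hle
      (hΘ.exists_holderBound hμ (α := α + β) (by push_cast; linarith) (by ring))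
    exact ⟨C, fun f g hf hg => hC f g _ _ hf.2 hg.2 (hf.holderBound hμ hW₁ h0₁ hle₁)
      (hg.holderBound hμ hW₂ h0₂ hle₂)⟩
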